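/- **Setting.** Write $\mathbb C^n=\mathbb C^d\times\mathbb C^{m}$ with coordinates $(z,w)$, $z=x+iy$, and let $\Delta$ be the open unit disc. Let $k\ge 4$ be an integer and $\frac1k<\alpha<1$. *The spaces.* $\mathcal F^{2,\alpha}$ is the space of continuous functions $\sigma$ on $\partial\Delta$ (written as functions of the angle $\theta\in[-\pi,\pi]$) that are $C^2$ on $\partial\Delta\setminus\{1\}$ and have finite norm $\|\sigma\|_{C^0}+\|\theta\sigma'\|_{C^\alpha}+\|\theta^2\sigma''\|_{C^\alpha}$ on $[-\pi,\pi]$. An $\mathcal F^{2,\alpha}$-disc is a map $A:\overline\Delta\to\mathbb C^n$, continuous, holomorphic in $\Delta$, with $A|_{\partial\Delta}\in\mathcal F^{2,\alpha}$; it is attached to a set $S$ if $A(\partial\Delta)\subset S$. *The manifold.* Let $M\subset\mathbb C^n$ be, near the point $p=0$, the graph $y=h(x,w)$ of a function $h:\mathbb R^d\times\mathbb C^m\to\mathbb R^d$ of class $C^{k+2}$ with $h(0)=0$, $\partial h(0)=0$, of weighted vanishing order (type) $\ge k$ at $p$, that is, $h(0,w)=O(|w|^k)$. Put $r=y-h(x,w)$.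 For $P\in M$ near $p$ the class $[\xi]$ of $\xi\in T_P\mathbb C^n$ modulo $T_PM$ is identified with $dr(P)\xi\in\mathbb R^d$. We write $[\partial_rA(1)]$ for the derivative at $\tau=1$ of the normal component of $A$ in the **inward** radial direction, i.e. $\frac{d}{ds}\big|_{s=0^+}dr(A(1))\big(A(1-s)\big)$. *The extension.* $M'\subset\mathbb C^n$ is a $C^k$ submanifold with boundary $M$ at $q\in M$ in the direction $v\in T_q\mathbb C^n$ if near $q$ it is given by $y=H(x,w,t)$, $t\ge0$, where $H$ is of class $C^k$, $H(x,w,0)=h(x,w)$, and $[v]=\partial_tH\ne0$ at $q$. *The matrix $G$.* Given a disc $A$ attached to $M$, let $G$ be a continuous real $d\times d$ matrix function on $\partial\Delta$ with $G(1)=\mathrm{id}$ such that $G\cdot\big(\frac{\partial r_j}{\partial z_l}\circ A\big)_{j,l}$ extends continuously to $\overline\Delta$ and holomorphically to $\Delta$. **Proposition 3.3.** There is $\delta>0$ such that the following holds for every $\mathcal F^{2,\alpha}$-disc $A$ with $\|A\|_{\mathcal F^{2,\alpha}}<\delta$ that is attached to $M$, satisfies $A(1)=p$, and is tangent to $M$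 at $p$ (meaning that $[\partial_rA(1)]$ exists and is $0$). A matrix function $G$ as above exists. For every such $G$, every $C^k$ submanifold $M'$ with boundary $M$ at $q=A(-1)$ in a direction $v$, and every $\varepsilon>0$, there are $\eta_0>0$, a vector $\mathcal E\in\mathbb R^d$ with $|\mathcal E|<\varepsilon$, and a family $A^\eta$, $0\le\eta\le\eta_0$, of $\mathcal F^{2,\alpha}$-discs attached to $M\cup M'$ with $A^0=A$ and $A^\eta(1)=p$ for all $\eta$, such that 1. the family is $C^k$-smooth: $(\eta,\tau)\mapsto A^\eta(\tau)$ is of class $C^k$ on $[0,\eta_0]\times\Delta$; moreover, up to the boundary, $\eta\mapsto A^\eta$ is of class $C^{k-3}$ with values in $\mathcal F^{2,\alpha}$; 2. for every $\eta\in[0,\eta_0]$ the derivative $[\partial_rA^\eta(1)]$ exists, and $$[\partial_rA^\eta(1)]=\eta\,\big(G(-1)[v]+\mathcal E\big)+o(\eta),\qquad \eta\to0^+ .$$ -/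

import Mathlib

open Set Filter Topology Metric Asymptotics
open scoped ENNReal

namespace CRDisc

/-- `ℂⁿ = ℂᵈ × ℂᵐ`, with coordinates `(z, w)`. -/
abbrev Cn (d m : ℕ) : Type := (Fin d → ℂ) × (Fin m → ℂ)

/-- The parameter space `ℝᵈ × ℂᵐ` of a graph, with coordinates `(x, w)`. -/
abbrev Par (d m : ℕ) : Type := (Fin d → ℝ) × (Fin m → ℂ)

/-- `x = Re z`. -/
def rePart {d m : ℕ} (P : Cn d m) : Fin d → ℝ := fun j => (P.1 j).re

/-- `y = Im z`. -/
def imPart {d m : ℕ} (P : Cn d m) : Fin d → ℝ := fun j => (P.1 j).im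

/-- The vector-valued defining function `r = y - h(x, w)`. -/
def definingFn {d m : ℕ} (h : Par d m → (Fin d → ℝ)) (P : Cn d m) : Fin d → ℝ :=
  imPart P - h (rePart P, P.2)

/-- In the given coordinates, centred at the point `0`, the set `M` is near `0` the graph
`y = h(x, w)` of a function of class `C^{k+2}` with `h(0) = 0` and `∂h(0) = 0`, and `M` has weighted
vanishing order (type) at least `k` at `0`: `h = O(|w|^k)` along `x = 0`, the remaining terms of
`h` being divisible by `x` (and vanishing to second order because `∂h(0) = 0`). -/
structure IsGraphOfOrder {d m : ℕ} (k : ℕ) (M : Set (Cn d m)) (h : Par d m → (Fin d → ℝ)) :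
    Prop where
  contDiffAt : ContDiffAt ℝ ((k + 2 : ℕ) : WithTop ℕ∞) h 0
  map_zero : h 0 = 0
  fderiv_zero : fderiv ℝ h 0 = 0
  mem_iff : ∀ᶠ P in 𝓝 (0 : Cn d m), P ∈ M ↔ imPart P = h (rePart P, P.2)
  order : (fun w : Fin m → ℂ => h (0, w)) =O[𝓝 0] (fun w => ‖w‖ ^ k)

/-- The class `[ξ]` in `T_P ℂⁿ / T_P M` of a tangent vector `ξ` at the point `P` of `M`, in the
coordinates `ξ ↦ dr(P) ξ` given by the defining functions (`dr(P) ξ = 2 Re ⟨∂r(P), ξ⟩`). -/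
noncomputable def normalPart {d m : ℕ} (h : Par d m → (Fin d → ℝ)) (P ξ : Cn d m) : Fin d → ℝ :=
  fderiv ℝ (definingFn h) P ξ

/-- `M'` is near `q` a submanifold of class `C^k` with boundary `M = {y = h(x, w)}`, of dimension
one more than `M`, and the vector `v` at `q` points into `M'`: `M'` is given by
`y = H(x, w, t)`, `t ≥ 0`, with `H(x, w, 0) = h(x, w)`, and `[v] = ∂ₜH ≠ 0` at `q`. -/
def IsExtensionAt {d m : ℕ} (k : ℕ) (h : Par d m → (Fin d → ℝ)) (M' : Set (Cn d m))
    (q v : Cn d m) : Prop :=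
  ∃ (H : Par d m × ℝ → (Fin d → ℝ)) (W : Set (Par d m × ℝ)),
    IsOpen W ∧ ((rePart q, q.2), (0 : ℝ)) ∈ W ∧ ContDiffOn ℝ (k : WithTop ℕ∞) H W ∧
    (∀ a : Par d m, (a, (0 : ℝ)) ∈ W → H (a, 0) = h a) ∧
    (∀ᶠ P in 𝓝 q, P ∈ M' ↔
      ∃ t : ℝ, 0 ≤ t ∧ ((rePart P, P.2), t) ∈ W ∧ imPart P = H ((rePart P, P.2), t)) ∧
    normalPart h q v = fderiv ℝ H ((rePart q, q.2), 0) (0, 1) ∧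
    normalPart h q v ≠ 0

/-- The norm of `C^a(s)`: supremum norm plus Hölder seminorm (`∞` if not finite). -/
noncomputable def holderNormOn {E : Type*} [NormedAddCommGroup E] (a : ℝ) (f : ℝ → E)
    (s : Set ℝ) : ℝ≥0∞ :=
  (⨆ x ∈ s, ‖f x‖ₑ) + ⨆ x ∈ s, ⨆ y ∈ s, edist (f x) (f y) / edist x y ^ a

/-- The norm of `F^{2,a}`: `‖σ‖_{C^0} + ‖θ σ'‖_{C^a} + ‖θ² σ''‖_{C^a}` on `[-π, π]`. -/
noncomputable def fNorm {E : Type*} [NormedAddCommGroup E] [NormedSpace ℝ E] (a : ℝ)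
    (σ : ℝ → E) : ℝ≥0∞ :=
  (⨆ θ ∈ Icc (-Real.pi) Real.pi, ‖σ θ‖ₑ)
    + holderNormOn a (fun θ => θ • deriv σ θ) (Icc (-Real.pi) Real.pi)
    + holderNormOn a (fun θ => θ ^ 2 • deriv (deriv σ) θ) (Icc (-Real.pi) Real.pi)

/-- The space `F^{2,a}` of functions on the unit circle (written as `2π`-periodic functions of the
angle `θ`): continuous, twice continuously differentiable off the point `1` of the circle, and of
finite norm. -/
def MemF {E : Type*} [NormedAddCommGroup E] [NormedSpace ℝ E] (a : ℝ) (σ : ℝ → E) : Prop :=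
  Function.Periodic σ (2 * Real.pi) ∧ Continuous σ ∧
    ContDiffOn ℝ 2 σ {θ : ℝ | ∀ n : ℤ, θ ≠ n * (2 * Real.pi)} ∧ fNorm a σ < ∞

/-- The boundary values `θ ↦ A(e^{iθ})` of a disc. -/
noncomputable def bdry {d m : ℕ} (A : ℂ → Cn d m) (θ : ℝ) : Cn d m :=
  A (Complex.exp (θ * Complex.I))

/-- An analytic disc of class `F^{2,a}`: continuous on the closed unit disc, holomorphic inside,
with boundary values in `F^{2,a}`. Values outside the closed disc play no role. -/
def IsFDisc {d m : ℕ} (a : ℝ) (A : ℂ → Cn d m) : Prop :=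
  DiffContOnCl ℂ A (ball 0 1) ∧ MemF a (bdry A)

/-- The disc `A` is attached to the set `S`. -/
def IsAttached {d m : ℕ} (A : ℂ → Cn d m) (S : Set (Cn d m)) : Prop :=
  ∀ τ ∈ sphere (0 : ℂ) 1, A τ ∈ S

/-- The normal component of `A` has at `1` a derivative along the inward radius, and its value, the
class in `T ℂⁿ / T M` of the derivative of `s ↦ A(1 - s)` at `s = 0⁺`, is `D`. Only the normal
component of `A` is differentiated. -/
def HasInnerNormalDeriv {d m : ℕ} (h : Par d m → (Fin d → ℝ)) (A : ℂ → Cn d m)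
    (D : Fin d → ℝ) : Prop :=
  HasDerivWithinAt (fun s : ℝ => normalPart h (A 1) (A ((1 - s : ℝ) : ℂ))) D (Ici 0) 0

/-- The matrix `∂'r(P) = (∂r_j/∂z_l)`, with `∂/∂z_l = (∂/∂x_l - i ∂/∂y_l)/2`. -/
noncomputable def dzr {d m : ℕ} (h : Par d m → (Fin d → ℝ)) (P : Cn d m) :
    Matrix (Fin d) (Fin d) ℂ :=
  Matrix.of fun j l =>
    (1 / 2 : ℂ) * ((fderiv ℝ (definingFn h) P (Pi.single l 1, 0) j : ℂ)
      - Complex.I * (fderiv ℝ (definingFn h) P (Pi.single l Complex.I, 0) j : ℂ))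

/-- A continuous real matrix function `G` on the unit circle with `G(1) = id` such that
`G · (∂'r ∘ A)` extends holomorphically to the unit disc. -/
def IsTransport {d m : ℕ} (h : Par d m → (Fin d → ℝ)) (A : ℂ → Cn d m)
    (G : ℂ → Matrix (Fin d) (Fin d) ℝ) : Prop :=
  ContinuousOn G (sphere 0 1) ∧ G 1 = 1 ∧
    ∃ Φ : ℂ → Matrix (Fin d) (Fin d) ℂ,
      (∀ i j, DiffContOnCl ℂ (fun τ => Φ τ i j) (ball 0 1)) ∧
      ∀ τ ∈ sphere (0 : ℂ) 1, Φ τ = (G τ).map Complex.ofReal * dzr h (A τ)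

/-- `c` is a curve of class `C^r` on `I` with values in the normed space `F^{2,a}`, with successive
derivatives `Γ 0 = c, Γ 1, …, Γ r`. -/
def IsFCurve {E : Type*} [NormedAddCommGroup E] [NormedSpace ℝ E] (a : ℝ) (r : ℕ) (I : Set ℝ)
    (c : ℝ → ℝ → E) : Prop :=
  ∃ Γ : ℕ → ℝ → ℝ → E,
    (∀ η ∈ I, Γ 0 η = c η) ∧
    (∀ j ≤ r, ∀ η ∈ I, MemF a (Γ j η)) ∧
    (∀ j ≤ r, ∀ η ∈ I, Tendsto (fun s => fNorm a (Γ j s - Γ j η)) (𝓝[I] η) (𝓝 0)) ∧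
    (∀ j < r, ∀ η ∈ I,
      Tendsto (fun s => fNorm a ((s - η)⁻¹ • (Γ j s - Γ j η) - Γ (j + 1) η)) (𝓝[I \ {η}] η) (𝓝 0))

/-- A `C^k` family of `F^{2,a}` discs `A^η`, `0 ≤ η ≤ η₀`: every `A^η` is an `F^{2,a}` disc,
`(η, τ) ↦ A^η(τ)` is of class `C^k` on `[0, η₀] × Δ` with `Δ` the open unit disc, and, up to the
boundary, `η ↦ A^η` is of class `C^{k-3}` in the norm of `F^{2,a}`. -/
structure IsDiscFamily {d m : ℕ} (k : ℕ) (a η₀ : ℝ) (A : ℝ → ℂ → Cn d m) : Prop where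
  isFDisc : ∀ η ∈ Icc 0 η₀, IsFDisc a (A η)
  contDiffOn : ContDiffOn ℝ (k : WithTop ℕ∞) (fun p : ℝ × ℂ => A p.1 p.2) (Icc 0 η₀ ×ˢ ball 0 1)
  isFCurve : IsFCurve a (k - 3) (Icc 0 η₀) (fun η => bdry (A η))

end CRDisc

/-! The new discs are sought as A + ((1 - τ) Z, 0) with Z holomorphic. The factor 1 - τ fixes A(1) =
p, and because A is tangent to M at p it makes the inner normal derivative at 1 equal to Im Z(1), so
that Z need only be continuous there. Near -1 the graph of h is replaced by that of h + K(·, ηχ),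
where K = H - h describes M' and χ ≥ 0 is a bump at -1. With s = Re((1 - ζ)Z), attachment becomes
Im((1 - ζ)Z) = R on the circle, where R = h(x + s, w) - h(x, w) + K(x + s, w, ηχ).

Put f = R/(1 - ζ) and let C be the Cauchy projection. As R is real, conj f = -ζ f, and the Plemelj
formula yields R = 2 Re((1 - ζ) Cf) (`one_sub_mul_eq`); hence a solution of Z = 2i Cf is a solution
of the attachment equation (`im_one_sub_mul_bishop`). The division by 1 - ζ creates no singularity:
h(x + s, w) - h(x, w) is an averaged differential (`hadamard`) applied to s, one has s/(1 - ζ) = (Z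
- conj ζ conj Z)/2 on the circle, and 1/(1 - ζ) is smooth on the support of χ. So f is a smooth
function of A, ζ, η and Z, whose Z-derivative at η = 0, Z = 0 vanishes when A = 0, and the implicit
function theorem solves Z = 2i Cf for all small A, uniformly in K and χ
(`eventually_exists_bishop_family`).

The regularity is a matter of counting derivatives. Composition with a fixed function loses none in
the supremum norm, one in a Hölder norm and three in F^{2,α} (`Bd.contDiff_nem`, `HSp.contDiff_nem`,
`FSp.contDiff_nem`). The projection C is bounded on Hölder spaces by Privalov's theorem, and on
F^{2,α} because it commutes with (ζ - 1) d/dζ (`WeightedDeriv.cauchyL`). So η ↦ Z is C^{k-3} into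
F^{2,α} and C^{k-1} into the Hölder space. The last derivative is gained in L², where C is an
orthogonal projection: the equation for ∂Z/∂η is linear, with coefficients of class C^{k-1} in the
supremum norm (`eventually_contDiffAt_toSqInt`). Pairing with the Cauchy kernel then gives joint C^k
smoothness inside the disc.

For the direction let V = ∂Z/∂η at η = 0, κ = ∂K/∂t and Φ = G · (∂'r ∘ A). Multiplying the
linearized equation by G removes the terms in Dh and leaves 2 Re((1 - ζ)ΦV) = χ Gκ, with ΦV
holomorphic. Poisson's formula on the radius, divided by 1 - r as r → 1, gives Im V(1) = 2 avg(|ζ -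
1|⁻² χ Gκ) (`im_eq_avg_transport`): a weighted mean of Gκ near -1, where Gκ is G(-1)[v]. Normalizing
χ and shrinking its support makes the error smaller than ε. The matrix G itself comes from a linear
equation of the same kind (`exists_transport_potential`). -/

namespace CRDisc

set_option linter.unusedSectionVars false

/-! ### Averaged differentials along segments -/

section Hadamard

variable {E : Type} [NormedAddCommGroup E] [NormedSpace ℝ E] [FiniteDimensional ℝ E]

/-- Differentiation under the integral sign, iterated. The derivative is again a parametric
integral, now with values in `E →L[ℝ] F`, so the induction runs over all target spaces at once. -/
theorem contDiff_parametric_integral (n : ℕ) :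
    ∀ {F : Type} [NormedAddCommGroup F] [NormedSpace ℝ F] {f : E × ℝ → F},
      ContDiff ℝ n f → ContDiff ℝ n (fun x => ∫ t in (0 : ℝ)..1, f (x, t)) := by
  induction n with
  | zero =>
    intro F _ _ f hf
    simp only [Nat.cast_zero, contDiff_zero] at hf ⊢
    exact intervalIntegral.continuous_parametric_intervalIntegral_of_continuous'
      (f := fun x t => f (x, t)) hf 0 1
  | succ n ih =>
    intro F _ _ f hf
    have : ProperSpace E := FiniteDimensional.proper ℝ E
    rw [Nat.cast_add, Nat.cast_one] at hf ⊢
    rw [contDiff_succ_iff_hasFDerivAt]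
    have hf1 : ContDiff ℝ n (fun p : E × ℝ => (fderiv ℝ f p).comp (ContinuousLinearMap.inl ℝ E ℝ)) :=
      (hf.fderiv_right le_rfl).clm_comp contDiff_const
    refine ⟨_, ih hf1, fun x => ?_⟩
    have hcont := hf1.continuous
    obtain ⟨C, hC⟩ := ((isCompact_closedBall x 1).prod (isCompact_Icc (a := (0 : ℝ)) (b := 1))).exists_bound_of_continuousOn hcont.continuousOn
    refine intervalIntegral.hasFDerivAt_integral_of_dominated_of_fderiv_le
      (bound := fun _ => C) (F := fun x t => f (x, t))
      (F' := fun x t => (fderiv ℝ f (x, t)).comp (ContinuousLinearMap.inl ℝ E ℝ))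
      (closedBall_mem_nhds x one_pos) ?_ ?_ ?_ ?_ ?_ ?_
    · exact Eventually.of_forall fun y =>
        (hf.continuous.comp (by fun_prop)).aestronglyMeasurable
    · exact (hf.continuous.comp (by fun_prop : Continuous fun t : ℝ => (x, t))).intervalIntegrable _ _
    · exact (hcont.comp (by fun_prop : Continuous fun t : ℝ => (x, t))).aestronglyMeasurable
    · refine Eventually.of_forall fun t ht y hy => hC (y, t) ⟨hy, ?_⟩
      rw [uIoc_of_le zero_le_one] at ht
      exact ⟨ht.1.le, ht.2⟩
    · exact intervalIntegrable_const
    · refine Eventually.of_forall fun t _ y _ => ?_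
      have h1 : HasFDerivAt f (fderiv ℝ f (y, t)) (y, t) :=
        (hf.differentiable (by simp)).differentiableAt.hasFDerivAt
      exact h1.comp y (hasFDerivAt_prodMk_left y t)

variable {F : Type} [NormedAddCommGroup F] [NormedSpace ℝ F]

/-- The mean `∫₀¹ Dg(b + t(a - b)) dt` of the derivative over a segment. -/
noncomputable def hadamard (g : E → F) (p : E × E) : E →L[ℝ] F :=
  ∫ t in (0 : ℝ)..1, fderiv ℝ g (p.2 + t • (p.1 - p.2))

theorem contDiff_hadamard {n : ℕ} {g : E → F} (hg : ContDiff ℝ (n + 1) g) :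
    ContDiff ℝ n (hadamard g) := by
  refine contDiff_parametric_integral n (E := E × E)
    (f := fun q => fderiv ℝ g (q.1.2 + q.2 • (q.1.1 - q.1.2))) ?_
  exact (hg.fderiv_right le_rfl).comp (by fun_prop)

theorem hadamard_self [CompleteSpace F] {g : E → F} (a : E) : hadamard g (a, a) = fderiv ℝ g a := by
  simp [hadamard]

/-- The fundamental theorem of calculus on the segment from b to a. The factorization is exact, with
a coefficient smooth in both end points; it lets difference quotients, and later the division by 1 -
ζ, pass through a composition with `g`. -/
theorem hadamard_apply_sub [CompleteSpace F] {g : E → F} (hg : ContDiff ℝ 1 g) (a b : E) :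
    hadamard g (a, b) (a - b) = g a - g b := by
  have hc : Continuous fun t : ℝ => fderiv ℝ g (b + t • (a - b)) :=
    (hg.continuous_fderiv (by simp)).comp (by fun_prop)
  have h1 : ∀ t ∈ uIcc (0 : ℝ) 1, HasDerivAt (fun t : ℝ => g (b + t • (a - b)))
      (fderiv ℝ g (b + t • (a - b)) (a - b)) t := by
    intro t _
    have h2 : HasDerivAt (fun t : ℝ => b + t • (a - b)) (a - b) t := by
      simpa using ((hasDerivAt_id t).smul_const (a - b)).const_add b
    exact (((hg.differentiable (by simp)) _).hasFDerivAt).comp_hasDerivAt t h2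
  have h3 := intervalIntegral.integral_eq_sub_of_hasDerivAt h1
    ((hc.clm_apply continuous_const).intervalIntegrable _ _)
  rw [hadamard, ContinuousLinearMap.intervalIntegral_apply (hc.intervalIntegrable _ _), h3]
  simp

end Hadamard

/-! ### Smoothness tested through a linear isometric embedding -/

section LinearIsometry

variable {X : Type} [NormedAddCommGroup X] [NormedSpace ℝ X]

/-- A map into a complete space is smooth if it is so after a linear isometric embedding. -/
theorem contDiff_of_linearIsometry_comp (n : ℕ) :
    ∀ {Y Z : Type} [NormedAddCommGroup Y] [NormedSpace ℝ Y] [CompleteSpace Y]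
      [NormedAddCommGroup Z] [NormedSpace ℝ Z] (j : Y →ₗᵢ[ℝ] Z) {f : X → Y},
      ContDiff ℝ n (fun x => j (f x)) → ContDiff ℝ n f := by
  induction n with
  | zero =>
    intro Y Z _ _ _ _ _ j f hf
    simp only [Nat.cast_zero, contDiff_zero] at hf ⊢
    exact j.isometry.isEmbedding.continuous_iff.2 hf
  | succ n ih =>
    intro Y Z _ _ _ _ _ j f hf
    rw [Nat.cast_add, Nat.cast_one] at hf ⊢
    rw [contDiff_succ_iff_hasFDerivAt] at hf ⊢
    obtain ⟨f', hf', hd⟩ := hf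
    have hcl : IsClosed (range j) := j.isometry.isClosedEmbedding.isClosed_range
    -- Directional derivatives are limits of difference quotients lying in the closed range of `j`,
    -- so the derivative of `j ∘ f` factors through `j`.
    have hmem : ∀ x v, f' x v ∈ range j := by
      intro x v
      have h1 : HasDerivAt (fun t : ℝ => j (f (x + t • v))) (f' x v) 0 := by
        have h2 : HasDerivAt (fun t : ℝ => x + t • v) v 0 := by
          simpa using ((hasDerivAt_id (0 : ℝ)).smul_const v).const_add x
        have h3 : HasFDerivAt (fun x => j (f x)) (f' x) (x + (0 : ℝ) • v) := by simpa using hd x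
        exact h3.comp_hasDerivAt (0 : ℝ) h2
      rw [hasDerivAt_iff_tendsto_slope] at h1
      refine hcl.mem_of_tendsto h1 (Eventually.of_forall fun t => ?_)
      refine ⟨(t - 0)⁻¹ • (f (x + t • v) - f (x + (0 : ℝ) • v)), ?_⟩
      simp [slope, map_smul, map_sub]
    have hex : ∀ x, ∃ L : X →L[ℝ] Y, ∀ v, j (L v) = f' x v := by
      intro x
      let e := LinearEquiv.ofInjective j.toLinearMap j.injective
      let L : X →ₗ[ℝ] Y := e.symm.toLinearMap.comp
        ((f' x : X →ₗ[ℝ] Z).codRestrict _ (fun v => by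
          exact hmem x v))
      have hL : ∀ v, j (L v) = f' x v := by
        intro v
        exact congrArg Subtype.val (e.apply_symm_apply ⟨f' x v, hmem x v⟩)
      refine ⟨L.mkContinuous ‖f' x‖ fun v => ?_, hL⟩
      rw [← j.norm_map, hL]
      exact (f' x).le_opNorm v
    choose L hL using hex
    -- Post-composition with `j` is again an isometry, so the induction hypothesis applies to the
    -- derivative.
    let J : (X →L[ℝ] Y) →ₗᵢ[ℝ] (X →L[ℝ] Z) :=
      { toFun := fun A => j.toContinuousLinearMap.comp A
        map_add' := fun A B => by ext; simp
        map_smul' := fun c A => by ext; simp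
        norm_map' := fun A => by
          refine le_antisymm ?_ ?_
          · refine ContinuousLinearMap.opNorm_le_bound _ (norm_nonneg _) fun v => ?_
            simpa using A.le_opNorm v
          · refine ContinuousLinearMap.opNorm_le_bound _ (norm_nonneg _) fun v => ?_
            simpa using (j.toContinuousLinearMap.comp A).le_opNorm v }
    have hJ : (fun x => J (L x)) = f' := by
      funext x; ext v; exact hL x v
    refine ⟨L, ih J (by rw [hJ]; exact hf'), fun x => ?_⟩
    have := hd x
    rw [hasFDerivAt_iff_isLittleO_nhds_zero] at this ⊢
    refine IsLittleO.of_norm_left (this.norm_left.congr_left fun v => ?_)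
    rw [← hL, ← map_sub, ← map_sub, j.norm_map]

end LinearIsometry

/-! ### Composition operators in the supremum norm -/

section Nemytskii

/-- Bounded continuous functions with the supremum norm. -/
def Bd (T : Type) [TopologicalSpace T] (E : Type) [NormedAddCommGroup E] : Type :=
  BoundedContinuousFunction T E

section

variable {T : Type} [TopologicalSpace T] {E : Type} [NormedAddCommGroup E]

noncomputable instance : NormedAddCommGroup (Bd T E) :=
  inferInstanceAs (NormedAddCommGroup (BoundedContinuousFunction T E))

noncomputable instance [NormedSpace ℝ E] : NormedSpace ℝ (Bd T E) :=
  inferInstanceAs (NormedSpace ℝ (BoundedContinuousFunction T E))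

instance [CompleteSpace E] : CompleteSpace (Bd T E) :=
  inferInstanceAs (CompleteSpace (BoundedContinuousFunction T E))

instance : FunLike (Bd T E) T E :=
  inferInstanceAs (FunLike (BoundedContinuousFunction T E) T E)

/-- A bounded continuous function as an element of the normed space. -/
noncomputable def Bd.mk (f : T → E) (hf : Continuous f) (hb : ∃ C, ∀ t, ‖f t‖ ≤ C) : Bd T E :=
  BoundedContinuousFunction.ofNormedAddCommGroup f hf hb.choose hb.choose_spec

@[simp] theorem Bd.mk_apply (f : T → E) (hf : Continuous f) (hb : ∃ C, ∀ t, ‖f t‖ ≤ C) (t : T) :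
    Bd.mk f hf hb t = f t := rfl

@[ext] theorem Bd.ext {f g : Bd T E} (h : ∀ t, f t = g t) : f = g :=
  BoundedContinuousFunction.ext h

theorem Bd.continuous (f : Bd T E) : Continuous f :=
  BoundedContinuousFunction.continuous (f : BoundedContinuousFunction T E)

@[simp] theorem Bd.add_apply (f g : Bd T E) (t : T) : (f + g) t = f t + g t := rfl
@[simp] theorem Bd.sub_apply (f g : Bd T E) (t : T) : (f - g) t = f t - g t := rfl
@[simp] theorem Bd.zero_apply (t : T) : (0 : Bd T E) t = 0 := rfl
@[simp] theorem Bd.smul_apply [NormedSpace ℝ E] (c : ℝ) (f : Bd T E) (t : T) :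
    (c • f) t = c • f t := rfl

theorem Bd.norm_apply_le (f : Bd T E) (t : T) : ‖f t‖ ≤ ‖f‖ :=
  BoundedContinuousFunction.norm_coe_le_norm (f : BoundedContinuousFunction T E) t

theorem Bd.norm_le {f : Bd T E} {C : ℝ} (hC : 0 ≤ C) : ‖f‖ ≤ C ↔ ∀ t, ‖f t‖ ≤ C :=
  BoundedContinuousFunction.norm_le hC

/-- Evaluation at a point. -/
noncomputable def Bd.eval [NormedSpace ℝ E] (t : T) : Bd T E →L[ℝ] E :=
  LinearMap.mkContinuous ⟨⟨fun f => f t, fun _ _ => rfl⟩, fun _ _ => rfl⟩ 1 fun f => by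
    rw [one_mul]; exact f.norm_apply_le t

@[simp] theorem Bd.eval_apply [NormedSpace ℝ E] (t : T) (f : Bd T E) : Bd.eval t f = f t := rfl

/-- Pairing of bounded continuous functions. -/
noncomputable def Bd.pair {F : Type} [NormedAddCommGroup F] (f : Bd T E) (g : Bd T F) :
    Bd T (E × F) :=
  Bd.mk (fun t => (f t, g t)) (f.continuous.prodMk g.continuous)
    ⟨max ‖f‖ ‖g‖, fun t => max_le_max (f.norm_apply_le t) (g.norm_apply_le t)⟩

theorem Bd.continuous_pair {F : Type} [NormedAddCommGroup F] (g : Bd T F) :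
    Continuous fun f : Bd T E => f.pair g := by
  refine LipschitzWith.continuous (K := 1) (LipschitzWith.of_dist_le_mul fun f f' => ?_)
  rw [NNReal.coe_one, one_mul, dist_eq_norm, dist_eq_norm]
  refine (Bd.norm_le (norm_nonneg _)).2 fun t => ?_
  simpa [Bd.pair] using (f - f').norm_apply_le t

end

variable {T : Type} [TopologicalSpace T]
variable {E : Type} [NormedAddCommGroup E] [NormedSpace ℝ E] [FiniteDimensional ℝ E]

/-- The composition operator `f ↦ g ∘ f` on bounded continuous functions. -/
noncomputable def Bd.nem {F : Type} [NormedAddCommGroup F] {g : E → F} (hg : Continuous g)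
    (f : Bd T E) : Bd T F :=
  Bd.mk (fun t => g (f t)) (hg.comp f.continuous) (by
    have : ProperSpace E := FiniteDimensional.proper ℝ E
    obtain ⟨C, hC⟩ := (isCompact_closedBall (0 : E) ‖f‖).exists_bound_of_continuousOn
      hg.continuousOn
    exact ⟨C, fun t => hC _ (by simpa using f.norm_apply_le t)⟩)

@[simp] theorem Bd.nem_apply {F : Type} [NormedAddCommGroup F] {g : E → F} (hg : Continuous g)
    (f : Bd T E) (t : T) : Bd.nem hg f t = g (f t) := rfl

theorem Bd.continuous_nem {F : Type} [NormedAddCommGroup F] {g : E → F} (hg : Continuous g) :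
    Continuous (Bd.nem hg : Bd T E → Bd T F) := by
  have : ProperSpace E := FiniteDimensional.proper ℝ E
  rw [Metric.continuous_iff]
  intro f ε hε
  -- A ball of radius `‖f‖ + 1` is compact and contains the values of every function at distance
  -- less than 1 from `f`.
  have huc := (isCompact_closedBall (0 : E) (‖f‖ + 1)).uniformContinuousOn_of_continuous
    hg.continuousOn
  rw [Metric.uniformContinuousOn_iff] at huc
  obtain ⟨δ, hδ, H⟩ := huc (ε / 2) (by positivity)
  refine ⟨min δ 1, by positivity, fun f' hf' => ?_⟩
  rw [dist_eq_norm] at hf' ⊢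
  refine lt_of_le_of_lt ((Bd.norm_le (by positivity : 0 ≤ ε / 2)).2 fun t => ?_)
    (half_lt_self hε)
  have h1 : ‖f' t - f t‖ < min δ 1 := lt_of_le_of_lt ((f' - f).norm_apply_le t) hf'
  have h2 : ‖f t‖ ≤ ‖f‖ := f.norm_apply_le t
  rw [Bd.sub_apply, Bd.nem_apply, Bd.nem_apply, ← dist_eq_norm]
  refine (H _ ?_ _ ?_ (by rw [dist_eq_norm]; exact h1.trans_le (min_le_left _ _))).le
  · have h3 := h1.trans_le (min_le_right _ _)
    have h4 := norm_le_norm_add_norm_sub' (f' t) (f t)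
    simp only [mem_closedBall, dist_zero_right]
    linarith
  · simp only [mem_closedBall, dist_zero_right]
    linarith

/-- The pointwise action of a function with values in linear maps. -/
noncomputable def Bd.applyL (T : Type) [TopologicalSpace T] (E F : Type) [NormedAddCommGroup E]
    [NormedSpace ℝ E] [NormedAddCommGroup F] [NormedSpace ℝ F] :
    Bd T (E →L[ℝ] F) →L[ℝ] Bd T E →L[ℝ] Bd T F :=
  LinearMap.mkContinuous₂
    (LinearMap.mk₂ ℝ
      (fun (A : Bd T (E →L[ℝ] F)) (f : Bd T E) => Bd.mk (fun t => A t (f t))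
        (A.continuous.clm_apply f.continuous) ⟨‖A‖ * ‖f‖, fun t =>
          ((A t).le_opNorm _).trans (by
            gcongr
            · exact A.norm_apply_le t
            · exact f.norm_apply_le t)⟩)
      (fun _ _ _ => by ext; simp) (fun _ _ _ => by ext; simp)
      (fun _ _ _ => by ext; simp) (fun _ _ _ => by ext; simp)) 1 (fun A f => by
        rw [one_mul]
        refine (Bd.norm_le (by positivity)).2 fun t => ?_
        refine ((A t).le_opNorm _).trans ?_
        gcongr
        · exact A.norm_apply_le t
        · exact f.norm_apply_le t)

@[simp] theorem Bd.applyL_apply {F : Type} [NormedAddCommGroup F] [NormedSpace ℝ F]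
    (A : Bd T (E →L[ℝ] F)) (f : Bd T E) (t : T) : Bd.applyL T E F A f t = A t (f t) := rfl

/-- No derivative is lost. The first order remainder at `f` is exactly `hadamard g (f', f) - Dg(f)`
applied to `f' - f`, and this coefficient tends to zero by mere continuity of composition operators.
The derivative is composition with `fderiv ℝ g`, to which induction applies. -/
theorem Bd.contDiff_nem (n : ℕ) :
    ∀ {F : Type} [NormedAddCommGroup F] [NormedSpace ℝ F] [CompleteSpace F] {g : E → F}
      (hc : Continuous g), ContDiff ℝ n g → ContDiff ℝ n (Bd.nem hc : Bd T E → Bd T F) := by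
  induction n with
  | zero =>
    intro F _ _ _ g hgc hg
    simp only [Nat.cast_zero, contDiff_zero]
    exact Bd.continuous_nem _
  | succ n ih =>
    intro F _ _ _ g hgc hg
    have hg' : ContDiff ℝ (n + 1) g := by exact_mod_cast hg
    have hg1 : ContDiff ℝ 1 g := hg'.of_le (by simp)
    have hd : ContDiff ℝ n (fderiv ℝ g) := hg'.fderiv_right le_rfl
    rw [Nat.cast_add, Nat.cast_one, contDiff_succ_iff_hasFDerivAt]
    refine ⟨fun f => Bd.applyL T E F (Bd.nem hd.continuous f),
      (Bd.applyL T E F).contDiff.comp (ih hd.continuous hd), fun f => ?_⟩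
    have hh := (contDiff_hadamard hg').continuous
    let Q : Bd T E → Bd T (E →L[ℝ] F) := fun f' => Bd.nem hh (f'.pair f)
    have hQc : Continuous Q := (Bd.continuous_nem hh).comp (Bd.continuous_pair f)
    have hQ : ∀ f' t, Q f' t = hadamard g (f' t, f t) := fun f' t => rfl
    have hQf : Q f = Bd.nem hd.continuous f := by
      ext1 t; rw [hQ, hadamard_self]; rfl
    rw [hasFDerivAt_iff_isLittleO]
    have hid : ∀ f', Bd.nem hgc f' - Bd.nem hgc f -
        Bd.applyL T E F (Bd.nem hd.continuous f) (f' - f) =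
        Bd.applyL T E F (Q f' - Q f) (f' - f) := by
      intro f'
      rw [map_sub (Bd.applyL T E F), _root_.sub_apply, hQf]
      congr 1
      ext1 t
      simp only [Bd.sub_apply, Bd.nem_apply, Bd.applyL_apply, hQ]
      exact (hadamard_apply_sub hg1 _ _).symm
    rw [isLittleO_iff]
    intro c hc
    have hlim : Tendsto (fun f' => ‖Bd.applyL T E F (Q f' - Q f)‖) (𝓝 f) (𝓝 0) := by
      have : Continuous fun f' => ‖Bd.applyL T E F (Q f' - Q f)‖ := by fun_prop
      simpa using this.tendsto f
    filter_upwards [hlim.eventually (gt_mem_nhds hc)] with f' hf'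
    rw [hid]
    exact ((Bd.applyL T E F (Q f' - Q f)).le_opNorm _).trans (by gcongr)

end Nemytskii

/-! ### Hölder spaces as spaces of bounded difference quotients -/

section HolderSpace

/-- The product `S × S`, with the discrete topology. -/
def Pairs (S : Type) : Type := S × S

/-- Discreteness makes every bounded function on pairs continuous, so difference quotients live in a
space `Bd` whose composition operators are already understood. -/
instance (S : Type) : TopologicalSpace (Pairs S) := ⊥
instance (S : Type) : DiscreteTopology (Pairs S) := ⟨rfl⟩

variable {S : Type} (ω : S → S → ℝ)

/-- Bounded functions whose oscillation is controlled by the weight `ω`. -/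
def holderSubmodule (E : Type) [NormedAddCommGroup E] [NormedSpace ℝ E] : Submodule ℝ (S → E) where
  carrier := {f | (∃ C, ∀ x, ‖f x‖ ≤ C) ∧ ∃ C, ∀ x y, ‖f x - f y‖ ≤ C * |ω x y|}
  add_mem' := by
    rintro f g ⟨⟨A, hA⟩, B, hB⟩ ⟨⟨A', hA'⟩, B', hB'⟩
    refine ⟨⟨A + A', fun x => (norm_add_le _ _).trans (add_le_add (hA x) (hA' x))⟩, B + B',
      fun x y => ?_⟩
    rw [add_mul, Pi.add_apply, Pi.add_apply, add_sub_add_comm]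
    exact (norm_add_le _ _).trans (add_le_add (hB x y) (hB' x y))
  zero_mem' := ⟨⟨0, by simp⟩, 0, by simp⟩
  smul_mem' := by
    rintro c f ⟨⟨A, hA⟩, B, hB⟩
    refine ⟨⟨‖c‖ * A, fun x => ?_⟩, ‖c‖ * B, fun x y => ?_⟩
    · rw [Pi.smul_apply, norm_smul]
      exact mul_le_mul_of_nonneg_left (hA x) (norm_nonneg _)
    · rw [Pi.smul_apply, Pi.smul_apply, ← smul_sub, norm_smul, mul_assoc]
      exact mul_le_mul_of_nonneg_left (hB x y) (norm_nonneg _)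

/-- The Hölder space with respect to the weight `ω`. -/
def HSp (E : Type) [NormedAddCommGroup E] [NormedSpace ℝ E] : Type := holderSubmodule ω E

variable {ω}
variable {E : Type} [NormedAddCommGroup E] [NormedSpace ℝ E]

instance : AddCommGroup (HSp ω E) := inferInstanceAs (AddCommGroup (holderSubmodule ω E))
instance : Module ℝ (HSp ω E) := inferInstanceAs (Module ℝ (holderSubmodule ω E))
instance : FunLike (HSp ω E) S E := ⟨fun f => f.1, Subtype.val_injective⟩

@[ext] theorem HSp.ext {f g : HSp ω E} (h : ∀ x, f x = g x) : f = g := DFunLike.ext _ _ h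

theorem HSp.bounded (f : HSp ω E) : ∃ C, ∀ x, ‖f x‖ ≤ C := f.2.1
theorem HSp.holder (f : HSp ω E) : ∃ C, ∀ x y, ‖f x - f y‖ ≤ C * |ω x y| := f.2.2

/-- An element of the Hölder space from its bounds. -/
def HSp.mk (f : S → E) (h1 : ∃ C, ∀ x, ‖f x‖ ≤ C)
    (h2 : ∃ C, ∀ x y, ‖f x - f y‖ ≤ C * |ω x y|) : HSp ω E := ⟨f, h1, h2⟩

@[simp] theorem HSp.mk_apply (f : S → E) (h1 : ∃ C, ∀ x, ‖f x‖ ≤ C)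
    (h2 : ∃ C, ∀ x y, ‖f x - f y‖ ≤ C * |ω x y|) (x : S) : (HSp.mk f h1 h2 : HSp ω E) x = f x := rfl

@[simp] theorem HSp.add_apply (f g : HSp ω E) (x : S) : (f + g) x = f x + g x := rfl
@[simp] theorem HSp.sub_apply (f g : HSp ω E) (x : S) : (f - g) x = f x - g x := rfl
@[simp] theorem HSp.zero_apply (x : S) : (0 : HSp ω E) x = 0 := rfl
@[simp] theorem HSp.smul_apply (c : ℝ) (f : HSp ω E) (x : S) : (c • f) x = c • f x := rfl

/-- A function together with its values and difference quotients on pairs. -/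
noncomputable def HSp.quot : HSp ω E →ₗ[ℝ] Bd (Pairs S) (E × E × E) where
  toFun f := Bd.mk (fun p => (f p.1, f p.2, (ω p.1 p.2)⁻¹ • (f p.1 - f p.2)))
    continuous_of_discreteTopology (by
      obtain ⟨A, hA⟩ := f.bounded
      obtain ⟨B, hB⟩ := f.holder
      refine ⟨max A (max A |B|), fun p => max_le_max (hA _) (max_le_max (hA _) ?_)⟩
      rw [norm_smul, norm_inv, Real.norm_eq_abs]
      by_cases h : ω p.1 p.2 = 0
      · simp [h]
      · rw [inv_mul_le_iff₀ (abs_pos.2 h), mul_comm]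
        exact (hB _ _).trans (by gcongr; exact le_abs_self _))
  map_add' f g := by
    ext p : 1
    simp [add_sub_add_comm]
  map_smul' c f := by
    ext p : 1
    simp [← smul_sub, smul_comm c]

theorem HSp.quot_apply (f : HSp ω E) (p : Pairs S) :
    HSp.quot f p = (f p.1, f p.2, (ω p.1 p.2)⁻¹ • (f p.1 - f p.2)) := rfl

theorem HSp.quot_injective : Function.Injective (HSp.quot : HSp ω E →ₗ[ℝ] _) := by
  intro f g h
  ext x
  have := congrArg (fun u : Bd (Pairs S) (E × E × E) => (u (x, x)).1) h
  exact this

noncomputable instance : NormedAddCommGroup (HSp ω E) :=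
  NormedAddCommGroup.induced (HSp ω E) (Bd (Pairs S) (E × E × E)) HSp.quot HSp.quot_injective

theorem HSp.norm_def (f : HSp ω E) : ‖f‖ = ‖HSp.quot f‖ := rfl

noncomputable instance : NormedSpace ℝ (HSp ω E) where
  norm_smul_le c f := by
    rw [HSp.norm_def, HSp.norm_def, map_smul]
    exact norm_smul_le _ _

/-- `HSp.quot` as a linear isometry. -/
noncomputable def HSp.quotIso : HSp ω E →ₗᵢ[ℝ] Bd (Pairs S) (E × E × E) :=
  ⟨HSp.quot, fun _ => rfl⟩

@[simp] theorem HSp.quotIso_apply (f : HSp ω E) : HSp.quotIso f = HSp.quot f := rfl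

theorem HSp.norm_apply_le (f : HSp ω E) (x : S) : ‖f x‖ ≤ ‖f‖ :=
  (le_max_left _ _).trans ((HSp.quot f).norm_apply_le (x, x))

theorem HSp.norm_sub_le (f : HSp ω E) {x y : S} (h : 0 ≤ ω x y) :
    ‖f x - f y‖ ≤ ‖f‖ * ω x y := by
  have h1 : ‖(ω x y)⁻¹ • (f x - f y)‖ ≤ ‖f‖ :=
    ((le_max_right _ _).trans (le_max_right _ _)).trans ((HSp.quot f).norm_apply_le (x, y))
  rcases h.eq_or_lt with h0 | h0
  · obtain ⟨B, hB⟩ := f.holder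
    have := hB x y
    rw [← h0, abs_zero, mul_zero] at this
    rwa [← h0, mul_zero]
  · rw [norm_smul, norm_inv, Real.norm_of_nonneg h, inv_mul_le_iff₀ h0] at h1
    rwa [mul_comm]

theorem HSp.norm_le {f : HSp ω E} {C : ℝ} (hC : 0 ≤ C) (h1 : ∀ x, ‖f x‖ ≤ C)
    (h2 : ∀ x y, ‖f x - f y‖ ≤ C * ω x y) : ‖f‖ ≤ C := by
  rw [HSp.norm_def]
  refine (Bd.norm_le hC).2 fun p => max_le (h1 _) (max_le (h1 _) ?_)
  change ‖(ω p.1 p.2)⁻¹ • (f p.1 - f p.2)‖ ≤ C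
  rw [norm_smul, norm_inv]
  by_cases h : ω p.1 p.2 = 0
  · simpa [h] using hC
  · rw [inv_mul_le_iff₀ (norm_pos_iff.2 h), mul_comm]
    exact (h2 _ _).trans (mul_le_mul_of_nonneg_left (le_abs_self _) hC)

/-- Evaluation at a point. -/
noncomputable def HSp.eval (x : S) : HSp ω E →L[ℝ] E :=
  LinearMap.mkContinuous ⟨⟨fun f => f x, fun _ _ => rfl⟩, fun _ _ => rfl⟩ 1 fun f => by
    rw [one_mul]; exact f.norm_apply_le x

@[simp] theorem HSp.eval_apply (x : S) (f : HSp ω E) : HSp.eval x f = f x := rfl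

/-- The range is cut out by pointwise linear relations. Both relations between the third entry and
the difference are needed: where ω = 0 the first forces equal values and the second forces the third
entry to be 0, in agreement with `0⁻¹ = 0`. -/
theorem HSp.isClosed_range_quot :
    IsClosed (range (HSp.quot : HSp ω E →ₗ[ℝ] Bd (Pairs S) (E × E × E))) := by
  have hrange : range (HSp.quot : HSp ω E →ₗ[ℝ] Bd (Pairs S) (E × E × E)) =
      ⋂ p : Pairs S, {u | (u p).1 = (u (p.1, p.1)).1 ∧ (u p).2.1 = (u (p.2, p.2)).1 ∧
        ω p.1 p.2 • (u p).2.2 = (u p).1 - (u p).2.1 ∧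
        (ω p.1 p.2)⁻¹ • ((u p).1 - (u p).2.1) = (u p).2.2} := by
    ext u
    simp only [mem_range, mem_iInter, mem_ofPred_eq]
    constructor
    · rintro ⟨f, rfl⟩ p
      refine ⟨rfl, rfl, ?_, rfl⟩
      simp only [HSp.quot_apply]
      by_cases h : ω p.1 p.2 = 0
      · obtain ⟨B, hB⟩ := f.holder
        have := hB p.1 p.2
        rw [h, abs_zero, mul_zero, norm_le_zero_iff] at this
        rw [h, zero_smul, this]
      · rw [smul_inv_smul₀ h]
    · intro h
      refine ⟨HSp.mk (fun x => (u (x, x)).1)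
        ⟨‖u‖, fun x => (norm_fst_le _).trans (u.norm_apply_le _)⟩ ⟨‖u‖ , fun x y => ?_⟩, ?_⟩
      · obtain ⟨h1, h2, h3, _⟩ := h (x, y)
        rw [← h1, ← h2, ← h3, norm_smul, mul_comm, Real.norm_eq_abs]
        gcongr
        exact ((norm_snd_le _).trans (norm_snd_le _)).trans (u.norm_apply_le _)
      · ext p : 1
        obtain ⟨h1, h2, h3, h4⟩ := h p
        rw [HSp.quot_apply, HSp.mk_apply, HSp.mk_apply, ← h1, ← h2, h4]
  rw [hrange]
  refine isClosed_iInter fun p => ?_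
  have he : ∀ q : Pairs S, Continuous fun u : Bd (Pairs S) (E × E × E) => u q :=
    fun q => (Bd.eval q).continuous
  exact (isClosed_eq (he p).fst (he _).fst).inter ((isClosed_eq (he p).snd.fst (he _).fst).inter
    ((isClosed_eq ((he p).snd.snd.const_smul _) ((he p).fst.sub (he p).snd.fst)).inter
      (isClosed_eq (((he p).fst.sub (he p).snd.fst).const_smul _) (he p).snd.snd)))

instance [CompleteSpace E] : CompleteSpace (HSp ω E) :=
  HSp.quotIso.isometry.isUniformInducing.completeSpace HSp.isClosed_range_quot.isComplete

/-- The composition operator with a linear map. -/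
noncomputable def HSp.map {F : Type} [NormedAddCommGroup F] [NormedSpace ℝ F] (L : E →L[ℝ] F) :
    HSp ω E →L[ℝ] HSp ω F :=
  LinearMap.mkContinuous
    { toFun := fun f => HSp.mk (fun x => L (f x))
        (by
          obtain ⟨A, hA⟩ := f.bounded
          exact ⟨‖L‖ * A, fun x => (L.le_opNorm _).trans (by gcongr; exact hA x)⟩)
        (by
          obtain ⟨B, hB⟩ := f.holder
          refine ⟨‖L‖ * B, fun x y => ?_⟩
          rw [← map_sub, mul_assoc]
          exact (L.le_opNorm _).trans (by gcongr; exact hB x y))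
      map_add' := fun f g => by ext; simp
      map_smul' := fun c f => by ext; simp } ‖L‖ fun f => by
    rw [HSp.norm_def]
    refine (Bd.norm_le (by positivity)).2 fun p => ?_
    have h := (HSp.quot f).norm_apply_le p
    rw [← HSp.norm_def] at h
    have h1 := (norm_fst_le _).trans h
    have h2 := (norm_fst_le _).trans ((norm_snd_le _).trans h)
    have h3 := (norm_snd_le _).trans ((norm_snd_le _).trans h)
    refine max_le ((L.le_opNorm _).trans (by gcongr; exact h1))
      (max_le ((L.le_opNorm _).trans (by gcongr; exact h2)) ?_)
    change ‖(ω p.1 p.2)⁻¹ • (L (f p.1) - L (f p.2))‖ ≤ _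
    rw [← map_sub, ← map_smul]
    exact (L.le_opNorm _).trans (by gcongr; exact h3)

@[simp] theorem HSp.map_apply {F : Type} [NormedAddCommGroup F] [NormedSpace ℝ F] (L : E →L[ℝ] F)
    (f : HSp ω E) (x : S) : HSp.map L f x = L (f x) := rfl

variable [FiniteDimensional ℝ E]
variable {F : Type} [NormedAddCommGroup F] [NormedSpace ℝ F] [CompleteSpace F]

/-- The composition operator `f ↦ g ∘ f` on a Hölder space. -/
noncomputable def HSp.nem {g : E → F} (hg : ContDiff ℝ 1 g) (f : HSp ω E) : HSp ω F :=
  HSp.mk (fun x => g (f x))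
    (by
      have : ProperSpace E := FiniteDimensional.proper ℝ E
      obtain ⟨A, hA⟩ := f.bounded
      obtain ⟨C, hC⟩ := (isCompact_closedBall (0 : E) A).exists_bound_of_continuousOn
        hg.continuous.continuousOn
      exact ⟨C, fun x => hC _ (by simpa using hA x)⟩)
    (by
      have : ProperSpace E := FiniteDimensional.proper ℝ E
      obtain ⟨A, hA⟩ := f.bounded
      obtain ⟨B, hB⟩ := f.holder
      have hc : Continuous (hadamard g) := (contDiff_hadamard (n := 0) (by simpa using hg)).continuous
      obtain ⟨C, hC⟩ := ((isCompact_closedBall (0 : E) A).prod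
        (isCompact_closedBall (0 : E) A)).exists_bound_of_continuousOn hc.continuousOn
      refine ⟨C * B, fun x y => ?_⟩
      rw [← hadamard_apply_sub hg, mul_assoc]
      have h1 : ‖hadamard g (f x, f y)‖ ≤ C :=
        hC (f x, f y) ⟨by simpa using hA x, by simpa using hA y⟩
      exact (ContinuousLinearMap.le_opNorm _ _).trans
        (mul_le_mul h1 (hB x y) (norm_nonneg _) ((norm_nonneg _).trans h1)))

@[simp] theorem HSp.nem_apply {g : E → F} (hg : ContDiff ℝ 1 g) (f : HSp ω E) (x : S) :
    HSp.nem hg f x = g (f x) := rfl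

/-- On values and difference quotients, composition with `g` becomes the pointwise map (u, v, q) ↦
(g u, g v, hadamard g (u, v) q) between bounded functions. Passing from `g` to `hadamard g` costs
the one derivative. -/
theorem HSp.contDiff_nem (n : ℕ) {g : E → F} (hg : ContDiff ℝ 1 g) (hn : ContDiff ℝ (n + 1) g) :
    ContDiff ℝ n (HSp.nem hg : HSp ω E → HSp ω F) := by
  refine contDiff_of_linearIsometry_comp n HSp.quotIso ?_
  have hh := contDiff_hadamard hn
  have hn' : ContDiff ℝ n g := hn.of_le (by exact_mod_cast Nat.le_succ n)
  have hG : ContDiff ℝ n (fun u : E × E × E => (g u.1, g u.2.1, hadamard g (u.1, u.2.1) u.2.2)) :=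
    (hn'.comp contDiff_fst).prodMk ((hn'.comp (contDiff_fst.comp contDiff_snd)).prodMk
      ((hh.comp (contDiff_fst.prodMk (contDiff_fst.comp contDiff_snd))).clm_apply
        (contDiff_snd.comp contDiff_snd)))
  have key : ∀ f : HSp ω E, HSp.quotIso (HSp.nem hg f) =
      Bd.nem hG.continuous (HSp.quotIso f) := by
    intro f
    ext p : 1
    simp only [HSp.quotIso_apply, HSp.quot_apply, Bd.nem_apply, HSp.nem_apply, map_smul,
      hadamard_apply_sub hg]
  simp_rw [key]
  exact (Bd.contDiff_nem n hG.continuous hG).comp HSp.quotIso.contDiff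

end HolderSpace

/-! ### The Banach space F^{2,a}, with weight 2 sin(θ/2) in place of θ -/

section WeightedSpace

/-- The double-angle weight `2 sin(θ/2)`, of modulus `|1 - e^{iθ}|`. -/
noncomputable def chordWeight (θ : ℝ) : ℝ := 2 * Real.sin (θ / 2)

/-- The angles of the points of the circle other than `1`. -/
def awayFromOne : Set ℝ := {θ : ℝ | ∀ n : ℤ, θ ≠ n * (2 * Real.pi)}

theorem chordWeight_eq_zero_iff {θ : ℝ} : chordWeight θ = 0 ↔ θ ∉ awayFromOne := by
  simp only [chordWeight, awayFromOne, mem_ofPred_eq, not_forall, not_not, mul_eq_zero,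
    OfNat.ofNat_ne_zero, false_or, Real.sin_eq_zero_iff]
  refine exists_congr fun n => ?_
  constructor <;> intro h <;> linarith

theorem chordWeight_ne_zero {θ : ℝ} (h : θ ∈ awayFromOne) : chordWeight θ ≠ 0 := fun h0 =>
  chordWeight_eq_zero_iff.1 h0 h

theorem contDiff_chordWeight {n : WithTop ℕ∞} : ContDiff ℝ n chordWeight :=
  contDiff_const.mul (Real.contDiff_sin.comp (contDiff_id.div_const _))

theorem continuous_chordWeight : Continuous chordWeight := contDiff_chordWeight (n := 0).continuous

theorem isOpen_awayFromOne : IsOpen awayFromOne := by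
  have : awayFromOne = chordWeight ⁻¹' {0}ᶜ := by
    ext θ
    simp [chordWeight_eq_zero_iff]
  rw [this]
  exact isOpen_compl_singleton.preimage continuous_chordWeight

theorem chordWeight_add_two_pi (θ : ℝ) : chordWeight (θ + 2 * Real.pi) = -chordWeight θ := by
  rw [chordWeight, chordWeight, add_div, mul_div_cancel_left₀ _ (two_ne_zero), Real.sin_add_pi]
  ring

/-- The Hölder weight `|x - y|^a` on the real line. -/
noncomputable def absWeight (a : ℝ) (x y : ℝ) : ℝ := |x - y| ^ a

/-- A Hölder exponent. -/
abbrev HExp (a : ℝ) : Prop := Fact (0 < a ∧ a < 1)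

variable {a : ℝ}

theorem absWeight_nonneg (x y : ℝ) : 0 ≤ absWeight a x y := Real.rpow_nonneg (abs_nonneg _) _

variable {E : Type} [NormedAddCommGroup E] [NormedSpace ℝ E]

theorem continuous_of_le_absWeight [ha : HExp a] {f : ℝ → E} {C : ℝ}
    (h : ∀ x y, ‖f x - f y‖ ≤ C * absWeight a x y) : Continuous f := by
  rw [continuous_iff_continuousAt]
  intro x
  rw [ContinuousAt, tendsto_iff_norm_sub_tendsto_zero]
  have h1 : Tendsto (fun y => C * absWeight a y x) (𝓝 x) (𝓝 0) := by
    have : Continuous fun y => C * absWeight a y x := by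
      unfold absWeight
      exact continuous_const.mul ((continuous_abs.comp (continuous_id.sub continuous_const)).rpow_const
        fun _ => Or.inr ha.out.1.le)
    simpa [absWeight, Real.zero_rpow ha.out.1.ne'] using this.tendsto x
  exact squeeze_zero (fun _ => norm_nonneg _) (fun y => h y x) h1

theorem HSp.continuous_absWeight [HExp a] (f : HSp (absWeight a) E) : Continuous f :=
  continuous_of_le_absWeight fun x y => f.norm_sub_le (absWeight_nonneg x y)

/-- The weighted derivatives of order at most two. -/
noncomputable def jet (σ : ℝ → E) (θ : ℝ) : E × E × E :=
  (σ θ, chordWeight θ • deriv σ θ, chordWeight θ ^ 2 • deriv (deriv σ) θ)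

theorem hasDerivAt_of_contDiffOn {σ : ℝ → E} (h : ContDiffOn ℝ 2 σ awayFromOne) {θ : ℝ}
    (hθ : θ ∈ awayFromOne) : HasDerivAt σ (deriv σ θ) θ :=
  ((h.differentiableOn (by simp)).differentiableAt (isOpen_awayFromOne.mem_nhds hθ)).hasDerivAt

theorem contDiffOn_deriv {σ : ℝ → E} (h : ContDiffOn ℝ 2 σ awayFromOne) :
    ContDiffOn ℝ 1 (deriv σ) awayFromOne :=
  ((contDiffOn_succ_iff_deriv_of_isOpen (n := 1) isOpen_awayFromOne).1
    (by simpa [one_add_one_eq_two] using h)).2.2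

theorem hasDerivAt_deriv_of_contDiffOn {σ : ℝ → E} (h : ContDiffOn ℝ 2 σ awayFromOne) {θ : ℝ}
    (hθ : θ ∈ awayFromOne) : HasDerivAt (deriv σ) (deriv (deriv σ) θ) θ :=
  (((contDiffOn_deriv h).differentiableOn (by simp)).differentiableAt
    (isOpen_awayFromOne.mem_nhds hθ)).hasDerivAt

theorem contDiffOn_two_of_hasDerivAt {σ σ₁ σ₂ : ℝ → E}
    (h1 : ∀ θ ∈ awayFromOne, HasDerivAt σ (σ₁ θ) θ)
    (h2 : ∀ θ ∈ awayFromOne, HasDerivAt σ₁ (σ₂ θ) θ) (h3 : ContinuousOn σ₂ awayFromOne) :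
    ContDiffOn ℝ 2 σ awayFromOne ∧ (∀ θ ∈ awayFromOne, deriv σ θ = σ₁ θ) ∧
      ∀ θ ∈ awayFromOne, deriv (deriv σ) θ = σ₂ θ := by
  have hd1 : ∀ θ ∈ awayFromOne, deriv σ θ = σ₁ θ := fun θ hθ => (h1 θ hθ).deriv
  have hd2 : ∀ θ ∈ awayFromOne, HasDerivAt (deriv σ) (σ₂ θ) θ := fun θ hθ =>
    (h2 θ hθ).congr_of_eventuallyEq (by
      filter_upwards [isOpen_awayFromOne.mem_nhds hθ] with φ hφ using hd1 φ hφ)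
  refine ⟨?_, hd1, fun θ hθ => (hd2 θ hθ).deriv⟩
  have e2 : (2 : WithTop ℕ∞) = 1 + 1 := one_add_one_eq_two.symm
  rw [e2, contDiffOn_succ_iff_deriv_of_isOpen isOpen_awayFromOne]
  refine ⟨fun θ hθ => (h1 θ hθ).differentiableAt.differentiableWithinAt, by simp, ?_⟩
  have e1 : (1 : WithTop ℕ∞) = 0 + 1 := (zero_add _).symm
  rw [e1, contDiffOn_succ_iff_deriv_of_isOpen isOpen_awayFromOne]
  refine ⟨fun θ hθ => (hd2 θ hθ).differentiableAt.differentiableWithinAt, by simp, ?_⟩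
  exact contDiffOn_zero.2 (h3.congr fun θ hθ => (hd2 θ hθ).deriv)

theorem jet_of_notMem {σ : ℝ → E} {θ : ℝ} (hθ : θ ∉ awayFromOne) : jet σ θ = (σ θ, 0, 0) := by
  simp [jet, chordWeight_eq_zero_iff.2 hθ]

theorem jet_add {σ τ : ℝ → E} (hσ : ContDiffOn ℝ 2 σ awayFromOne)
    (hτ : ContDiffOn ℝ 2 τ awayFromOne) : jet (σ + τ) = jet σ + jet τ := by
  obtain ⟨_, h1, h2⟩ := contDiffOn_two_of_hasDerivAt (σ := σ + τ) (σ₁ := deriv σ + deriv τ)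
    (σ₂ := deriv (deriv σ) + deriv (deriv τ))
    (fun θ hθ => (hasDerivAt_of_contDiffOn hσ hθ).add (hasDerivAt_of_contDiffOn hτ hθ))
    (fun θ hθ => (hasDerivAt_deriv_of_contDiffOn hσ hθ).add (hasDerivAt_deriv_of_contDiffOn hτ hθ))
    (((contDiffOn_deriv hσ).continuousOn_deriv_of_isOpen isOpen_awayFromOne le_rfl).add
      ((contDiffOn_deriv hτ).continuousOn_deriv_of_isOpen isOpen_awayFromOne le_rfl))
  funext θ
  by_cases hθ : θ ∈ awayFromOne
  · simp [jet, h1 θ hθ, h2 θ hθ]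
  · simp [jet_of_notMem hθ]

theorem jet_smul (c : ℝ) (σ : ℝ → E) : jet (c • σ) = c • jet σ := by
  have h : ∀ f : ℝ → E, deriv (c • f) = c • deriv f := fun f => by
    funext θ; exact deriv_const_smul_field c f
  funext θ
  simp [jet, h, smul_comm c]

variable (a E) in
/-- The space `F^{2,a}` as a submodule of all functions. -/
def fSubmodule : Submodule ℝ (ℝ → E) where
  -- The Hölder condition is taken on the line and not on the circle: the weight changes sign over a
  -- period, so the second entry of the jet is only antiperiodic.
  carrier := {σ | Function.Periodic σ (2 * Real.pi) ∧ ContDiffOn ℝ 2 σ awayFromOne ∧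
    jet σ ∈ holderSubmodule (absWeight a) (E × E × E)}
  add_mem' := fun {σ τ} hσ hτ => ⟨hσ.1.add hτ.1, hσ.2.1.add hτ.2.1, by
    rw [jet_add hσ.2.1 hτ.2.1]; exact Submodule.add_mem _ hσ.2.2 hτ.2.2⟩
  zero_mem' := by
    refine ⟨fun _ => rfl, contDiffOn_const, ?_⟩
    have : jet (0 : ℝ → E) = 0 := by
      have := jet_smul (0 : ℝ) (0 : ℝ → E)
      simpa using this
    rw [this]; exact Submodule.zero_mem _
  smul_mem' := fun c σ hσ => ⟨hσ.1.smul c, contDiffOn_const.smul hσ.2.1, by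
    rw [jet_smul]; exact Submodule.smul_mem _ _ hσ.2.2⟩

variable (a E) in
/-- The normed space `F^{2,a}`. -/
def FSp : Type := fSubmodule a E

instance : AddCommGroup (FSp a E) := inferInstanceAs (AddCommGroup (fSubmodule a E))
instance : Module ℝ (FSp a E) := inferInstanceAs (Module ℝ (fSubmodule a E))
instance : FunLike (FSp a E) ℝ E := ⟨fun f => f.1, Subtype.val_injective⟩

@[ext] theorem FSp.ext {f g : FSp a E} (h : ∀ x, f x = g x) : f = g := DFunLike.ext _ _ h

@[simp] theorem FSp.add_apply (f g : FSp a E) (x : ℝ) : (f + g) x = f x + g x := rfl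
@[simp] theorem FSp.sub_apply (f g : FSp a E) (x : ℝ) : (f - g) x = f x - g x := rfl
@[simp] theorem FSp.zero_apply (x : ℝ) : (0 : FSp a E) x = 0 := rfl
@[simp] theorem FSp.smul_apply (c : ℝ) (f : FSp a E) (x : ℝ) : (c • f) x = c • f x := rfl

theorem FSp.periodic (f : FSp a E) : Function.Periodic f (2 * Real.pi) := f.2.1
theorem FSp.contDiffOn (f : FSp a E) : ContDiffOn ℝ 2 f awayFromOne := f.2.2.1
theorem FSp.jet_mem (f : FSp a E) : jet f ∈ holderSubmodule (absWeight a) (E × E × E) := f.2.2.2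

/-- An element of `F^{2,a}`. -/
def FSp.mk (σ : ℝ → E) (h1 : Function.Periodic σ (2 * Real.pi)) (h2 : ContDiffOn ℝ 2 σ awayFromOne)
    (h3 : jet σ ∈ holderSubmodule (absWeight a) (E × E × E)) : FSp a E := ⟨σ, h1, h2, h3⟩

@[simp] theorem FSp.mk_apply (σ : ℝ → E) (h1 : Function.Periodic σ (2 * Real.pi))
    (h2 : ContDiffOn ℝ 2 σ awayFromOne) (h3 : jet σ ∈ holderSubmodule (absWeight a) (E × E × E))
    (θ : ℝ) : FSp.mk σ h1 h2 h3 θ = σ θ := rfl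

/-- The jet as a linear map into a Hölder space. -/
noncomputable def FSp.jetL : FSp a E →ₗ[ℝ] HSp (absWeight a) (E × E × E) where
  toFun f := HSp.mk (jet f) f.jet_mem.1 f.jet_mem.2
  map_add' f g := by
    refine HSp.ext fun x => ?_
    exact congrFun (jet_add f.contDiffOn g.contDiffOn) x
  map_smul' c f := by
    refine HSp.ext fun x => ?_
    exact congrFun (jet_smul c f) x

theorem FSp.jetL_apply (f : FSp a E) (θ : ℝ) : FSp.jetL f θ = jet f θ := rfl

theorem FSp.jetL_injective : Function.Injective (FSp.jetL : FSp a E →ₗ[ℝ] _) := by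
  intro f g h
  ext x
  exact congrArg (fun u : HSp (absWeight a) (E × E × E) => (u x).1) h

noncomputable instance : NormedAddCommGroup (FSp a E) :=
  NormedAddCommGroup.induced (FSp a E) (HSp (absWeight a) (E × E × E)) FSp.jetL FSp.jetL_injective

theorem FSp.norm_def (f : FSp a E) : ‖f‖ = ‖FSp.jetL f‖ := rfl

noncomputable instance : NormedSpace ℝ (FSp a E) where
  norm_smul_le c f := by
    rw [FSp.norm_def, FSp.norm_def, map_smul]
    exact norm_smul_le _ _

/-- The jet as a linear isometry. -/
noncomputable def FSp.jetIso : FSp a E →ₗᵢ[ℝ] HSp (absWeight a) (E × E × E) :=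
  ⟨FSp.jetL, fun _ => rfl⟩

@[simp] theorem FSp.jetIso_apply (f : FSp a E) : FSp.jetIso f = FSp.jetL f := rfl

theorem FSp.norm_jet_le (f : FSp a E) (θ : ℝ) : ‖jet f θ‖ ≤ ‖f‖ := (FSp.jetL f).norm_apply_le θ

theorem FSp.norm_apply_le (f : FSp a E) (θ : ℝ) : ‖f θ‖ ≤ ‖f‖ :=
  (norm_fst_le (jet f θ)).trans (f.norm_jet_le θ)

theorem FSp.norm_jet_sub_le (f : FSp a E) (θ φ : ℝ) :
    ‖jet f θ - jet f φ‖ ≤ ‖f‖ * |θ - φ| ^ a :=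
  (FSp.jetL f).norm_sub_le (absWeight_nonneg θ φ)

theorem FSp.norm_sub_le (f : FSp a E) (θ φ : ℝ) : ‖f θ - f φ‖ ≤ ‖f‖ * |θ - φ| ^ a :=
  (norm_fst_le (jet f θ - jet f φ)).trans (f.norm_jet_sub_le θ φ)

theorem FSp.continuous [HExp a] (f : FSp a E) : Continuous f :=
  (FSp.jetL f).continuous_absWeight.fst

/-- Evaluation at a point. -/
noncomputable def FSp.eval (x : ℝ) : FSp a E →L[ℝ] E :=
  LinearMap.mkContinuous ⟨⟨fun f => f x, fun _ _ => rfl⟩, fun _ _ => rfl⟩ 1 fun f => by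
    rw [one_mul]; exact f.norm_apply_le x

@[simp] theorem FSp.eval_apply (x : ℝ) (f : FSp a E) : FSp.eval x f = f x := rfl

/-- Uniform convergence is preserved locally by multiplication with a continuous function. -/
theorem tendstoLocallyUniformlyOn_smul {f : ℕ → ℝ → E} {g : ℝ → E} {ε : ℕ → ℝ} {U : Set ℝ}
    {m : ℝ → ℝ} (hm : ContinuousOn m U) (hε : Tendsto ε atTop (𝓝 0))
    (h : ∀ n x, ‖f n x - g x‖ ≤ ε n) :
    TendstoLocallyUniformlyOn (fun n x => m x • f n x) (fun x => m x • g x) atTop U := by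
  rw [Metric.tendstoLocallyUniformlyOn_iff]
  intro δ hδ x hx
  have h1 : ∀ᶠ y in 𝓝[U] x, |m y| < |m x| + 1 :=
    (hm x hx).abs.eventually (gt_mem_nhds (lt_add_one _))
  refine ⟨_, h1, ?_⟩
  have hp : 0 < |m x| + 1 := by positivity
  filter_upwards [hε.eventually (gt_mem_nhds (div_pos hδ hp))] with n hn y hy
  have hy' : |m y| < |m x| + 1 := hy
  rw [dist_eq_norm, ← smul_sub, norm_smul, Real.norm_eq_abs, norm_sub_rev]
  calc |m y| * ‖f n y - g y‖ ≤ (|m x| + 1) * ε n := by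
        gcongr
        exact h n y
    _ < (|m x| + 1) * (δ / (|m x| + 1)) := by gcongr
    _ = δ := by field_simp

/-- Uniform convergence of jets becomes, after division by the weights, locally uniform convergence
of σ, σ' and σ'' away from the point 1, so a limit of jets is a jet. At the point 1 itself the
derivative entries are 0, and this passes to the limit. The resulting completeness is needed for the
closed graph and implicit function theorems. -/
theorem FSp.isClosed_range_jetL [HExp a] :
    IsClosed (range (FSp.jetL : FSp a E →ₗ[ℝ] HSp (absWeight a) (E × E × E))) := by
  refine isClosed_of_closure_subset fun u hu => ?_
  obtain ⟨v, hv, hlim⟩ := mem_closure_iff_seq_limit.1 hu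
  choose σ hσ using hv
  have hε : Tendsto (fun n => ‖v n - u‖) atTop (𝓝 0) := tendsto_iff_norm_sub_tendsto_zero.1 hlim
  have hle : ∀ n x, ‖jet (σ n) x - u x‖ ≤ ‖v n - u‖ := by
    intro n x
    have := (v n - u).norm_apply_le x
    rw [HSp.sub_apply, ← hσ n] at this
    rwa [← hσ n]
  have hpt : ∀ x, Tendsto (fun n => jet (σ n) x) atTop (𝓝 (u x)) := fun x =>
    tendsto_iff_norm_sub_tendsto_zero.2 (squeeze_zero (fun _ => norm_nonneg _) (fun n => hle n x) hε)
  have hcu := u.continuous_absWeight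
  have hm1 : ContinuousOn (fun θ => (chordWeight θ)⁻¹) awayFromOne :=
    continuous_chordWeight.continuousOn.inv₀ fun θ hθ => chordWeight_ne_zero hθ
  have hm2 : ContinuousOn (fun θ => (chordWeight θ ^ 2)⁻¹) awayFromOne :=
    (continuous_chordWeight.pow 2).continuousOn.inv₀ fun θ hθ => pow_ne_zero _ (chordWeight_ne_zero hθ)
  have hD1 : ∀ θ ∈ awayFromOne,
      HasDerivAt (fun θ => (u θ).1) ((chordWeight θ)⁻¹ • (u θ).2.1) θ := by
    intro θ hθ
    refine hasDerivAt_of_tendstoLocallyUniformlyOn (l := atTop) (f := fun n => σ n)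
      (f' := fun n θ => (chordWeight θ)⁻¹ • (jet (σ n) θ).2.1) isOpen_awayFromOne
      (tendstoLocallyUniformlyOn_smul hm1 hε fun n x =>
        ((norm_fst_le _).trans (norm_snd_le _)).trans (hle n x)) ?_ (fun x _ => (hpt x).fst_nhds) hθ
    refine Eventually.of_forall fun n x hx => ?_
    simpa [jet, inv_smul_smul₀ (chordWeight_ne_zero hx)] using
      hasDerivAt_of_contDiffOn (σ n).contDiffOn hx
  have hD2 : ∀ θ ∈ awayFromOne, HasDerivAt (fun θ => (chordWeight θ)⁻¹ • (u θ).2.1)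
      ((chordWeight θ ^ 2)⁻¹ • (u θ).2.2) θ := by
    intro θ hθ
    refine hasDerivAt_of_tendstoLocallyUniformlyOn (l := atTop) (f := fun n => deriv (σ n))
      (f' := fun n θ => (chordWeight θ ^ 2)⁻¹ • (jet (σ n) θ).2.2) isOpen_awayFromOne
      (tendstoLocallyUniformlyOn_smul hm2 hε fun n x =>
        ((norm_snd_le _).trans (norm_snd_le _)).trans (hle n x)) ?_ (fun x hx => ?_) hθ
    · refine Eventually.of_forall fun n x hx => ?_
      simpa [jet, inv_smul_smul₀ (pow_ne_zero 2 (chordWeight_ne_zero hx))] using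
        hasDerivAt_deriv_of_contDiffOn (σ n).contDiffOn hx
    · refine ((hpt x).snd_nhds.fst_nhds.const_smul (chordWeight x)⁻¹).congr fun n => ?_
      simp [jet, inv_smul_smul₀ (chordWeight_ne_zero hx)]
  obtain ⟨h2, h3, h4⟩ := contDiffOn_two_of_hasDerivAt hD1 hD2 (hm2.smul hcu.snd.snd.continuousOn)
  have hjet : jet (fun θ => (u θ).1) = u := by
    funext θ
    by_cases hθ : θ ∈ awayFromOne
    · simp [jet, h3 θ hθ, h4 θ hθ, smul_inv_smul₀ (chordWeight_ne_zero hθ),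
        smul_inv_smul₀ (pow_ne_zero 2 (chordWeight_ne_zero hθ))]
    · rw [jet_of_notMem hθ]
      have h0 : (u θ).2 = (0, 0) := by
        refine tendsto_nhds_unique (hpt θ).snd_nhds ?_
        simp [jet_of_notMem hθ]
      rw [← h0]
  refine ⟨FSp.mk (fun θ => (u θ).1) (fun θ => ?_) h2 (by rw [hjet]; exact u.2), ?_⟩
  · refine tendsto_nhds_unique (hpt (θ + 2 * Real.pi)).fst_nhds ((hpt θ).fst_nhds.congr fun n => ?_)
    exact ((σ n).periodic θ).symm
  · refine HSp.ext fun θ => ?_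
    exact congrFun hjet θ

instance [HExp a] [CompleteSpace E] : CompleteSpace (FSp a E) :=
  FSp.jetIso.isometry.isUniformInducing.completeSpace FSp.isClosed_range_jetL.isComplete

variable [FiniteDimensional ℝ E]
variable {F : Type} [NormedAddCommGroup F] [NormedSpace ℝ F] [CompleteSpace F]

/-- The second order tangent map. -/
noncomputable def tangentTwo (g : E → F) (u : E × E × E) : F × F × F :=
  (g u.1, fderiv ℝ g u.1 u.2.1,
    fderiv ℝ (fderiv ℝ g) u.1 u.2.1 u.2.1 + fderiv ℝ g u.1 u.2.2)

theorem contDiff_tangentTwo {n : ℕ} {g : E → F} (hg : ContDiff ℝ (n + 2) g) :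
    ContDiff ℝ n (tangentTwo g) := by
  have h2 : ContDiff ℝ (n + 1) (fderiv ℝ g) :=
    hg.fderiv_right (by rw [add_assoc, one_add_one_eq_two])
  have h3 : ContDiff ℝ n (fderiv ℝ (fderiv ℝ g)) := h2.fderiv_right le_rfl
  have h2' : ContDiff ℝ n (fderiv ℝ g) := h2.of_le (by exact_mod_cast Nat.le_succ n)
  have h1' : ContDiff ℝ n g := hg.of_le (by exact_mod_cast Nat.le_add_right n 2)
  have e : ContDiff ℝ n fun u : E × E × E => u.2.1 := contDiff_fst.comp contDiff_snd
  exact (h1'.comp contDiff_fst).prodMk (((h2'.comp contDiff_fst).clm_apply e).prodMk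
    ((((h3.comp contDiff_fst).clm_apply e).clm_apply e).add
      ((h2'.comp contDiff_fst).clm_apply (contDiff_snd.comp contDiff_snd))))

/-- The second order chain rule respects the weights: each term of (g ∘ σ)'' contains either σ'
twice or σ'' once, and so absorbs the square of the weight exactly. -/
theorem contDiffOn_comp_and_jet {g : E → F} (hg : ContDiff ℝ 3 g) {σ : ℝ → E}
    (hσ : ContDiffOn ℝ 2 σ awayFromOne) :
    ContDiffOn ℝ 2 (fun θ => g (σ θ)) awayFromOne ∧
      jet (fun θ => g (σ θ)) = fun θ => tangentTwo g (jet σ θ) := by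
  have hg2 : ContDiff ℝ 2 g := hg.of_le (by norm_cast)
  have hg1 : Differentiable ℝ g := hg2.differentiable (by simp)
  have hdg : ContDiff ℝ 1 (fderiv ℝ g) := hg2.fderiv_right (by simp [one_add_one_eq_two])
  have hdg1 : Differentiable ℝ (fderiv ℝ g) := hdg.differentiable (by simp)
  obtain ⟨h, h1, h2⟩ := contDiffOn_two_of_hasDerivAt (σ := fun θ => g (σ θ))
    (σ₁ := fun θ => fderiv ℝ g (σ θ) (deriv σ θ))
    (σ₂ := fun θ => fderiv ℝ (fderiv ℝ g) (σ θ) (deriv σ θ) (deriv σ θ) +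
      fderiv ℝ g (σ θ) (deriv (deriv σ) θ))
    (fun θ hθ => (hg1 _).hasFDerivAt.comp_hasDerivAt θ (hasDerivAt_of_contDiffOn hσ hθ))
    (fun θ hθ => ((hdg1 _).hasFDerivAt.comp_hasDerivAt θ
      (hasDerivAt_of_contDiffOn hσ hθ)).clm_apply (hasDerivAt_deriv_of_contDiffOn hσ hθ))
    (by
      have c0 := hσ.continuousOn
      have c1 := (contDiffOn_deriv hσ).continuousOn
      have c2 := (contDiffOn_deriv hσ).continuousOn_deriv_of_isOpen isOpen_awayFromOne le_rfl
      have d1 := (hdg.continuous_fderiv (by simp)).comp_continuousOn c0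
      have d0 := hdg.continuous.comp_continuousOn c0
      exact ((d1.clm_apply c1).clm_apply c1).add (d0.clm_apply c2))
  refine ⟨h, ?_⟩
  funext θ
  by_cases hθ : θ ∈ awayFromOne
  · simp [jet, tangentTwo, h1 θ hθ, h2 θ hθ, smul_smul, sq]
  · simp [jet_of_notMem hθ, tangentTwo]

/-- The composition operator `f ↦ g ∘ f` on `F^{2,a}`. -/
noncomputable def FSp.nem {g : E → F} (hg : ContDiff ℝ 3 g) (f : FSp a E) : FSp a F :=
  FSp.mk (fun θ => g (f θ)) (fun θ => congrArg g (f.periodic θ))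
    (contDiffOn_comp_and_jet hg f.contDiffOn).1 (by
      have hT : ContDiff ℝ 1 (tangentTwo g) := by
        exact_mod_cast contDiff_tangentTwo (n := 1) (by norm_num; exact hg)
      rw [(contDiffOn_comp_and_jet hg f.contDiffOn).2]
      exact (HSp.nem hT (FSp.jetL f)).2)

@[simp] theorem FSp.nem_apply {g : E → F} (hg : ContDiff ℝ 3 g) (f : FSp a E) (x : ℝ) :
    FSp.nem hg f x = g (f x) := rfl

/-- On jets this is composition with `tangentTwo g`. Two derivatives go into the tangent map, and
the Hölder norm costs the third. -/
theorem FSp.contDiff_nem [HExp a] (n : ℕ) {g : E → F} (hg : ContDiff ℝ 3 g)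
    (hn : ContDiff ℝ (n + 3 : ℕ) g) : ContDiff ℝ n (FSp.nem hg : FSp a E → FSp a F) := by
  refine contDiff_of_linearIsometry_comp n FSp.jetIso ?_
  have hT : ContDiff ℝ 1 (tangentTwo g) := by
    exact_mod_cast contDiff_tangentTwo (n := 1) (by norm_num; exact hg)
  have hTn : ContDiff ℝ (n + 1) (tangentTwo g) := by
    exact_mod_cast contDiff_tangentTwo (n := n + 1) (by exact_mod_cast hn)
  have key : ∀ f : FSp a E, FSp.jetIso (FSp.nem hg f) = HSp.nem hT (FSp.jetIso f) := by
    intro f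
    refine HSp.ext fun θ => ?_
    exact congrFun (contDiffOn_comp_and_jet hg f.contDiffOn).2 θ
  simp_rw [key]
  exact (HSp.contDiff_nem n hT hTn).comp FSp.jetIso.contDiff

end WeightedSpace

/-! ### Equivalence of the Banach norm with the norm on [-π, π] -/

section Comparison

variable {E : Type} [NormedAddCommGroup E] [NormedSpace ℝ E] {a : ℝ}

theorem rpow_add_le_of_le_one {x y : ℝ} (hx : 0 ≤ x) (hy : 0 ≤ y) (ha : 0 ≤ a) (ha1 : a ≤ 1) :
    (x + y) ^ a ≤ x ^ a + y ^ a := by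
  lift x to NNReal using hx
  lift y to NNReal using hy
  exact_mod_cast NNReal.rpow_add_le_add_rpow x y ha ha1

/-- A function whose derivative has a power singularity at distance is Hölder continuous. -/
theorem norm_sub_le_of_deriv_le_rpow {f f' : ℝ → E} {p b c N : ℝ} (hp : p ≤ b) (hbc : b ≤ c)
    (ha : 0 < a) (ha1 : a ≤ 1) (hN : 0 ≤ N) (hf : ContinuousOn f (Icc p b))
    (hd : ∀ t ∈ Ico p b, HasDerivAt f (f' t) t)
    (hb : ∀ t ∈ Ico p b, ‖f' t‖ ≤ N * (c - t) ^ (a - 1)) :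
    ‖f b - f p‖ ≤ N / a * (b - p) ^ a := by
  -- The majorant is the primitive of the bound that vanishes at p; subadditivity of t ↦ t^a then
  -- bounds its increment by (b - p)^a.
  have hB : ∀ t ∈ Ico p b, HasDerivWithinAt (fun t => N / a * ((c - p) ^ a - (c - t) ^ a))
      (N * (c - t) ^ (a - 1)) (Ici t) t := by
    intro t ht
    have h0 : c - t ≠ 0 := by linarith [ht.2]
    have h1 : HasDerivAt (fun t => c - t) (-1) t := by
      simpa using (hasDerivAt_id t).const_sub c
    have h2 := ((h1.rpow_const (p := a) (Or.inl h0)).const_sub ((c - p) ^ a)).const_mul (N / a)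
    refine (h2.congr_deriv ?_).hasDerivWithinAt
    field_simp
  have hBc : ContinuousOn (fun t => N / a * ((c - p) ^ a - (c - t) ^ a)) (Icc p b) := by
    refine Continuous.continuousOn (continuous_const.mul (continuous_const.sub ?_))
    exact (continuous_const.sub continuous_id).rpow_const fun _ => Or.inr ha.le
  have h := image_norm_le_of_norm_deriv_right_le_deriv_boundary' (f := fun t => f t - f p)
    (hf.sub continuousOn_const) (fun t ht => ((hd t ht).sub_const _).hasDerivWithinAt)
    (by simp) hBc hB hb (right_mem_Icc.2 hp)
  refine h.trans (mul_le_mul_of_nonneg_left ?_ (by positivity))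
  have := rpow_add_le_of_le_one (a := a) (sub_nonneg.2 hp) (sub_nonneg.2 hbc) ha.le ha1
  rw [show b - p + (c - b) = c - p by ring] at this
  linarith

theorem norm_bounds_of_holderNormOn_le {f : ℝ → E} {s : Set ℝ} {N : ℝ} (ha : 0 < a)
    (hN : 0 ≤ N) (h : holderNormOn a f s ≤ ENNReal.ofReal N) :
    (∀ x ∈ s, ‖f x‖ ≤ N) ∧ ∀ x ∈ s, ∀ y ∈ s, ‖f x - f y‖ ≤ N * |x - y| ^ a := by
  constructor
  · intro x hx
    have h1 : ‖f x‖ₑ ≤ ENNReal.ofReal N :=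
      (le_iSup₂_of_le (f := fun x (_ : x ∈ s) => ‖f x‖ₑ) x hx le_rfl).trans
        (le_self_add.trans h)
    rwa [← ofReal_norm, ENNReal.ofReal_le_ofReal_iff hN] at h1
  · intro x hx y hy
    by_cases hxy : x = y
    · simp [hxy, Real.zero_rpow ha.ne']
    have h1 : edist (f x) (f y) / edist x y ^ a ≤ ENNReal.ofReal N :=
      (le_iSup₂_of_le (f := fun x (_ : x ∈ s) => ⨆ y ∈ s, edist (f x) (f y) / edist x y ^ a) x hx
        (le_iSup₂_of_le (f := fun y (_ : y ∈ s) => edist (f x) (f y) / edist x y ^ a) y hy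
          le_rfl)).trans (le_add_self.trans h)
    have hpos : 0 < |x - y| := abs_pos.2 (sub_ne_zero.2 hxy)
    rw [edist_dist x y, Real.dist_eq, ENNReal.ofReal_rpow_of_pos hpos, edist_dist, dist_eq_norm,
      ← ENNReal.ofReal_div_of_pos (Real.rpow_pos_of_pos hpos a),
      ENNReal.ofReal_le_ofReal_iff hN, div_le_iff₀ (Real.rpow_pos_of_pos hpos a)] at h1
    exact h1

theorem holderNormOn_le_of_norm_bounds {f : ℝ → E} {s : Set ℝ} {N : ℝ}
    (hN : 0 ≤ N) (h1 : ∀ x ∈ s, ‖f x‖ ≤ N)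
    (h2 : ∀ x ∈ s, ∀ y ∈ s, ‖f x - f y‖ ≤ N * |x - y| ^ a) :
    holderNormOn a f s ≤ ENNReal.ofReal (2 * N) := by
  rw [two_mul, ENNReal.ofReal_add hN hN]
  refine add_le_add (iSup₂_le fun x hx => ?_) (iSup₂_le fun x hx => iSup₂_le fun y hy => ?_)
  · rw [← ofReal_norm]
    exact ENNReal.ofReal_le_ofReal (h1 x hx)
  · by_cases hxy : x = y
    · simp [hxy]
    have hpos : 0 < |x - y| := abs_pos.2 (sub_ne_zero.2 hxy)
    rw [edist_dist x y, Real.dist_eq, ENNReal.ofReal_rpow_of_pos hpos, edist_dist, dist_eq_norm,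
      ← ENNReal.ofReal_div_of_pos (Real.rpow_pos_of_pos hpos a)]
    exact ENNReal.ofReal_le_ofReal ((div_le_iff₀ (Real.rpow_pos_of_pos hpos a)).2 (h2 x hx y hy))

variable (a) in
/-- Supremum and Hölder bounds on `[-π, π]`. -/
def HBound (f : ℝ → E) (N : ℝ) : Prop :=
  (∀ x ∈ Icc (-Real.pi) Real.pi, ‖f x‖ ≤ N) ∧
    ∀ x ∈ Icc (-Real.pi) Real.pi, ∀ y ∈ Icc (-Real.pi) Real.pi, ‖f x - f y‖ ≤ N * |x - y| ^ a

/-- On an interval of length 2π a Lipschitz function is Hölder, at the cost of a factor (2π)^(1 -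
a). Multiplication by powers of 2 sin(θ/2)/θ and of its inverse exchanges the two weights. -/
theorem exists_hBound_smul (ha : HExp a) {m : ℝ → ℝ}
    (hm : ContDiffOn ℝ 1 m (Icc (-Real.pi) Real.pi)) :
    ∃ C : ℝ, 0 ≤ C ∧ ∀ (v : ℝ → E) (N : ℝ), 0 ≤ N → HBound a v N →
      HBound a (fun θ => m θ • v θ) (C * N) := by
  obtain ⟨A, hA⟩ := isCompact_Icc.exists_bound_of_continuousOn hm.continuousOn
  obtain ⟨K, hK⟩ := hm.exists_lipschitzOnWith (by simp) (convex_Icc _ _) isCompact_Icc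
  have hA0 : 0 ≤ A := (norm_nonneg _).trans (hA 0 ⟨by linarith [Real.pi_pos], Real.pi_pos.le⟩)
  have hpi := Real.pi_pos
  refine ⟨A + K * (2 * Real.pi) ^ (1 - a), by positivity, fun v N hN hv => ⟨fun x hx => ?_,
    fun x hx y hy => ?_⟩⟩
  · rw [norm_smul]
    calc ‖m x‖ * ‖v x‖ ≤ A * N := mul_le_mul (hA x hx) (hv.1 x hx) (norm_nonneg _) hA0
      _ ≤ _ := by
        refine mul_le_mul_of_nonneg_right ?_ hN
        have : 0 ≤ (K : ℝ) * (2 * Real.pi) ^ (1 - a) := by positivity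
        linarith
  · have h1 : m x • v x - m y • v y = m x • (v x - v y) + (m x - m y) • v y := by
      rw [smul_sub, sub_smul]; abel
    have h2 : |m x - m y| ≤ K * (2 * Real.pi) ^ (1 - a) * |x - y| ^ a := by
      have h3 := hK.dist_le_mul x hx y hy
      rw [Real.dist_eq, Real.dist_eq] at h3
      refine h3.trans ?_
      rw [mul_assoc]
      refine mul_le_mul_of_nonneg_left ?_ K.coe_nonneg
      have h4 : |x - y| = |x - y| ^ (1 - a) * |x - y| ^ a := by
        rw [← Real.rpow_add_of_nonneg (abs_nonneg _) (by linarith [ha.out.2]) ha.out.1.le]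
        simp
      calc |x - y| = |x - y| ^ (1 - a) * |x - y| ^ a := h4
        _ ≤ _ := by
          refine mul_le_mul_of_nonneg_right ?_ (Real.rpow_nonneg (abs_nonneg _) _)
          refine Real.rpow_le_rpow (abs_nonneg _) ?_ (by linarith [ha.out.2])
          rw [abs_le]
          constructor <;> linarith [hx.1, hx.2, hy.1, hy.2]
    rw [h1]
    calc ‖m x • (v x - v y) + (m x - m y) • v y‖
        ≤ ‖m x‖ * ‖v x - v y‖ + |m x - m y| * ‖v y‖ := by
          refine (norm_add_le _ _).trans ?_
          rw [norm_smul, norm_smul, Real.norm_eq_abs (m x - m y)]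
      _ ≤ A * (N * |x - y| ^ a) + K * (2 * Real.pi) ^ (1 - a) * |x - y| ^ a * N := by
          gcongr
          · exact hA x hx
          · exact hv.2 x hx y hy
          · exact hv.1 y hy
      _ = _ := by ring

/-- The quotient `2 sin(θ/2)/θ`, continued smoothly to `0`. -/
noncomputable def sincWeight (θ : ℝ) : ℝ := hadamard chordWeight (θ, 0) 1

theorem contDiff_sincWeight : ContDiff ℝ 1 sincWeight := by
  have h : ContDiff ℝ 1 (hadamard chordWeight) := by
    exact_mod_cast contDiff_hadamard (n := 1) contDiff_chordWeight
  exact (h.comp (by fun_prop : ContDiff ℝ 1 fun θ : ℝ => (θ, (0 : ℝ)))).clm_apply contDiff_const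

theorem sincWeight_mul (θ : ℝ) : sincWeight θ * θ = chordWeight θ := by
  have h := hadamard_apply_sub contDiff_chordWeight θ 0
  have h0 : chordWeight 0 = 0 := by simp [chordWeight]
  rw [h0, sub_zero, sub_zero] at h
  rw [← h, sincWeight, mul_comm, ← smul_eq_mul, ← map_smul, smul_eq_mul, mul_one]

theorem mem_awayFromOne {θ : ℝ} (h : θ ∈ Icc (-Real.pi) Real.pi) (h0 : θ ≠ 0) :
    θ ∈ awayFromOne := by
  intro n hn
  have hpi := Real.pi_pos
  have h1 : (-1 : ℝ) < n := by
    by_contra hc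
    push Not at hc
    nlinarith [h.1]
  have h2 : (n : ℝ) < 1 := by
    by_contra hc
    push Not at hc
    nlinarith [h.2]
  have h3 : n = 0 := by
    have h1' : (-1 : ℤ) < n := by exact_mod_cast h1
    have h2' : n < (1 : ℤ) := by exact_mod_cast h2
    omega
  exact h0 (by simp [hn, h3])

theorem sincWeight_ne_zero {θ : ℝ} (h : θ ∈ Icc (-Real.pi) Real.pi) : sincWeight θ ≠ 0 := by
  by_cases h0 : θ = 0
  · have hd : HasDerivAt chordWeight (2 * (Real.cos (0 / 2) * (1 / 2))) 0 :=
      ((Real.hasDerivAt_sin _).comp (0 : ℝ) ((hasDerivAt_id (0 : ℝ)).div_const 2)).const_mul 2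
    have : fderiv ℝ chordWeight 0 1 = 1 := by
      have := hd.deriv
      rw [← fderiv_apply_one_eq_deriv] at this
      rw [this]; simp
    rw [h0, sincWeight, hadamard_self, this]
    exact one_ne_zero
  · intro hs
    have := sincWeight_mul θ
    rw [hs, zero_mul] at this
    exact chordWeight_ne_zero (mem_awayFromOne h h0) this.symm

theorem contDiffOn_sincWeight_inv :
    ContDiffOn ℝ 1 (fun θ => (sincWeight θ)⁻¹) (Icc (-Real.pi) Real.pi) :=
  contDiff_sincWeight.contDiffOn.inv fun _ h => sincWeight_ne_zero h

/-- A bound on a period extends to the whole line for periodic and antiperiodic functions. -/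
theorem norm_bounds_of_hBound (ha : HExp a) {v : ℝ → E} {N e : ℝ} (hN : 0 ≤ N)
    (he : |e| = 1) (hper : ∀ θ, v (θ + 2 * Real.pi) = e • v θ) (hv : HBound a v N) :
    (∀ x, ‖v x‖ ≤ N) ∧ ∀ x y, ‖v x - v y‖ ≤ 2 * N * |x - y| ^ a := by
  have hpi := Real.pi_pos
  have hn : Function.Periodic (fun θ => ‖v θ‖) (2 * Real.pi) := fun θ => by
    simp only [hper, norm_smul, Real.norm_eq_abs, he, one_mul]
  have hb : ∀ x, ‖v x‖ ≤ N := by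
    intro x
    obtain ⟨y, hy, hxy⟩ := hn.exists_mem_Ico (by positivity) x (-Real.pi)
    rw [hxy]
    exact hv.1 y ⟨hy.1, by linarith [hy.2]⟩
  refine ⟨hb, ?_⟩
  -- Steps of length at least 2π are covered by the supremum bound. A shorter step is translated to
  -- start in [-π, π) and is cut at π if it crosses that point, which accounts for the factor 2.
  have key : ∀ x h, 0 ≤ h → ‖v x - v (x + h)‖ ≤ 2 * N * h ^ a := by
    intro x h hh
    rcases le_or_gt (2 * Real.pi) h with h2 | h2
    · calc ‖v x - v (x + h)‖ ≤ ‖v x‖ + ‖v (x + h)‖ := norm_sub_le _ _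
        _ ≤ 2 * N * 1 := by linarith [hb x, hb (x + h)]
        _ ≤ 2 * N * h ^ a := by
          have : (1 : ℝ) ≤ h ^ a := Real.one_le_rpow (by linarith [Real.pi_gt_three]) ha.out.1.le
          gcongr
    · have hn2 : Function.Periodic (fun θ => ‖v θ - v (θ + h)‖) (2 * Real.pi) := fun θ => by
        have e1 : θ + 2 * Real.pi + h = θ + h + 2 * Real.pi := by ring
        simp only [e1, hper, ← smul_sub, norm_smul, Real.norm_eq_abs, he, one_mul]
      obtain ⟨y, hy, hxy⟩ := hn2.exists_mem_Ico (by positivity) x (-Real.pi)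
      rw [hxy]
      have hyI : y ∈ Icc (-Real.pi) Real.pi := ⟨hy.1, by linarith [hy.2]⟩
      have hha : 0 ≤ h ^ a := Real.rpow_nonneg hh _
      rcases le_or_gt (y + h) Real.pi with h3 | h3
      · refine (hv.2 y hyI (y + h) ⟨by linarith [hy.1], h3⟩).trans ?_
        rw [show |y - (y + h)| = h by rw [sub_add_cancel_left, abs_neg, abs_of_nonneg hh]]
        nlinarith
      · have e1 : v (y + h) = e • v (y + h - 2 * Real.pi) := by
          rw [← hper]; congr 1; ring
        have e2 : v Real.pi = e • v (-Real.pi) := by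
          rw [← hper]; congr 1; ring
        have h4 : ‖v y - v Real.pi‖ ≤ N * h ^ a := by
          refine (hv.2 y hyI _ ⟨by linarith, le_rfl⟩).trans ?_
          refine mul_le_mul_of_nonneg_left (Real.rpow_le_rpow (abs_nonneg _) ?_ ha.out.1.le) hN
          rw [abs_sub_comm, abs_of_nonneg (by linarith [hyI.2])]
          linarith
        have h5 : ‖v Real.pi - v (y + h)‖ ≤ N * h ^ a := by
          rw [e1, e2, ← smul_sub, norm_smul, Real.norm_eq_abs, he, one_mul]
          refine (hv.2 _ ⟨le_rfl, by linarith⟩ _ ⟨by linarith, by linarith [hyI.2]⟩).trans ?_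
          refine mul_le_mul_of_nonneg_left (Real.rpow_le_rpow (abs_nonneg _) ?_ ha.out.1.le) hN
          rw [abs_sub_comm, abs_of_nonneg (by linarith)]
          linarith [hyI.2]
        calc ‖v y - v (y + h)‖ ≤ ‖v y - v Real.pi‖ + ‖v Real.pi - v (y + h)‖ :=
              norm_sub_le_norm_sub_add_norm_sub _ _ _
          _ ≤ _ := by linarith
  intro x y
  rcases le_total x y with hxy | hxy
  · have := key x (y - x) (by linarith)
    rwa [add_sub_cancel, ← abs_of_nonneg (by linarith : 0 ≤ y - x), abs_sub_comm] at this
  · have := key y (x - y) (by linarith)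
    rwa [add_sub_cancel, norm_sub_rev, ← abs_of_nonneg (by linarith : 0 ≤ x - y)] at this

/-- Since θσ' vanishes at 0, its Hölder bound reads |σ'| ≤ N|θ|^(a - 1), which is integrable; an
increment across 0 is split there, whence 2/a. This supplies the Hölder bound for σ itself, absent
from the norm of F^{2,a}. -/
theorem hBound_of_weighted_deriv (ha : HExp a) {σ : ℝ → E} {N : ℝ} (hN : 0 ≤ N)
    (hc : Continuous σ) (hσ : ContDiffOn ℝ 2 σ awayFromOne)
    (h0 : ∀ x ∈ Icc (-Real.pi) Real.pi, ‖σ x‖ ≤ N)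
    (h1 : HBound a (fun θ => θ • deriv σ θ) N) : HBound a σ ((1 + 2 / a) * N) := by
  have hpi := Real.pi_pos
  have ha0 := ha.out.1
  have hd : ∀ x ∈ Icc (-Real.pi) Real.pi, x ≠ 0 → ‖deriv σ x‖ ≤ N * |x| ^ (a - 1) := by
    intro x hx hx0
    have h2 := h1.2 x hx 0 ⟨by linarith, hpi.le⟩
    simp only [zero_smul, sub_zero, norm_smul, Real.norm_eq_abs] at h2
    have hxp := abs_pos.2 hx0
    rw [Real.rpow_sub_one hxp.ne', mul_div_assoc', le_div_iff₀ hxp, mul_comm]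
    exact h2
  have hneg : ∀ x y, -Real.pi ≤ x → x ≤ y → y ≤ 0 → ‖σ y - σ x‖ ≤ N / a * (y - x) ^ a := by
    intro x y hx hxy hy
    refine norm_sub_le_of_deriv_le_rpow (f' := deriv σ) hxy hy ha0 ha.out.2.le hN hc.continuousOn
      (fun t ht => ?_) (fun t ht => ?_)
    · exact hasDerivAt_of_contDiffOn hσ
        (mem_awayFromOne ⟨by linarith [ht.1], by linarith [ht.2]⟩ (by linarith [ht.2] : t < 0).ne)
    · have ht0 : t < 0 := by linarith [ht.2]
      have := hd t ⟨by linarith [ht.1], by linarith [ht.2]⟩ ht0.ne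
      rwa [abs_of_neg ht0, ← zero_sub] at this
  have hpos : ∀ x y, 0 ≤ x → x ≤ y → y ≤ Real.pi → ‖σ y - σ x‖ ≤ N / a * (y - x) ^ a := by
    intro x y hx hxy hy
    have := norm_sub_le_of_deriv_le_rpow (f := fun t => σ (-t)) (f' := fun t => -deriv σ (-t))
      (p := -y) (b := -x) (c := 0) (a := a)
      (by linarith) (by linarith) ha0 ha.out.2.le hN (hc.comp continuous_neg).continuousOn
      (fun t ht => ?_) (fun t ht => ?_)
    · rw [neg_neg, neg_neg, norm_sub_rev, show -x - -y = y - x by ring] at this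
      exact this
    · have ht0 : t < 0 := by linarith [ht.2]
      have h3 := hasDerivAt_of_contDiffOn hσ
        (mem_awayFromOne (θ := -t) ⟨by linarith [ht.1], by linarith [ht.1]⟩ (by linarith : 0 < -t).ne')
      have h4 : HasDerivAt (fun t => σ (-t)) _ t := h3.scomp t (hasDerivAt_neg t)
      simpa using h4
    · have ht0 : t < 0 := by linarith [ht.2]
      have := hd (-t) ⟨by linarith [ht.1], by linarith [ht.1]⟩ (by linarith : 0 < -t).ne'
      rw [norm_neg, zero_sub]
      rwa [abs_neg, abs_of_neg ht0] at this
  refine ⟨fun x hx => (h0 x hx).trans ?_, ?_⟩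
  · have : 0 ≤ 2 / a * N := by positivity
    linarith
  have key : ∀ x y, -Real.pi ≤ x → x ≤ y → y ≤ Real.pi →
      ‖σ y - σ x‖ ≤ (1 + 2 / a) * N * (y - x) ^ a := by
    intro x y hx hxy hy
    have hr : 0 ≤ (y - x) ^ a := Real.rpow_nonneg (by linarith) _
    have hna : 0 ≤ N / a := by positivity
    have e : (1 + 2 / a) * N * (y - x) ^ a = N * (y - x) ^ a + 2 * (N / a * (y - x) ^ a) := by ring
    have hs : N / a * (y - x) ^ a ≤ (1 + 2 / a) * N * (y - x) ^ a := by
      rw [e]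
      have : 0 ≤ N / a * (y - x) ^ a := by positivity
      have : 0 ≤ N * (y - x) ^ a := by positivity
      linarith
    rcases le_total y 0 with hy0 | hy0
    · exact (hneg x y hx hxy hy0).trans hs
    rcases le_total 0 x with hx0 | hx0
    · exact (hpos x y hx0 hxy hy).trans hs
    have h2 : ‖σ 0 - σ x‖ ≤ N / a * (y - x) ^ a := (hneg x 0 hx hx0 le_rfl).trans (by
      gcongr)
    have h3 : ‖σ y - σ 0‖ ≤ N / a * (y - x) ^ a := (hpos 0 y le_rfl hy0 hy).trans (by
      gcongr)
    rw [e]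
    have := norm_sub_le_norm_sub_add_norm_sub (σ y) (σ 0) (σ x)
    have : 0 ≤ N * (y - x) ^ a := by positivity
    linarith
  intro x hx y hy
  rcases le_total x y with hxy | hxy
  · rw [norm_sub_rev, abs_sub_comm, abs_of_nonneg (by linarith : 0 ≤ y - x)]
    exact key x y hx.1 hxy hy.2
  · rw [abs_of_nonneg (by linarith : 0 ≤ x - y)]
    exact key y x hy.1 hxy hx.2

variable (E) in
/-- The norm of the Banach space `F^{2,a}` is controlled by `fNorm`. -/
theorem exists_mem_fSubmodule_of_memF (ha : HExp a) :
    ∃ C : ℝ, 0 ≤ C ∧ ∀ (σ : ℝ → E), MemF a σ →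
      ∃ f : FSp a E, (∀ θ, f θ = σ θ) ∧ ∀ N, 0 ≤ N → fNorm a σ ≤ ENNReal.ofReal N →
        ‖f‖ ≤ C * N := by
  obtain ⟨C1, hC1, hm1⟩ := exists_hBound_smul (E := E) ha contDiff_sincWeight.contDiffOn
  obtain ⟨C2, hC2, hm2⟩ := exists_hBound_smul (E := E) ha (contDiff_sincWeight.pow 2).contDiffOn
  have ha0 := ha.out.1
  have hsa : 0 ≤ 1 + 2 / a := by positivity
  refine ⟨2 * ((1 + 2 / a) + C1 + C2), by positivity, fun σ hσ => ?_⟩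
  obtain ⟨hper, hc, hcd, hfin⟩ := hσ
  have main : ∀ N, 0 ≤ N → fNorm a σ ≤ ENNReal.ofReal N →
      (∀ x, ‖jet σ x‖ ≤ 2 * ((1 + 2 / a) + C1 + C2) * N) ∧
      ∀ x y, ‖jet σ x - jet σ y‖ ≤ 2 * ((1 + 2 / a) + C1 + C2) * N * |x - y| ^ a := by
    intro N hN hle
    have hb0 : ∀ x ∈ Icc (-Real.pi) Real.pi, ‖σ x‖ ≤ N := by
      intro x hx
      have h1 : ‖σ x‖ₑ ≤ ENNReal.ofReal N :=
        (le_iSup₂_of_le (f := fun x (_ : x ∈ Icc (-Real.pi) Real.pi) => ‖σ x‖ₑ) x hx le_rfl).trans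
          ((le_self_add.trans le_self_add).trans hle)
      rwa [← ofReal_norm, ENNReal.ofReal_le_ofReal_iff hN] at h1
    have hb1 : HBound a (fun θ => θ • deriv σ θ) N :=
      norm_bounds_of_holderNormOn_le ha0 hN ((le_add_self.trans le_self_add).trans hle)
    have hb2 : HBound a (fun θ => θ ^ 2 • deriv (deriv σ) θ) N :=
      norm_bounds_of_holderNormOn_le ha0 hN (le_add_self.trans hle)
    have hj0 := hBound_of_weighted_deriv ha hN hc hcd hb0 hb1
    have hj1 := hm1 _ _ hN hb1
    have hj2 := hm2 _ _ hN hb2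
    simp only [smul_smul, ← mul_pow, sincWeight_mul] at hj1 hj2
    have hdper : Function.Periodic (deriv σ) (2 * Real.pi) := fun θ => by
      rw [← deriv_comp_add_const, funext hper]
    have hddper : Function.Periodic (deriv (deriv σ)) (2 * Real.pi) := fun θ => by
      rw [← deriv_comp_add_const, funext hdper]
    -- Over a period the weight changes sign and its square does not, so the three jet entries have
    -- multipliers 1, -1 and 1.
    have k0 := norm_bounds_of_hBound ha (e := 1) (by positivity) (by simp)
      (fun θ => by rw [hper θ, one_smul]) hj0
    have k1 := norm_bounds_of_hBound ha (e := -1) (by positivity) (by simp)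
      (fun θ => by rw [hdper θ, chordWeight_add_two_pi, neg_one_smul, neg_smul]) hj1
    have k2 := norm_bounds_of_hBound ha (e := 1) (by positivity) (by simp)
      (fun θ => by rw [hddper θ, chordWeight_add_two_pi, one_smul, neg_sq]) hj2
    have e0 : (1 + 2 / a) * N ≤ ((1 + 2 / a) + C1 + C2) * N :=
      mul_le_mul_of_nonneg_right (by linarith) hN
    have e1 : C1 * N ≤ ((1 + 2 / a) + C1 + C2) * N :=
      mul_le_mul_of_nonneg_right (by linarith) hN
    have e2 : C2 * N ≤ ((1 + 2 / a) + C1 + C2) * N :=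
      mul_le_mul_of_nonneg_right (by linarith) hN
    have e3 : 0 ≤ ((1 + 2 / a) + C1 + C2) * N := by positivity
    constructor
    · intro x
      exact max_le ((k0.1 x).trans (by linarith)) (max_le ((k1.1 x).trans (by linarith))
        ((k2.1 x).trans (by linarith)))
    · intro x y
      have hr : 0 ≤ |x - y| ^ a := Real.rpow_nonneg (abs_nonneg _) _
      refine max_le ((k0.2 x y).trans ?_) (max_le ((k1.2 x y).trans ?_) ((k2.2 x y).trans ?_)) <;>
      exact mul_le_mul_of_nonneg_right (by linarith) hr
  obtain ⟨g1, g2⟩ := main _ ENNReal.toReal_nonneg (ENNReal.ofReal_toReal hfin.ne).symm.le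
  have hj : jet σ ∈ holderSubmodule (absWeight a) (E × E × E) :=
    ⟨⟨_, g1⟩, _, fun x y => by
      rw [abs_of_nonneg (absWeight_nonneg x y)]
      exact g2 x y⟩
  refine ⟨FSp.mk σ hper hcd hj, fun θ => rfl, fun N hN hle => ?_⟩
  · obtain ⟨g1, g2⟩ := main N hN hle
    exact HSp.norm_le (by positivity) g1 g2

variable (E) in
/-- `fNorm` is controlled by the norm of the Banach space `F^{2,a}`. -/
theorem exists_fNorm_le (ha : HExp a) :
    ∃ C : ℝ, 0 ≤ C ∧ ∀ f : FSp a E, MemF a f ∧ fNorm a f ≤ ENNReal.ofReal (C * ‖f‖) := by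
  obtain ⟨C1, hC1, hm1⟩ := exists_hBound_smul (E := E) ha contDiffOn_sincWeight_inv
  obtain ⟨C2, hC2, hm2⟩ := exists_hBound_smul (E := E) ha (contDiffOn_sincWeight_inv.pow 2)
  have ha0 := ha.out.1
  refine ⟨1 + 2 * C1 + 2 * C2, by positivity, fun f => ?_⟩
  suffices h : fNorm a f ≤ ENNReal.ofReal ((1 + 2 * C1 + 2 * C2) * ‖f‖) from
    ⟨⟨f.periodic, f.continuous, f.contDiffOn, h.trans_lt ENNReal.ofReal_lt_top⟩, h⟩
  have hb1 : HBound a (fun θ => chordWeight θ • deriv f θ) ‖f‖ :=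
    ⟨fun x _ => ((norm_fst_le _).trans (norm_snd_le _)).trans (f.norm_jet_le x),
      fun x _ y _ => ((norm_fst_le _).trans (norm_snd_le _)).trans (f.norm_jet_sub_le x y)⟩
  have hb2 : HBound a (fun θ => chordWeight θ ^ 2 • deriv (deriv f) θ) ‖f‖ :=
    ⟨fun x _ => ((norm_snd_le _).trans (norm_snd_le _)).trans (f.norm_jet_le x),
      fun x _ y _ => ((norm_snd_le _).trans (norm_snd_le _)).trans (f.norm_jet_sub_le x y)⟩
  have hj1 := hm1 _ _ (norm_nonneg _) hb1
  have hj2 := hm2 _ _ (norm_nonneg _) hb2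
  have hq : ∀ x ∈ Icc (-Real.pi) Real.pi, (sincWeight x)⁻¹ * chordWeight x = x := fun x hx => by
    rw [← sincWeight_mul, inv_mul_cancel_left₀ (sincWeight_ne_zero hx)]
  have hj1' : HBound a (fun θ => θ • deriv f θ) (C1 * ‖f‖) := by
    refine ⟨fun x hx => ?_, fun x hx y hy => ?_⟩
    · have := hj1.1 x hx
      simp only [smul_smul, hq x hx] at this
      exact this
    · have := hj1.2 x hx y hy
      simp only [smul_smul, hq x hx, hq y hy] at this
      exact this
  have hj2' : HBound a (fun θ => θ ^ 2 • deriv (deriv f) θ) (C2 * ‖f‖) := by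
    refine ⟨fun x hx => ?_, fun x hx y hy => ?_⟩
    · have := hj2.1 x hx
      simp only [smul_smul, ← mul_pow, hq x hx] at this
      exact this
    · have := hj2.2 x hx y hy
      simp only [smul_smul, ← mul_pow, hq x hx, hq y hy] at this
      exact this
  have hn := norm_nonneg f
  have e : (1 + 2 * C1 + 2 * C2) * ‖f‖ = ‖f‖ + 2 * (C1 * ‖f‖) + 2 * (C2 * ‖f‖) := by ring
  rw [e, ENNReal.ofReal_add (by positivity) (by positivity),
    ENNReal.ofReal_add (by positivity) (by positivity)]
  refine add_le_add (add_le_add (iSup₂_le fun x _ => ?_) ?_) ?_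
  · rw [← ofReal_norm]
    exact ENNReal.ofReal_le_ofReal (f.norm_apply_le x)
  · exact holderNormOn_le_of_norm_bounds (by positivity) hj1'.1 hj1'.2
  · exact holderNormOn_le_of_norm_bounds (by positivity) hj2'.1 hj2'.2

end Comparison

/-! ### The unit circle and chordal distances -/

section Circle

/-- The parametrization `θ ↦ e^{iθ}` of the unit circle. -/
noncomputable def circ (θ : ℝ) : ℂ := Complex.exp (θ * Complex.I)

theorem circleMap_eq_circ (θ : ℝ) : circleMap 0 1 θ = circ θ := by simp [circleMap, circ]

@[simp] theorem norm_circ (θ : ℝ) : ‖circ θ‖ = 1 := Complex.norm_exp_ofReal_mul_I θ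

theorem circ_ne_zero (θ : ℝ) : circ θ ≠ 0 := Complex.exp_ne_zero _

@[simp] theorem circ_zero : circ 0 = 1 := by simp [circ]

theorem circ_add (θ φ : ℝ) : circ (θ + φ) = circ θ * circ φ := by
  simp [circ, add_mul, Complex.exp_add]

theorem circ_periodic : Function.Periodic circ (2 * Real.pi) := fun θ => by
  rw [circ_add]
  simp [circ]

theorem contDiff_circ {n : WithTop ℕ∞} : ContDiff ℝ n circ :=
  (Complex.ofRealCLM.contDiff.mul contDiff_const).cexp

theorem continuous_circ : Continuous circ := contDiff_circ (n := 0).continuous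

theorem hasDerivAt_circ (θ : ℝ) : HasDerivAt circ (circ θ * Complex.I) θ := by
  have h : HasDerivAt (fun t : ℝ => (t : ℂ) * Complex.I) (1 * Complex.I) θ :=
    (Complex.ofRealCLM.hasDerivAt (x := θ)).mul_const Complex.I
  have h2 := h.cexp
  rw [one_mul] at h2
  exact h2

theorem circ_mem_sphere (θ : ℝ) : circ θ ∈ sphere (0 : ℂ) 1 := by simp

theorem exists_circ_eq {τ : ℂ} (h : ‖τ‖ = 1) : ∃ θ, circ θ = τ := by
  obtain ⟨θ, hθ⟩ := (Complex.norm_eq_one_iff τ).1 h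
  exact ⟨θ, hθ⟩

theorem norm_circ_sub_circ (x y : ℝ) : ‖circ x - circ y‖ = |chordWeight (x - y)| := by
  have h1 : circ x - circ y = circ y * (circ (x - y) - 1) := by
    rw [mul_sub, ← circ_add]; simp
  rw [h1, norm_mul, norm_circ, one_mul, circ, mul_comm, Complex.norm_exp_I_mul_ofReal_sub_one]
  rfl

theorem norm_circ_sub_circ_le (x y : ℝ) : ‖circ x - circ y‖ ≤ |x - y| := by
  rw [norm_circ_sub_circ, chordWeight, abs_mul, abs_two]
  have := Real.abs_sin_le_abs (x := (x - y) / 2)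
  rw [abs_div, abs_two] at this
  linarith

theorem le_norm_circ_sub_circ {x y : ℝ} (h : |x - y| ≤ Real.pi) :
    2 / Real.pi * |x - y| ≤ ‖circ x - circ y‖ := by
  rw [norm_circ_sub_circ, chordWeight, abs_mul, abs_two]
  have h1 := Real.mul_le_sin (x := |x - y| / 2) (by positivity) (by linarith)
  have h2 : Real.sin (|x - y| / 2) ≤ |Real.sin ((x - y) / 2)| := by
    rcases abs_cases (x - y) with ⟨h, _⟩ | ⟨h, _⟩ <;> rw [h]
    · exact le_abs_self _
    · rw [neg_div, Real.sin_neg]; exact neg_le_abs _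
  linarith

theorem circ_sub_ne_zero {τ : ℂ} (hτ : ‖τ‖ < 1) (θ : ℝ) : circ θ - τ ≠ 0 := fun h => by
  rw [← sub_eq_zero.1 h, norm_circ] at hτ
  exact lt_irrefl _ hτ

theorem le_norm_circ_sub (τ : ℂ) (θ : ℝ) : 1 - ‖τ‖ ≤ ‖circ θ - τ‖ := by
  have := norm_sub_norm_le (circ θ) τ
  rwa [norm_circ] at this

theorem circ_eq_one_iff {θ : ℝ} : circ θ = 1 ↔ θ ∉ awayFromOne := by
  rw [← chordWeight_eq_zero_iff, ← sub_eq_zero, ← norm_eq_zero, ← circ_zero, norm_circ_sub_circ,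
    sub_zero, abs_eq_zero]

/-- `e^{iθ} - 1 = i e^{iθ/2} s(θ)`. -/
theorem circ_sub_one (θ : ℝ) : circ θ - 1 = Complex.I * circ (θ / 2) * chordWeight θ := by
  have h : circ θ = circ (θ / 2) * circ (θ / 2) := by rw [← circ_add, add_halves]
  have h1 : circ (θ / 2) * circ (-(θ / 2)) = 1 := by rw [← circ_add]; simp
  have h2 : Complex.I * (chordWeight θ : ℂ) = circ (θ / 2) - circ (-(θ / 2)) := by
    simp only [circ, chordWeight, Complex.exp_mul_I]
    push_cast
    rw [Complex.cos_neg, Complex.sin_neg]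
    ring
  rw [h, mul_right_comm, h2, sub_mul, mul_comm (circ (-(θ / 2))), h1]

end Circle

/-! ### Mean values over a period and the basic kernel estimate -/

section Average

variable {E : Type} [NormedAddCommGroup E] [NormedSpace ℝ E]

/-- The mean value of a function over a period. -/
noncomputable def avg (f : ℝ → E) : E := (2 * Real.pi)⁻¹ • ∫ θ in 0..2 * Real.pi, f θ

theorem circleAverage_eq_avg (f : ℂ → E) : Real.circleAverage f 0 1 = avg fun θ => f (circ θ) := by
  simp only [Real.circleAverage, avg, circleMap_eq_circ]

theorem avg_add {f g : ℝ → E} (hf : Continuous f) (hg : Continuous g) :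
    avg (fun θ => f θ + g θ) = avg f + avg g := by
  simp only [avg]
  rw [intervalIntegral.integral_add (hf.intervalIntegrable _ _) (hg.intervalIntegrable _ _),
    smul_add]

theorem avg_sub {f g : ℝ → E} (hf : Continuous f) (hg : Continuous g) :
    avg (fun θ => f θ - g θ) = avg f - avg g := by
  simp only [avg]
  rw [intervalIntegral.integral_sub (hf.intervalIntegrable _ _) (hg.intervalIntegrable _ _),
    smul_sub]

theorem avg_const [CompleteSpace E] (c : E) : avg (fun _ => c) = c := by
  have : (2 * Real.pi)⁻¹ * (2 * Real.pi) = 1 := inv_mul_cancel₀ (by positivity)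
  rw [avg, intervalIntegral.integral_const, sub_zero, smul_smul, this, one_smul]

theorem avg_clm {F : Type} [NormedAddCommGroup F] [NormedSpace ℝ F] [CompleteSpace E]
    [CompleteSpace F] (L : E →L[ℝ] F) {f : ℝ → E} (hf : Continuous f) :
    avg (fun θ => L (f θ)) = L (avg f) := by
  simp only [avg, map_smul]
  rw [L.intervalIntegral_comp_comm (hf.intervalIntegrable _ _)]

theorem norm_avg_le (f : ℝ → E) : ‖avg f‖ ≤ avg fun θ => ‖f θ‖ := by
  have hpi := Real.pi_pos
  rw [avg, avg, norm_smul, Real.norm_of_nonneg (by positivity), smul_eq_mul]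
  gcongr
  exact intervalIntegral.norm_integral_le_integral_norm (by positivity)

theorem avg_mono {f g : ℝ → ℝ} (hf : Continuous f) (hg : Continuous g) (h : ∀ θ, f θ ≤ g θ) :
    avg f ≤ avg g := by
  have hpi := Real.pi_pos
  refine smul_le_smul_of_nonneg_left ?_ (by positivity)
  exact intervalIntegral.integral_mono_on (by positivity) (hf.intervalIntegrable _ _)
    (hg.intervalIntegrable _ _) fun θ _ => h θ

theorem avg_mul_const (f : ℝ → ℝ) (c : ℝ) : avg (fun θ => f θ * c) = avg f * c := by
  simp [avg, mul_assoc]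

theorem avg_const_mul (f : ℝ → ℝ) (c : ℝ) : avg (fun θ => c * f θ) = c * avg f := by
  simp [avg]; ring

theorem avg_shift {f : ℝ → E} (hf : Function.Periodic f (2 * Real.pi)) (φ : ℝ) :
    avg (fun θ => f (θ + φ)) = avg f := by
  rw [avg, avg, intervalIntegral.integral_comp_add_right, zero_add, add_comm,
    hf.intervalIntegral_add_eq φ 0, zero_add]

theorem avg_eq_symm {f : ℝ → E} (hf : Function.Periodic f (2 * Real.pi)) :
    avg f = (2 * Real.pi)⁻¹ • ∫ θ in (-Real.pi)..Real.pi, f θ := by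
  have := hf.intervalIntegral_add_eq 0 (-Real.pi)
  rw [zero_add, show -Real.pi + 2 * Real.pi = Real.pi by ring] at this
  rw [avg, this]

/-- The basic kernel estimate: powers of the distance to an interior point. -/
theorem avg_rpow_le {a : ℝ} (ha : HExp a) {τ : ℂ} (hτ : ‖τ‖ < 1) :
    avg (fun θ => ‖circ θ - τ‖ ^ (a - 2)) ≤ 4 / (1 - a) * (1 - ‖τ‖) ^ (a - 1) := by
  have hpi := Real.pi_pos
  have ha1 : 0 < 1 - a := by linarith [ha.out.2]
  have ha0 := ha.out.1
  set ρ := 1 - ‖τ‖ with hρ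
  have hρ0 : 0 < ρ := by linarith
  obtain ⟨φ, hφ⟩ : ∃ φ, τ = ‖τ‖ * circ φ := ⟨τ.arg, (Complex.norm_mul_exp_arg_mul_I τ).symm⟩
  have hper : Function.Periodic (fun θ => ‖circ θ - τ‖ ^ (a - 2)) (2 * Real.pi) := fun θ => by
    simp only [circ_periodic θ]
  have hpos : ∀ θ : ℝ, 0 < (ρ + |θ| / Real.pi) / 2 := fun θ => by positivity
  -- After τ has been rotated to the positive axis, the distance dominates both 1 - |τ| and |θ|/π,
  -- hence their arithmetic mean, whose powers have an explicit primitive.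
  have hlow : ∀ θ : ℝ, |θ| ≤ Real.pi → (ρ + |θ| / Real.pi) / 2 ≤ ‖circ (θ + φ) - τ‖ := by
    intro θ hθ
    have e : circ (θ + φ) - τ = circ φ * (circ θ - ‖τ‖) := by
      rw [circ_add]; nth_rewrite 1 [hφ]; ring
    rw [e, norm_mul, norm_circ, one_mul]
    have h1 : ρ ≤ ‖circ θ - (‖τ‖ : ℂ)‖ := by
      have := le_norm_circ_sub (‖τ‖ : ℂ) θ
      rwa [Complex.norm_real, norm_norm] at this
    have h2 : 2 / Real.pi * |θ| ≤ ‖circ θ - 1‖ := by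
      have := le_norm_circ_sub_circ (x := θ) (y := 0) (by simpa using hθ)
      simpa using this
    have h3 : ‖circ θ - 1‖ ≤ ‖circ θ - (‖τ‖ : ℂ)‖ + ρ := by
      have := norm_sub_le_norm_sub_add_norm_sub (circ θ) (‖τ‖ : ℂ) 1
      have h4 : ‖(‖τ‖ : ℂ) - 1‖ = ρ := by
        rw [norm_sub_rev, ← Complex.ofReal_one, ← Complex.ofReal_sub, Complex.norm_real,
          Real.norm_of_nonneg hρ0.le]
      rwa [h4] at this
    have h5 : |θ| / Real.pi = (2 / Real.pi * |θ|) / 2 := by ring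
    rw [h5]
    linarith
  rw [← avg_shift hper φ, avg_eq_symm (fun θ => by
    simp only [add_right_comm θ, circ_periodic (θ + φ)])]
  have hcont : Continuous fun θ : ℝ => ((ρ + |θ| / Real.pi) / 2) ^ (a - 2) :=
    (by fun_prop : Continuous fun θ : ℝ => (ρ + |θ| / Real.pi) / 2).rpow_const
      fun θ => Or.inl (hpos θ).ne'
  have hcont' : Continuous fun θ : ℝ => ‖circ (θ + φ) - τ‖ ^ (a - 2) := by
    refine ((continuous_circ.comp (by fun_prop)).sub continuous_const).norm.rpow_const
      fun θ => Or.inl (norm_ne_zero_iff.2 (circ_sub_ne_zero hτ _))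
  have hmono : ∫ θ in (-Real.pi)..Real.pi, ‖circ (θ + φ) - τ‖ ^ (a - 2) ≤
      ∫ θ in (-Real.pi)..Real.pi, ((ρ + |θ| / Real.pi) / 2) ^ (a - 2) := by
    refine intervalIntegral.integral_mono_on (by linarith) (hcont'.intervalIntegrable _ _)
      (hcont.intervalIntegrable _ _) fun θ hθ => ?_
    exact Real.rpow_le_rpow_of_nonpos (hpos θ) (hlow θ (abs_le.2 hθ)) (by linarith)
  have hhalf : ∫ θ in (0 : ℝ)..Real.pi, ((ρ + |θ| / Real.pi) / 2) ^ (a - 2) ≤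
      4 * Real.pi / (1 - a) * ρ ^ (a - 1) := by
    have hd : ∀ θ ∈ uIcc 0 Real.pi, HasDerivAt
        (fun θ => -(2 * Real.pi / (1 - a)) * ((ρ + θ / Real.pi) / 2) ^ (a - 1))
        (((ρ + |θ| / Real.pi) / 2) ^ (a - 2)) θ := by
      intro θ hθ
      rw [uIcc_of_le hpi.le] at hθ
      have hp := hpos θ
      rw [abs_of_nonneg hθ.1] at hp ⊢
      have h1 : HasDerivAt (fun θ : ℝ => (ρ + θ / Real.pi) / 2) (1 / Real.pi / 2) θ :=
        (((hasDerivAt_id θ).div_const _).const_add ρ).div_const 2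
      have h2 := (h1.rpow_const (p := a - 1) (Or.inl hp.ne')).const_mul (-(2 * Real.pi / (1 - a)))
      refine h2.congr_deriv ?_
      rw [show a - 1 - 1 = a - 2 by ring]
      field_simp
      ring
    rw [intervalIntegral.integral_eq_sub_of_hasDerivAt hd (hcont.intervalIntegrable _ _)]
    have h3 : 0 ≤ ((ρ + Real.pi / Real.pi) / 2) ^ (a - 1) := by positivity
    have h4 : ((ρ + 0 / Real.pi) / 2) ^ (a - 1) ≤ 2 * ρ ^ (a - 1) := by
      rw [zero_div, add_zero, Real.div_rpow hρ0.le zero_le_two, div_eq_mul_inv, mul_comm,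
        ← Real.rpow_neg zero_le_two]
      refine mul_le_mul_of_nonneg_right ?_ (by positivity)
      calc (2 : ℝ) ^ (-(a - 1)) ≤ 2 ^ (1 : ℝ) :=
            Real.rpow_le_rpow_of_exponent_le one_le_two (by linarith)
        _ = 2 := Real.rpow_one 2
    have h5 : 0 ≤ 2 * Real.pi / (1 - a) := by positivity
    have h6 : 4 * Real.pi / (1 - a) * ρ ^ (a - 1) =
        2 * Real.pi / (1 - a) * (2 * ρ ^ (a - 1)) := by ring
    rw [h6]
    nlinarith [mul_le_mul_of_nonneg_left h4 h5, mul_nonneg h5 h3]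
  have hsum : ∫ θ in (-Real.pi)..Real.pi, ((ρ + |θ| / Real.pi) / 2) ^ (a - 2) =
      2 * ∫ θ in (0 : ℝ)..Real.pi, ((ρ + |θ| / Real.pi) / 2) ^ (a - 2) := by
    rw [← intervalIntegral.integral_add_adjacent_intervals (b := 0)
      (hcont.intervalIntegrable _ _) (hcont.intervalIntegrable _ _), two_mul]
    congr 1
    have := intervalIntegral.integral_comp_neg (a := 0) (b := Real.pi)
      (fun θ : ℝ => ((ρ + |θ| / Real.pi) / 2) ^ (a - 2))
    simp only [abs_neg, neg_zero] at this
    exact this.symm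
  rw [smul_eq_mul, inv_mul_le_iff₀ (by positivity)]
  rw [hsum] at hmono
  refine hmono.trans ?_
  calc 2 * ∫ θ in (0 : ℝ)..Real.pi, ((ρ + |θ| / Real.pi) / 2) ^ (a - 2)
      ≤ 2 * (4 * Real.pi / (1 - a) * ρ ^ (a - 1)) := by gcongr
    _ = 2 * Real.pi * (4 / (1 - a) * ρ ^ (a - 1)) := by ring

end Average

/-! ### From derivative bounds inside the disc to Hölder continuity -/

section HardyLittlewood

variable {E : Type} [NormedAddCommGroup E] [NormedSpace ℂ E]

/-- The Hardy–Littlewood criterion for Hölder continuity on the disc. -/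
theorem norm_sub_le_of_deriv_le {a : ℝ} (ha : HExp a) {F F' : ℂ → E} {K : ℝ} (hK : 0 ≤ K)
    (hd : ∀ τ ∈ ball (0 : ℂ) 1, HasDerivAt F (F' τ) τ)
    (hb : ∀ τ ∈ ball (0 : ℂ) 1, ‖F' τ‖ ≤ K * (1 - ‖τ‖) ^ (a - 1)) {τ τ' : ℂ}
    (hτ : τ ∈ ball (0 : ℂ) 1) (hτ' : τ' ∈ ball (0 : ℂ) 1) :
    ‖F τ - F τ'‖ ≤ K * (2 / a + 1) * ‖τ - τ'‖ ^ a := by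
  have ha0 := ha.out.1
  have ha1 := ha.out.2
  have hrad : ∀ σ ∈ ball (0 : ℂ) 1, ∀ p : ℝ, 0 ≤ p → p ≤ 1 →
      ‖F σ - F ((p : ℂ) * σ)‖ ≤ K / a * (1 - p) ^ a := by
    intro σ hσ p hp hp1
    rw [mem_ball_zero_iff] at hσ
    have hmem : ∀ t : ℝ, 0 ≤ t → t ≤ 1 → ‖(t : ℂ) * σ‖ ≤ t * ‖σ‖ ∧ (t : ℂ) * σ ∈ ball (0 : ℂ) 1 := by
      intro t ht ht1
      have h1 : ‖(t : ℂ) * σ‖ = t * ‖σ‖ := by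
        rw [norm_mul, Complex.norm_real, Real.norm_of_nonneg ht]
      refine ⟨h1.le, ?_⟩
      rw [mem_ball_zero_iff, h1]
      nlinarith [norm_nonneg σ]
    have hder : ∀ t : ℝ, 0 ≤ t → t ≤ 1 →
        HasDerivAt (fun t : ℝ => F ((t : ℂ) * σ)) (σ • F' ((t : ℂ) * σ)) t := by
      intro t ht ht1
      have h1 : HasDerivAt (fun t : ℝ => (t : ℂ) * σ) σ t := by
        have := (Complex.ofRealCLM.hasDerivAt (x := t)).mul_const σ
        simp only [Complex.ofRealCLM_apply, Complex.ofReal_one, one_mul] at this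
        exact this
      exact HasDerivAt.scomp t (hd _ (hmem t ht ht1).2) h1
    have := norm_sub_le_of_deriv_le_rpow (f := fun t : ℝ => F ((t : ℂ) * σ))
      (f' := fun t => σ • F' ((t : ℂ) * σ)) (p := p) (b := 1) (c := 1) hp1 le_rfl ha0 ha1.le hK
      (fun t ht => (hder t (hp.trans ht.1) ht.2).continuousAt.continuousWithinAt)
      (fun t ht => hder t (hp.trans ht.1) ht.2.le) (fun t ht => ?_)
    · simpa using this
    · have h0 := hp.trans ht.1
      obtain ⟨h1, h2⟩ := hmem t h0 ht.2.le
      rw [norm_smul]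
      have h3 : (1 - ‖(t : ℂ) * σ‖) ^ (a - 1) ≤ (1 - t) ^ (a - 1) :=
        Real.rpow_le_rpow_of_nonpos (by linarith [ht.2]) (by nlinarith [norm_nonneg σ])
          (by linarith)
      have h4 := hb _ h2
      calc ‖σ‖ * ‖F' ((t : ℂ) * σ)‖ ≤ 1 * ‖F' ((t : ℂ) * σ)‖ := by gcongr
        _ ≤ K * (1 - t) ^ (a - 1) := by
          rw [one_mul]
          exact h4.trans (by gcongr)
  set ρ := ‖τ - τ'‖ with hρ
  have hρ0 : 0 ≤ ρ := norm_nonneg _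
  have e : K * (2 / a + 1) * ρ ^ a = K / a * ρ ^ a + K * ρ ^ a + K / a * ρ ^ a := by ring
  rw [e]
  have hKρ : 0 ≤ K * ρ ^ a := by positivity
  -- Both points retreat radially by their distance ρ. On the disc of radius 1 - ρ the derivative is
  -- at most Kρ^(a - 1), so the middle segment, of length at most ρ, contributes Kρ^a. For ρ > 1
  -- both points are joined to the centre instead.
  rcases le_or_gt ρ 1 with h1 | h1
  · have r1 := hrad τ hτ (1 - ρ) (by linarith) (by linarith)
    have r2 := hrad τ' hτ' (1 - ρ) (by linarith) (by linarith)
    rw [sub_sub_cancel] at r1 r2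
    set q : ℂ := ((1 - ρ : ℝ) : ℂ) with hq
    have r3 : ‖F (q * τ) - F (q * τ')‖ ≤ K * ρ ^ a := by
      rcases hρ0.eq_or_lt with h0 | h0
      · have : τ = τ' := by rw [← sub_eq_zero, ← norm_eq_zero]; exact h0.symm
        rw [this, sub_self, norm_zero]; exact hKρ
      have hin : ∀ σ ∈ ball (0 : ℂ) 1, q * σ ∈ ball (0 : ℂ) 1 ∩ closedBall 0 (1 - ρ) := by
        intro σ hσ
        rw [mem_ball_zero_iff] at hσ
        have hqn : ‖q * σ‖ ≤ (1 - ρ) * ‖σ‖ := by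
          rw [norm_mul, hq, Complex.norm_real, Real.norm_of_nonneg (by linarith)]
        rw [mem_inter_iff, mem_ball_zero_iff, mem_closedBall_zero_iff]
        constructor <;> nlinarith [norm_nonneg σ]
      have hc : Convex ℝ (ball (0 : ℂ) 1 ∩ closedBall 0 (1 - ρ)) :=
        (convex_ball _ _).inter (convex_closedBall _ _)
      have h2 := hc.norm_image_sub_le_of_norm_hasDerivWithin_le (C := K * ρ ^ (a - 1))
        (f := F) (f' := F') (fun x hx => (hd x hx.1).hasDerivWithinAt) (fun x hx => ?_)
        (hin τ' hτ') (hin τ hτ)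
      · refine h2.trans ?_
        have h3 : ‖q * τ - q * τ'‖ ≤ ρ := by
          rw [← mul_sub, norm_mul, hq, Complex.norm_real, Real.norm_of_nonneg (by linarith)]
          nlinarith
        calc K * ρ ^ (a - 1) * ‖q * τ - q * τ'‖ ≤ K * ρ ^ (a - 1) * ρ := by gcongr
          _ = K * ρ ^ a := by rw [mul_assoc, ← Real.rpow_add_one h0.ne', sub_add_cancel]
      · refine (hb x hx.1).trans (mul_le_mul_of_nonneg_left ?_ hK)
        have := mem_closedBall_zero_iff.1 hx.2
        exact Real.rpow_le_rpow_of_nonpos h0 (by linarith) (by linarith)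
    calc ‖F τ - F τ'‖ ≤ ‖F τ - F (q * τ)‖ + ‖F (q * τ) - F (q * τ')‖ + ‖F (q * τ') - F τ'‖ := by
          have h3 := norm_sub_le_norm_sub_add_norm_sub (F τ) (F (q * τ)) (F τ')
          have h4 := norm_sub_le_norm_sub_add_norm_sub (F (q * τ)) (F (q * τ')) (F τ')
          linarith
      _ ≤ _ := by
          rw [norm_sub_rev (F (q * τ'))]
          linarith
  · have r1 := hrad τ hτ 0 le_rfl zero_le_one
    have r2 := hrad τ' hτ' 0 le_rfl zero_le_one
    simp only [Complex.ofReal_zero, zero_mul, sub_zero, Real.one_rpow, mul_one] at r1 r2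
    have h2 : 1 ≤ ρ ^ a := Real.one_le_rpow h1.le ha0.le
    have h3 : K / a ≤ K / a * ρ ^ a := le_mul_of_one_le_right (by positivity) h2
    have h4 := norm_sub_le_norm_sub_add_norm_sub (F τ) (F 0) (F τ')
    rw [norm_sub_rev (F 0)] at h4
    linarith

/-- A uniformly Hölder function on the open disc extends to the closed disc. -/
theorem exists_tendsto_of_holder [CompleteSpace E] {a : ℝ} (ha : 0 < a) {F : ℂ → E} {C : ℝ}
    (h : ∀ τ ∈ ball (0 : ℂ) 1, ∀ τ' ∈ ball (0 : ℂ) 1, ‖F τ - F τ'‖ ≤ C * ‖τ - τ'‖ ^ a)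
    {x : ℂ} (hx : x ∈ closedBall (0 : ℂ) 1) : ∃ y, Tendsto F (𝓝[ball 0 1] x) (𝓝 y) := by
  have hne : (𝓝[ball (0 : ℂ) 1] x).NeBot := by
    rw [← mem_closure_iff_nhdsWithin_neBot, closure_ball _ one_ne_zero]
    exact hx
  refine cauchy_map_iff_exists_tendsto.1 ?_
  refine ⟨hne.map _, ?_⟩
  rw [Filter.prod_map_map_eq]
  refine Metric.uniformity_basis_dist.ge_iff.2 fun ε hε => ?_
  have h1 : Tendsto (fun p : ℂ × ℂ => C * ‖p.1 - p.2‖ ^ a) (𝓝 (x, x)) (𝓝 0) := by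
    have : Continuous fun p : ℂ × ℂ => C * ‖p.1 - p.2‖ ^ a :=
      continuous_const.mul ((continuous_fst.sub continuous_snd).norm.rpow_const
        fun _ => Or.inr ha.le)
    simpa [Real.zero_rpow ha.ne'] using this.tendsto (x, x)
  have h2 : 𝓝[ball 0 1] x ×ˢ 𝓝[ball 0 1] x ≤ 𝓝 (x, x) := by
    rw [nhds_prod_eq]
    exact Filter.prod_mono nhdsWithin_le_nhds nhdsWithin_le_nhds
  refine mem_map.2 ?_
  filter_upwards [(h1.mono_left h2).eventually (gt_mem_nhds hε),
    prod_mem_prod (self_mem_nhdsWithin (a := x)) (self_mem_nhdsWithin (a := x))] with p hp hp2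
  change dist (F p.1) (F p.2) < ε
  rw [dist_eq_norm]
  exact (h _ hp2.1 _ hp2.2).trans_lt hp

end HardyLittlewood

/-! ### Cauchy integrals on Hölder spaces -/

section CauchyIntegral

variable {E : Type} [NormedAddCommGroup E] [NormedSpace ℂ E]

/-- The Cauchy integral of a function on the circle. -/
noncomputable def cauchy (f : ℝ → E) (τ : ℂ) : E := avg fun θ => (circ θ / (circ θ - τ)) • f θ

theorem continuous_kernel {τ : ℂ} (hτ : ‖τ‖ < 1) : Continuous fun θ => circ θ / (circ θ - τ) :=
  continuous_circ.div (continuous_circ.sub continuous_const) (circ_sub_ne_zero hτ)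

theorem continuous_kernel_sq {τ : ℂ} (hτ : ‖τ‖ < 1) :
    Continuous fun θ => circ θ / (circ θ - τ) ^ 2 :=
  continuous_circ.div ((continuous_circ.sub continuous_const).pow 2)
    fun θ => pow_ne_zero 2 (circ_sub_ne_zero hτ θ)

theorem hasDerivAt_cauchy {f : ℝ → E} (hf : Continuous f) {τ : ℂ} (hτ : ‖τ‖ < 1) :
    HasDerivAt (cauchy f) (avg fun θ => (circ θ / (circ θ - τ) ^ 2) • f θ) τ := by
  set d := (1 - ‖τ‖) / 2 with hd
  have hd0 : 0 < d := by rw [hd]; linarith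
  have hball : ∀ x ∈ ball τ d, ‖x‖ < 1 ∧ ∀ θ, d ≤ ‖circ θ - x‖ := by
    intro x hx
    rw [mem_ball, dist_eq_norm] at hx
    have h1 : ‖x‖ ≤ ‖x - τ‖ + ‖τ‖ := by simpa using norm_add_le (x - τ) τ
    refine ⟨by linarith, fun θ => ?_⟩
    have := le_norm_circ_sub x θ
    linarith
  have hm : ∀ x ∈ ball τ d, Continuous fun θ => (circ θ / (circ θ - x)) • f θ := fun x hx =>
    (continuous_kernel (hball x hx).1).smul hf
  have h := intervalIntegral.hasDerivAt_integral_of_dominated_loc_of_deriv_le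
    (μ := MeasureTheory.volume) (a := 0) (b := 2 * Real.pi)
    (F := fun x θ => (circ θ / (circ θ - x)) • f θ)
    (F' := fun x θ => (circ θ / (circ θ - x) ^ 2) • f θ)
    (bound := fun θ => (d ^ 2)⁻¹ * ‖f θ‖) (x₀ := τ) (ball_mem_nhds τ hd0)
    (by
      filter_upwards [ball_mem_nhds τ hd0] with x hx
      exact (hm x hx).aestronglyMeasurable)
    ((hm τ (mem_ball_self hd0)).intervalIntegrable _ _)
    ((continuous_kernel_sq hτ).smul hf).aestronglyMeasurable
    (by
      filter_upwards with θ _ x hx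
      rw [norm_smul, norm_div, norm_circ, norm_pow, one_div]
      have := (hball x hx).2 θ
      gcongr)
    ((continuous_const.mul hf.norm).intervalIntegrable _ _)
    (by
      filter_upwards with θ _ x hx
      have h0 := circ_sub_ne_zero (hball x hx).1 θ
      have h1 : HasDerivAt (fun x : ℂ => circ θ / (circ θ - x)) (circ θ / (circ θ - x) ^ 2) x := by
        have := (hasDerivAt_const x (circ θ)).div ((hasDerivAt_id x).const_sub (circ θ)) h0
        refine this.congr_deriv ?_
        simp
      exact h1.smul_const _)
  exact h.2.const_smul ((2 * Real.pi)⁻¹ : ℝ)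

theorem differentiableOn_cauchy {f : ℝ → E} (hf : Continuous f) :
    DifferentiableOn ℂ (cauchy f) (ball 0 1) := fun _ hτ =>
  (hasDerivAt_cauchy hf (mem_ball_zero_iff.1 hτ)).differentiableAt.differentiableWithinAt

theorem cauchy_circ [CompleteSpace E] {u : ℂ → E} (hu : DiffContOnCl ℂ u (ball 0 1)) {τ : ℂ}
    (hτ : ‖τ‖ < 1) : cauchy (fun θ => u (circ θ)) τ = u τ := by
  have := DiffContOnCl.circleAverage_smul_div (c := 0) (R := 1) (f := u) (w := τ)
    (by simpa using hu) (by simpa using hτ)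
  unfold cauchy
  simpa [circleAverage_eq_avg] using this

theorem avg_circ [CompleteSpace E] {u : ℂ → E} (hu : DiffContOnCl ℂ u (ball 0 1)) :
    avg (fun θ => u (circ θ)) = u 0 := by
  have := DiffContOnCl.circleAverage (c := 0) (R := 1) (f := u) (by simpa using hu)
  simpa [circleAverage_eq_avg] using this

theorem cauchy_const [CompleteSpace E] (c : E) {τ : ℂ} (hτ : ‖τ‖ < 1) :
    cauchy (fun _ => c) τ = c :=
  cauchy_circ (u := fun _ => c) diffContOnCl_const hτ

theorem cauchy_zero [CompleteSpace E] (f : ℝ → E) : cauchy f 0 = avg f := by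
  simp [cauchy, div_self, circ_ne_zero]

/-- The kernel is the τ-derivative of the Cauchy kernel, which reproduces constants. Hence a
constant may be subtracted from f before the derivative of its Cauchy integral is estimated. -/
theorem avg_kernel_sq_smul [CompleteSpace E] (c : E) {τ : ℂ} (hτ : ‖τ‖ < 1) :
    avg (fun θ => (circ θ / (circ θ - τ) ^ 2) • c) = 0 := by
  have h1 := hasDerivAt_cauchy (continuous_const (y := c)) hτ
  refine h1.unique ((hasDerivAt_const τ c).congr_of_eventuallyEq ?_)
  filter_upwards [isOpen_ball.mem_nhds (mem_ball_zero_iff.2 hτ)] with x hx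
  exact cauchy_const c (mem_ball_zero_iff.1 hx)

/-- The Hölder weight `|e^{ix} - e^{iy}|^a`. -/
noncomputable def chordHolder (a : ℝ) (x y : ℝ) : ℝ := ‖circ x - circ y‖ ^ a

theorem chordHolder_nonneg (a x y : ℝ) : 0 ≤ chordHolder a x y := Real.rpow_nonneg (norm_nonneg _) _

theorem periodic_of_chordHolder {a : ℝ} (ha : 0 < a) {f : ℝ → E} {N : ℝ}
    (h : ∀ x y, ‖f x - f y‖ ≤ N * chordHolder a x y) : Function.Periodic f (2 * Real.pi) := by
  intro θ
  have := h (θ + 2 * Real.pi) θ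
  rw [chordHolder, circ_periodic, sub_self, norm_zero, Real.zero_rpow ha.ne', mul_zero,
    norm_le_zero_iff, sub_eq_zero] at this
  exact this

theorem chordHolder_le_absWeight {a : ℝ} (ha : 0 ≤ a) (x y : ℝ) :
    chordHolder a x y ≤ absWeight a x y :=
  Real.rpow_le_rpow (norm_nonneg _) (norm_circ_sub_circ_le x y) ha

theorem HSp.continuous_chord {E : Type} [NormedAddCommGroup E] [NormedSpace ℝ E] {a : ℝ}
    [ha : HExp a] (f : HSp (chordHolder a) E) : Continuous f :=
  continuous_of_le_absWeight fun x y => (f.norm_sub_le (chordHolder_nonneg a x y)).trans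
    (mul_le_mul_of_nonneg_left (chordHolder_le_absWeight ha.out.1.le x y) (norm_nonneg _))

/-- The integral of a function with kernel of size `|e^{iθ} - τ|⁻²` against the oscillation of a
Hölder function. -/
theorem norm_avg_smul_le {a : ℝ} (ha : HExp a) {f : ℝ → E} (hf : Continuous f) {N : ℝ}
    (hN : 0 ≤ N) (h : ∀ x y, ‖f x - f y‖ ≤ N * chordHolder a x y) {τ : ℂ} (hτ : ‖τ‖ < 1) {φ : ℝ}
    (hφ : τ = ‖τ‖ * circ φ) {k : ℝ → ℂ} (hk : Continuous k) {A : ℝ} (hA : 0 ≤ A)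
    (hkA : ∀ θ, ‖k θ‖ ≤ A * (‖circ θ - τ‖ ^ 2)⁻¹) :
    ‖avg fun θ => k θ • (f θ - f φ)‖ ≤ 8 * N / (1 - a) * A * (1 - ‖τ‖) ^ (a - 1) := by
  have ha0 := ha.out.1
  have ha1 : 0 < 1 - a := by linarith [ha.out.2]
  have hpos : ∀ θ, 0 < ‖circ θ - τ‖ := fun θ => norm_pos_iff.2 (circ_sub_ne_zero hτ θ)
  have hφτ : ‖τ - circ φ‖ = 1 - ‖τ‖ := by
    have : τ - circ φ = ((‖τ‖ - 1 : ℝ) : ℂ) * circ φ := by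
      nth_rewrite 1 [hφ]; push_cast; ring
    rw [this, norm_mul, norm_circ, mul_one, Complex.norm_real, Real.norm_eq_abs,
      abs_of_nonpos (by linarith)]
    ring
  have hle : ∀ θ, ‖k θ • (f θ - f φ)‖ ≤ ‖circ θ - τ‖ ^ (a - 2) * (2 * N * A) := by
    intro θ
    -- `circ φ` is the boundary point nearest to τ, so the oscillation of f is absorbed by the
    -- kernel and leaves |ζ - τ|^(a - 2).
    have h1 : ‖circ θ - circ φ‖ ≤ 2 * ‖circ θ - τ‖ := by
      have := norm_sub_le_norm_sub_add_norm_sub (circ θ) τ (circ φ)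
      have := le_norm_circ_sub τ θ
      linarith
    have h2 : chordHolder a θ φ ≤ 2 * ‖circ θ - τ‖ ^ a := by
      calc chordHolder a θ φ ≤ (2 * ‖circ θ - τ‖) ^ a :=
            Real.rpow_le_rpow (norm_nonneg _) h1 ha0.le
        _ = 2 ^ a * ‖circ θ - τ‖ ^ a := Real.mul_rpow zero_le_two (norm_nonneg _)
        _ ≤ 2 ^ (1 : ℝ) * ‖circ θ - τ‖ ^ a := by
            gcongr
            · exact one_le_two
            · linarith
        _ = _ := by rw [Real.rpow_one]
    rw [norm_smul]
    calc ‖k θ‖ * ‖f θ - f φ‖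
        ≤ (A * (‖circ θ - τ‖ ^ 2)⁻¹) * (N * (2 * ‖circ θ - τ‖ ^ a)) :=
          mul_le_mul (hkA θ) ((h θ φ).trans (by gcongr)) (norm_nonneg _)
            (mul_nonneg hA (by positivity))
      _ = ‖circ θ - τ‖ ^ (a - 2) * (2 * N * A) := by
          rw [Real.rpow_sub (hpos θ), Real.rpow_two]
          ring
  have hc1 : Continuous fun θ => ‖circ θ - τ‖ ^ (a - 2) :=
    (continuous_circ.sub continuous_const).norm.rpow_const fun θ => Or.inl (hpos θ).ne'
  refine (norm_avg_le _).trans ((avg_mono (g := fun θ => ‖circ θ - τ‖ ^ (a - 2) * (2 * N * A))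
    (hk.smul (hf.sub continuous_const)).norm (hc1.mul continuous_const) hle).trans ?_)
  rw [avg_mul_const]
  have := avg_rpow_le ha hτ
  calc avg (fun θ => ‖circ θ - τ‖ ^ (a - 2)) * (2 * N * A)
      ≤ 4 / (1 - a) * (1 - ‖τ‖) ^ (a - 1) * (2 * N * A) := by gcongr
    _ = _ := by ring

theorem exists_eq_norm_mul_circ (τ : ℂ) : ∃ φ, τ = ‖τ‖ * circ φ :=
  ⟨τ.arg, (Complex.norm_mul_exp_arg_mul_I τ).symm⟩

/-- The kernel has mean zero, so only the oscillation of f about its value at the boundary point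
nearest to τ matters. -/
theorem norm_deriv_cauchy_le [CompleteSpace E] {a : ℝ} (ha : HExp a) {f : ℝ → E}
    (hf : Continuous f) {N : ℝ} (hN : 0 ≤ N) (h : ∀ x y, ‖f x - f y‖ ≤ N * chordHolder a x y)
    {τ : ℂ} (hτ : ‖τ‖ < 1) :
    ‖avg fun θ => (circ θ / (circ θ - τ) ^ 2) • f θ‖ ≤
      8 * N / (1 - a) * (1 - ‖τ‖) ^ (a - 1) := by
  obtain ⟨φ, hφ⟩ := exists_eq_norm_mul_circ τ
  have h1 := norm_avg_smul_le ha hf hN h hτ hφ (continuous_kernel_sq hτ) zero_le_one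
    (fun θ => by rw [norm_div, norm_circ, norm_pow, one_mul, one_div])
  have h2 : (avg fun θ => (circ θ / (circ θ - τ) ^ 2) • (f θ - f φ)) =
      avg fun θ => (circ θ / (circ θ - τ) ^ 2) • f θ := by
    simp only [smul_sub]
    have hc : Continuous fun θ => (circ θ / (circ θ - τ) ^ 2) • f θ := (continuous_kernel_sq hτ).smul hf
    have hc' : Continuous fun θ => (circ θ / (circ θ - τ) ^ 2) • f φ :=
      (continuous_kernel_sq hτ).smul continuous_const
    rw [avg_sub hc hc', avg_kernel_sq_smul _ hτ, sub_zero]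
  rw [h2, mul_one] at h1
  exact h1

/-- The constant in the Hölder estimate of Cauchy integrals. -/
noncomputable def privalovConst (a : ℝ) : ℝ := 8 / (1 - a) * (2 / a + 1)

theorem privalovConst_nonneg {a : ℝ} (ha : HExp a) : 0 ≤ privalovConst a := by
  have := ha.out.1
  have : 0 < 1 - a := by linarith [ha.out.2]
  unfold privalovConst; positivity

/-- Privalov's theorem: the derivative grows at most like (1 - |τ|)^(a - 1), and the
Hardy–Littlewood criterion applies. -/
theorem norm_cauchy_sub_le [CompleteSpace E] {a : ℝ} (ha : HExp a) {f : ℝ → E}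
    (hf : Continuous f) {N : ℝ} (hN : 0 ≤ N) (h : ∀ x y, ‖f x - f y‖ ≤ N * chordHolder a x y)
    {τ τ' : ℂ} (hτ : τ ∈ ball (0 : ℂ) 1) (hτ' : τ' ∈ ball (0 : ℂ) 1) :
    ‖cauchy f τ - cauchy f τ'‖ ≤ privalovConst a * N * ‖τ - τ'‖ ^ a := by
  have ha1 : 0 < 1 - a := by linarith [ha.out.2]
  have := norm_sub_le_of_deriv_le ha (K := 8 * N / (1 - a)) (by positivity)
    (fun τ hτ => hasDerivAt_cauchy hf (mem_ball_zero_iff.1 hτ))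
    (fun τ hτ => norm_deriv_cauchy_le ha hf hN h (mem_ball_zero_iff.1 hτ)) hτ hτ'
  refine this.trans_eq ?_
  rw [privalovConst]
  ring

/-- The Cauchy integral, continued to the closed disc. -/
noncomputable def cauchyExt (f : ℝ → E) : ℂ → E := extendFrom (ball 0 1) (cauchy f)

theorem cauchyExt_of_mem {f : ℝ → E} (hf : Continuous f) {τ : ℂ} (hτ : τ ∈ ball (0 : ℂ) 1) :
    cauchyExt f τ = cauchy f τ :=
  extendFrom_extends (differentiableOn_cauchy hf).continuousOn τ hτ

variable [CompleteSpace E] {a : ℝ} [ha : HExp a]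

theorem continuousOn_cauchyExt (f : HSp (chordHolder a) E) :
    ContinuousOn (cauchyExt f) (closedBall 0 1) := by
  refine continuousOn_extendFrom (closure_ball (0 : ℂ) one_ne_zero).ge fun x hx => ?_
  exact exists_tendsto_of_holder ha.out.1 (fun τ hτ τ' hτ' => norm_cauchy_sub_le ha
    f.continuous_chord (norm_nonneg f) (fun x y => f.norm_sub_le (chordHolder_nonneg a x y)) hτ hτ')
    hx

theorem diffContOnCl_cauchyExt (f : HSp (chordHolder a) E) :
    DiffContOnCl ℂ (cauchyExt f) (ball 0 1) := by
  refine ⟨(differentiableOn_cauchy f.continuous_chord).congr fun τ hτ =>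
    cauchyExt_of_mem f.continuous_chord hτ, ?_⟩
  rw [closure_ball (0 : ℂ) one_ne_zero]
  exact continuousOn_cauchyExt f

/-- Two functions continuous on the closed disc and equal on the open disc are equal. -/
theorem eqOn_closedBall {F : Type} [TopologicalSpace F] [T2Space F] {u v : ℂ → F}
    (hu : ContinuousOn u (closedBall 0 1)) (hv : ContinuousOn v (closedBall 0 1))
    (h : ∀ τ ∈ ball (0 : ℂ) 1, u τ = v τ) : ∀ τ ∈ closedBall (0 : ℂ) 1, u τ = v τ :=
  EqOn.of_subset_closure (s := ball (0 : ℂ) 1) h hu hv ball_subset_closedBall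
    (closure_ball (0 : ℂ) one_ne_zero).ge

theorem le_closedBall {u v : ℂ → ℝ}
    (hu : ContinuousOn u (closedBall 0 1)) (hv : ContinuousOn v (closedBall 0 1))
    (h : ∀ τ ∈ ball (0 : ℂ) 1, u τ ≤ v τ) : ∀ τ ∈ closedBall (0 : ℂ) 1, u τ ≤ v τ := by
  intro τ hτ
  have hτ' : τ ∈ closure (ball (0 : ℂ) 1) := by rwa [closure_ball (0 : ℂ) one_ne_zero]
  refine ContinuousWithinAt.closure_le hτ' ((hu τ hτ).mono ball_subset_closedBall)
    ((hv τ hτ).mono ball_subset_closedBall) h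

theorem norm_cauchyExt_sub_le (f : HSp (chordHolder a) E) {τ τ' : ℂ}
    (hτ : τ ∈ closedBall (0 : ℂ) 1) (hτ' : τ' ∈ closedBall (0 : ℂ) 1) :
    ‖cauchyExt f τ - cauchyExt f τ'‖ ≤ privalovConst a * ‖f‖ * ‖τ - τ'‖ ^ a := by
  have hc := continuousOn_cauchyExt f
  have hr : ∀ c : ℂ, ContinuousOn (fun x : ℂ => privalovConst a * ‖f‖ * ‖x - c‖ ^ a)
      (closedBall 0 1) := fun c => Continuous.continuousOn (continuous_const.mul
    ((continuous_id.sub continuous_const).norm.rpow_const fun _ => Or.inr ha.out.1.le))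
  refine le_closedBall (u := fun x => ‖cauchyExt f x - cauchyExt f τ'‖)
    (hc.sub continuousOn_const).norm (hr τ') (fun x hx => ?_) τ hτ
  have := le_closedBall (u := fun y => ‖cauchyExt f y - cauchyExt f x‖)
    (hc.sub continuousOn_const).norm (hr x) (fun y hy => ?_) τ' hτ'
  · rw [norm_sub_rev, norm_sub_rev x]; exact this
  · rw [cauchyExt_of_mem f.continuous_chord hx, cauchyExt_of_mem f.continuous_chord hy]
    exact norm_cauchy_sub_le ha f.continuous_chord (norm_nonneg f)
      (fun x y => f.norm_sub_le (chordHolder_nonneg a x y)) hy hx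

theorem circ_mem_closedBall (θ : ℝ) : circ θ ∈ closedBall (0 : ℂ) 1 := by simp

theorem cauchyExt_zero (f : HSp (chordHolder a) E) : cauchyExt f 0 = avg f := by
  rw [cauchyExt_of_mem f.continuous_chord (by simp), cauchy_zero]

theorem norm_avg_le_norm (f : HSp (chordHolder a) E) : ‖avg f‖ ≤ ‖f‖ := by
  refine (norm_avg_le _).trans ((avg_mono f.continuous_chord.norm continuous_const
    f.norm_apply_le).trans_eq (avg_const _))

theorem norm_cauchyExt_le (f : HSp (chordHolder a) E) {τ : ℂ} (hτ : τ ∈ closedBall (0 : ℂ) 1) :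
    ‖cauchyExt f τ‖ ≤ (1 + privalovConst a) * ‖f‖ := by
  have h1 := norm_cauchyExt_sub_le f hτ (mem_closedBall_self zero_le_one)
  rw [cauchyExt_zero, sub_zero] at h1
  have h2 : ‖τ‖ ^ a ≤ 1 := Real.rpow_le_one (norm_nonneg _) (mem_closedBall_zero_iff.1 hτ)
    ha.out.1.le
  have h3 : ‖cauchyExt f τ‖ ≤ ‖cauchyExt f τ - avg f‖ + ‖avg f‖ := by
    simpa using norm_add_le (cauchyExt f τ - avg f) (avg f)
  have h4 := norm_avg_le_norm f
  have h5 : privalovConst a * ‖f‖ * ‖τ‖ ^ a ≤ privalovConst a * ‖f‖ :=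
    mul_le_of_le_one_right (mul_nonneg (privalovConst_nonneg ha) (norm_nonneg _)) h2
  linarith

theorem cauchyExt_add (f g : HSp (chordHolder a) E) {τ : ℂ} (hτ : τ ∈ closedBall (0 : ℂ) 1) :
    cauchyExt (f + g : HSp (chordHolder a) E) τ = cauchyExt f τ + cauchyExt g τ := by
  refine eqOn_closedBall (continuousOn_cauchyExt (f + g))
    ((continuousOn_cauchyExt f).add (continuousOn_cauchyExt g)) (fun τ hτ => ?_) τ hτ
  rw [Pi.add_apply]
  rw [cauchyExt_of_mem f.continuous_chord hτ, cauchyExt_of_mem g.continuous_chord hτ,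
    cauchyExt_of_mem (f + g).continuous_chord hτ]
  have hk := continuous_kernel (mem_ball_zero_iff.1 hτ)
  simp only [cauchy, HSp.add_apply, smul_add]
  exact avg_add (hk.smul f.continuous_chord) (hk.smul g.continuous_chord)

/-- Compatibility of the Cauchy integral with linear maps. -/
theorem cauchyExt_map {F : Type} [NormedAddCommGroup F] [NormedSpace ℂ F] [CompleteSpace F]
    (L : E →L[ℂ] F) (f : HSp (chordHolder a) E) {τ : ℂ} (hτ : τ ∈ closedBall (0 : ℂ) 1) :
    cauchyExt (fun θ => L (f θ)) τ = L (cauchyExt f τ) := by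
  have hc : (fun θ => L (f θ)) = HSp.map (ω := chordHolder a) (L.restrictScalars ℝ) f := rfl
  rw [hc]
  refine eqOn_closedBall (continuousOn_cauchyExt _)
    (L.continuous.comp_continuousOn (continuousOn_cauchyExt f)) (fun τ hτ => ?_) τ hτ
  rw [cauchyExt_of_mem (HSp.continuous_chord _) hτ, Function.comp_apply,
    cauchyExt_of_mem f.continuous_chord hτ]
  have hk := continuous_kernel (mem_ball_zero_iff.1 hτ)
  simp only [cauchy, HSp.map_apply, ContinuousLinearMap.coe_restrictScalars', ← map_smul]
  exact avg_clm (L.restrictScalars ℝ) (hk.smul f.continuous_chord)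

/-- The Cauchy projection on Hölder functions. -/
noncomputable def HSp.cauchyL : HSp (chordHolder a) E →L[ℝ] HSp (chordHolder a) E :=
  LinearMap.mkContinuous
    { toFun := fun f => HSp.mk (fun θ => cauchyExt f (circ θ))
        ⟨_, fun θ => norm_cauchyExt_le f (circ_mem_closedBall θ)⟩
        ⟨_, fun x y => by
          rw [abs_of_nonneg (chordHolder_nonneg a x y)]
          exact norm_cauchyExt_sub_le f (circ_mem_closedBall x) (circ_mem_closedBall y)⟩
      map_add' := fun f g => by
        ext θ
        exact cauchyExt_add f g (circ_mem_closedBall θ)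
      map_smul' := fun c f => by
        ext θ
        exact cauchyExt_map (c • (1 : E →L[ℂ] E)) f (circ_mem_closedBall θ) }
    (1 + privalovConst a) fun f => by
    have hp := privalovConst_nonneg ha
    refine HSp.norm_le (by positivity) (fun θ => norm_cauchyExt_le f (circ_mem_closedBall θ))
      fun x y => ?_
    refine (norm_cauchyExt_sub_le f (circ_mem_closedBall x) (circ_mem_closedBall y)).trans ?_
    refine mul_le_mul_of_nonneg_right ?_ (chordHolder_nonneg a x y)
    linarith [norm_nonneg f]

theorem HSp.cauchyL_apply (f : HSp (chordHolder a) E) (θ : ℝ) :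
    HSp.cauchyL f θ = cauchyExt f (circ θ) := rfl

end CauchyIntegral

/-! ### Boundary values: Poisson kernel and Plemelj formula -/

section Plemelj

variable {a : ℝ} [ha : HExp a]

/-- Complex conjugation of Hölder functions. -/
noncomputable def HSp.conj (f : HSp (chordHolder a) ℂ) : HSp (chordHolder a) ℂ :=
  HSp.map (Complex.conjCLE : ℂ →L[ℝ] ℂ) f

@[simp] theorem HSp.conj_apply (f : HSp (chordHolder a) ℂ) (θ : ℝ) :
    HSp.conj f θ = (starRingEnd ℂ) (f θ) := rfl

/-- The right-hand side is the Poisson kernel, so boundary values can be recovered from Cauchy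
integrals of f and of its conjugate. -/
theorem kernel_add_conj {τ : ℂ} (hτ : ‖τ‖ < 1) (θ : ℝ) :
    circ θ / (circ θ - τ) + (starRingEnd ℂ) (circ θ / (circ θ - τ)) - 1 =
      ((1 - ‖τ‖ ^ 2) * (‖circ θ - τ‖ ^ 2)⁻¹ : ℝ) := by
  have h0 := circ_sub_ne_zero hτ θ
  have h1 : (starRingEnd ℂ) (circ θ - τ) ≠ 0 := (map_ne_zero _).2 h0
  have h2 : circ θ * (starRingEnd ℂ) (circ θ) = 1 := by
    rw [Complex.mul_conj, Complex.normSq_eq_norm_sq, norm_circ]; simp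
  have h3 : ((‖τ‖ ^ 2 : ℝ) : ℂ) = τ * (starRingEnd ℂ) τ := by
    rw [Complex.mul_conj, Complex.normSq_eq_norm_sq]
  have h4 : ((‖circ θ - τ‖ ^ 2 : ℝ) : ℂ) = (circ θ - τ) * (starRingEnd ℂ) (circ θ - τ) := by
    rw [Complex.mul_conj, Complex.normSq_eq_norm_sq]
  rw [Complex.ofReal_mul, Complex.ofReal_inv, h4, Complex.ofReal_sub, h3, map_div₀]
  field_simp
  rw [Complex.ofReal_one, map_sub]
  linear_combination h2

theorem avg_conj {f : ℝ → ℂ} (hf : Continuous f) :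
    avg (fun θ => (starRingEnd ℂ) (f θ)) = (starRingEnd ℂ) (avg f) :=
  avg_clm (Complex.conjCLE : ℂ →L[ℝ] ℂ) hf

/-- The Poisson integral, expressed by Cauchy integrals. -/
theorem cauchy_add_conj {f : ℝ → ℂ} (hf : Continuous f) {τ : ℂ} (hτ : ‖τ‖ < 1) :
    cauchy f τ + (starRingEnd ℂ) (cauchy (fun θ => (starRingEnd ℂ) (f θ)) τ) - avg f =
      avg fun θ => (((1 - ‖τ‖ ^ 2) * (‖circ θ - τ‖ ^ 2)⁻¹ : ℝ) : ℂ) * f θ := by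
  have hk := continuous_kernel hτ
  have hk' : Continuous fun θ => (starRingEnd ℂ) (circ θ / (circ θ - τ)) :=
    Complex.continuous_conj.comp hk
  have c1 : Continuous fun θ => (circ θ / (circ θ - τ)) * f θ := hk.mul hf
  have c2 : Continuous fun θ => (starRingEnd ℂ) (circ θ / (circ θ - τ)) * f θ := hk'.mul hf
  have c3 : Continuous fun θ => (circ θ / (circ θ - τ)) * (starRingEnd ℂ) (f θ) :=
    hk.mul (Complex.continuous_conj.comp hf)
  have e1 : (starRingEnd ℂ) (cauchy (fun θ => (starRingEnd ℂ) (f θ)) τ) =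
      avg fun θ => (starRingEnd ℂ) (circ θ / (circ θ - τ)) * f θ := by
    simp only [cauchy, smul_eq_mul]
    rw [← avg_conj c3]
    simp only [map_mul, Complex.conj_conj]
  rw [e1]
  simp only [cauchy, smul_eq_mul]
  have c4 : Continuous fun θ => (circ θ / (circ θ - τ)) * f θ +
      (starRingEnd ℂ) (circ θ / (circ θ - τ)) * f θ := c1.add c2
  rw [← avg_add c1 c2, ← avg_sub c4 hf]
  congr 1
  funext θ
  rw [← kernel_add_conj hτ]
  ring

/-- The Poisson kernel has mean one, which brings in the oscillation of f, and it carries a factor 1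
- |τ|², which raises the exponent a - 1 of the kernel estimate to a. -/
theorem norm_poisson_sub_le (f : HSp (chordHolder a) ℂ) {τ : ℂ} (hτ : ‖τ‖ < 1) {φ : ℝ}
    (hφ : τ = ‖τ‖ * circ φ) :
    ‖cauchy f τ + (starRingEnd ℂ) (cauchy (HSp.conj f) τ) - avg f - f φ‖ ≤
      16 * ‖f‖ / (1 - a) * (1 - ‖τ‖) ^ a := by
  have hf := f.continuous_chord
  have ha1 : 0 < 1 - a := by linarith [ha.out.2]
  have hρ : 0 < 1 - ‖τ‖ := by linarith
  have h1 := cauchy_add_conj hf hτ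
  have h2 := cauchy_add_conj (continuous_const (y := f φ)) hτ
  rw [cauchy_const _ hτ, cauchy_const _ hτ, avg_const, Complex.conj_conj, add_sub_cancel_right] at h2
  have hn : ‖τ‖ ^ 2 ≤ 1 := by nlinarith [norm_nonneg τ]
  have hk : Continuous fun θ => (((1 - ‖τ‖ ^ 2) * (‖circ θ - τ‖ ^ 2)⁻¹ : ℝ) : ℂ) := by
    refine Complex.continuous_ofReal.comp (continuous_const.mul ?_)
    exact ((continuous_circ.sub continuous_const).norm.pow 2).inv₀
      fun θ => pow_ne_zero 2 (norm_ne_zero_iff.2 (circ_sub_ne_zero hτ θ))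
  have h3 := norm_avg_smul_le ha hf (norm_nonneg f)
    (fun x y => f.norm_sub_le (chordHolder_nonneg a x y)) hτ hφ hk (sub_nonneg.2 hn) (fun θ => by
      rw [Complex.norm_real, Real.norm_of_nonneg (by
        have := sub_nonneg.2 hn
        positivity)])
  have c1 : Continuous fun θ => (((1 - ‖τ‖ ^ 2) * (‖circ θ - τ‖ ^ 2)⁻¹ : ℝ) : ℂ) * f θ := hk.mul hf
  have c2 : Continuous fun θ => (((1 - ‖τ‖ ^ 2) * (‖circ θ - τ‖ ^ 2)⁻¹ : ℝ) : ℂ) * f φ :=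
    hk.mul continuous_const
  have e : cauchy f τ + (starRingEnd ℂ) (cauchy (HSp.conj f) τ) - avg f - f φ =
      avg fun θ => (((1 - ‖τ‖ ^ 2) * (‖circ θ - τ‖ ^ 2)⁻¹ : ℝ) : ℂ) • (f θ - f φ) := by
    simp only [smul_eq_mul, mul_sub]
    rw [avg_sub c1 c2, ← h2]
    exact congrArg (· - f φ) h1
  rw [e]
  refine h3.trans ?_
  have h4 : 1 - ‖τ‖ ^ 2 ≤ 2 * (1 - ‖τ‖) := by nlinarith [norm_nonneg τ]
  calc 8 * ‖f‖ / (1 - a) * (1 - ‖τ‖ ^ 2) * (1 - ‖τ‖) ^ (a - 1)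
      ≤ 8 * ‖f‖ / (1 - a) * (2 * (1 - ‖τ‖)) * (1 - ‖τ‖) ^ (a - 1) := by gcongr
    _ = 16 * ‖f‖ / (1 - a) * ((1 - ‖τ‖) ^ (a - 1) * (1 - ‖τ‖)) := by ring
    _ = _ := by rw [← Real.rpow_add_one hρ.ne', sub_add_cancel]

/-- Radial approach to a boundary point. -/
theorem tendsto_radial {F : Type} [TopologicalSpace F] {u : ℂ → F}
    (hu : ContinuousOn u (closedBall 0 1)) (φ : ℝ) :
    Tendsto (fun r : ℝ => u (r * circ φ)) (𝓝[<] 1) (𝓝 (u (circ φ))) := by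
  have h1 : ContinuousWithinAt u (closedBall 0 1) (((1 : ℝ) : ℂ) * circ φ) := hu _ (by simp)
  have h2 : Tendsto (fun r : ℝ => (r : ℂ) * circ φ) (𝓝[<] 1)
      (𝓝[closedBall 0 1] (((1 : ℝ) : ℂ) * circ φ)) := by
    refine tendsto_nhdsWithin_iff.2 ⟨?_, ?_⟩
    · exact ((Complex.continuous_ofReal.mul continuous_const).tendsto 1).mono_left
        nhdsWithin_le_nhds
    · filter_upwards [Ioo_mem_nhdsLT (show (0 : ℝ) < 1 by norm_num)] with r hr
      rw [mem_closedBall_zero_iff, norm_mul, norm_circ, mul_one, Complex.norm_real,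
        Real.norm_of_nonneg hr.1.le]
      exact hr.2.le
  have h3 := h1.tendsto.comp h2
  rw [Complex.ofReal_one, one_mul] at h3
  exact h3

/-- The Plemelj formula. -/
theorem plemelj (f : HSp (chordHolder a) ℂ) (φ : ℝ) :
    f φ = cauchyExt f (circ φ) + (starRingEnd ℂ) (cauchyExt (HSp.conj f) (circ φ)) - avg f := by
  have hc : ContinuousOn (fun τ => cauchyExt f τ + (starRingEnd ℂ) (cauchyExt (HSp.conj f) τ) -
      avg f - f φ) (closedBall 0 1) :=
    (((continuousOn_cauchyExt f).add (Complex.continuous_conj.comp_continuousOn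
      (continuousOn_cauchyExt (HSp.conj f)))).sub continuousOn_const).sub continuousOn_const
  have h1 := tendsto_radial hc φ
  have h2 : Tendsto (fun r : ℝ => 16 * ‖f‖ / (1 - a) * (1 - r) ^ a) (𝓝[<] 1) (𝓝 0) := by
    have : Continuous fun r : ℝ => 16 * ‖f‖ / (1 - a) * (1 - r) ^ a :=
      continuous_const.mul ((continuous_const.sub continuous_id).rpow_const
        fun _ => Or.inr ha.out.1.le)
    have h := this.tendsto 1
    simp only [sub_self, Real.zero_rpow ha.out.1.ne', mul_zero] at h
    exact h.mono_left nhdsWithin_le_nhds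
  -- The same expression tends along the radius to its boundary value and, by the Poisson estimate,
  -- to 0.
  have h3 := tendsto_nhds_unique h1 (squeeze_zero_norm' ?_ h2)
  · linear_combination -h3
  · filter_upwards [Ioo_mem_nhdsLT (show (0 : ℝ) < 1 by norm_num)] with r hr
    have hn : ‖(r : ℂ) * circ φ‖ = r := by
      rw [norm_mul, norm_circ, mul_one, Complex.norm_real, Real.norm_of_nonneg hr.1.le]
    have hb : (r : ℂ) * circ φ ∈ ball (0 : ℂ) 1 := by
      rw [mem_ball_zero_iff, hn]; exact hr.2
    have := norm_poisson_sub_le f (τ := (r : ℂ) * circ φ) (by rw [hn]; exact hr.2) (φ := φ)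
      (by rw [hn])
    rw [hn] at this
    rwa [cauchyExt_of_mem f.continuous_chord hb, cauchyExt_of_mem (HSp.conj f).continuous_chord hb]

variable {E : Type} [NormedAddCommGroup E] [NormedSpace ℂ E] [CompleteSpace E]

/-- The Cauchy integral of `ζ f`. -/
theorem cauchyExt_circ_mul (f g : HSp (chordHolder a) E) (h : ∀ θ, g θ = circ θ • f θ) {τ : ℂ}
    (hτ : τ ∈ closedBall (0 : ℂ) 1) : cauchyExt g τ = avg g + τ • cauchyExt f τ := by
  refine eqOn_closedBall (continuousOn_cauchyExt g)
    (continuousOn_const.add (continuousOn_id.smul (continuousOn_cauchyExt f))) (fun τ hτ => ?_) τ hτ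
  have hτ' := mem_ball_zero_iff.1 hτ
  have hk := continuous_kernel hτ'
  have hf := f.continuous_chord
  rw [Pi.add_apply, Pi.smul_apply', id, cauchyExt_of_mem g.continuous_chord hτ,
    cauchyExt_of_mem hf hτ]
  have c1 : Continuous fun θ => (circ θ / (circ θ - τ)) • f θ := hk.smul hf
  have e1 : τ • cauchy f τ = avg fun θ => τ • (circ θ / (circ θ - τ)) • f θ :=
    (avg_clm ((τ • (1 : E →L[ℂ] E)).restrictScalars ℝ) c1).symm
  have c2 : Continuous fun θ => τ • (circ θ / (circ θ - τ)) • f θ := c1.const_smul τ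
  rw [e1, ← avg_add g.continuous_chord c2, cauchy]
  congr 1
  funext θ
  have h0 := circ_sub_ne_zero hτ' θ
  simp only [h, smul_smul, ← add_smul]
  congr 1
  field_simp
  ring

theorem circ_mul_conj (θ : ℝ) : circ θ * (starRingEnd ℂ) (circ θ) = 1 := by
  rw [Complex.mul_conj, Complex.normSq_eq_norm_sq, norm_circ]; simp

/-- If `(1 - ζ) f` is real, then it is twice the real part of `1 - ζ` times the Cauchy integral. -/
theorem one_sub_mul_eq (f : HSp (chordHolder a) ℂ)
    (h : ∀ θ, (starRingEnd ℂ) (f θ) = -(circ θ * f θ)) (φ : ℝ) :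
    (1 - circ φ) * f φ = (2 * ((1 - circ φ) * cauchyExt f (circ φ)).re : ℝ) := by
  -- The hypothesis reads ζf = -conj f, so the formula for the Cauchy integral of ζf expresses that
  -- of conj f through that of f; the Plemelj formula then contains f only.
  have h1 := cauchyExt_circ_mul f (-HSp.conj f) (fun θ => by
    rw [← zero_sub, HSp.sub_apply, HSp.zero_apply, HSp.conj_apply, h, zero_sub, neg_neg,
      smul_eq_mul]) (circ_mem_closedBall φ)
  have h2 : cauchyExt (-HSp.conj f : HSp (chordHolder a) ℂ) (circ φ) =
      -cauchyExt (HSp.conj f) (circ φ) := by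
    rw [← HSp.cauchyL_apply, ← HSp.cauchyL_apply, map_neg, ← zero_sub, HSp.sub_apply,
      HSp.zero_apply, zero_sub]
  have h3 : avg (-HSp.conj f : HSp (chordHolder a) ℂ) = -(starRingEnd ℂ) (avg f) := by
    rw [← avg_conj f.continuous_chord]
    have := avg_clm (-1 : ℂ →L[ℝ] ℂ) (HSp.conj f).continuous_chord
    simp only [neg_apply, one_apply_eq_self] at this
    exact this
  rw [h2, h3] at h1
  have h4 := plemelj f φ
  have h5 : cauchyExt (HSp.conj f) (circ φ) =
      (starRingEnd ℂ) (avg f) - circ φ * cauchyExt f (circ φ) := by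
    rw [smul_eq_mul] at h1
    linear_combination -h1
  rw [h5, map_sub, Complex.conj_conj, map_mul] at h4
  have h6 := circ_mul_conj φ
  have h7 : ((2 * ((1 - circ φ) * cauchyExt f (circ φ)).re : ℝ) : ℂ) =
      (1 - circ φ) * cauchyExt f (circ φ) +
        (starRingEnd ℂ) ((1 - circ φ) * cauchyExt f (circ φ)) := by
    rw [Complex.add_conj]
  rw [h7, h4, map_mul, map_sub, map_one]
  linear_combination (starRingEnd ℂ) (cauchyExt f (circ φ)) * h6

end Plemelj

/-! ### From F^{2,a} to the Hölder space of the circle -/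

section ToHolder

variable {E : Type} [NormedAddCommGroup E] [NormedSpace ℝ E] {a : ℝ}

/-- Periodic Hölder functions are Hölder with respect to the chordal distance. -/
theorem norm_sub_le_chordHolder (ha : HExp a) {f : ℝ → E} {N : ℝ} (hN : 0 ≤ N)
    (hper : Function.Periodic f (2 * Real.pi)) (h : ∀ x y, ‖f x - f y‖ ≤ N * |x - y| ^ a) (x y : ℝ) :
    ‖f x - f y‖ ≤ 2 * N * chordHolder a x y := by
  have hpi := Real.pi_pos
  obtain ⟨z, hz, hfz⟩ : ∃ z, |z - y| ≤ Real.pi ∧ f x = f z ∧ circ x = circ z := by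
    have hp : Function.Periodic (fun t => (f t, circ t)) (2 * Real.pi) := fun t => by
      simp only [hper t, circ_periodic t]
    obtain ⟨z, hz, hxz⟩ := hp.exists_mem_Ico (by positivity) x (y - Real.pi)
    exact ⟨z, abs_le.2 ⟨by linarith [hz.1], by linarith [hz.2]⟩, congrArg Prod.fst hxz,
      congrArg Prod.snd hxz⟩
  rw [chordHolder, hfz.1, hfz.2]
  refine (h z y).trans ?_
  have h1 : |z - y| ≤ 2 * ‖circ z - circ y‖ := by
    have h2 := le_norm_circ_sub_circ hz
    have h3 : 1 ≤ 4 / Real.pi := by rw [le_div_iff₀ hpi]; linarith [Real.pi_le_four]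
    have h4 : 4 / Real.pi * |z - y| = 2 * (2 / Real.pi * |z - y|) := by ring
    nlinarith [abs_nonneg (z - y)]
  calc N * |z - y| ^ a ≤ N * (2 * ‖circ z - circ y‖) ^ a := by
        refine mul_le_mul_of_nonneg_left ?_ hN
        exact Real.rpow_le_rpow (abs_nonneg _) h1 ha.out.1.le
    _ = N * (2 ^ a * ‖circ z - circ y‖ ^ a) := by rw [Real.mul_rpow zero_le_two (norm_nonneg _)]
    _ ≤ N * (2 ^ (1 : ℝ) * ‖circ z - circ y‖ ^ a) := by
        gcongr
        · exact one_le_two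
        · exact ha.out.2.le
    _ = _ := by rw [Real.rpow_one]; ring

/-- The inclusion of `F^{2,a}` in the chordal Hölder space. -/
noncomputable def FSp.toHSp [ha : HExp a] : FSp a E →L[ℝ] HSp (chordHolder a) E :=
  LinearMap.mkContinuous
    { toFun := fun f => HSp.mk f ⟨_, f.norm_apply_le⟩ ⟨_, fun x y => by
        rw [abs_of_nonneg (chordHolder_nonneg a x y)]
        exact norm_sub_le_chordHolder ha (norm_nonneg f) f.periodic f.norm_sub_le x y⟩
      map_add' := fun _ _ => rfl
      map_smul' := fun _ _ => rfl } 2 fun f =>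
    HSp.norm_le (by positivity) (fun x => (f.norm_apply_le x).trans (by linarith [norm_nonneg f]))
      fun x y => norm_sub_le_chordHolder ha (norm_nonneg f) f.periodic f.norm_sub_le x y

@[simp] theorem FSp.toHSp_apply [HExp a] (f : FSp a E) (x : ℝ) : FSp.toHSp f x = f x := rfl

end ToHolder

/-! ### The weighted derivative (ζ - 1) d/dζ and its commutation with the Cauchy integral -/

section WeightedDerivative

variable {E : Type} [NormedAddCommGroup E] [NormedSpace ℂ E] {a : ℝ}

/-- Multiplication of a Hölder function with a bounded Lipschitz function. -/
theorem smul_mem_holderSubmodule (ha : HExp a) {m : ℝ → ℂ} {A L : ℝ} (hA : ∀ x, ‖m x‖ ≤ A)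
    (hL : ∀ x y, ‖m x - m y‖ ≤ L * |x - y|) {f : ℝ → E}
    (hf : f ∈ holderSubmodule (absWeight a) E) :
    (fun θ => m θ • f θ) ∈ holderSubmodule (absWeight a) E := by
  obtain ⟨⟨B, hB⟩, C, hC⟩ := hf
  have hA0 : 0 ≤ A := (norm_nonneg _).trans (hA 0)
  have hB0 : 0 ≤ B := (norm_nonneg _).trans (hB 0)
  have hL0 : 0 ≤ L := by
    have := (norm_nonneg _).trans (hL 1 0)
    simpa using this
  refine ⟨⟨A * B, fun x => ?_⟩, A * C + (2 * A + L) * B, fun x y => ?_⟩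
  · rw [norm_smul]; exact mul_le_mul (hA x) (hB x) (norm_nonneg _) hA0
  · have hC' := hC x y
    rw [abs_of_nonneg (absWeight_nonneg x y)] at hC' ⊢
    have h1 : m x • f x - m y • f y = m x • (f x - f y) + (m x - m y) • f y := by
      rw [smul_sub, sub_smul]; abel
    have h2 : ‖m x - m y‖ ≤ (2 * A + L) * absWeight a x y := by
      have h0 := absWeight_nonneg (a := a) x y
      rcases le_or_gt |x - y| 1 with h | h
      · have h3 : |x - y| ≤ absWeight a x y := by
          have := Real.rpow_le_rpow_of_exponent_ge' (abs_nonneg (x - y)) h ha.out.1.le ha.out.2.le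
          rwa [Real.rpow_one] at this
        have h4 := hL x y
        nlinarith
      · have h3 : 1 ≤ absWeight a x y := Real.one_le_rpow h.le ha.out.1.le
        have h4 : ‖m x - m y‖ ≤ 2 * A := (norm_sub_le _ _).trans (by linarith [hA x, hA y])
        nlinarith
    rw [h1]
    refine (norm_add_le _ _).trans ?_
    rw [norm_smul, norm_smul, add_mul]
    refine add_le_add ?_ ?_
    · rw [mul_assoc]
      exact mul_le_mul (hA x) hC' (norm_nonneg _) hA0
    · calc ‖m x - m y‖ * ‖f y‖ ≤ (2 * A + L) * absWeight a x y * B :=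
            mul_le_mul h2 (hB y) (norm_nonneg _)
              (mul_nonneg (by positivity) (absWeight_nonneg x y))
        _ = _ := by ring

/-- Multiplication with a smooth function of the half angle. -/
theorem circ_smul_mem (ha : HExp a) (c : ℝ) {f : ℝ → E}
    (hf : f ∈ holderSubmodule (absWeight a) E) :
    (fun θ => circ (c * θ) • f θ) ∈ holderSubmodule (absWeight a) E := by
  refine smul_mem_holderSubmodule ha (A := 1) (L := |c|) (fun x => (norm_circ _).le) (fun x y => ?_) hf
  refine (norm_circ_sub_circ_le _ _).trans_eq ?_
  rw [← mul_sub, abs_mul]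

theorem chordWeight_eq_circ (θ : ℝ) :
    (chordWeight θ : ℂ) = -Complex.I * (circ (1 / 2 * θ) - circ (-(1 / 2) * θ)) := by
  have h1 : circ (1 / 2 * θ) * circ (-(1 / 2) * θ) = 1 := by rw [← circ_add]; simp
  have h := circ_sub_one θ
  have h2 : circ θ = circ (1 / 2 * θ) * circ (1 / 2 * θ) := by rw [← circ_add]; congr 1; ring
  rw [h2, show θ / 2 = 1 / 2 * θ by ring] at h
  have h3 := circ_ne_zero (1 / 2 * θ)
  refine mul_left_cancel₀ h3 ?_
  linear_combination Complex.I * h - Complex.I * h1 +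
    circ (1 / 2 * θ) * (chordWeight θ : ℂ) * Complex.I_mul_I

/-- The relation `v = V g` between a function and its weighted derivative. -/
def WeightedDeriv (g v : ℝ → E) : Prop :=
  ∀ θ ∈ awayFromOne, HasDerivAt g ((circ (1 / 2 * θ) / (chordWeight θ : ℂ)) • v θ) θ

theorem Ioo_subset_awayFromOne {θ : ℝ} (h : θ ∈ Ioo 0 (2 * Real.pi)) : θ ∈ awayFromOne := by
  have hpi := Real.pi_pos
  intro n hn
  rw [hn] at h
  have h1 : (0 : ℝ) < n := by
    by_contra hc; push Not at hc; nlinarith [h.1]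
  have h2 : (n : ℝ) < 1 := by
    by_contra hc; push Not at hc; nlinarith [h.2]
  have h1' : (0 : ℤ) < n := by exact_mod_cast h1
  have h2' : n < (1 : ℤ) := by exact_mod_cast h2
  omega

theorem circ_eq_sq (θ : ℝ) : circ θ = circ (1 / 2 * θ) * circ (1 / 2 * θ) := by
  rw [← circ_add]; congr 1; ring

variable [CompleteSpace E] [ha : HExp a]

/-- Differentiation of the Cauchy integral in terms of the weighted derivative. -/
theorem WeightedDeriv.deriv_cauchy {g v : ℝ → E} (h : WeightedDeriv g v)
    (hg : Continuous g) (hv : Continuous v) {τ : ℂ}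
    (hτ : ‖τ‖ < 1) :
    (1 - τ) • (avg fun θ => (circ θ / (circ θ - τ) ^ 2) • g θ) = -cauchy v τ := by
  have hpi := Real.pi_pos
  -- This primitive of (1 - τ)ζ/(ζ - τ)² vanishes at ζ = 1. In the integration by parts it removes
  -- the boundary terms and compensates the singularity of g' at both ends of the period.
  set M : ℝ → ℂ := fun θ => -Complex.I * (circ θ - 1) / (circ θ - τ) with hM
  have hMd : ∀ θ, HasDerivAt M ((1 - τ) * (circ θ / (circ θ - τ) ^ 2)) θ := by
    intro θ
    have h0 := circ_sub_ne_zero hτ θ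
    have h1 := (((hasDerivAt_circ θ).sub_const 1).const_mul (-Complex.I)).div
      ((hasDerivAt_circ θ).sub_const τ) h0
    refine h1.congr_deriv ?_
    field_simp
    linear_combination (-(circ θ * (1 - τ))) * Complex.I_sq
  have hMc : Continuous M := continuous_iff_continuousAt.2 fun θ => (hMd θ).continuousAt
  have c1 : Continuous fun θ => (circ θ / (circ θ - τ) ^ 2) • g θ := (continuous_kernel_sq hτ).smul hg
  have c1' : Continuous fun θ => (1 - τ) • (circ θ / (circ θ - τ) ^ 2) • g θ := c1.const_smul _
  have c2 : Continuous fun θ => (circ θ / (circ θ - τ)) • v θ := (continuous_kernel hτ).smul hv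
  have c3 : Continuous fun θ => (1 - τ) • (circ θ / (circ θ - τ) ^ 2) • g θ +
      (circ θ / (circ θ - τ)) • v θ := c1'.add c2
  have key := intervalIntegral.integral_eq_sub_of_hasDerivAt_of_le (a := 0) (b := 2 * Real.pi)
    (f := fun θ => M θ • g θ) (f' := fun θ => (1 - τ) • (circ θ / (circ θ - τ) ^ 2) • g θ +
      (circ θ / (circ θ - τ)) • v θ) (by positivity) (hMc.smul hg).continuousOn (fun θ hθ => by
        have hθ' := Ioo_subset_awayFromOne hθ
        refine ((hMd θ).smul (h θ hθ')).congr_deriv ?_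
        have h0 := circ_sub_ne_zero hτ θ
        have hs : (chordWeight θ : ℂ) ≠ 0 := Complex.ofReal_ne_zero.2 (chordWeight_ne_zero hθ')
        rw [smul_smul, smul_smul, add_comm]
        congr 2
        have h2 := circ_sub_one θ
        rw [show θ / 2 = 1 / 2 * θ by ring] at h2
        rw [hM]
        dsimp only
        rw [h2, circ_eq_sq θ]
        rw [circ_eq_sq θ, ← sq] at h0
        generalize circ (1 / 2 * θ) = p at *
        field_simp
        linear_combination (-(p ^ 2)) * Complex.I_sq) (c3.intervalIntegrable _ _)
  have h1 : circ (2 * Real.pi) = 1 := by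
    have := circ_periodic 0
    rwa [zero_add, circ_zero] at this
  have h2 : M 0 = 0 := by simp [hM]
  have h3 : M (2 * Real.pi) = 0 := by simp [hM, h1]
  simp only [h2, h3, zero_smul, sub_zero] at key
  have h4 : avg (fun θ => (1 - τ) • (circ θ / (circ θ - τ) ^ 2) • g θ +
      (circ θ / (circ θ - τ)) • v θ) = 0 := by
    rw [avg, key, smul_zero]
  rw [avg_add c1' c2] at h4
  have h5 := avg_clm (((1 - τ) • (1 : E →L[ℂ] E)).restrictScalars ℝ) c1
  rw [← cauchy] at h4
  rw [← add_eq_zero_iff_eq_neg, ← h4]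
  congr 1
  exact h5.symm

theorem hasDerivAt_cauchyExt {g v : HSp (chordHolder a) E} (h : WeightedDeriv g v) {τ : ℂ}
    (hτ : τ ∈ ball (0 : ℂ) 1) :
    HasDerivAt (cauchyExt g) ((-(1 - τ)⁻¹) • cauchyExt v τ) τ := by
  have hτ' := mem_ball_zero_iff.1 hτ
  have h1 := hasDerivAt_cauchy g.continuous_chord hτ'
  have h2 := h.deriv_cauchy g.continuous_chord v.continuous_chord hτ'
  have h0 : 1 - τ ≠ 0 := by
    have := circ_sub_ne_zero hτ' 0
    rwa [circ_zero] at this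
  rw [cauchyExt_of_mem v.continuous_chord hτ, neg_smul, ← smul_neg, ← h2, inv_smul_smul₀ h0]
  refine h1.congr_of_eventuallyEq ?_
  filter_upwards [isOpen_ball.mem_nhds hτ] with x hx
  exact cauchyExt_of_mem g.continuous_chord hx

/-- On the radius the Cauchy integral of v is -(1 - r) times the derivative of that of g, which is
O((1 - r)^(a - 1)). So the weighted derivatives of a Cauchy projection vanish at 1, as membership in
F^{2,a} will require. -/
theorem WeightedDeriv.cauchyExt_one {g v : HSp (chordHolder a) E} (h : WeightedDeriv g v) :
    cauchyExt v 1 = 0 := by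
  have ha1 : 0 < 1 - a := by linarith [ha.out.2]
  have h1 := tendsto_radial (continuousOn_cauchyExt v) 0
  simp only [circ_zero, mul_one] at h1
  have h2 : Tendsto (fun r : ℝ => 8 * ‖g‖ / (1 - a) * (1 - r) ^ a) (𝓝[<] 1) (𝓝 0) := by
    have : Continuous fun r : ℝ => 8 * ‖g‖ / (1 - a) * (1 - r) ^ a :=
      continuous_const.mul ((continuous_const.sub continuous_id).rpow_const
        fun _ => Or.inr ha.out.1.le)
    have h := this.tendsto 1
    simp only [sub_self, Real.zero_rpow ha.out.1.ne', mul_zero] at h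
    exact h.mono_left nhdsWithin_le_nhds
  refine tendsto_nhds_unique h1 (squeeze_zero_norm' ?_ h2)
  filter_upwards [Ioo_mem_nhdsLT (show (0 : ℝ) < 1 by norm_num)] with r hr
  have hn : ‖(r : ℂ)‖ = r := by rw [Complex.norm_real, Real.norm_of_nonneg hr.1.le]
  have hr1 : ‖(r : ℂ)‖ < 1 := by rw [hn]; exact hr.2
  have h3 := h.deriv_cauchy g.continuous_chord v.continuous_chord hr1
  have h4 := norm_deriv_cauchy_le ha g.continuous_chord (norm_nonneg g)
    (fun x y => g.norm_sub_le (chordHolder_nonneg a x y)) hr1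
  rw [cauchyExt_of_mem v.continuous_chord (mem_ball_zero_iff.2 hr1), ← norm_neg, ← h3, norm_smul]
  rw [hn] at h4
  have h5 : ‖1 - (r : ℂ)‖ = 1 - r := by
    rw [← Complex.ofReal_one, ← Complex.ofReal_sub, Complex.norm_real,
      Real.norm_of_nonneg (by linarith [hr.2])]
  have h6 : 0 < 1 - r := by linarith [hr.2]
  rw [h5]
  calc (1 - r) * ‖avg fun θ => (circ θ / (circ θ - (r : ℂ)) ^ 2) • g θ‖
      ≤ (1 - r) * (8 * ‖g‖ / (1 - a) * (1 - r) ^ (a - 1)) := by gcongr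
    _ = 8 * ‖g‖ / (1 - a) * ((1 - r) ^ (a - 1) * (1 - r)) := by ring
    _ = _ := by rw [← Real.rpow_add_one h6.ne', sub_add_cancel]

/-- The Cauchy projection commutes with the weighted derivative. -/
theorem WeightedDeriv.cauchyL {g v : HSp (chordHolder a) E} (h : WeightedDeriv g v) :
    WeightedDeriv (HSp.cauchyL g) (HSp.cauchyL v) := by
  intro θ hθ
  have hne : circ θ ≠ 1 := fun h => circ_eq_one_iff.1 h hθ
  have h1 : (1 : ℂ) - circ θ ≠ 0 := sub_ne_zero.2 hne.symm
  set D : ℂ → E := fun y => (-(1 - y)⁻¹) • cauchyExt v y with hD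
  set J : E → (ℂ →L[ℝ] E) := fun c =>
    ContinuousLinearMap.restrictScalarsL ℂ ℂ E ℝ ℝ (ContinuousLinearMap.smulRightL ℂ ℂ E 1 c) with hJ
  have hJc : Continuous J := (ContinuousLinearMap.restrictScalarsL ℂ ℂ E ℝ ℝ).continuous.comp
    (ContinuousLinearMap.smulRightL ℂ ℂ E 1).continuous
  have hJa : ∀ c z, J c z = z • c := fun c z => rfl
  have hfd : ∀ y ∈ ball (0 : ℂ) 1, HasFDerivAt (cauchyExt g) (J (D y)) y := by
    intro y hy
    have h2 := (hasDerivAt_cauchyExt h hy).hasFDerivAt.restrictScalars ℝ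
    refine h2.congr_fderiv ?_
    ext
    rfl
  have hDc : Tendsto D (𝓝[ball 0 1] (circ θ)) (𝓝 (D (circ θ))) := by
    have hv : Tendsto (cauchyExt v) (𝓝[ball 0 1] (circ θ)) (𝓝 (cauchyExt v (circ θ))) :=
      ((continuousOn_cauchyExt v) _ (circ_mem_closedBall θ)).tendsto.mono_left
        (nhdsWithin_mono _ ball_subset_closedBall)
    have hq : ContinuousAt (fun y : ℂ => -(1 - y)⁻¹) (circ θ) :=
      ((continuousAt_const.sub continuousAt_id).inv₀ h1).neg
    exact (hq.tendsto.mono_left nhdsWithin_le_nhds).smul hv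
  have hcl : closure (ball (0 : ℂ) 1) = closedBall 0 1 := closure_ball (0 : ℂ) one_ne_zero
  -- The complex derivative inside the disc has a limit at every boundary point other than 1, so the
  -- Cauchy integral is differentiable there within the closed disc and can be differentiated along
  -- the circle.
  have h3 : HasFDerivWithinAt (cauchyExt g) (J (D (circ θ))) (closure (ball (0 : ℂ) 1)) (circ θ) := by
    refine hasFDerivWithinAt_closure_of_tendsto_fderiv
      (fun y hy => (hfd y hy).differentiableAt.differentiableWithinAt) (convex_ball _ _) isOpen_ball
      (fun y hy => ?_) ?_
    · rw [hcl] at hy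
      exact ((continuousOn_cauchyExt g) y hy).mono ball_subset_closedBall
    · refine (hJc.continuousAt.tendsto.comp hDc).congr' ?_
      filter_upwards [self_mem_nhdsWithin] with y hy
      exact (hfd y hy).fderiv.symm
  rw [hcl] at h3
  have h4 := h3.comp_hasDerivAt θ (hasDerivAt_circ θ)
    (Eventually.of_forall fun t => circ_mem_closedBall t)
  refine h4.congr_deriv ?_
  rw [hJa, hD]
  dsimp only
  rw [smul_smul, HSp.cauchyL_apply]
  congr 1
  have hs : (chordWeight θ : ℂ) ≠ 0 := Complex.ofReal_ne_zero.2 (chordWeight_ne_zero hθ)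
  have h2 := circ_sub_one θ
  rw [show θ / 2 = 1 / 2 * θ by ring] at h2
  have h5 : (1 : ℂ) - circ θ = -(Complex.I * circ (1 / 2 * θ) * chordWeight θ) := by
    rw [← h2]; ring
  have h6 := circ_ne_zero (1 / 2 * θ)
  rw [h5, circ_eq_sq θ]
  field_simp

end WeightedDerivative

/-! ### The Cauchy projection on F^{2,a} -/

section CauchyF

variable {E : Type} [NormedAddCommGroup E] [NormedSpace ℂ E] {a : ℝ} [ha : HExp a]

/-- A periodic Hölder function on the line as a Hölder function on the circle. -/
noncomputable def HSp.ofPeriodic (f : ℝ → E) (hf : f ∈ holderSubmodule (absWeight a) E)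
    (hper : Function.Periodic f (2 * Real.pi)) : HSp (chordHolder a) E :=
  HSp.mk f hf.1 (by
    obtain ⟨_, C, hC⟩ := hf
    refine ⟨2 * |C|, fun x y => ?_⟩
    rw [abs_of_nonneg (chordHolder_nonneg a x y)]
    refine norm_sub_le_chordHolder ha (abs_nonneg C) hper (fun x y => (hC x y).trans ?_) x y
    rw [abs_of_nonneg (absWeight_nonneg x y)]
    exact mul_le_mul_of_nonneg_right (le_abs_self C) (absWeight_nonneg x y))

@[simp] theorem HSp.ofPeriodic_apply (f : ℝ → E) (hf : f ∈ holderSubmodule (absWeight a) E)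
    (hper : Function.Periodic f (2 * Real.pi)) (x : ℝ) : HSp.ofPeriodic f hf hper x = f x := rfl

theorem HSp.mem_absWeight (f : HSp (chordHolder a) E) :
    (f : ℝ → E) ∈ holderSubmodule (absWeight a) E := by
  refine ⟨f.bounded, ‖f‖, fun x y => ?_⟩
  rw [abs_of_nonneg (absWeight_nonneg x y)]
  exact (f.norm_sub_le (chordHolder_nonneg a x y)).trans
    (mul_le_mul_of_nonneg_left (chordHolder_le_absWeight ha.out.1.le x y) (norm_nonneg _))

theorem hasDerivAt_chordWeight (θ : ℝ) : HasDerivAt chordWeight (Real.cos (θ / 2)) θ := by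
  have h := ((Real.hasDerivAt_sin _).comp θ ((hasDerivAt_id θ).div_const 2)).const_mul 2
  refine h.congr_deriv ?_
  simp only [id]
  ring

theorem cos_half_eq_circ (θ : ℝ) :
    (Real.cos (θ / 2) : ℂ) = (circ (1 / 2 * θ) + circ (-(1 / 2) * θ)) / 2 := by
  simp only [circ, Complex.exp_mul_I]
  push_cast
  rw [show -(1 / 2) * (θ : ℂ) = -(θ / 2) by ring, show 1 / 2 * (θ : ℂ) = θ / 2 by ring,
    Complex.cos_neg, Complex.sin_neg]
  ring

theorem hasDerivAt_circ_mul (c θ : ℝ) :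
    HasDerivAt (fun t => circ (c * t)) (c * circ (c * θ) * Complex.I) θ := by
  have h := (hasDerivAt_circ (c * θ)).scomp θ ((hasDerivAt_id θ).const_mul c)
  refine h.congr_deriv ?_
  rw [mul_one, Complex.real_smul]
  ring

theorem circ_half_inv (θ : ℝ) : circ (1 / 2 * θ) * circ (-(1 / 2) * θ) = 1 := by
  rw [← circ_add]; simp

theorem hasDerivAt_circ_div_chordWeight {θ : ℝ} (hθ : θ ∈ awayFromOne) :
    HasDerivAt (fun t => circ (1 / 2 * t) / (chordWeight t : ℂ)) (-((chordWeight θ : ℂ) ^ 2)⁻¹) θ := by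
  have hs : (chordWeight θ : ℂ) ≠ 0 := Complex.ofReal_ne_zero.2 (chordWeight_ne_zero hθ)
  have h := (hasDerivAt_circ_mul (1 / 2) θ).div (hasDerivAt_chordWeight θ).ofReal_comp hs
  refine h.congr_deriv ?_
  have h1 := chordWeight_eq_circ θ
  have h2 := cos_half_eq_circ θ
  have h3 := circ_half_inv θ
  have hn : -((chordWeight θ : ℂ) ^ 2)⁻¹ * (chordWeight θ : ℂ) ^ 2 = -1 := by field_simp
  rw [h2, div_eq_iff (pow_ne_zero 2 hs), hn]
  generalize circ (1 / 2 * θ) = p at *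
  generalize circ (-(1 / 2) * θ) = q at *
  rw [h1]
  push_cast
  linear_combination (-1 : ℂ) * h3 + (-(1 / 2) * p * (p - q)) * Complex.I_sq

/-- The first weighted derivative of an element of `F^{2,a}`. -/
noncomputable def FSp.weightedOne (f : FSp a E) : HSp (chordHolder a) E :=
  -- The factor e^{-iθ/2} makes the antiperiodic jet entry periodic and turns it into (ζ - 1) df/dζ.
  HSp.ofPeriodic (fun θ => circ (-(1 / 2) * θ) • (jet f θ).2.1)
    (circ_smul_mem ha _ (HSp.map (ContinuousLinearMap.fst ℝ E E ∘L ContinuousLinearMap.snd ℝ E (E × E))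
      (FSp.jetL f)).2) (fun θ => by
    have hd : deriv f (θ + 2 * Real.pi) = deriv f θ := by
      rw [← deriv_comp_add_const, funext f.periodic]
    have h1 : circ (-(1 / 2) * (θ + 2 * Real.pi)) = -circ (-(1 / 2) * θ) := by
      rw [mul_add, circ_add]
      have : circ (-(1 / 2) * (2 * Real.pi)) = -1 := by
        rw [show -(1 / 2) * (2 * Real.pi) = -Real.pi by ring]
        simp [circ, Complex.exp_neg, Complex.exp_pi_mul_I, neg_mul]
      rw [this]; ring
    simp only [jet, h1, hd, chordWeight_add_two_pi, neg_smul, smul_neg, neg_neg])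

theorem FSp.weightedOne_apply (f : FSp a E) (θ : ℝ) :
    f.weightedOne θ = circ (-(1 / 2) * θ) • chordWeight θ • deriv f θ := rfl

/-- The second weighted derivative of an element of `F^{2,a}`. -/
noncomputable def FSp.weightedTwo (f : FSp a E) : HSp (chordHolder a) E :=
  -- The weighted derivative applied twice; the last term arises because the coefficient 2 sin(θ/2)
  -- e^{-iθ/2} has derivative e^{-iθ}.
  HSp.ofPeriodic (fun θ => circ (-1 * θ) • (jet f θ).2.2 + circ (-1 * θ) • f.weightedOne θ)
    (Submodule.add_mem _ (circ_smul_mem ha _ (HSp.map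
      (ContinuousLinearMap.snd ℝ E E ∘L ContinuousLinearMap.snd ℝ E (E × E)) (FSp.jetL f)).2)
      (circ_smul_mem ha _ f.weightedOne.mem_absWeight)) (fun θ => by
    have hd : deriv f (θ + 2 * Real.pi) = deriv f θ := by
      rw [← deriv_comp_add_const, funext f.periodic]
    have hd2 : deriv (deriv f) (θ + 2 * Real.pi) = deriv (deriv f) θ := by
      have : Function.Periodic (deriv f) (2 * Real.pi) := fun θ => by
        rw [← deriv_comp_add_const, funext f.periodic]
      rw [← deriv_comp_add_const, funext this]
    have h1 : circ (-1 * (θ + 2 * Real.pi)) = circ (-1 * θ) := by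
      have := circ_periodic.sub_eq (-1 * θ)
      rw [← this]; congr 1; ring
    have h2 := periodic_of_chordHolder ha.out.1
      fun x y => f.weightedOne.norm_sub_le (chordHolder_nonneg a x y)
    simp only [jet, h1, hd2, chordWeight_add_two_pi, neg_sq, h2 θ])

theorem FSp.weightedTwo_apply (f : FSp a E) (θ : ℝ) : f.weightedTwo θ =
    circ (-1 * θ) • chordWeight θ ^ 2 • deriv (deriv f) θ + circ (-1 * θ) • f.weightedOne θ := rfl

theorem FSp.weightedDeriv_one (f : FSp a E) : WeightedDeriv f f.weightedOne := by
  intro θ hθ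
  have hs : (chordWeight θ : ℂ) ≠ 0 := Complex.ofReal_ne_zero.2 (chordWeight_ne_zero hθ)
  refine (hasDerivAt_of_contDiffOn f.contDiffOn hθ).congr_deriv ?_
  rw [FSp.weightedOne_apply, ← Complex.coe_smul, smul_smul, smul_smul]
  have h : circ (1 / 2 * θ) / (chordWeight θ : ℂ) * circ (-(1 / 2) * θ) * (chordWeight θ : ℂ) = 1 := by
    have := circ_half_inv θ
    generalize circ (1 / 2 * θ) = p at *
    generalize circ (-(1 / 2) * θ) = q at *
    field_simp
    exact this
  rw [h, one_smul]

theorem FSp.weightedDeriv_two (f : FSp a E) : WeightedDeriv f.weightedOne f.weightedTwo := by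
  intro θ hθ
  have hs : (chordWeight θ : ℂ) ≠ 0 := Complex.ofReal_ne_zero.2 (chordWeight_ne_zero hθ)
  have h1 : HasDerivAt (fun t => (circ (-(1 / 2) * t) * (chordWeight t : ℂ)) • deriv f t) _ θ :=
    (((hasDerivAt_circ_mul (-(1 / 2)) θ).mul (hasDerivAt_chordWeight θ).ofReal_comp)).smul
      (hasDerivAt_deriv_of_contDiffOn f.contDiffOn hθ)
  have e : (f.weightedOne : ℝ → E) =
      fun t => (circ (-(1 / 2) * t) * (chordWeight t : ℂ)) • deriv f t := by
    funext t
    rw [FSp.weightedOne_apply, ← Complex.coe_smul, smul_smul]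
  rw [FSp.weightedTwo_apply, e]
  refine h1.congr_deriv ?_
  simp only [← Complex.coe_smul, smul_smul, smul_add, Pi.mul_apply]
  have h3 := circ_half_inv θ
  have h4 : circ (-1 * θ) = circ (-(1 / 2) * θ) ^ 2 := by rw [sq, ← circ_add]; congr 1; ring
  have h5 := chordWeight_eq_circ θ
  have h6 := cos_half_eq_circ θ
  rw [h4, h6]
  push_cast
  generalize circ (1 / 2 * θ) = p at *
  generalize circ (-(1 / 2) * θ) = q at *
  generalize (chordWeight θ : ℂ) = s at *
  refine congrArg₂ (· + ·) (congrArg (· • _) ?_) (congrArg (· • _) ?_)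
  · field_simp
    linear_combination (-q) * h3
  · field_simp
    rw [h5]
    linear_combination (-2 * q ^ 2) * h3 + q * (p - q) * Complex.I_sq

variable [CompleteSpace E]

/-- With s = 2 sin(θ/2), the jet entries are recovered from the weighted derivatives: s g' =
e^{iθ/2} v and s² g'' = e^{iθ} v₂ - v. At the point 1, where the derivative entries of a jet are 0,
the vanishing of v and v₂ makes the formulas agree. -/
theorem mem_fSubmodule_of_weightedDeriv {g v v₂ : HSp (chordHolder a) E} (h1 : WeightedDeriv g v)
    (h2 : WeightedDeriv v v₂) (hv : ∀ θ ∉ awayFromOne, v θ = 0) (hv₂ : ∀ θ ∉ awayFromOne, v₂ θ = 0) :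
    (g : ℝ → E) ∈ fSubmodule a E := by
  have hcirc : ContinuousOn (fun θ => circ (1 / 2 * θ) / (chordWeight θ : ℂ)) awayFromOne :=
    fun θ hθ => (hasDerivAt_circ_div_chordWeight hθ).continuousAt.continuousWithinAt
  obtain ⟨hc, hd1, hd2⟩ := contDiffOn_two_of_hasDerivAt (σ := g)
    (σ₁ := fun θ => (circ (1 / 2 * θ) / (chordWeight θ : ℂ)) • v θ)
    (σ₂ := fun θ => (circ (1 / 2 * θ) / (chordWeight θ : ℂ)) •
      (circ (1 / 2 * θ) / (chordWeight θ : ℂ)) • v₂ θ + (-((chordWeight θ : ℂ) ^ 2)⁻¹) • v θ) h1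
    (fun θ hθ => (hasDerivAt_circ_div_chordWeight hθ).smul (h2 θ hθ))
    ((hcirc.smul (hcirc.smul v₂.continuous_chord.continuousOn)).add (ContinuousOn.smul
      ((((Complex.continuous_ofReal.comp continuous_chordWeight).pow 2).continuousOn.inv₀
        fun θ hθ => pow_ne_zero 2 (Complex.ofReal_ne_zero.2 (chordWeight_ne_zero hθ))).neg)
      v.continuous_chord.continuousOn))
  have hj : jet g = fun θ => (g θ, circ (1 / 2 * θ) • v θ, circ (1 * θ) • v₂ θ - v θ) := by
    funext θ
    by_cases hθ : θ ∈ awayFromOne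
    · have hs : (chordWeight θ : ℂ) ≠ 0 := Complex.ofReal_ne_zero.2 (chordWeight_ne_zero hθ)
      simp only [jet, hd1 θ hθ, hd2 θ hθ, ← Complex.coe_smul, smul_smul, smul_add]
      have e1 : (chordWeight θ : ℂ) * (circ (1 / 2 * θ) / (chordWeight θ : ℂ)) = circ (1 / 2 * θ) := by
        field_simp
      have e2 : ((chordWeight θ ^ 2 : ℝ) : ℂ) * (circ (1 / 2 * θ) / (chordWeight θ : ℂ) *
          (circ (1 / 2 * θ) / (chordWeight θ : ℂ))) = circ (1 * θ) := by
        rw [one_mul, circ_eq_sq θ]; push_cast; field_simp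
      have e3 : ((chordWeight θ ^ 2 : ℝ) : ℂ) * -((chordWeight θ : ℂ) ^ 2)⁻¹ = -1 := by
        push_cast; field_simp
      rw [e1, e2, e3, neg_one_smul, sub_eq_add_neg]
    · simp [jet_of_notMem hθ, hv θ hθ, hv₂ θ hθ]
  refine ⟨periodic_of_chordHolder ha.out.1 fun x y => g.norm_sub_le (chordHolder_nonneg a x y),
    hc, ?_⟩
  rw [hj]
  have m0 := g.mem_absWeight
  have m1 := circ_smul_mem ha (1 / 2) v.mem_absWeight
  have m2 := Submodule.sub_mem _ (circ_smul_mem ha 1 v₂.mem_absWeight) v.mem_absWeight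
  have k0 := (HSp.map (ω := absWeight a) (ContinuousLinearMap.inl ℝ E (E × E)) ⟨_, m0⟩).2
  have k1 := (HSp.map (ω := absWeight a) (ContinuousLinearMap.inr ℝ E (E × E) ∘L
    ContinuousLinearMap.inl ℝ E E) ⟨_, m1⟩).2
  have k2 := (HSp.map (ω := absWeight a) (ContinuousLinearMap.inr ℝ E (E × E) ∘L
    ContinuousLinearMap.inr ℝ E E) ⟨_, m2⟩).2
  convert Submodule.add_mem _ k0 (Submodule.add_mem _ k1 k2) using 1
  funext θ
  have e0 : ∀ x y z : E, (x, y, z) = (x, (0 : E × E)) + ((0, (y, 0)) + (0, (0, z))) := by simp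
  exact e0 _ _ _

theorem FSp.cauchy_mem (f : FSp a E) : (HSp.cauchyL (FSp.toHSp f) : ℝ → E) ∈ fSubmodule a E := by
  have hz : ∀ {g v : HSp (chordHolder a) E}, WeightedDeriv g v → ∀ θ ∉ awayFromOne,
      HSp.cauchyL v θ = 0 := fun h θ hθ => by
    rw [HSp.cauchyL_apply, circ_eq_one_iff.2 hθ, h.cauchyExt_one]
  have h1 : WeightedDeriv (FSp.toHSp f) f.weightedOne := f.weightedDeriv_one
  exact mem_fSubmodule_of_weightedDeriv h1.cauchyL f.weightedDeriv_two.cauchyL (hz h1)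
    (hz f.weightedDeriv_two)

/-- The Cauchy projection on `F^{2,a}`. -/
noncomputable def FSp.cauchyL : FSp a E →L[ℝ] FSp a E :=
  -- Continuity comes from the closed graph theorem: convergence in F^{2,a} implies pointwise
  -- convergence, and the projection is already continuous on the Hölder space.
  ContinuousLinearMap.ofSeqClosedGraph
    (g :=
      { toFun := fun f => (⟨_, f.cauchy_mem⟩ : fSubmodule a E)
        map_add' := fun f g => by
          refine FSp.ext fun θ => ?_
          change HSp.cauchyL (FSp.toHSp (f + g)) θ = _
          rw [map_add, map_add]; rfl
        map_smul' := fun c f => by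
          refine FSp.ext fun θ => ?_
          change HSp.cauchyL (FSp.toHSp (c • f)) θ = _
          rw [map_smul, map_smul]; rfl }) (by
    intro u x y hu hg
    refine FSp.ext fun θ => ?_
    have h1 := ((FSp.eval θ).continuous.tendsto y).comp hg
    have h2 := ((HSp.eval θ ∘L HSp.cauchyL ∘L FSp.toHSp).continuous.tendsto x).comp hu
    exact tendsto_nhds_unique h1 h2)

end CauchyF

/-! ### Linear maps and smooth functions in F^{2,a} -/

section Maps

variable {a : ℝ} [ha : HExp a]

/-- Composition with a linear map on `F^{2,a}`. -/
noncomputable def FSp.map {E F : Type} [NormedAddCommGroup E] [NormedSpace ℝ E]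
    [FiniteDimensional ℝ E] [NormedAddCommGroup F] [NormedSpace ℝ F] [CompleteSpace F]
    (L : E →L[ℝ] F) : FSp a E →L[ℝ] FSp a F where
  toFun f := FSp.nem L.contDiff f
  map_add' f g := by ext θ; simp
  map_smul' c f := by ext θ; simp
  cont := (FSp.contDiff_nem 0 L.contDiff L.contDiff).continuous

@[simp] theorem FSp.map_apply {E F : Type} [NormedAddCommGroup E] [NormedSpace ℝ E]
    [FiniteDimensional ℝ E] [NormedAddCommGroup F] [NormedSpace ℝ F] [CompleteSpace F]
    (L : E →L[ℝ] F) (f : FSp a E) (θ : ℝ) : FSp.map L f θ = L (f θ) := rfl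

variable {E : Type} [NormedAddCommGroup E] [NormedSpace ℝ E]

theorem exists_hBound_of_contDiff (ha : HExp a) {g : ℝ → E} (hg : ContDiff ℝ 1 g) :
    ∃ N, 0 ≤ N ∧ HBound a g N := by
  have hpi := Real.pi_pos
  obtain ⟨A, hA⟩ := (isCompact_Icc (a := -Real.pi) (b := Real.pi)).exists_bound_of_continuousOn
    hg.continuous.continuousOn
  obtain ⟨K, hK⟩ := hg.contDiffOn.exists_lipschitzOnWith (by simp)
    (convex_Icc (-Real.pi) Real.pi) isCompact_Icc
  have hA0 : 0 ≤ A := (norm_nonneg _).trans (hA 0 ⟨by linarith, hpi.le⟩)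
  have hc : 0 ≤ (K : ℝ) * (2 * Real.pi) ^ (1 - a) := by positivity
  refine ⟨A + K * (2 * Real.pi) ^ (1 - a), by positivity, fun x hx => (hA x hx).trans (by linarith),
    fun x hx y hy => ?_⟩
  have h3 := hK.dist_le_mul x hx y hy
  rw [dist_eq_norm, Real.dist_eq] at h3
  have h4 : |x - y| = |x - y| ^ (1 - a) * |x - y| ^ a := by
    rw [← Real.rpow_add_of_nonneg (abs_nonneg _) (by linarith [ha.out.2]) ha.out.1.le]
    simp
  have h5 : |x - y| ^ (1 - a) ≤ (2 * Real.pi) ^ (1 - a) := by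
    refine Real.rpow_le_rpow (abs_nonneg _) ?_ (by linarith [ha.out.2])
    rw [abs_le]
    constructor <;> linarith [hx.1, hx.2, hy.1, hy.2]
  have h6 : 0 ≤ |x - y| ^ a := Real.rpow_nonneg (abs_nonneg _) _
  calc ‖g x - g y‖ ≤ K * (|x - y| ^ (1 - a) * |x - y| ^ a) := h4 ▸ h3
    _ ≤ K * ((2 * Real.pi) ^ (1 - a) * |x - y| ^ a) := by gcongr
    _ ≤ _ := by nlinarith [mul_nonneg hA0 h6]

/-- Smooth periodic functions belong to `F^{2,a}`. -/
theorem exists_fSp_of_contDiff {σ : ℝ → E} (hσ : ContDiff ℝ 3 σ)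
    (hper : Function.Periodic σ (2 * Real.pi)) : ∃ f : FSp a E, ∀ θ, f θ = σ θ := by
  have h1 : ContDiff ℝ 2 (deriv σ) := by
    have : ContDiff ℝ (2 + 1) σ := by norm_num; exact hσ
    exact (contDiff_succ_iff_deriv.1 this).2.2
  have h2 : ContDiff ℝ 1 (deriv (deriv σ)) := by
    have : ContDiff ℝ (1 + 1) (deriv σ) := by norm_num; exact h1
    exact (contDiff_succ_iff_deriv.1 this).2.2
  obtain ⟨N0, hN0, hb0⟩ := exists_hBound_of_contDiff ha (hσ.of_le (by norm_num) : ContDiff ℝ 1 σ)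
  obtain ⟨N1, hN1, hb1⟩ := exists_hBound_of_contDiff ha
    (contDiff_id.smul (h1.of_le (by norm_num)) : ContDiff ℝ 1 fun θ : ℝ => θ • deriv σ θ)
  obtain ⟨N2, hN2, hb2⟩ := exists_hBound_of_contDiff ha
    ((contDiff_id.pow 2).smul h2 : ContDiff ℝ 1 fun θ : ℝ => θ ^ 2 • deriv (deriv σ) θ)
  have hm : MemF a σ := by
    refine ⟨hper, hσ.continuous, (hσ.of_le (by norm_num)).contDiffOn, ?_⟩
    refine (add_le_add (add_le_add (iSup₂_le fun x hx => ?_)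
      (holderNormOn_le_of_norm_bounds hN1 hb1.1 hb1.2))
      (holderNormOn_le_of_norm_bounds hN2 hb2.1 hb2.2)).trans_lt
      (ENNReal.add_lt_top.2 ⟨ENNReal.add_lt_top.2 ⟨ENNReal.ofReal_lt_top (r := N0),
        ENNReal.ofReal_lt_top⟩, ENNReal.ofReal_lt_top⟩)
    rw [← ofReal_norm]
    exact ENNReal.ofReal_le_ofReal (hb0.1 x hx)
  obtain ⟨C, _, h⟩ := exists_mem_fSubmodule_of_memF E ha
  obtain ⟨f, hf, _⟩ := h σ hm
  exact ⟨f, hf⟩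

end Maps

/-! ### The implicit function theorem for fixed point equations -/

section
variable {U S : Type} [NormedAddCommGroup U] [NormedSpace ℝ U] [NormedAddCommGroup S]
  [NormedSpace ℝ S] [CompleteSpace S]

/-- The implicit function theorem for fixed points `Z = T (η, Z)`. -/
theorem exists_fixedPoint_curve {Q : Type} [NormedAddCommGroup Q]
    [NormedSpace ℝ Q] [CompleteSpace Q] {n : ℕ} (hn : 1 ≤ n) {T : Q × S → S} (hT : ContDiff ℝ n T)
    (h0 : T (0, 0) = 0) (hd : ‖(fderiv ℝ T (0, 0)).comp (ContinuousLinearMap.inr ℝ Q S)‖ < 1) :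
    ∃ Z : Q → S, Z 0 = 0 ∧ (∀ᶠ η in 𝓝 0, ContDiffAt ℝ n Z η ∧ Z η = T (η, Z η)) ∧
      ∀ᶠ p in 𝓝 (0 : Q × S), p.2 = T p → p.2 = Z p.1 := by
  have hn0 : ((n : ℕ) : WithTop ℕ∞) ≠ 0 := by
    simpa using (by omega : n ≠ 0)
  have hcd : ContDiffAt ℝ n (fun p : Q × S => p.2 - T p) (0, 0) :=
    (contDiff_snd.sub hT).contDiffAt
  have hfd : fderiv ℝ (fun p : Q × S => p.2 - T p) (0, 0) =
      ContinuousLinearMap.snd ℝ Q S - fderiv ℝ T (0, 0) :=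
    (hasFDerivAt_snd.sub (hT.differentiable hn0 (0, 0)).hasFDerivAt).fderiv
  have hinv : ((fderiv ℝ (fun p : Q × S => p.2 - T p) (0, 0)).comp
      (ContinuousLinearMap.inr ℝ Q S)).IsInvertible := by
    have e : (fderiv ℝ (fun p : Q × S => p.2 - T p) (0, 0)).comp
        (ContinuousLinearMap.inr ℝ Q S) =
        1 - (fderiv ℝ T (0, 0)).comp (ContinuousLinearMap.inr ℝ Q S) := by
      rw [hfd]; ext v; simp
    rw [e]
    have hu : IsUnit (1 - (fderiv ℝ T (0, 0)).comp (ContinuousLinearMap.inr ℝ Q S)) :=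
      (Units.oneSub _ hd).isUnit
    obtain ⟨w, hw⟩ := hu
    exact ⟨ContinuousLinearEquiv.unitsEquiv ℝ S w, by ext x; simp [← hw]⟩
  refine ⟨hcd.implicitFunction hn0 hinv, hcd.implicitFunction_apply_self hn0 hinv, ?_, ?_⟩
  · have h1 := hcd.eventually_apply_implicitFunction hn0 hinv
    have h2 := hcd.contDiffAt_implicitFunction hn0 hinv
    filter_upwards [h1, h2.eventually (by simp)] with η h1 h2
    refine ⟨h2, ?_⟩
    simpa [h0, sub_eq_zero] using h1
  · filter_upwards [hcd.eventually_apply_eq_iff_implicitFunction hn0 hinv] with p hp h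
    refine (hp.1 ?_).symm
    simp [h0, ← h]

/-- Small perturbations of a superposition operator with vanishing derivative. -/
theorem eventually_exists_curve {n : ℕ} (hn : 1 ≤ n) (P : S →L[ℝ] S) {N₀ : U × S → S}
    (h₀ : ContDiff ℝ n N₀) (hz : ∀ u, N₀ (u, 0) = 0) (u₀ : U)
    (hd : ∀ v, fderiv ℝ N₀ (u₀, 0) (0, v) = 0) :
    ∀ᶠ u in 𝓝 u₀, ∀ N₁ : ℝ × S → S, ContDiff ℝ n N₁ → (∀ Z, N₁ (0, Z) = 0) →
      ∃ Z : ℝ → S, Z 0 = 0 ∧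
        (∀ᶠ η in 𝓝 0, ContDiffAt ℝ n Z η ∧ Z η = P (N₀ (u, Z η) + N₁ (η, Z η))) ∧
        ∀ᶠ p in 𝓝 (0 : ℝ × S), p.2 = P (N₀ (u, p.2) + N₁ p) → p.2 = Z p.1 := by
  have hn0 : ((n : ℕ) : WithTop ℕ∞) ≠ 0 := by
    simpa using (by omega : n ≠ 0)
  -- Only `N₀` enters the smallness condition, since every admissible `N₁` vanishes at parameter 0.
  -- One neighbourhood of `u₀` therefore serves all perturbations.
  have hc : Continuous fun u : U =>
      ‖P.comp ((fderiv ℝ N₀ (u, 0)).comp (ContinuousLinearMap.inr ℝ U S))‖ := by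
    have := h₀.continuous_fderiv hn0
    have h1 : Continuous fun u : U => fderiv ℝ N₀ (u, 0) := by fun_prop
    exact (continuous_const.clm_comp (h1.clm_comp continuous_const)).norm
  have h0 : ‖P.comp ((fderiv ℝ N₀ (u₀, 0)).comp (ContinuousLinearMap.inr ℝ U S))‖ < 1 := by
    have : (fderiv ℝ N₀ (u₀, 0)).comp (ContinuousLinearMap.inr ℝ U S) = 0 := by
      ext v; simpa using hd v
    simp [this]
  filter_upwards [hc.continuousAt.eventually_lt continuousAt_const h0] with u hu N₁ h₁ hz₁
  have hT : ContDiff ℝ n fun p : ℝ × S => P (N₀ (u, p.2) + N₁ p) :=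
    P.contDiff.comp ((h₀.comp (contDiff_const.prodMk contDiff_snd)).add h₁)
  refine exists_fixedPoint_curve hn hT (by simp [hz, hz₁]) ?_
  have hZ : HasFDerivAt (fun Z : S => P (N₀ (u, Z) + N₁ (0, Z)))
      (P.comp ((fderiv ℝ N₀ (u, 0)).comp (ContinuousLinearMap.inr ℝ U S))) 0 := by
    simp only [hz₁, add_zero]
    exact P.hasFDerivAt.comp (0 : S) (HasFDerivAt.comp (0 : S)
      (h₀.differentiable hn0 (u, 0)).hasFDerivAt (hasFDerivAt_prodMk_right u (0 : S)))
  have hZ' : HasFDerivAt (fun Z : S => P (N₀ (u, Z) + N₁ (0, Z)))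
      ((fderiv ℝ (fun p : ℝ × S => P (N₀ (u, p.2) + N₁ p)) (0, 0)).comp
        (ContinuousLinearMap.inr ℝ ℝ S)) 0 :=
    HasFDerivAt.comp (0 : S) (f := fun Z : S => ((0 : ℝ), Z))
      (hT.differentiable hn0 (0, 0)).hasFDerivAt (hasFDerivAt_prodMk_right (0 : ℝ) (0 : S))
  rw [hZ'.unique hZ]
  exact hu

end

/-! ### Derivatives of superposition operators, computed pointwise -/

section
variable {V W : Type} [NormedAddCommGroup V] [NormedSpace ℝ V] [NormedAddCommGroup W]
  [NormedSpace ℝ W] {X Y : Type} [NormedAddCommGroup X] [NormedSpace ℝ X] [NormedAddCommGroup Y]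
  [NormedSpace ℝ Y]

/-- Pointwise computation of the derivative of a superposition operator. -/
theorem fderiv_apply_of_eval {N : V → W} {v : V} (hN : DifferentiableAt ℝ N v) {g : X → Y}
    (e : V →L[ℝ] X) (e' : W →L[ℝ] Y) (hg : DifferentiableAt ℝ g (e v))
    (h : ∀ v, e' (N v) = g (e v)) (v' : V) : e' (fderiv ℝ N v v') = fderiv ℝ g (e v) (e v') := by
  have h1 : HasFDerivAt (fun v => e' (N v)) (e'.comp (fderiv ℝ N v)) v :=
    e'.hasFDerivAt.comp v hN.hasFDerivAt
  have h2 : HasFDerivAt (fun v => e' (N v)) ((fderiv ℝ g (e v)).comp e) v := by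
    simp only [h]
    exact HasFDerivAt.comp v hg.hasFDerivAt e.hasFDerivAt
  exact DFunLike.congr_fun (h1.unique h2) v'

end

/-! ### The Cauchy projection and the Cauchy kernel in L² -/

section SquareIntegrable

open MeasureTheory

/-- Lebesgue measure on one period. -/
noncomputable def periodMeasure : Measure ℝ := volume.restrict (Ioc 0 (2 * Real.pi))

instance : IsFiniteMeasure periodMeasure := by
  unfold periodMeasure; infer_instance

theorem integral_periodMeasure {E : Type} [NormedAddCommGroup E] [NormedSpace ℝ E] (f : ℝ → E) :
    ∫ θ, f θ ∂periodMeasure = (2 * Real.pi) • avg f := by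
  rw [avg, smul_smul, mul_inv_cancel₀ (by positivity), one_smul,
    intervalIntegral.integral_of_le (by positivity)]
  rfl

/-- A Hölder function on the circle as a bounded continuous function. -/
noncomputable def HSp.toBd {E : Type} [NormedAddCommGroup E] [NormedSpace ℝ E] (a : ℝ)
    [HExp a] : HSp (chordHolder a) E →L[ℝ] Bd ℝ E :=
  LinearMap.mkContinuous
    { toFun := fun f => Bd.mk f f.continuous_chord ⟨_, f.norm_apply_le⟩
      map_add' := fun _ _ => rfl
      map_smul' := fun _ _ => rfl } 1 fun f => by
    rw [one_mul]
    exact (Bd.norm_le (norm_nonneg f)).2 f.norm_apply_le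

@[simp] theorem HSp.toBd_apply {E : Type} [NormedAddCommGroup E] [NormedSpace ℝ E] {a : ℝ}
    [HExp a] (f : HSp (chordHolder a) E) (θ : ℝ) : HSp.toBd a f θ = f θ := rfl

section
variable (E : Type) [NormedAddCommGroup E] [NormedSpace ℝ E]

/-- The class of a bounded continuous function in `L²` of one period. -/
noncomputable def Bd.toL2 : Bd ℝ E →L[ℝ] Lp E 2 periodMeasure :=
  BoundedContinuousFunction.toLp 2 periodMeasure ℝ

/-- The class of a bounded continuous function in `L^∞` of one period. -/
noncomputable def Bd.toLinf : Bd ℝ E →L[ℝ] Lp E ∞ periodMeasure :=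
  BoundedContinuousFunction.toLp ∞ periodMeasure ℝ

variable {E}

theorem Bd.coeFn_toL2 (f : Bd ℝ E) : Bd.toL2 E f =ᵐ[periodMeasure] f :=
  BoundedContinuousFunction.coeFn_toLp 2 periodMeasure ℝ _

theorem Bd.coeFn_toLinf (f : Bd ℝ E) : Bd.toLinf E f =ᵐ[periodMeasure] f :=
  BoundedContinuousFunction.coeFn_toLp ∞ periodMeasure ℝ _

theorem norm_toLp_top_le (f : BoundedContinuousFunction ℝ E) :
    ‖BoundedContinuousFunction.toLp ∞ periodMeasure ℝ f‖ ≤ ‖f‖ := by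
  have h := Lp.norm_le_of_ae_bound (f := BoundedContinuousFunction.toLp ∞ periodMeasure ℝ f)
    (norm_nonneg f) (by
      filter_upwards [BoundedContinuousFunction.coeFn_toLp ∞ periodMeasure ℝ f] with θ hθ
      rw [hθ]
      exact f.norm_coe_le_norm θ)
  simpa using h

theorem Bd.norm_toLinf_le (f : Bd ℝ E) : ‖Bd.toLinf E f‖ ≤ ‖f‖ := norm_toLp_top_le _

/-- Multiplication of square integrable functions by bounded continuous functions. -/
noncomputable def Bd.mulL2 (E : Type) [NormedAddCommGroup E] [NormedSpace ℝ E] :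
    Bd ℝ (E →L[ℝ] E) →L[ℝ] Lp E 2 periodMeasure →L[ℝ] Lp E 2 periodMeasure :=
  ((ContinuousLinearMap.id ℝ (E →L[ℝ] E)).holderL periodMeasure ∞ 2 2).comp (Bd.toLinf (E →L[ℝ] E))

theorem Bd.norm_mulL2_le (A : Bd ℝ (E →L[ℝ] E)) : ‖Bd.mulL2 E A‖ ≤ ‖A‖ := by
  refine (((ContinuousLinearMap.id ℝ (E →L[ℝ] E)).holderL periodMeasure ∞ 2 2).le_of_opNorm_le
    (ContinuousLinearMap.norm_holderL_le _) _).trans ?_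
  refine (mul_le_mul ContinuousLinearMap.norm_id_le A.norm_toLinf_le (norm_nonneg _)
    zero_le_one).trans_eq (one_mul _)

theorem Bd.mulL2_toL2 (A : Bd ℝ (E →L[ℝ] E)) (f : Bd ℝ E) :
    Bd.mulL2 E A (Bd.toL2 E f) = Bd.toL2 E (Bd.applyL ℝ E E A f) := by
  refine Lp.ext ?_
  have h := (ContinuousLinearMap.id ℝ (E →L[ℝ] E)).coeFn_holder (r := 2) (Bd.toLinf _ A)
    (Bd.toL2 E f)
  filter_upwards [h, A.coeFn_toLinf, f.coeFn_toL2,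
    (Bd.applyL ℝ E E A f).coeFn_toL2] with θ h1 h2 h3 h4
  rw [h4]
  refine Eq.trans h1 ?_
  rw [h2, h3]
  rfl

end

section Projection

variable {E : Type} [NormedAddCommGroup E] [InnerProductSpace ℂ E] [FiniteDimensional ℂ E]
  [CompleteSpace E] {a : ℝ} [ha : HExp a]

/-- The class in `L²` of a Hölder function. -/
noncomputable def HSp.toL2 (a : ℝ) [HExp a] (E : Type) [NormedAddCommGroup E]
    [InnerProductSpace ℂ E] : HSp (chordHolder a) E →L[ℝ] Lp E 2 periodMeasure :=
  (Bd.toL2 E).comp (HSp.toBd a)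

theorem HSp.coeFn_toL2 (f : HSp (chordHolder a) E) : HSp.toL2 a E f =ᵐ[periodMeasure] f :=
  (HSp.toBd a f).coeFn_toL2

/-- Hölder boundary values of holomorphic functions are orthogonal to `f` minus its Cauchy
integral. -/
theorem inner_sub_cauchyL (f g : HSp (chordHolder a) E) :
    inner ℂ (HSp.toL2 a E f - HSp.toL2 a E (HSp.cauchyL f)) (HSp.toL2 a E (HSp.cauchyL g)) = 0 := by
  let b := stdOrthonormalBasis ℂ E
  let p : Fin (Module.finrank ℂ E) → (E →L[ℂ] ℂ) := fun i => innerSL ℂ (b i)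
  let c : Fin (Module.finrank ℂ E) → HSp (chordHolder a) E → HSp (chordHolder a) ℂ :=
    fun i f => HSp.map ((p i).restrictScalars ℝ) f
  have hc : ∀ i f θ, c i f θ = inner ℂ (b i) (f θ) := fun i f θ => rfl
  have hC : ∀ i f θ, inner ℂ (b i) (HSp.cauchyL f θ) = cauchyExt (c i f) (circ θ) := fun i f θ =>
    (cauchyExt_map (p i) f (circ_mem_closedBall θ)).symm
  -- By the Plemelj formula the conjugate of f - Cf is C(conj f) minus its value at 0. The inner
  -- product is thus the boundary value of a holomorphic function vanishing at 0, and its mean is 0.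
  let u : ℂ → ℂ := fun τ => ∑ i, (cauchyExt (HSp.conj (c i f)) τ -
    cauchyExt (HSp.conj (c i f)) 0) * cauchyExt (c i g) τ
  have hu : DiffContOnCl ℂ u (ball 0 1) := by
    refine ⟨?_, ?_⟩
    · refine DifferentiableOn.fun_sum fun i _ => ?_
      exact ((diffContOnCl_cauchyExt _).differentiableOn.sub_const _).mul
        (diffContOnCl_cauchyExt _).differentiableOn
    · refine continuousOn_finsetSum _ fun i _ => ?_
      exact ((diffContOnCl_cauchyExt _).continuousOn.sub continuousOn_const).mul
        (diffContOnCl_cauchyExt _).continuousOn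
  have key : ∀ θ, inner ℂ (f θ - HSp.cauchyL f θ) (HSp.cauchyL g θ) = u (circ θ) := by
    intro θ
    rw [← b.sum_inner_mul_inner]
    refine Finset.sum_congr rfl fun i _ => ?_
    rw [hC, ← inner_conj_symm, inner_sub_right, hC, ← hc, plemelj (c i f) θ]
    simp only [map_sub, map_add, Complex.conj_conj]
    rw [cauchyExt_zero, show avg (HSp.conj (c i f)) = (starRingEnd ℂ) (avg (c i f)) from
      avg_conj (c i f).continuous_chord]
    ring
  rw [L2.inner_def]
  have h1 : (fun θ => inner ℂ ((HSp.toL2 a E f - HSp.toL2 a E (HSp.cauchyL f) :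
      Lp E 2 periodMeasure) θ) (HSp.toL2 a E (HSp.cauchyL g) θ)) =ᵐ[periodMeasure]
      fun θ => u (circ θ) := by
    filter_upwards [Lp.coeFn_sub (HSp.toL2 a E f) (HSp.toL2 a E (HSp.cauchyL f)), f.coeFn_toL2,
      (HSp.cauchyL f).coeFn_toL2, (HSp.cauchyL g).coeFn_toL2] with θ h1 h2 h3 h4
    rw [h1, Pi.sub_apply, h2, h3, h4, key]
  rw [integral_congr_ae h1, integral_periodMeasure, avg_circ hu]
  simp [u]

/-- The closure in `L²` of the Hölder boundary values of holomorphic functions. -/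
noncomputable def hardySpace (a : ℝ) [HExp a] (E : Type) [NormedAddCommGroup E]
    [InnerProductSpace ℂ E] [CompleteSpace E] : Submodule ℂ (Lp E 2 periodMeasure) :=
  (Submodule.span ℂ (range fun g : HSp (chordHolder a) E =>
    HSp.toL2 a E (HSp.cauchyL g))).topologicalClosure

instance : CompleteSpace (hardySpace a E) :=
  (Submodule.isClosed_topologicalClosure _).completeSpace_coe

/-- The function splits into its Cauchy projection, which lies in the space, and a remainder
orthogonal to it. This identifies the Cauchy projection with an orthogonal projection, of norm at
most 1 on L². -/
theorem starProjection_hardySpace (f : HSp (chordHolder a) E) :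
    (hardySpace a E).starProjection (HSp.toL2 a E f) = HSp.toL2 a E (HSp.cauchyL f) := by
  refine (Submodule.eq_starProjection_of_mem_of_inner_eq_zero ?_ ?_)
  · exact Submodule.le_topologicalClosure _ (Submodule.subset_span ⟨f, rfl⟩)
  · have hle : hardySpace a E ≤
        (ℂ ∙ (HSp.toL2 a E f - HSp.toL2 a E (HSp.cauchyL f)))ᗮ := by
      refine Submodule.topologicalClosure_minimal _ (Submodule.span_le.2 ?_)
        (Submodule.isClosed_orthogonal _)
      rintro _ ⟨g, rfl⟩
      exact (Submodule.mem_orthogonal_singleton_iff_inner_right).2 (inner_sub_cauchyL f g)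
    exact fun w hw => (Submodule.mem_orthogonal_singleton_iff_inner_right).1 (hle hw)

end Projection

section Kernel

/-- The conjugate coordinate on the circle. -/
noncomputable def conjCirc : BoundedContinuousFunction ℝ ℂ :=
  BoundedContinuousFunction.ofNormedAddCommGroup (fun θ => (starRingEnd ℂ) (circ θ))
    (Complex.continuous_conj.comp continuous_circ) 1 fun θ => by simp [norm_circ]

theorem norm_conjCirc_le : ‖conjCirc‖ ≤ 1 :=
  (BoundedContinuousFunction.norm_le zero_le_one).2 fun θ => by simp [conjCirc, norm_circ]

/-- The Cauchy kernel as a bounded continuous function. -/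
noncomputable def cauchyKernel (τ : ℂ) : BoundedContinuousFunction ℝ ℂ :=
  -- On the circle ζ/(ζ - τ) = (1 - τ conj ζ)⁻¹; as an inverse in a Banach algebra it depends
  -- smoothly on τ.
  Ring.inverse (1 - τ • conjCirc)

theorem norm_smul_conjCirc_lt {τ : ℂ} (hτ : τ ∈ ball (0 : ℂ) 1) : ‖τ • conjCirc‖ < 1 := by
  rw [norm_smul]
  exact (mul_le_of_le_one_right (norm_nonneg _) norm_conjCirc_le).trans_lt
    (mem_ball_zero_iff.1 hτ)

theorem cauchyKernel_apply {τ : ℂ} (hτ : τ ∈ ball (0 : ℂ) 1) (θ : ℝ) :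
    cauchyKernel τ θ = circ θ / (circ θ - τ) := by
  have hu : IsUnit (1 - τ • conjCirc) := (Units.oneSub _ (norm_smul_conjCirc_lt hτ)).isUnit
  have h1 := congrArg (fun f : BoundedContinuousFunction ℝ ℂ => f θ) (Ring.mul_inverse_cancel _ hu)
  have h2 : (1 - τ * (starRingEnd ℂ) (circ θ)) * cauchyKernel τ θ = 1 := h1
  have h0 := circ_sub_ne_zero (mem_ball_zero_iff.1 hτ) θ
  rw [eq_div_iff h0]
  linear_combination circ θ * h2 + τ * cauchyKernel τ θ * circ_mul_conj θ

theorem contDiffAt_cauchyKernel {n : WithTop ℕ∞} {τ : ℂ} (hτ : τ ∈ ball (0 : ℂ) 1) :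
    ContDiffAt ℝ n cauchyKernel τ := by
  have hu : IsUnit (1 - τ • conjCirc) := (Units.oneSub _ (norm_smul_conjCirc_lt hτ)).isUnit
  obtain ⟨u, hu⟩ := hu
  have h1 : ContDiffAt ℝ n (fun τ : ℂ => 1 - τ • conjCirc) τ :=
    contDiffAt_const.sub
      (((ContinuousLinearMap.toSpanSingleton ℂ conjCirc).restrictScalars ℝ).contDiff.contDiffAt)
  have h2 : ContDiffAt ℝ n (Ring.inverse : BoundedContinuousFunction ℝ ℂ → _)
      (1 - τ • conjCirc) := by
    rw [← hu]; exact contDiffAt_ringInverse ℝ u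
  exact h2.comp τ h1

variable {E : Type} [NormedAddCommGroup E] [InnerProductSpace ℂ E] [FiniteDimensional ℂ E]
  [CompleteSpace E] {a : ℝ} [ha : HExp a]

/-- Scalar multiplication as a real bilinear map. -/
noncomputable def smulBilin (E : Type) [NormedAddCommGroup E] [InnerProductSpace ℂ E] :
    ℂ →L[ℝ] E →L[ℝ] E :=
  (ContinuousLinearMap.restrictScalarsL ℂ E E ℝ ℝ).comp
    ((ContinuousLinearMap.lsmul ℂ ℂ : ℂ →L[ℂ] E →L[ℂ] E).restrictScalars ℝ)

theorem smulBilin_apply (c : ℂ) (x : E) : smulBilin E c x = c • x := rfl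

/-- Square integrable functions on one period, as a real Banach space. -/
def SqInt (E : Type) [NormedAddCommGroup E] : Type := Lp E 2 periodMeasure

noncomputable instance (E : Type) [NormedAddCommGroup E] : NormedAddCommGroup (SqInt E) :=
  inferInstanceAs (NormedAddCommGroup (Lp E 2 periodMeasure))

noncomputable instance (E : Type) [NormedAddCommGroup E] [NormedSpace ℝ E] :
    NormedSpace ℝ (SqInt E) :=
  inferInstanceAs (NormedSpace ℝ (Lp E 2 periodMeasure))

instance (E : Type) [NormedAddCommGroup E] [CompleteSpace E] : CompleteSpace (SqInt E) :=
  inferInstanceAs (CompleteSpace (Lp E 2 periodMeasure))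

/-- The class of a bounded continuous function. -/
noncomputable def Bd.toSqInt (E : Type) [NormedAddCommGroup E] [NormedSpace ℝ E] :
    Bd ℝ E →L[ℝ] SqInt E := Bd.toL2 E

/-- The class of a Hölder function. -/
noncomputable def HSp.toSqInt (a : ℝ) [HExp a] (E : Type) [NormedAddCommGroup E]
    [InnerProductSpace ℂ E] : HSp (chordHolder a) E →L[ℝ] SqInt E :=
  (Bd.toSqInt E).comp (HSp.toBd a)

/-- Multiplication by bounded continuous functions. -/
noncomputable def SqInt.mul (E : Type) [NormedAddCommGroup E] [NormedSpace ℝ E] :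
    Bd ℝ (E →L[ℝ] E) →L[ℝ] SqInt E →L[ℝ] SqInt E := Bd.mulL2 E

theorem SqInt.norm_mul_le {E : Type} [NormedAddCommGroup E] [NormedSpace ℝ E]
    (A : Bd ℝ (E →L[ℝ] E)) : ‖SqInt.mul E A‖ ≤ ‖A‖ := Bd.norm_mulL2_le A

theorem SqInt.mul_toSqInt {E : Type} [NormedAddCommGroup E] [NormedSpace ℝ E]
    (A : Bd ℝ (E →L[ℝ] E)) (f : Bd ℝ E) :
    SqInt.mul E A (Bd.toSqInt E f) = Bd.toSqInt E (Bd.applyL ℝ E E A f) := Bd.mulL2_toL2 A f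

/-- Twice the imaginary unit times the projection to boundary values of holomorphic functions. -/
noncomputable def SqInt.proj (a : ℝ) [HExp a] (E : Type) [NormedAddCommGroup E]
    [InnerProductSpace ℂ E] [FiniteDimensional ℂ E] [CompleteSpace E] : SqInt E →L[ℝ] SqInt E :=
  (((2 * Complex.I) • (hardySpace a E).starProjection : Lp E 2 periodMeasure →L[ℂ]
    Lp E 2 periodMeasure).restrictScalars ℝ : Lp E 2 periodMeasure →L[ℝ] Lp E 2 periodMeasure)

theorem SqInt.norm_proj_apply_le (x : SqInt E) : ‖SqInt.proj a E x‖ ≤ 2 * ‖x‖ := by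
  have h := (hardySpace a E).starProjection_norm_le
  have h1 : ‖((2 * Complex.I) • (hardySpace a E).starProjection : Lp E 2 periodMeasure →L[ℂ]
    Lp E 2 periodMeasure)‖ ≤ 2 := by
    rw [norm_smul]
    simpa using h
  exact ContinuousLinearMap.le_of_opNorm_le _ h1 x

/-- The pairing of square integrable functions. -/
noncomputable def SqInt.pair (E : Type) [NormedAddCommGroup E] [InnerProductSpace ℂ E]
    [CompleteSpace E] : SqInt ℂ →L[ℝ] SqInt E →L[ℝ] E :=
  (smulBilin E).lpPairing periodMeasure 2 2

/-- The class of a bounded continuous function. -/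
noncomputable def toSqIntC : BoundedContinuousFunction ℝ ℂ →L[ℝ] SqInt ℂ :=
  BoundedContinuousFunction.toLp 2 periodMeasure ℝ

theorem SqInt.pair_cauchyKernel (f : HSp (chordHolder a) E) {τ : ℂ} (hτ : τ ∈ ball (0 : ℂ) 1) :
    (2 * Real.pi)⁻¹ • SqInt.pair E (toSqIntC (cauchyKernel τ)) (HSp.toSqInt a E f) =
      cauchyExt f τ := by
  rw [cauchyExt_of_mem f.continuous_chord hτ, cauchy]
  have h0 : SqInt.pair E (toSqIntC (cauchyKernel τ)) (HSp.toSqInt a E f) =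
      ∫ θ, smulBilin E (BoundedContinuousFunction.toLp 2 periodMeasure ℝ (cauchyKernel τ) θ)
        (HSp.toL2 a E f θ) ∂periodMeasure :=
    ContinuousLinearMap.lpPairing_eq_integral _ _ _
  have h3 : (fun θ => smulBilin E (BoundedContinuousFunction.toLp 2 periodMeasure ℝ
      (cauchyKernel τ) θ) (HSp.toL2 a E f θ))
      =ᵐ[periodMeasure] fun θ => (circ θ / (circ θ - τ)) • f θ := by
    filter_upwards [BoundedContinuousFunction.coeFn_toLp 2 periodMeasure ℝ (cauchyKernel τ),
      f.coeFn_toL2] with θ h4 h5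
    rw [smulBilin_apply, h4, h5, cauchyKernel_apply hτ]
  rw [h0, integral_congr_ae h3, integral_periodMeasure, smul_smul,
    inv_mul_cancel₀ (by positivity), one_smul]

/-- Joint smoothness of Cauchy integrals in the parameter and the point. -/
theorem contDiffAt_cauchyExt {n : WithTop ℕ∞} {Z : ℝ → HSp (chordHolder a) E} {η : ℝ}
    (hZ : ContDiffAt ℝ n (fun η => HSp.toSqInt a E (Z η)) η) {τ : ℂ} (hτ : τ ∈ ball (0 : ℂ) 1) :
    ContDiffAt ℝ n (fun p : ℝ × ℂ => cauchyExt (Z p.1) p.2) (η, τ) := by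
  have h2 : ContDiffAt ℝ n (fun p : ℝ × ℂ => cauchyKernel p.2) (η, τ) :=
    ContDiffAt.comp (g := cauchyKernel) (f := Prod.snd) (η, τ) (contDiffAt_cauchyKernel hτ)
      contDiffAt_snd
  have h3 : ContDiffAt ℝ n (fun p : ℝ × ℂ => SqInt.pair E (toSqIntC (cauchyKernel p.2)))
      (η, τ) :=
    ((SqInt.pair E).contDiff.comp toSqIntC.contDiff).contDiffAt.comp (η, τ) h2
  have h4 : ContDiffAt ℝ n (fun p : ℝ × ℂ => HSp.toSqInt a E (Z p.1)) (η, τ) :=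
    ContDiffAt.comp (f := Prod.fst) (η, τ) hZ contDiffAt_fst
  refine ((h3.clm_apply h4).const_smul (2 * Real.pi)⁻¹).congr_of_eventuallyEq ?_
  have h2 : ∀ᶠ p : ℝ × ℂ in 𝓝 (η, τ), p.2 ∈ ball (0 : ℂ) 1 :=
    continuousAt_snd.eventually (isOpen_ball.mem_nhds hτ)
  filter_upwards [h2] with p hp
  exact (SqInt.pair_cauchyKernel (Z p.1) hp).symm

end Kernel

end SquareIntegrable

/-! ### One more derivative in the parameter, gained in L² -/

section Smoothing

variable {E : Type} [NormedAddCommGroup E] [InnerProductSpace ℂ E] [FiniteDimensional ℂ E]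
  [FiniteDimensional ℝ E] [CompleteSpace E] {a : ℝ} [ha : HExp a]

/-- Multiplication by `2i`. -/
noncomputable def twoI (E : Type) [NormedAddCommGroup E] [InnerProductSpace ℂ E] : E →L[ℝ] E :=
  ((2 * Complex.I) • (1 : E →L[ℂ] E)).restrictScalars ℝ

@[simp] theorem twoI_apply (x : E) : twoI E x = (2 * Complex.I) • x := rfl

/-- The Cauchy integral, multiplied by `2i`, on Hölder functions. -/
noncomputable def HSp.bishop (a : ℝ) [HExp a] (E : Type) [NormedAddCommGroup E]
    [InnerProductSpace ℂ E] [CompleteSpace E] :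
    HSp (chordHolder a) E →L[ℝ] HSp (chordHolder a) E :=
  (HSp.map (twoI E)).comp HSp.cauchyL

/-- The Cauchy integral, multiplied by `2i`, on `F^{2,a}`. -/
noncomputable def FSp.bishop (a : ℝ) [HExp a] (E : Type) [NormedAddCommGroup E]
    [InnerProductSpace ℂ E] [FiniteDimensional ℝ E] [CompleteSpace E] :
    FSp a E →L[ℝ] FSp a E :=
  (FSp.map (twoI E)).comp FSp.cauchyL

theorem HSp.bishop_apply (f : HSp (chordHolder a) E) (θ : ℝ) :
    HSp.bishop a E f θ = (2 * Complex.I) • cauchyExt f (circ θ) := rfl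

theorem FSp.toHSp_bishop (f : FSp a E) :
    FSp.toHSp (FSp.bishop a E f) = HSp.bishop a E (FSp.toHSp f) := rfl

theorem HSp.toSqInt_bishop (f : HSp (chordHolder a) E) :
    HSp.toSqInt a E (HSp.bishop a E f) = SqInt.proj a E (HSp.toSqInt a E f) := by
  have h1 : HSp.toL2 a E (HSp.bishop a E f) =
      (2 * Complex.I) • HSp.toL2 a E (HSp.cauchyL f) := by
    refine MeasureTheory.Lp.ext ?_
    filter_upwards [(HSp.bishop a E f).coeFn_toL2, (HSp.cauchyL f).coeFn_toL2,
      MeasureTheory.Lp.coeFn_smul (2 * Complex.I) (HSp.toL2 a E (HSp.cauchyL f))] with θ h1 h2 h3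
    rw [h1, h3, Pi.smul_apply, h2]
    rfl
  refine Eq.trans h1 ?_
  rw [← starProjection_hardySpace]
  rfl

variable {W : Type} [NormedAddCommGroup W] [NormedSpace ℝ W] [FiniteDimensional ℝ W]

/-- Solutions of a Bishop equation, smooth of order `N` in a Hölder space, are smooth of order
`N + 1` in the space of square integrable functions. -/
theorem eventually_contDiffAt_toSqInt {N : ℕ} (hN : 1 ≤ N) {g : W → E} (hg1 : ContDiff ℝ 1 g)
    (hg : ContDiff ℝ (N + 1) g) (c₀ c₁ : HSp (chordHolder a) W) (J : E →L[ℝ] W)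
    {Z : ℝ → HSp (chordHolder a) E}
    (hZ : ∀ᶠ η in 𝓝 0, ContDiffAt ℝ N Z η ∧
      Z η = HSp.bishop a E (HSp.nem hg1 (c₀ + η • c₁ + HSp.map J (Z η))))
    (hs : ∀ θ, ‖(fderiv ℝ g (c₀ θ + J (Z 0 θ))).comp J‖ ≤ 1 / 4) :
    ∀ᶠ η in 𝓝 0, ContDiffAt ℝ (N + 1) (fun η => HSp.toSqInt a E (Z η)) η := by
  have hN0 : ((N : ℕ) : WithTop ℕ∞) ≠ 0 := by simpa using (by omega : N ≠ 0)
  have hdg : ContDiff ℝ N (fderiv ℝ g) := hg.fderiv_right le_rfl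
  have hdJ : ContDiff ℝ N (fun x => (fderiv ℝ g x).comp J) := hdg.clm_comp contDiff_const
  let w : ℝ → HSp (chordHolder a) W := fun η => c₀ + η • c₁ + HSp.map J (Z η)
  -- `A` and `b` are the derivatives of the right-hand side in Z and in η. Only their supremum norms
  -- matter, and there composition with the C^N map `fderiv ℝ g` loses no derivative.
  let A : ℝ → Bd ℝ (E →L[ℝ] E) := fun η => Bd.nem hdJ.continuous (HSp.toBd a (w η))
  let b : ℝ → Bd ℝ E := fun η =>
    Bd.applyL ℝ W E (Bd.nem hdg.continuous (HSp.toBd a (w η))) (HSp.toBd a c₁)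
  have hw : ∀ η, ContDiffAt ℝ N Z η → ContDiffAt ℝ N w η := fun η h =>
    (contDiffAt_const.add (contDiffAt_id.smul contDiffAt_const)).add
      ((HSp.map J).contDiff.contDiffAt.comp η h)
  have hA : ∀ η, ContDiffAt ℝ N Z η → ContDiffAt ℝ N A η := fun η h =>
    (Bd.contDiff_nem N hdJ.continuous hdJ).contDiffAt.comp η
      ((HSp.toBd a).contDiff.contDiffAt.comp η (hw η h))
  have hb : ∀ η, ContDiffAt ℝ N Z η → ContDiffAt ℝ N b η := fun η h =>
    ((Bd.applyL ℝ W E).contDiff.contDiffAt.comp η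
      ((Bd.contDiff_nem N hdg.continuous hdg).contDiffAt.comp η
      ((HSp.toBd a).contDiff.contDiffAt.comp η (hw η h)))).clm_apply contDiffAt_const
  have hA0 : ‖A 0‖ < 1 / 3 := by
    refine lt_of_le_of_lt ((Bd.norm_le (by norm_num : (0 : ℝ) ≤ 1 / 4)).2 fun θ => ?_) (by norm_num)
    have : w 0 θ = c₀ θ + J (Z 0 θ) := by simp [w]
    change ‖(fderiv ℝ g (w 0 θ)).comp J‖ ≤ _
    rw [this]; exact hs θ
  have hAc : ∀ᶠ η in 𝓝 0, ‖A η‖ < 1 / 3 :=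
    (hA 0 hZ.self_of_nhds.1).continuousAt.norm.eventually_lt continuousAt_const hA0
  have hnem : ContDiff ℝ N (HSp.nem hg1 : HSp (chordHolder a) W → HSp (chordHolder a) E) :=
    HSp.contDiff_nem N hg1 hg
  -- `SqInt.proj` is 2i times an orthogonal projection and has norm at most 2, so the bound 1/3
  -- allows a Neumann series.
  have hsmall : ∀ η, ‖A η‖ < 1 / 3 → ‖(SqInt.proj a E).comp (SqInt.mul E (A η))‖ < 1 := by
    intro η h
    refine lt_of_le_of_lt (ContinuousLinearMap.opNorm_le_bound _ (by positivity :
      (0 : ℝ) ≤ 2 * (1 / 3)) fun x => ?_) (by norm_num)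
    refine (SqInt.norm_proj_apply_le _).trans ?_
    rw [mul_assoc]
    gcongr
    exact ContinuousLinearMap.le_of_opNorm_le _ ((SqInt.norm_mul_le _).trans h.le) x
  have hderiv : ∀ᶠ η in 𝓝 0, ContDiffAt ℝ N Z η ∧ ‖A η‖ < 1 / 3 ∧
      HSp.toSqInt a E (deriv Z η) = Ring.inverse (1 - (SqInt.proj a E).comp (SqInt.mul E (A η)))
        (SqInt.proj a E (Bd.toSqInt E (b η))) := by
    filter_upwards [hZ.eventually_nhds, hAc] with η hη hAη
    obtain ⟨hc, -⟩ := hη.self_of_nhds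
    refine ⟨hc, hAη, ?_⟩
    have d1 : HasDerivAt Z (deriv Z η) η := (hc.differentiableAt hN0).hasDerivAt
    have d2 : HasDerivAt w (c₁ + HSp.map J (deriv Z η)) η := by
      have h1 : HasDerivAt (fun η : ℝ => c₀ + η • c₁) c₁ η := by
        simpa using ((hasDerivAt_id η).smul_const c₁).const_add c₀
      exact h1.add ((HSp.map J).hasFDerivAt.comp_hasDerivAt η d1)
    have d3 : HasDerivAt (fun η => HSp.bishop a E (HSp.nem hg1 (w η)))
        (HSp.bishop a E (fderiv ℝ (HSp.nem hg1) (w η) (c₁ + HSp.map J (deriv Z η)))) η :=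
      (HSp.bishop a E).hasFDerivAt.comp_hasDerivAt η
        ((hnem.differentiable hN0 (w η)).hasFDerivAt.comp_hasDerivAt η d2)
    have d4 := d3.congr_of_eventuallyEq (f₁ := Z) (hη.mono fun η h => h.2)
    have d5 := d1.unique d4
    have d6 : HSp.toBd a (fderiv ℝ (HSp.nem hg1) (w η) (c₁ + HSp.map J (deriv Z η))) =
        Bd.applyL ℝ E E (A η) (HSp.toBd a (deriv Z η)) + b η := by
      ext θ
      have := fderiv_apply_of_eval (hnem.differentiable hN0 (w η)) (HSp.eval θ) (HSp.eval θ)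
        (hg1.differentiable (by simp) (w η θ)) (fun _ => rfl) (c₁ + HSp.map J (deriv Z η))
      refine this.trans ?_
      simp only [HSp.eval_apply, HSp.map_apply, map_add]
      rw [add_comm]
      rfl
    -- The differentiated equation read in L². It is linear in the derivative of Z and can be solved
    -- for it.
    have d7 : HSp.toSqInt a E (deriv Z η) =
        SqInt.proj a E (SqInt.mul E (A η) (HSp.toSqInt a E (deriv Z η)) +
          Bd.toSqInt E (b η)) := by
      conv_lhs => rw [d5]
      rw [HSp.toSqInt_bishop]
      congr 1
      change Bd.toSqInt E (HSp.toBd a _) = _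
      rw [d6, map_add, ← SqInt.mul_toSqInt]
      rfl
    have hu : IsUnit (1 - (SqInt.proj a E).comp (SqInt.mul E (A η))) :=
      (Units.oneSub _ (hsmall η hAη)).isUnit
    have d8 : (1 - (SqInt.proj a E).comp (SqInt.mul E (A η))) (HSp.toSqInt a E (deriv Z η)) =
        SqInt.proj a E (Bd.toSqInt E (b η)) := by
      rw [_root_.sub_apply, one_apply_eq_self, ContinuousLinearMap.comp_apply,
        sub_eq_iff_eq_add', ← map_add]
      exact d7
    rw [← d8, ← mul_apply_eq_comp, Ring.inverse_mul_cancel _ hu,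
      one_apply_eq_self]
  obtain ⟨U, hU, hUo, h0⟩ := _root_.eventually_nhds_iff.1 hderiv
  filter_upwards [hUo.mem_nhds h0] with η hη
  have hsucc : ContDiffOn ℝ (N + 1) (fun η => HSp.toSqInt a E (Z η)) U := by
    have hd : ∀ η ∈ U, HasDerivAt (fun η => HSp.toSqInt a E (Z η))
        (HSp.toSqInt a E (deriv Z η)) η := fun η hη =>
      (HSp.toSqInt a E).hasFDerivAt.comp_hasDerivAt η
        (((hU η hη).1.differentiableAt hN0).hasDerivAt)
    rw [contDiffOn_succ_iff_deriv_of_isOpen hUo]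
    refine ⟨fun η hη => (hd η hη).differentiableAt.differentiableWithinAt, by simp, ?_⟩
    -- The solved form uses only `A` and `b`, both of class C^N, so the derivative is C^N with
    -- values in L² and Z is C^{N + 1} there.
    refine ContDiffOn.congr (f := fun η => Ring.inverse (1 - (SqInt.proj a E).comp
      (SqInt.mul E (A η))) (SqInt.proj a E (Bd.toSqInt E (b η)))) (fun η hη => ?_)
      fun η hη => by rw [(hd η hη).deriv]; exact (hU η hη).2.2
    obtain ⟨hc, hAη, -⟩ := hU η hη
    have e1 : ContDiffAt ℝ N (fun η => 1 - (SqInt.proj a E).comp (SqInt.mul E (A η))) η :=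
      contDiffAt_const.sub (contDiffAt_const.clm_comp
        ((SqInt.mul E).contDiff.contDiffAt.comp η (hA η hc)))
    have e2 : ContDiffAt ℝ N (Ring.inverse : (SqInt E →L[ℝ] SqInt E) → _)
        (1 - (SqInt.proj a E).comp (SqInt.mul E (A η))) :=
      contDiffAt_ringInverse ℝ (Units.oneSub _ (hsmall η hAη))
    have e3 : ContDiffAt ℝ N (fun η => SqInt.proj a E (Bd.toSqInt E (b η))) η :=
      ((SqInt.proj a E).comp (Bd.toSqInt E)).contDiff.contDiffAt.comp η (hb η hc)
    have e4 : ContDiffAt ℝ N (fun η => Ring.inverse (1 - (SqInt.proj a E).comp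
        (SqInt.mul E (A η)))) η :=
      ContDiffAt.comp (g := Ring.inverse) η e2 e1
    exact (e4.clm_apply e3).contDiffWithinAt
  exact hsucc.contDiffAt (hUo.mem_nhds hη)

end Smoothing

/-! ### Perturbed Bishop equations in all three function spaces -/

section Family

variable {E : Type} [NormedAddCommGroup E] [InnerProductSpace ℂ E] [FiniteDimensional ℂ E]
  [FiniteDimensional ℝ E] [CompleteSpace E] {a : ℝ} [ha : HExp a]
variable {X : Type} [NormedAddCommGroup X] [NormedSpace ℝ X] [FiniteDimensional ℝ X]
  [CompleteSpace X]

/-- A constant function in `F^{2,a}`. -/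
noncomputable def FSp.const (a : ℝ) [HExp a] (c : X) : FSp a X :=
  (exists_fSp_of_contDiff (a := a) (σ := fun _ => c) contDiff_const fun _ => rfl).choose

@[simp] theorem FSp.const_apply (c : X) (θ : ℝ) : FSp.const a c θ = c :=
  (exists_fSp_of_contDiff (a := a) (σ := fun _ => c) contDiff_const fun _ => rfl).choose_spec θ

/-- The embedding of the last factor. -/
noncomputable def lastInr (X E : Type) [NormedAddCommGroup X] [NormedSpace ℝ X]
    [NormedAddCommGroup E] [NormedSpace ℝ E] : E →L[ℝ] X × ℝ × E :=
  (ContinuousLinearMap.inr ℝ X (ℝ × E)).comp (ContinuousLinearMap.inr ℝ ℝ E)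

@[simp] theorem lastInr_apply (e : E) : lastInr X E e = (0, 0, e) := rfl

/-- The total right-hand side of a perturbed Bishop equation. -/
def perturbed (G : X × E → E) (K : X × ℝ × E → E) (p : X × ℝ × E) : E := G (p.1, p.2.2) + K p

theorem contDiff_perturbed {n : WithTop ℕ∞} {G : X × E → E} {K : X × ℝ × E → E}
    (hG : ContDiff ℝ n G) (hK : ContDiff ℝ n K) : ContDiff ℝ n (perturbed G K) :=
  (hG.comp (contDiff_fst.prodMk (contDiff_snd.comp contDiff_snd))).add hK

/-- `K` vanishes identically at parameter 0 and so has no derivative in the last variable there; the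
smallness conditions concern the unperturbed equation only. -/
theorem fderiv_perturbed_inr {G : X × E → E} {K : X × ℝ × E → E} (hG : ContDiff ℝ 1 G)
    (hK : ContDiff ℝ 1 K) (hK0 : ∀ x e, K (x, 0, e) = 0) (x : X) :
    (fderiv ℝ (perturbed G K) (x, 0, 0)).comp (lastInr X E) =
      (fderiv ℝ G (x, 0)).comp (ContinuousLinearMap.inr ℝ X E) := by
  have h1 : HasFDerivAt (fun e : E => perturbed G K (x, 0, e))
      ((fderiv ℝ (perturbed G K) (x, 0, 0)).comp (lastInr X E)) 0 := by
    have h2 : HasFDerivAt (fun e : E => (x, (0 : ℝ), e)) (lastInr X E) 0 := by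
      have := (lastInr X E).hasFDerivAt (x := 0) |>.const_add (x, (0 : ℝ), (0 : E))
      simpa using this
    exact HasFDerivAt.comp (0 : E) (((contDiff_perturbed hG hK).differentiable (by simp)
      (x, 0, 0)).hasFDerivAt) h2
  have h2 : HasFDerivAt (fun e : E => perturbed G K (x, 0, e))
      ((fderiv ℝ G (x, 0)).comp (ContinuousLinearMap.inr ℝ X E)) 0 := by
    simp only [perturbed, hK0, add_zero]
    exact HasFDerivAt.comp (0 : E) ((hG.differentiable (by simp) (x, 0)).hasFDerivAt)
      (hasFDerivAt_prodMk_right x (0 : E))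
  exact h1.unique h2

/-- Solution of perturbed Bishop equations, with smooth dependence on the parameter. -/
theorem eventually_exists_bishop_family (n : ℕ) {G : X × E → E} (hG : ContDiff ℝ (n + 4 : ℕ) G)
    (hG0 : ∀ x, G (x, 0) = 0) (u₀ : FSp a X) (hd : ∀ θ v, fderiv ℝ G (u₀ θ, 0) (0, v) = 0) :
    ∀ᶠ u in 𝓝 u₀, ∀ K : X × ℝ × E → E, ContDiff ℝ (n + 4 : ℕ) K → (∀ x e, K (x, 0, e) = 0) →
      ∃ Z : ℝ → FSp a E, Z 0 = 0 ∧
        (∀ᶠ η in 𝓝 0, ContDiffAt ℝ (n + 1 : ℕ) Z η ∧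
          (∃ f : FSp a E, (∀ θ, f θ = perturbed G K (u θ, η, Z η θ)) ∧ Z η = FSp.bishop a E f) ∧
          ContDiffAt ℝ (n + 4 : ℕ) (fun η => HSp.toSqInt a E (FSp.toHSp (Z η))) η) ∧
        ∃ f : FSp a E, (∀ θ, f θ = fderiv ℝ (perturbed G K) (u θ, 0, 0) (0, 1, deriv Z 0 θ)) ∧
          deriv Z 0 = FSp.bishop a E f := by
  have hG3 : ContDiff ℝ 3 G := hG.of_le (by norm_cast; omega)
  have hG1 : ContDiff ℝ 1 G := hG.of_le (by norm_cast; omega)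
  have hdG : Continuous (fderiv ℝ G) := hG1.continuous_fderiv (by simp)
  let NF : FSp a X × FSp a E → FSp a E := fun p =>
    FSp.nem hG3 (FSp.map (ContinuousLinearMap.inl ℝ X E) p.1 +
      FSp.map (ContinuousLinearMap.inr ℝ X E) p.2)
  let NH : HSp (chordHolder a) X × HSp (chordHolder a) E → HSp (chordHolder a) E := fun p =>
    HSp.nem hG1 (HSp.map (ContinuousLinearMap.inl ℝ X E) p.1 +
      HSp.map (ContinuousLinearMap.inr ℝ X E) p.2)
  have hNFa : ∀ p θ, NF p θ = G (p.1 θ, p.2 θ) := fun p θ => by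
    change G ((p.1 θ, 0) + (0, p.2 θ)) = _
    simp
  have hNHa : ∀ p θ, NH p θ = G (p.1 θ, p.2 θ) := fun p θ => by
    change G ((p.1 θ, 0) + (0, p.2 θ)) = _
    simp
  have hNF : ContDiff ℝ (n + 1 : ℕ) NF := (FSp.contDiff_nem (n + 1) hG3 hG).comp
    (((FSp.map _).contDiff.comp contDiff_fst).add ((FSp.map _).contDiff.comp contDiff_snd))
  have hNH : ContDiff ℝ (n + 3 : ℕ) NH := (HSp.contDiff_nem (n + 3) hG1
    (by exact_mod_cast hG)).comp
    (((HSp.map _).contDiff.comp contDiff_fst).add ((HSp.map _).contDiff.comp contDiff_snd))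
  -- The equation is solved twice, with n + 1 derivatives in F^{2,a} and with n + 3 in the Hölder
  -- space. Local uniqueness in the Hölder space identifies the two solutions.
  have hF := eventually_exists_curve (n := n + 1) (by omega) (FSp.bishop a E) hNF
    (fun u => FSp.ext fun θ => by rw [hNFa]; exact hG0 _) u₀ (fun v => FSp.ext fun θ => by
      have := fderiv_apply_of_eval (hNF.differentiable (by simp) (u₀, 0))
        (((FSp.eval θ : FSp a X →L[ℝ] X)).prodMap (FSp.eval θ)) (FSp.eval θ)
        (hG1.differentiable (by simp) _) (fun p => hNFa p θ) (0, v)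
      exact this.trans (hd θ (v θ)))
  have hH := (FSp.toHSp (a := a) (E := X)).continuous.continuousAt.eventually
    (eventually_exists_curve (n := n + 3) (by omega) (HSp.bishop a E) hNH
    (fun u => HSp.ext fun θ => by rw [hNHa]; exact hG0 _) (FSp.toHSp u₀)
    (fun v => HSp.ext fun θ => by
      have := fderiv_apply_of_eval (hNH.differentiable (by simp) (FSp.toHSp u₀, 0))
        (((HSp.eval θ : HSp (chordHolder a) X →L[ℝ] X)).prodMap (HSp.eval θ)) (HSp.eval θ)
        (hG1.differentiable (by simp) _) (fun p => hNHa p θ) (0, v)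
      exact this.trans (hd θ (v θ))))
  have hcS : Continuous fun x : X => (fderiv ℝ G (x, 0)).comp (ContinuousLinearMap.inr ℝ X E) :=
    (hdG.comp (Continuous.prodMk_left (0 : E))).clm_comp continuous_const
  -- The third smallness condition on u is the bound 1/4 required by the gain of a derivative in L².
  have hS : ∀ᶠ u : FSp a X in 𝓝 u₀, ‖Bd.nem hcS (HSp.toBd a (FSp.toHSp u))‖ < 1 / 4 := by
    have h1 : Continuous fun u : FSp a X => ‖Bd.nem hcS (HSp.toBd a (FSp.toHSp u))‖ :=
      ((Bd.continuous_nem hcS).comp ((HSp.toBd a).continuous.comp FSp.toHSp.continuous)).norm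
    refine h1.continuousAt.eventually_lt continuousAt_const ?_
    have : Bd.nem hcS (HSp.toBd a (FSp.toHSp u₀)) = 0 := by
      ext θ v
      exact hd θ v
    rw [this, norm_zero]; norm_num
  filter_upwards [hF, hH, hS] with u hF hH hS K hK hK0
  have hK3 : ContDiff ℝ 3 K := hK.of_le (by norm_cast; omega)
  have hK1 : ContDiff ℝ 1 K := hK.of_le (by norm_cast; omega)
  let κ : FSp a (X × ℝ × E) := FSp.const a (0, 1, 0)
  let c₀ : FSp a (X × ℝ × E) := FSp.map (ContinuousLinearMap.inl ℝ X (ℝ × E)) u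
  let wF : ℝ × FSp a E → FSp a (X × ℝ × E) := fun p => c₀ + p.1 • κ + FSp.map (lastInr X E) p.2
  let wH : ℝ × HSp (chordHolder a) E → HSp (chordHolder a) (X × ℝ × E) := fun p =>
    FSp.toHSp c₀ + p.1 • FSp.toHSp κ + HSp.map (lastInr X E) p.2
  have hwFa : ∀ p θ, wF p θ = (u θ, p.1, p.2 θ) := fun p θ => by
    change (u θ, (0 : ℝ × E)) + p.1 • κ θ + (0, 0, p.2 θ) = _
    rw [FSp.const_apply]
    ext <;> simp
  have hwHa : ∀ p θ, wH p θ = (u θ, p.1, p.2 θ) := fun p θ => by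
    change (u θ, (0 : ℝ × E)) + p.1 • κ θ + (0, 0, p.2 θ) = _
    rw [FSp.const_apply]
    ext <;> simp
  have hwF : ContDiff ℝ (n + 1 : ℕ) wF := (contDiff_const.add
    (contDiff_fst.smul contDiff_const)).add ((FSp.map _).contDiff.comp contDiff_snd)
  have hwH : ContDiff ℝ (n + 3 : ℕ) wH := (contDiff_const.add
    (contDiff_fst.smul contDiff_const)).add ((HSp.map _).contDiff.comp contDiff_snd)
  obtain ⟨ZF, hZF0, hZF, -⟩ := hF (fun p => FSp.nem hK3 (wF p))
    ((FSp.contDiff_nem (n + 1) hK3 hK).comp hwF)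
    (fun Z => FSp.ext fun θ => by rw [FSp.nem_apply, hwFa]; exact hK0 _ _)
  obtain ⟨ZH, hZH0, hZH, huniq⟩ := hH (fun p => HSp.nem hK1 (wH p))
    ((HSp.contDiff_nem (n + 3) hK1 (by exact_mod_cast hK)).comp hwH)
    (fun Z => HSp.ext fun θ => by rw [HSp.nem_apply, hwHa]; exact hK0 _ _)
  have hcF : ContinuousAt ZF 0 := hZF.self_of_nhds.1.continuousAt
  have heq : ∀ᶠ η in 𝓝 0, FSp.toHSp (ZF η) = ZH η := by
    have ht : Tendsto (fun η => (η, FSp.toHSp (ZF η))) (𝓝 0)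
        (𝓝 (0 : ℝ × HSp (chordHolder a) E)) := by
      have h1 : ContinuousAt (fun η : ℝ => (η, FSp.toHSp (ZF η))) 0 :=
        continuousAt_id.prodMk (FSp.toHSp.continuous.continuousAt.comp hcF)
      have h2 : ((0 : ℝ), FSp.toHSp (ZF 0)) = (0 : ℝ × HSp (chordHolder a) E) := by
        rw [hZF0, map_zero]; rfl
      rw [← h2]; exact h1
    filter_upwards [ht.eventually huniq, hZF] with η h1 h2
    refine h1 ?_
    have h3 := congrArg FSp.toHSp h2.2
    refine h3.trans ?_
    rw [FSp.toHSp_bishop]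
    congr 1
  have hg : ContDiff ℝ (n + 4 : ℕ) (perturbed G K) := contDiff_perturbed hG hK
  have hg1 : ContDiff ℝ 1 (perturbed G K) := contDiff_perturbed hG1 hK1
  have hg3 : ContDiff ℝ 3 (perturbed G K) := contDiff_perturbed hG3 hK3
  have hsm := eventually_contDiffAt_toSqInt (N := n + 3) (by omega) hg1 (by exact_mod_cast hg)
    (FSp.toHSp c₀) (FSp.toHSp κ) (lastInr X E) (Z := ZH) (by
      filter_upwards [hZH] with η h
      refine ⟨h.1, h.2.trans ?_⟩
      congr 1
      refine HSp.ext fun θ => ?_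
      change NH _ θ + HSp.nem hK1 _ θ = perturbed G K (wH (η, ZH η) θ)
      rw [hNHa, HSp.nem_apply, hwHa]
      rfl) (fun θ => by
      have h1 : FSp.toHSp c₀ θ + lastInr X E (ZH 0 θ) = (u θ, 0, 0) := by
        rw [hZH0]
        change (u θ, (0 : ℝ × E)) + (0, 0, 0) = _
        ext <;> simp
      rw [h1, fderiv_perturbed_inr hG1 hK1 hK0]
      exact (Bd.norm_apply_le _ θ).trans hS.le)
  have heqF : ∀ᶠ η in 𝓝 0, ZF η = FSp.bishop a E (FSp.nem hg3 (wF (η, ZF η))) := by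
    filter_upwards [hZF] with η h
    refine h.2.trans ?_
    congr 1
    refine FSp.ext fun θ => ?_
    change NF _ θ + FSp.nem hK3 _ θ = perturbed G K (wF (η, ZF η) θ)
    rw [hNFa, FSp.nem_apply, hwFa]
    rfl
  refine ⟨ZF, hZF0, ?_, ?_⟩
  · filter_upwards [hZF, heqF, hsm, heq.eventually_nhds] with η h1 h2 h3 h4
    refine ⟨h1.1, ⟨_, fun θ => ?_, h2⟩, ?_⟩
    · rw [FSp.nem_apply, hwFa]
    · have h5 : ContDiffAt ℝ (n + 4 : ℕ) (fun η => HSp.toSqInt a E (ZH η)) η := by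
        exact_mod_cast h3
      exact h5.congr_of_eventuallyEq (h4.mono fun η h => by simp only [h])
  · have hnem := FSp.contDiff_nem (a := a) (n + 1) hg3 hg
    have d1 : HasDerivAt ZF (deriv ZF 0) 0 :=
      (hZF.self_of_nhds.1.differentiableAt (by simp)).hasDerivAt
    have d2 : HasDerivAt (fun η => wF (η, ZF η)) (κ + FSp.map (lastInr X E) (deriv ZF 0)) 0 := by
      have h1 : HasDerivAt (fun η : ℝ => c₀ + η • κ) κ 0 := by
        simpa using ((hasDerivAt_id (0 : ℝ)).smul_const κ).const_add c₀
      exact h1.add ((FSp.map (lastInr X E)).hasFDerivAt.comp_hasDerivAt (0 : ℝ) d1)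
    have d3' : HasDerivAt (fun η => FSp.nem hg3 (wF (η, ZF η))) (fderiv ℝ (FSp.nem hg3)
        (wF (0, ZF 0)) (κ + FSp.map (lastInr X E) (deriv ZF 0))) 0 :=
      HasFDerivAt.comp_hasDerivAt (f := fun η => wF (η, ZF η)) (0 : ℝ)
        (hnem.differentiable (by simp) (wF (0, ZF 0))).hasFDerivAt d2
    have d3 : HasDerivAt (fun η => FSp.bishop a E (FSp.nem hg3 (wF (η, ZF η))))
        (FSp.bishop a E (fderiv ℝ (FSp.nem hg3) (wF (0, ZF 0))
          (κ + FSp.map (lastInr X E) (deriv ZF 0)))) 0 :=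
      (FSp.bishop a E).hasFDerivAt.comp_hasDerivAt (0 : ℝ) d3'
    refine ⟨_, fun θ => ?_, d1.unique (d3.congr_of_eventuallyEq heqF)⟩
    have := fderiv_apply_of_eval (hnem.differentiable (by simp) (wF (0, ZF 0))) (FSp.eval θ)
      (FSp.eval θ) (hg1.differentiable (by simp) (wF (0, ZF 0) θ)) (fun _ => rfl)
      (κ + FSp.map (lastInr X E) (deriv ZF 0))
    refine this.trans ?_
    have e1 : FSp.eval θ (wF (0, ZF 0)) = (u θ, 0, 0) := by
      rw [FSp.eval_apply, hwFa, hZF0]; rfl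
    have e2 : FSp.eval θ (κ + FSp.map (lastInr X E) (deriv ZF 0)) = (0, 1, deriv ZF 0 θ) := by
      change κ θ + (0, 0, deriv ZF 0 θ) = _
      rw [FSp.const_apply]
      ext <;> simp
    rw [e1, e2]

end Family

/-! ### The right-hand side of the Bishop equation of a graph -/

section RightHandSide

variable {E : Type} [NormedAddCommGroup E] [InnerProductSpace ℂ E] [FiniteDimensional ℂ E]
  [FiniteDimensional ℝ E] [CompleteSpace E] {d m : ℕ} (p : Fin d → E →L[ℂ] ℂ) (b : Fin d → E)

/-- The real part of `(1 - c) ζ`, in coordinates. -/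
noncomputable def shift (c : ℂ) (ζ : E) : Fin d → ℝ := fun l => ((1 - c) * p l ζ).re

/-- The quotient of the real part of `(1 - c) ζ_l` by `1 - c`, for `c` on the unit circle. -/
noncomputable def shiftQuot (c : ℂ) (ζ : E) (l : Fin d) : ℂ :=
  (p l ζ - (starRingEnd ℂ) c * (starRingEnd ℂ) (p l ζ)) / 2

/-- The parameters of a graph at a point of `ℂⁿ`. -/
def par (P : Cn d m) : Par d m := (rePart P, P.2)

/-- Assembling a vector from its coordinates. -/
noncomputable def assemble (v : Fin d → ℂ) : E := ∑ j, v j • b j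

/-- The right-hand side of the Bishop equation of a graph `y = h(x, w)`. -/
noncomputable def graphRhs (h : Par d m → (Fin d → ℝ)) (q : (Cn d m × ℂ) × E) : E :=
  -- On the unit circle this is (h(x + s, w) - h(x, w))/(1 - c), with s given by `shift`. In this
  -- form it is defined and smooth for all c, the point 1 included.
  assemble b fun j => ∑ l, ((hadamard h (par q.1.1 + (shift p q.1.2 q.2, 0), par q.1.1)
    (Pi.single l 1, 0) j : ℝ) : ℂ) * shiftQuot p q.1.2 q.2 l

/-- The right-hand side for a perturbation `K` of the graph, localized by `χ`. -/
noncomputable def bumpRhs (K : Par d m × ℝ → (Fin d → ℝ)) (μ : ℂ → ℂ) (χ : ℂ → ℝ)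
    (q : (Cn d m × ℂ) × ℝ × E) : E :=
  -- The factor μ stands for 1/(1 - c), with which it need agree only where χ is not zero.
  assemble b fun j => μ q.1.2 *
    (K (par q.1.1 + (shift p q.1.2 q.2.2, 0), q.2.1 * χ q.1.2) j : ℝ)

theorem contDiff_par {n : WithTop ℕ∞} : ContDiff ℝ n (par : Cn d m → Par d m) := by
  refine ContDiff.prodMk (contDiff_pi.2 fun j => ?_) contDiff_snd
  exact Complex.reCLM.contDiff.comp ((contDiff_apply ℝ ℂ j).comp contDiff_fst)

variable {Y : Type} [NormedAddCommGroup Y] [NormedSpace ℝ Y] {n : WithTop ℕ∞}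

theorem contDiff_ofReal : ContDiff ℝ n (fun x : ℝ => (x : ℂ)) := Complex.ofRealCLM.contDiff

theorem contDiff_assemble {v : Y → Fin d → ℂ} (hv : ∀ j, ContDiff ℝ n fun y => v y j) :
    ContDiff ℝ n fun y => assemble b (v y) := by
  refine ContDiff.sum fun j _ => ?_
  exact ((ContinuousLinearMap.toSpanSingleton ℂ (b j)).restrictScalars ℝ).contDiff.comp (hv j)

theorem contDiff_coord (l : Fin d) : ContDiff ℝ n fun ζ : E => p l ζ :=
  ((p l).restrictScalars ℝ).contDiff

theorem contDiff_shift {c : Y → ℂ} {ζ : Y → E} (hc : ContDiff ℝ n c) (hζ : ContDiff ℝ n ζ) :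
    ContDiff ℝ n fun y => shift p (c y) (ζ y) := by
  refine contDiff_pi.2 fun l => ?_
  exact Complex.reCLM.contDiff.comp
    ((contDiff_const.sub hc).mul ((contDiff_coord p l).comp hζ))

theorem contDiff_conj {f : Y → ℂ} (hf : ContDiff ℝ n f) :
    ContDiff ℝ n fun y => (starRingEnd ℂ) (f y) :=
  (Complex.conjCLE : ℂ →L[ℝ] ℂ).contDiff.comp hf

theorem contDiff_shiftQuot {c : Y → ℂ} {ζ : Y → E} (hc : ContDiff ℝ n c) (hζ : ContDiff ℝ n ζ)
    (l : Fin d) : ContDiff ℝ n fun y => shiftQuot p (c y) (ζ y) l := by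
  have h1 := (contDiff_coord (n := n) p l).comp hζ
  exact (h1.sub ((contDiff_conj hc).mul (contDiff_conj h1))).div_const 2

theorem contDiff_graphRhs {n : ℕ} {h : Par d m → (Fin d → ℝ)} (hh : ContDiff ℝ (n + 1) h) :
    ContDiff ℝ n (graphRhs p b h) := by
  refine contDiff_assemble b fun j => ContDiff.sum fun l _ => ?_
  have hP : ContDiff ℝ n fun q : (Cn d m × ℂ) × E => par q.1.1 :=
    contDiff_par.comp (contDiff_fst.comp contDiff_fst)
  have hS : ContDiff ℝ n fun q : (Cn d m × ℂ) × E => shift p q.1.2 q.2 :=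
    contDiff_shift p (contDiff_snd.comp contDiff_fst) contDiff_snd
  have hH : ContDiff ℝ n fun q : (Cn d m × ℂ) × E =>
      hadamard h (par q.1.1 + (shift p q.1.2 q.2, 0), par q.1.1) :=
    (contDiff_hadamard hh).comp ((hP.add (hS.prodMk contDiff_const)).prodMk hP)
  exact (contDiff_ofReal.comp ((contDiff_apply ℝ ℝ j).comp (hH.clm_apply contDiff_const))).mul
    (contDiff_shiftQuot p (contDiff_snd.comp contDiff_fst) contDiff_snd l)

theorem contDiff_bumpRhs {K : Par d m × ℝ → (Fin d → ℝ)} {μ : ℂ → ℂ} {χ : ℂ → ℝ}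
    (hK : ContDiff ℝ n K) (hμ : ContDiff ℝ n μ) (hχ : ContDiff ℝ n χ) :
    ContDiff ℝ n (bumpRhs p b K μ χ) := by
  refine contDiff_assemble b fun j => ?_
  have hc : ContDiff ℝ n fun q : (Cn d m × ℂ) × ℝ × E => q.1.2 := contDiff_snd.comp contDiff_fst
  have hP : ContDiff ℝ n fun q : (Cn d m × ℂ) × ℝ × E => par q.1.1 :=
    contDiff_par.comp (contDiff_fst.comp contDiff_fst)
  have hS : ContDiff ℝ n fun q : (Cn d m × ℂ) × ℝ × E => shift p q.1.2 q.2.2 :=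
    contDiff_shift p hc (contDiff_snd.comp contDiff_snd)
  have hKq : ContDiff ℝ n fun q : (Cn d m × ℂ) × ℝ × E =>
      K (par q.1.1 + (shift p q.1.2 q.2.2, 0), q.2.1 * χ q.1.2) :=
    hK.comp ((hP.add (hS.prodMk contDiff_const)).prodMk
      ((contDiff_fst.comp contDiff_snd).mul (hχ.comp hc)))
  exact (hμ.comp hc).mul (contDiff_ofReal.comp ((contDiff_apply ℝ ℝ j).comp hKq))

theorem assemble_zero : assemble b (fun _ => 0) = 0 := by simp [assemble]

theorem real_smul_smul (t : ℝ) (z : ℂ) (x : E) : t • z • x = ((t : ℂ) * z) • x := by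
  rw [← Complex.coe_smul, smul_smul]

theorem shiftQuot_smul (c : ℂ) (t : ℝ) (ζ : E) (l : Fin d) :
    shiftQuot p c (t • ζ) l = t * shiftQuot p c ζ l := by
  have h1 : p l (t • ζ) = t * p l ζ := by
    rw [← Complex.coe_smul, map_smul, smul_eq_mul]
  rw [shiftQuot, h1, map_mul, Complex.conj_ofReal, shiftQuot]
  ring

theorem shift_smul (c : ℂ) (t : ℝ) (ζ : E) : shift p c (t • ζ) = t • shift p c ζ := by
  funext l
  have h1 : p l (t • ζ) = t * p l ζ := by
    rw [← Complex.coe_smul, map_smul, smul_eq_mul]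
  simp only [shift, h1, Pi.smul_apply, smul_eq_mul]
  rw [mul_left_comm, Complex.re_ofReal_mul]

theorem graphRhs_zero (h : Par d m → (Fin d → ℝ)) (x : Cn d m × ℂ) :
    graphRhs p b h (x, 0) = 0 := by
  simp [graphRhs, shiftQuot, assemble_zero]

theorem bumpRhs_zero {K : Par d m × ℝ → (Fin d → ℝ)} (hK : ∀ a, K (a, 0) = 0) (μ : ℂ → ℂ)
    (χ : ℂ → ℝ) (x : Cn d m × ℂ) (ζ : E) : bumpRhs p b K μ χ (x, 0, ζ) = 0 := by
  simp [bumpRhs, hK, assemble_zero]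

/-- The right-hand side of the Bishop equation has vanishing differential over the origin. -/
theorem fderiv_graphRhs_zero {h : Par d m → (Fin d → ℝ)} (hh : ContDiff ℝ 2 h)
    (hh0 : fderiv ℝ h 0 = 0) (c : ℂ) (v : E) :
    fderiv ℝ (graphRhs p b h) (((0 : Cn d m), c), 0) (0, v) = 0 := by
  have hd : ContDiff ℝ 1 (graphRhs p b h) :=
    contDiff_graphRhs (n := 1) p b (by exact_mod_cast hh)
  have h1 : HasDerivAt (fun t : ℝ => graphRhs p b h (((0 : Cn d m), c), t • v))
      (fderiv ℝ (graphRhs p b h) (((0 : Cn d m), c), 0) (0, v)) 0 := by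
    have h2 : HasDerivAt (fun t : ℝ => (((0 : Cn d m), c), t • v)) (0, v) 0 := by
      have := (hasDerivAt_id (0 : ℝ)).smul_const v
      simpa using (hasDerivAt_const (0 : ℝ) ((0 : Cn d m), c)).prodMk this
    have h3 : HasFDerivAt (graphRhs p b h) (fderiv ℝ (graphRhs p b h) (((0 : Cn d m), c), 0))
        (((0 : Cn d m), c), (0 : ℝ) • v) := by
      rw [zero_smul]; exact (hd.differentiable (by simp) _).hasFDerivAt
    exact h3.comp_hasDerivAt (0 : ℝ) h2
  -- Along the line through v the right-hand side is t • S t, where S is continuous and S 0 = 0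
  -- because Dh(0) = 0; so its derivative at 0 vanishes.
  let S : ℝ → E := fun t => assemble b fun j => ∑ l, ((hadamard h
    (par (0 : Cn d m) + (shift p c (t • v), 0), par (0 : Cn d m)) (Pi.single l 1, 0) j : ℝ) : ℂ) *
      shiftQuot p c v l
  have hS : Continuous S := by
    have hc : ContDiff ℝ 1 S := by
      refine contDiff_assemble b fun j => ContDiff.sum fun l _ => ?_
      have hH : ContDiff ℝ 1 fun t : ℝ =>
          hadamard h (par (0 : Cn d m) + (shift p c (t • v), 0), par (0 : Cn d m)) := by
        refine (contDiff_hadamard (n := 1) (by exact_mod_cast hh)).comp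
          ((contDiff_const.add (ContDiff.prodMk ?_ contDiff_const)).prodMk contDiff_const)
        exact contDiff_shift p contDiff_const (contDiff_id.smul contDiff_const)
      exact (contDiff_ofReal.comp ((contDiff_apply ℝ ℝ j).comp
        (hH.clm_apply contDiff_const))).mul contDiff_const
    exact hc.continuous
  have hS0 : S 0 = 0 := by
    have e1 : par (0 : Cn d m) + (shift p c ((0 : ℝ) • v), 0) = 0 := by
      rw [shift_smul]
      ext <;> simp [par, rePart]
    have e2 : par (0 : Cn d m) = 0 := by ext <;> simp [par, rePart]
    simp only [S]
    rw [e1, e2, hadamard_self, hh0]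
    simp [assemble]
  have heq : (fun t : ℝ => graphRhs p b h (((0 : Cn d m), c), t • v)) = fun t => t • S t := by
    funext t
    simp only [graphRhs, S, assemble, Finset.smul_sum, shiftQuot_smul]
    refine Finset.sum_congr rfl fun j _ => ?_
    rw [real_smul_smul]
    congr 1
    rw [Finset.mul_sum]
    exact Finset.sum_congr rfl fun l _ => by ring
  rw [heq] at h1
  have h4 : HasDerivAt (fun t : ℝ => t • S t) 0 0 := by
    rw [hasDerivAt_iff_tendsto_slope]
    have h5 : Tendsto S (𝓝[≠] 0) (𝓝 0) := by
      have := hS.tendsto 0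
      rw [hS0] at this
      exact this.mono_left nhdsWithin_le_nhds
    refine h5.congr' ?_
    filter_upwards [self_mem_nhdsWithin] with t ht
    rw [slope_def_module, zero_smul, sub_zero, sub_zero, smul_smul, inv_mul_cancel₀ ht, one_smul]
  exact h1.unique h4

variable {p b}

theorem coord_assemble (hpb : ∀ i j, p i (b j) = if i = j then 1 else 0) (v : Fin d → ℂ)
    (j : Fin d) : p j (assemble b v) = v j := by
  simp [assemble, hpb]

/-- On the circle (1 - c) conj c = -conj(1 - c), so the product is half the sum of (1 - c) `p l ζ`
and its conjugate. -/
theorem one_sub_mul_shiftQuot {c : ℂ} (hc : c * (starRingEnd ℂ) c = 1) (ζ : E) (l : Fin d) :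
    (1 - c) * shiftQuot p c ζ l = (shift p c ζ l : ℝ) := by
  rw [shift, Complex.re_eq_add_conj, shiftQuot, map_mul, map_sub, map_one]
  linear_combination (starRingEnd ℂ) (p l ζ) / 2 * hc

theorem conj_shiftQuot {c : ℂ} (hc : c * (starRingEnd ℂ) c = 1) (ζ : E) (l : Fin d) :
    (starRingEnd ℂ) (shiftQuot p c ζ l) = -(c * shiftQuot p c ζ l) := by
  rw [shiftQuot, map_div₀, map_sub, map_mul, Complex.conj_conj, Complex.conj_conj, map_ofNat]
  linear_combination -((starRingEnd ℂ) (p l ζ) / 2) * hc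

/-- On the unit circle the right-hand side, multiplied by `1 - c`, is real. -/
theorem one_sub_mul_rhs (hpb : ∀ i j, p i (b j) = if i = j then 1 else 0)
    {h : Par d m → (Fin d → ℝ)} (hh : ContDiff ℝ 1 h) {K : Par d m × ℝ → (Fin d → ℝ)}
    (hK : ∀ a, K (a, 0) = 0) {μ : ℂ → ℂ} {χ : ℂ → ℝ} (hμ : ∀ c, χ c ≠ 0 → (1 - c) * μ c = 1)
    {c : ℂ} (hc : c * (starRingEnd ℂ) c = 1) (P : Cn d m) (η : ℝ) (ζ : E) (j : Fin d) :
    (1 - c) * p j (perturbed (graphRhs p b h) (bumpRhs p b K μ χ) ((P, c), η, ζ)) =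
      ((h (par P + (shift p c ζ, 0)) j - h (par P) j +
        K (par P + (shift p c ζ, 0), η * χ c) j : ℝ) : ℂ) := by
  rw [perturbed, map_add, graphRhs, bumpRhs, coord_assemble hpb, coord_assemble hpb, mul_add,
    Complex.ofReal_add]
  congr 1
  · have h1 := hadamard_apply_sub hh (par P + (shift p c ζ, 0)) (par P)
    rw [add_sub_cancel_left] at h1
    have h2 : ((shift p c ζ, 0) : Par d m) = ∑ l, shift p c ζ l • (Pi.single l 1, 0) := by
      refine Prod.ext ?_ ?_
      · funext i
        simp [Prod.fst_sum, Finset.sum_apply, Pi.single_apply]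
      · simp [Prod.snd_sum]
    have h3 := congrFun h1 j
    conv at h3 => lhs; rw [h2]
    rw [map_sum, Finset.sum_apply] at h3
    rw [Pi.sub_apply] at h3
    rw [← h3, Finset.mul_sum, Complex.ofReal_sum]
    refine Finset.sum_congr rfl fun l _ => ?_
    rw [mul_left_comm, one_sub_mul_shiftQuot hc, map_smul, Pi.smul_apply, smul_eq_mul,
      Complex.ofReal_mul, ← h2, mul_comm]
  · rw [← mul_assoc]
    by_cases h0 : χ c = 0
    · simp [h0, hK]
    · simp only [hμ c h0, one_mul]

/-- For |c| = 1 and c ≠ 1 this relation says that 1 - c times the right-hand side is real, but it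
remains meaningful at c = 1. It is the form required by the Plemelj argument. -/
theorem conj_rhs (hpb : ∀ i j, p i (b j) = if i = j then 1 else 0)
    {h : Par d m → (Fin d → ℝ)} {K : Par d m × ℝ → (Fin d → ℝ)}
    (hK : ∀ a, K (a, 0) = 0) {μ : ℂ → ℂ} {χ : ℂ → ℝ} (hμ : ∀ c, χ c ≠ 0 → (1 - c) * μ c = 1)
    {c : ℂ} (hc : c * (starRingEnd ℂ) c = 1) (P : Cn d m) (η : ℝ) (ζ : E) (j : Fin d) :
    (starRingEnd ℂ) (p j (perturbed (graphRhs p b h) (bumpRhs p b K μ χ) ((P, c), η, ζ))) =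
      -(c * p j (perturbed (graphRhs p b h) (bumpRhs p b K μ χ) ((P, c), η, ζ))) := by
  rw [perturbed, map_add, graphRhs, bumpRhs, coord_assemble hpb, coord_assemble hpb, mul_add,
    map_add, neg_add]
  congr 1
  · rw [map_sum, Finset.mul_sum, ← Finset.sum_neg_distrib]
    refine Finset.sum_congr rfl fun l _ => ?_
    rw [map_mul, Complex.conj_ofReal, conj_shiftQuot hc]
    ring
  · by_cases h0 : χ c = 0
    · simp [h0, hK]
    · have h1 := hμ c h0
      have h2 := congrArg (starRingEnd ℂ) h1
      rw [map_mul, map_sub, map_one] at h2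
      have h3 : (starRingEnd ℂ) (μ c) = -(c * μ c) := by
        linear_combination (-c * μ c) * h2 - (starRingEnd ℂ) (μ c) * h1 -
          (starRingEnd ℂ) (μ c) * μ c * hc
      rw [map_mul, Complex.conj_ofReal, h3]
      ring

end RightHandSide

/-! ### Boundary derivative by Poisson's formula; cutoffs; curves in F^{2,a} -/

section Auxiliary

/-- Poisson's formula for the boundary derivative at `1`: the real part of `Ψ(1)` in terms of the
boundary values of `2 Re ((1 - τ) Ψ(τ))`. -/
theorem re_eq_avg_of_boundary {Ψ : ℂ → ℂ} (hΨ : DiffContOnCl ℂ Ψ (ball 0 1)) {g : ℝ → ℝ}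
    (hg : Continuous g) (h : ∀ θ, 2 * ((1 - circ θ) * Ψ (circ θ)).re = g θ)
    (h0 : ∀ θ, 0 ≤ (circ θ).re → g θ = 0) :
    (Ψ 1).re = avg fun θ => (‖circ θ - 1‖ ^ 2)⁻¹ * g θ := by
  have hcl : ContinuousOn Ψ (closedBall 0 1) := by
    have := hΨ.continuousOn
    rwa [closure_ball (0 : ℂ) one_ne_zero] at this
  have hsq : ∀ (θ r : ℝ), 0 ≤ r → (circ θ).re < 0 → 1 ≤ ‖circ θ - r‖ ^ 2 := by
    intro θ r hr hθ
    have h1 := norm_circ θ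
    have h2 : ‖circ θ‖ ^ 2 = 1 := by rw [h1]; norm_num
    rw [← Complex.normSq_eq_norm_sq, Complex.normSq_apply] at h2 ⊢
    simp only [Complex.sub_re, Complex.ofReal_re, Complex.sub_im, Complex.ofReal_im, sub_zero]
    nlinarith [mul_nonneg hr (neg_nonneg.2 hθ.le)]
  -- The Poisson kernel at r, divided by 1 - r, is (1 + r)/|ζ - r|². On the left half circle, where
  -- alone g can be nonzero, the denominator is at least 1 for r ≥ 0; taking the maximum with 1
  -- changes nothing there and makes the integrand continuous up to r = 1.
  let k : ℝ → ℝ → ℝ := fun r θ => (1 + r) / 2 * ((max (‖circ θ - r‖ ^ 2) 1)⁻¹ * g θ)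
  have hk : Continuous (Function.uncurry k) := by
    have c1 : Continuous fun q : ℝ × ℝ => ‖circ q.2 - q.1‖ ^ 2 :=
      (((continuous_circ.comp continuous_snd).sub
        (Complex.continuous_ofReal.comp continuous_fst)).norm).pow 2
    have c2 : Continuous fun q : ℝ × ℝ => (max (‖circ q.2 - q.1‖ ^ 2) 1)⁻¹ :=
      (c1.max continuous_const).inv₀ fun q => (lt_max_of_lt_right one_pos).ne'
    have c3 : Continuous fun q : ℝ × ℝ => (1 + q.1) / 2 := by fun_prop
    exact c3.mul (c2.mul (hg.comp continuous_snd))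
  have hkr : ∀ r : ℝ, 0 ≤ r → ∀ θ, k r θ = (1 + r) / 2 * ((‖circ θ - r‖ ^ 2)⁻¹ * g θ) := by
    intro r hr θ
    by_cases hθ : 0 ≤ (circ θ).re
    · simp [k, h0 θ hθ]
    · simp only [k]
      rw [max_eq_left (hsq θ r hr (not_le.1 hθ))]
  have hA : Continuous fun r => avg (k r) := by
    have := intervalIntegral.continuous_parametric_intervalIntegral_of_continuous'
      (μ := MeasureTheory.volume) hk 0 (2 * Real.pi)
    exact this.const_smul (2 * Real.pi)⁻¹
  have hr : ∀ r : ℝ, 0 ≤ r → r < 1 → (Ψ r).re = avg (k r) := by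
    intro r hr hr1
    have hm : (r : ℂ) ∈ ball (0 : ℂ) 1 := by simp [abs_of_nonneg hr, hr1]
    have hF : DiffContOnCl ℂ (fun τ => (1 - τ) * Ψ τ) (ball 0 1) :=
      (((differentiable_const (1 : ℂ)).sub differentiable_id).diffContOnCl).smul hΨ
    have h1 := hF.circleAverage_poissonKernel_smul' hm
    rw [circleAverage_eq_avg] at h1
    have hmn : ‖(r : ℂ)‖ < 1 := mem_ball_zero_iff.1 hm
    have h2 := avg_clm Complex.reCLM (f := fun θ => ((‖circ θ - 0‖ ^ 2 - ‖(r : ℂ) - 0‖ ^ 2) /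
      ‖(circ θ - 0) - ((r : ℂ) - 0)‖ ^ 2) • ((1 - circ θ) * Ψ (circ θ))) (by
        have c1 : Continuous fun θ => Ψ (circ θ) :=
          hcl.comp_continuous continuous_circ circ_mem_closedBall
        simp only [sub_zero]
        refine Continuous.smul (Continuous.div (((continuous_circ.norm).pow 2).sub
          continuous_const) ((continuous_circ.sub continuous_const).norm.pow 2) fun θ =>
            pow_ne_zero 2 (norm_ne_zero_iff.2 (circ_sub_ne_zero hmn θ))) ?_
        exact (continuous_const.sub continuous_circ).mul c1)
    rw [h1] at h2
    simp only [Complex.reCLM_apply] at h2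
    have h3 : ((1 - (r : ℂ)) * Ψ r).re = (1 - r) * (Ψ r).re := by
      rw [show (1 - (r : ℂ)) = ((1 - r : ℝ) : ℂ) by push_cast; ring, Complex.re_ofReal_mul]
    rw [h3] at h2
    have h4 : (fun θ => (((‖circ θ - 0‖ ^ 2 - ‖(r : ℂ) - 0‖ ^ 2) /
        ‖(circ θ - 0) - ((r : ℂ) - 0)‖ ^ 2) • ((1 - circ θ) * Ψ (circ θ))).re) =
        fun θ => (1 - r) * k r θ := by
      funext θ
      rw [Complex.smul_re, smul_eq_mul, hkr r hr θ, ← h θ, sub_zero, sub_zero, norm_circ,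
        Complex.norm_real, Real.norm_of_nonneg hr]
      ring
    rw [h4] at h2
    have h5 : avg (fun θ => (1 - r) * k r θ) = (1 - r) * avg (k r) := by
      simpa using avg_clm ((1 - r) • (1 : ℝ →L[ℝ] ℝ)) (f := k r)
        (hk.comp (Continuous.prodMk_right r))
    rw [h5] at h2
    exact mul_left_cancel₀ (sub_pos.2 hr1).ne' h2.symm
  have ht := (Complex.continuous_re.tendsto _).comp (tendsto_radial hcl 0)
  rw [circ_zero] at ht
  have ht2 : Tendsto (fun r => avg (k r)) (𝓝[<] 1) (𝓝 (avg (k 1))) :=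
    (hA.tendsto 1).mono_left nhdsWithin_le_nhds
  have h6 := tendsto_nhds_unique (ht.congr' (by
    filter_upwards [Ioo_mem_nhdsLT (show (0 : ℝ) < 1 by norm_num)] with r hr'
    rw [Function.comp_apply, mul_one]
    exact hr r hr'.1.le hr'.2)) ht2
  rw [h6]
  congr 1
  funext θ
  rw [hkr 1 zero_le_one, Complex.ofReal_one]
  norm_num

/-- Smooth localization of a function near a point. -/
theorem exists_contDiff_eventuallyEq {E F : Type} [NormedAddCommGroup E] [NormedSpace ℝ E]
    [FiniteDimensional ℝ E] [NormedAddCommGroup F] [NormedSpace ℝ F] {n : ℕ} {f : E → F} {x₀ : E}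
    (hf : ContDiffAt ℝ n f x₀) {U : Set E} (hU : U ∈ 𝓝 x₀) :
    ∃ g : E → F, ContDiff ℝ n g ∧ g =ᶠ[𝓝 x₀] f ∧ ∀ x, ∃ c : ℝ, 0 ≤ c ∧ g x = c • f x ∧
      (x ∉ U → c = 0) := by
  have h1 : ∀ᶠ x in 𝓝 x₀, ContDiffAt ℝ n f x ∧ x ∈ U := (hf.eventually (by simp)).and hU
  obtain ⟨r, hr, hball⟩ := Metric.nhds_basis_closedBall.eventually_iff.1 h1
  let β : ContDiffBump x₀ := ⟨r / 2, r, by positivity, by linarith⟩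
  refine ⟨fun x => β x • f x, ?_, ?_, fun x => ⟨β x, β.nonneg, rfl, fun hx => ?_⟩⟩
  · rw [contDiff_iff_contDiffAt]
    intro x
    by_cases hx : x ∈ closedBall x₀ r
    · exact β.contDiff.contDiffAt.smul (hball hx).1
    · have : (fun x => β x • f x) =ᶠ[𝓝 x] fun _ => 0 := by
        filter_upwards [isClosed_closedBall.isOpen_compl.mem_nhds hx] with y hy
        have : β y = 0 := β.zero_of_le_dist (by
          simp only [mem_compl_iff, mem_closedBall, not_le] at hy
          exact hy.le)
        rw [this, zero_smul]
      exact contDiffAt_const.congr_of_eventuallyEq this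
  · filter_upwards [β.eventuallyEq_one] with x hx
    rw [hx, Pi.one_apply, one_smul]
  · refine β.zero_of_le_dist ?_
    by_contra hlt
    exact hx (hball (mem_closedBall.2 (not_le.1 hlt).le)).2

theorem hasDerivWithinAt_smul_of_continuousWithinAt {E : Type} [NormedAddCommGroup E]
    [NormedSpace ℝ E] {g : ℝ → E} {s : Set ℝ} (hg : ContinuousWithinAt g s 0) :
    HasDerivWithinAt (fun t => t • g t) (g 0) s 0 := by
  rw [hasDerivWithinAt_iff_tendsto_slope]
  have h1 : Tendsto g (𝓝[s \ {0}] 0) (𝓝 (g 0)) := hg.mono_left (nhdsWithin_mono _ sdiff_subset)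
  refine h1.congr' ?_
  filter_upwards [self_mem_nhdsWithin] with t ht
  have ht0 : t ≠ 0 := ht.2
  rw [slope_def_module, zero_smul, sub_zero, sub_zero, smul_smul, inv_mul_cancel₀ ht0, one_smul]

/-- Smooth curves in `F^{2,a}` give differentiable families of boundary values. -/
theorem isFCurve_of_contDiffOn {E : Type} [NormedAddCommGroup E] [NormedSpace ℝ E] {a : ℝ}
    (ha : HExp a) {r : ℕ} {U I : Set ℝ} (hU : IsOpen U) (hIU : I ⊆ U) {c : ℝ → FSp a E}
    (hc : ContDiffOn ℝ r c U) : IsFCurve a r I (fun η => (c η : ℝ → E)) := by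
  obtain ⟨C, hC, hN⟩ := exists_fNorm_le E ha
  let Γ : ℕ → ℝ → FSp a E := fun j => iteratedDerivWithin j c U
  have hlim : ∀ {l : Filter ℝ} {F : ℝ → FSp a E}, Tendsto (fun s => ‖F s‖) l (𝓝 0) →
      Tendsto (fun s => fNorm a (F s)) l (𝓝 0) := by
    intro l F hF
    have h1 : Tendsto (fun s => ENNReal.ofReal (C * ‖F s‖)) l (𝓝 0) := by
      have := ENNReal.tendsto_ofReal (hF.const_mul C)
      simpa using this
    exact tendsto_of_tendsto_of_tendsto_of_le_of_le tendsto_const_nhds h1 (fun _ => zero_le)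
      fun s => (hN (F s)).2
  have hsub : ∀ f g : FSp a E, (f : ℝ → E) - g = ⇑(f - g) := fun f g =>
    funext fun θ => (FSp.sub_apply f g θ).symm
  have hsmul : ∀ (t : ℝ) (f : FSp a E), t • (f : ℝ → E) = ⇑(t • f) := fun t f =>
    funext fun θ => (FSp.smul_apply t f θ).symm
  refine ⟨fun j η => Γ j η, fun η _ => ?_, fun j _ η _ => (hN _).1, fun j hj η hη => ?_,
    fun j hj η hη => ?_⟩
  · simp [Γ]
  · have h1 : ContinuousAt (Γ j) η := (hc.continuousOn_iteratedDerivWithin (by exact_mod_cast hj)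
      hU.uniqueDiffOn).continuousAt (hU.mem_nhds (hIU hη))
    have h2 : Tendsto (fun s => ‖Γ j s - Γ j η‖) (𝓝[I] η) (𝓝 0) :=
      (tendsto_iff_norm_sub_tendsto_zero.1 h1.tendsto).mono_left nhdsWithin_le_nhds
    simp only [hsub]
    exact hlim h2
  · have h1 : HasDerivAt (Γ j) (Γ (j + 1) η) η := by
      have h2 := (hc.differentiableOn_iteratedDerivWithin (by exact_mod_cast hj)
        hU.uniqueDiffOn) η (hIU hη)
      have h3 := h2.hasDerivWithinAt.hasDerivAt (hU.mem_nhds (hIU hη))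
      rwa [← iteratedDerivWithin_succ] at h3
    have h2 : Tendsto (fun s => ‖(s - η)⁻¹ • (Γ j s - Γ j η) - Γ (j + 1) η‖) (𝓝[I \ {η}] η)
        (𝓝 0) := by
      have h3 := tendsto_iff_norm_sub_tendsto_zero.1 (hasDerivAt_iff_tendsto_slope.1 h1)
      simp only [slope_def_module] at h3
      exact h3.mono_left (nhdsWithin_mono _ fun x hx => hx.2)
    simp only [hsub, hsmul]
    exact hlim h2

end Auxiliary

/-! ### Existence of the matrix G for small discs -/

section Transport

variable {a : ℝ} [ha : HExp a] {d m : ℕ}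

/-- Constant functions. -/
noncomputable def HSp.constL (a : ℝ) (E : Type) [NormedAddCommGroup E] [NormedSpace ℝ E] :
    E →L[ℝ] HSp (chordHolder a) E :=
  LinearMap.mkContinuous
    { toFun := fun c => HSp.mk (fun _ => c) ⟨‖c‖, fun _ => le_rfl⟩ ⟨0, fun x y => by simp⟩
      map_add' := fun _ _ => rfl
      map_smul' := fun _ _ => rfl } 1 fun c => by
    rw [one_mul]
    refine HSp.norm_le (norm_nonneg c) (fun _ => le_rfl) fun x y => ?_
    change ‖c - c‖ ≤ _
    rw [sub_self, norm_zero]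
    exact mul_nonneg (norm_nonneg c) (chordHolder_nonneg a x y)

/-- Twice the imaginary part of the Cauchy integral, normalized to vanish at `1`. -/
noncomputable def HSp.hilbert (a : ℝ) [HExp a] :
    HSp (chordHolder a) ℂ →L[ℝ] HSp (chordHolder a) ℂ :=
  (2 : ℝ) • (((HSp.map (Complex.ofRealCLM.comp Complex.imCLM)).comp HSp.cauchyL) -
    (HSp.constL a ℂ).comp ((HSp.eval 0).comp
      ((HSp.map (Complex.ofRealCLM.comp Complex.imCLM)).comp HSp.cauchyL)))

theorem HSp.hilbert_apply (f : HSp (chordHolder a) ℂ) (θ : ℝ) : HSp.hilbert a f θ =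
    ((2 * (cauchyExt f (circ θ)).im - 2 * (cauchyExt f 1).im : ℝ) : ℂ) := by
  have h : HSp.hilbert a f θ = (2 : ℝ) • (((cauchyExt f (circ θ)).im : ℂ) -
    ((cauchyExt f (circ 0)).im : ℂ)) := rfl
  rw [h, circ_zero, ← Complex.coe_smul, smul_eq_mul]
  push_cast
  ring

theorem contDiff_complex_mul : ContDiff ℝ 3 fun z : ℂ × ℂ => z.1 * z.2 :=
  contDiff_fst.mul contDiff_snd

/-- The product of Hölder functions. -/
noncomputable def HSp.prod (f g : HSp (chordHolder a) ℂ) : HSp (chordHolder a) ℂ :=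
  HSp.nem (contDiff_complex_mul.of_le (by norm_cast))
    (HSp.map (ContinuousLinearMap.inl ℝ ℂ ℂ) f + HSp.map (ContinuousLinearMap.inr ℝ ℂ ℂ) g)

theorem HSp.prod_apply (f g : HSp (chordHolder a) ℂ) (θ : ℝ) :
    HSp.prod f g θ = f θ * g θ := by
  change (f θ + 0) * (0 + g θ) = _
  rw [add_zero, zero_add]

theorem HSp.contDiff_prod {Y : Type} [NormedAddCommGroup Y] [NormedSpace ℝ Y]
    {f g : Y → HSp (chordHolder a) ℂ} (hf : ContDiff ℝ 1 f) (hg : ContDiff ℝ 1 g) :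
    ContDiff ℝ 1 fun y => HSp.prod (f y) (g y) := by
  have h := HSp.contDiff_nem (ω := chordHolder a) 1 (contDiff_complex_mul.of_le (by norm_cast))
    (contDiff_complex_mul.of_le (by norm_num))
  exact (by exact_mod_cast h : ContDiff ℝ 1 _).comp
    (((HSp.map _).contDiff.comp hf).add ((HSp.map _).contDiff.comp hg))

/-- The matrix of derivatives of `h` in the directions `x`. -/
noncomputable def slopeMatrix (h : Par d m → (Fin d → ℝ)) (i j : Fin d) (P : Cn d m) : ℂ :=
  ((fderiv ℝ h (par P) (Pi.single j 1, 0) i : ℝ) : ℂ)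

theorem contDiff_slopeMatrix {h : Par d m → (Fin d → ℝ)} (hh : ContDiff ℝ 3 h) (i j : Fin d) :
    ContDiff ℝ 2 (slopeMatrix h i j) := by
  have h1 : ContDiff ℝ 2 (fderiv ℝ h) := hh.fderiv_right (by norm_num)
  exact contDiff_ofReal.comp ((contDiff_apply ℝ ℝ i).comp
    ((h1.comp contDiff_par).clm_apply contDiff_const))

/-- Let S be the matrix ∂h/∂x along the disc and T the operator `HSp.hilbert`. If G = 1 - Ty and y =
-GS, then G + iy has a holomorphic extension and equals 2i times G(-S - i)/2, the matrix to be
extended. The resulting equation y = -S + (Ty)S is solved by the implicit function theorem, since S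
= 0 for the zero disc. -/
theorem exists_transport_potential {h : Par d m → (Fin d → ℝ)} (hh : ContDiff ℝ 3 h)
    (hh0 : fderiv ℝ h 0 = 0) :
    ∀ᶠ u in 𝓝 (0 : HSp (chordHolder a) (Cn d m)), ∃ y : Fin d → Fin d → HSp (chordHolder a) ℂ,
      ∀ i j θ, y i j θ = -slopeMatrix h i j (u θ) +
        ∑ l, HSp.hilbert a (y i l) θ * slopeMatrix h l j (u θ) := by
  have hN1 : ∀ i j, ContDiff ℝ 1 (slopeMatrix (m := m) h i j) := fun i j =>
    (contDiff_slopeMatrix hh i j).of_le (by norm_cast)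
  let N : Fin d → Fin d → HSp (chordHolder a) (Cn d m) → HSp (chordHolder a) ℂ := fun i j u =>
    HSp.nem (hN1 i j) u
  have hN : ∀ i j, ContDiff ℝ 1 (N i j) := fun i j => by
    have := HSp.contDiff_nem (ω := chordHolder a) 1 (hN1 i j)
      (by simpa [one_add_one_eq_two] using contDiff_slopeMatrix hh i j)
    exact_mod_cast this
  have hN0 : ∀ i j, N i j 0 = 0 := fun i j => by
    refine HSp.ext fun θ => ?_
    have : par (0 : Cn d m) = 0 := by ext <;> simp [par, rePart]
    change slopeMatrix h i j 0 = 0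
    rw [slopeMatrix, this, hh0]
    simp
  let T : HSp (chordHolder a) (Cn d m) × (Fin d → Fin d → HSp (chordHolder a) ℂ) →
      (Fin d → Fin d → HSp (chordHolder a) ℂ) := fun q i j =>
    -N i j q.1 + ∑ l, HSp.prod (HSp.hilbert a (q.2 i l)) (N l j q.1)
  have hT : ContDiff ℝ (1 : ℕ) T := by
    rw [Nat.cast_one]
    refine contDiff_pi.2 fun i => contDiff_pi.2 fun j => ?_
    refine ((hN i j).comp contDiff_fst).neg.add (ContDiff.sum fun l _ => HSp.contDiff_prod ?_ ?_)
    · exact (HSp.hilbert a).contDiff.comp ((contDiff_apply ℝ (HSp (chordHolder a) ℂ) l).comp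
        ((contDiff_apply ℝ (Fin d → HSp (chordHolder a) ℂ) i).comp contDiff_snd))
    · exact (hN l j).comp contDiff_fst
  have hT0 : ∀ y, T (0, y) = 0 := by
    intro y
    funext i j
    refine HSp.ext fun θ => ?_
    simp only [T, hN0, neg_zero, zero_add]
    have : ∀ f : HSp (chordHolder a) ℂ, HSp.prod f 0 = 0 := fun f =>
      HSp.ext fun θ => by rw [HSp.prod_apply, HSp.zero_apply, mul_zero]
    simp [this]
  have hd : (fderiv ℝ T (0, 0)).comp (ContinuousLinearMap.inr ℝ _ _) = 0 := by
    have h1 : HasFDerivAt (fun y => T (0, y))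
        ((fderiv ℝ T (0, 0)).comp (ContinuousLinearMap.inr ℝ _ _)) 0 :=
      HasFDerivAt.comp (0 : Fin d → Fin d → HSp (chordHolder a) ℂ)
        (hT.differentiable (by simp) (0, 0)).hasFDerivAt
        (hasFDerivAt_prodMk_right (0 : HSp (chordHolder a) (Cn d m)) 0)
    simp only [hT0] at h1
    exact h1.unique (hasFDerivAt_const _ _)
  obtain ⟨Z, -, hZ, -⟩ := exists_fixedPoint_curve le_rfl hT (hT0 0) (by rw [hd, norm_zero]; norm_num)
  filter_upwards [hZ] with u hu
  refine ⟨Z u, fun i j θ => ?_⟩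
  have h1 := congrArg (fun y : Fin d → Fin d → HSp (chordHolder a) ℂ => HSp.eval θ (y i j)) hu.2
  simp only [T, map_add, map_neg, map_sum, HSp.eval_apply, HSp.prod_apply] at h1
  exact h1

/-- Existence of the transport along a small disc. -/
theorem eventually_exists_transport {h : Par d m → (Fin d → ℝ)} (hh : ContDiff ℝ 3 h)
    (hh0 : fderiv ℝ h 0 = 0) :
    ∀ᶠ u in 𝓝 (0 : HSp (chordHolder a) (Cn d m)), ∃ G : ℂ → Matrix (Fin d) (Fin d) ℝ,
      ContinuousOn G (sphere 0 1) ∧ G 1 = 1 ∧ ∃ Φ : ℂ → Matrix (Fin d) (Fin d) ℂ,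
        (∀ i j, DiffContOnCl ℂ (fun τ => Φ τ i j) (ball 0 1)) ∧
        ∀ θ, Φ (circ θ) = (G (circ θ)).map Complex.ofReal * Matrix.of fun j l =>
          (1 / 2 : ℂ) * (-slopeMatrix h j l (u θ) - Complex.I * if j = l then 1 else 0) := by
  filter_upwards [exists_transport_potential (a := a) (m := m) hh hh0] with u hu
  obtain ⟨y, hy⟩ := hu
  -- The right-hand side of the equation for y is real whatever y is, so the solution is real.
  have hreal : ∀ i j, HSp.conj (y i j) = y i j := fun i j => HSp.ext fun θ => by
    rw [HSp.conj_apply, hy i j θ]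
    simp only [map_add, map_neg, map_sum, map_mul, HSp.hilbert_apply, slopeMatrix,
      Complex.conj_ofReal]
  let G : ℂ → Matrix (Fin d) (Fin d) ℝ := fun τ => Matrix.of fun i j =>
    (1 : Matrix (Fin d) (Fin d) ℝ) i j - 2 * (cauchyExt (y i j) τ).im +
      2 * (cauchyExt (y i j) 1).im
  -- Ψ is the holomorphic extension of G + iy. Since y = -GS, the product G(-S - i)/2 equals -(i/2)Ψ
  -- on the circle.
  let Ψ : Fin d → Fin d → ℂ → ℂ := fun i j τ => (1 : Matrix (Fin d) (Fin d) ℂ) i j +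
    Complex.I * (2 * cauchyExt (y i j) τ - avg (y i j)) + 2 * ((cauchyExt (y i j) 1).im : ℂ)
  have hΨ : ∀ i j θ, Ψ i j (circ θ) = (G (circ θ) i j : ℂ) + Complex.I * y i j θ := by
    intro i j θ
    have h1 := plemelj (y i j) θ
    rw [hreal] at h1
    have h2 : ((1 : Matrix (Fin d) (Fin d) ℝ) i j : ℂ) = (1 : Matrix (Fin d) (Fin d) ℂ) i j := by
      simp only [Matrix.one_apply]
      split_ifs <;> simp
    simp only [Ψ, G, Matrix.of_apply]
    push_cast
    rw [h2, Complex.im_eq_sub_conj (cauchyExt (y i j) (circ θ))]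
    have hI := Complex.I_sq
    rw [h1]
    field_simp
    linear_combination (cauchyExt (y i j) (circ θ) -
      (starRingEnd ℂ) (cauchyExt (y i j) (circ θ))) * hI
  refine ⟨G, ?_, ?_, fun τ => Matrix.of fun i j => -(Complex.I / 2) * Ψ i j τ, fun i j => ?_,
    fun θ => ?_⟩
  · refine continuousOn_pi.2 fun i => continuousOn_pi.2 fun j => ?_
    have := (continuousOn_cauchyExt (y i j)).mono sphere_subset_closedBall
    exact (continuousOn_const.sub (continuousOn_const.mul
      (Complex.continuous_im.comp_continuousOn this))).add continuousOn_const
  · ext i j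
    simp [G]
  · have h1 := diffContOnCl_cauchyExt (y i j)
    simp only [Matrix.of_apply]
    refine ⟨?_, ?_⟩
    · exact ((((h1.differentiableOn.const_mul 2).sub_const _).const_mul _).const_add _ |>.add_const
        _).const_mul _
    · exact continuousOn_const.mul ((continuousOn_const.add (continuousOn_const.mul
        ((continuousOn_const.mul h1.continuousOn).sub continuousOn_const))).add continuousOn_const)
  · ext i j
    change -(Complex.I / 2) * Ψ i j (circ θ) = _
    rw [hΨ, Matrix.mul_apply]
    simp only [Matrix.map_apply, Matrix.of_apply]
    have h1 : ∑ l, (G (circ θ) i l : ℂ) * slopeMatrix h l j (u θ) = -y i j θ := by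
      rw [hy i j θ, neg_add, neg_neg, ← Finset.sum_neg_distrib]
      have h2 : ∀ l, (G (circ θ) i l : ℂ) = (1 : Matrix (Fin d) (Fin d) ℂ) i l -
          HSp.hilbert a (y i l) θ := by
        intro l
        rw [HSp.hilbert_apply]
        simp only [G, Matrix.of_apply]
        push_cast
        simp only [Matrix.one_apply]
        split_ifs <;> push_cast <;> ring
      simp only [h2, sub_mul, Finset.sum_sub_distrib, Matrix.one_apply, ite_mul, one_mul, zero_mul,
        Finset.sum_ite_eq, Finset.mem_univ, if_true, Finset.sum_neg_distrib]
      ring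
    have h3 : ∀ l, (G (circ θ) i l : ℂ) * (1 / 2 * (-slopeMatrix h l j (u θ) -
        Complex.I * if l = j then 1 else 0)) =
        -(1 / 2) * ((G (circ θ) i l : ℂ) * slopeMatrix h l j (u θ)) -
          Complex.I / 2 * if l = j then (G (circ θ) i l : ℂ) else 0 := by
      intro l
      split_ifs <;> ring
    simp only [h3, Finset.sum_sub_distrib, ← Finset.mul_sum, h1, Finset.sum_ite_eq',
      Finset.mem_univ, if_true]
    linear_combination (-(1 / 2) * y i j θ) * Complex.I_sq

end Transport

/-! ### From the fixed point equation to the attachment equation -/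

section CoordinateFamily

variable {E : Type} [NormedAddCommGroup E] [InnerProductSpace ℂ E] [FiniteDimensional ℂ E]
  [FiniteDimensional ℝ E] [CompleteSpace E] {a : ℝ} [ha : HExp a] {d m : ℕ}
  {p : Fin d → E →L[ℂ] ℂ} {b : Fin d → E}

theorem cauchyExt_bishop (f : HSp (chordHolder a) E) {τ : ℂ} (hτ : τ ∈ closedBall (0 : ℂ) 1) :
    cauchyExt (HSp.bishop a E f) τ = (2 * Complex.I) • cauchyExt f τ := by
  have hu : DiffContOnCl ℂ (fun τ => (2 * Complex.I) • cauchyExt f τ) (ball 0 1) :=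
    (diffContOnCl_cauchyExt f).const_smul (2 * Complex.I)
  refine eqOn_closedBall (continuousOn_cauchyExt _)
    ((continuousOn_cauchyExt f).const_smul (2 * Complex.I)) (fun τ hτ => ?_) τ hτ
  rw [cauchyExt_of_mem (HSp.continuous_chord _) hτ]
  exact cauchy_circ hu (mem_ball_zero_iff.1 hτ)

/-- For Z = 2i Cf one has Im((1 - ζ)Z) = 2 Re((1 - ζ)Cf), which is (1 - ζ)f as soon as this product
is real. So the fixed point equation solves the attachment equation. -/
theorem im_one_sub_mul_bishop (f : HSp (chordHolder a) E) (q : E →L[ℂ] ℂ) {R : ℝ → ℝ}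
    (hconj : ∀ θ, (starRingEnd ℂ) (q (f θ)) = -(circ θ * q (f θ)))
    (hR : ∀ θ, (1 - circ θ) * q (f θ) = (R θ : ℂ)) (θ : ℝ) :
    ((1 - circ θ) * q (HSp.bishop a E f θ)).im = R θ := by
  have h1 := one_sub_mul_eq (HSp.map (ω := chordHolder a) (q.restrictScalars ℝ) f) hconj θ
  have h2 : cauchyExt (HSp.map (ω := chordHolder a) (q.restrictScalars ℝ) f) (circ θ) =
      q (cauchyExt f (circ θ)) := cauchyExt_map q f (circ_mem_closedBall θ)
  rw [h2] at h1
  have h3 := (hR θ).symm.trans h1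
  rw [HSp.bishop_apply, map_smul, smul_eq_mul, Complex.ofReal_inj.1 h3]
  simp only [Complex.mul_im, Complex.mul_re, Complex.I_re, Complex.I_im, Complex.re_ofNat,
    Complex.im_ofNat]
  ring

/-- The two identities for the right-hand side hold along t ↦ (t, t • v) and are differentiated at t
= 0. As K vanishes on the original graph, it contributes only its derivative in the last variable.
-/
theorem fderiv_rhs (hpb : ∀ i j, p i (b j) = if i = j then 1 else 0)
    {h : Par d m → (Fin d → ℝ)} (hh : ContDiff ℝ 2 h) {K : Par d m × ℝ → (Fin d → ℝ)}
    (hK1 : ContDiff ℝ 1 K) (hK : ∀ a, K (a, 0) = 0) {μ : ℂ → ℂ} {χ : ℂ → ℝ}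
    (hμ1 : ContDiff ℝ 1 μ) (hχ1 : ContDiff ℝ 1 χ) (hμ : ∀ c, χ c ≠ 0 → (1 - c) * μ c = 1)
    {c : ℂ} (hc : c * (starRingEnd ℂ) c = 1) (P : Cn d m) (v : E) (j : Fin d) :
    (starRingEnd ℂ) (p j (fderiv ℝ (perturbed (graphRhs p b h) (bumpRhs p b K μ χ))
      ((P, c), 0, 0) (0, 1, v))) = -(c * p j (fderiv ℝ (perturbed (graphRhs p b h)
        (bumpRhs p b K μ χ)) ((P, c), 0, 0) (0, 1, v))) ∧
    (1 - c) * p j (fderiv ℝ (perturbed (graphRhs p b h) (bumpRhs p b K μ χ))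
      ((P, c), 0, 0) (0, 1, v)) = ((fderiv ℝ h (par P) (shift p c v, 0) j +
        χ c * fderiv ℝ K (par P, 0) (0, 1) j : ℝ) : ℂ) := by
  set g := perturbed (graphRhs p b h) (bumpRhs p b K μ χ) with hg
  have hg1 : ContDiff ℝ 1 g := contDiff_perturbed
    (contDiff_graphRhs (n := 1) p b (by exact_mod_cast hh)) (contDiff_bumpRhs p b hK1 hμ1 hχ1)
  have d0 : HasDerivAt (fun t : ℝ => t • v) v 0 := by
    simpa using (hasDerivAt_id (0 : ℝ)).smul_const v
  have d1 : HasDerivAt (fun t : ℝ => g ((P, c), t, t • v)) (fderiv ℝ g ((P, c), 0, 0) (0, 1, v))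
      0 := by
    have h2 : HasDerivAt (fun t : ℝ => ((P, c), t, t • v)) (0, 1, v) 0 :=
      (hasDerivAt_const (0 : ℝ) (P, c)).prodMk ((hasDerivAt_id (0 : ℝ)).prodMk d0)
    have h3 : HasFDerivAt g (fderiv ℝ g ((P, c), 0, 0)) ((P, c), (0 : ℝ), (0 : ℝ) • v) := by
      rw [zero_smul]; exact (hg1.differentiable (by simp) _).hasFDerivAt
    exact h3.comp_hasDerivAt (0 : ℝ) h2
  have d2 : HasDerivAt (fun t : ℝ => p j (g ((P, c), t, t • v)))
      (p j (fderiv ℝ g ((P, c), 0, 0) (0, 1, v))) 0 :=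
    ((p j).restrictScalars ℝ).hasFDerivAt.comp_hasDerivAt (0 : ℝ) d1
  refine ⟨?_, ?_⟩
  · have d3 : HasDerivAt (fun t : ℝ => (starRingEnd ℂ) (p j (g ((P, c), t, t • v))))
        ((starRingEnd ℂ) (p j (fderiv ℝ g ((P, c), 0, 0) (0, 1, v)))) 0 :=
      (Complex.conjCLE : ℂ →L[ℝ] ℂ).hasFDerivAt.comp_hasDerivAt (0 : ℝ) d2
    have d4 : HasDerivAt (fun t : ℝ => -(c * p j (g ((P, c), t, t • v))))
        (-(c * p j (fderiv ℝ g ((P, c), 0, 0) (0, 1, v)))) 0 := (d2.const_mul c).fun_neg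
    simp only [hg, conj_rhs hpb hK hμ hc] at d3
    exact d3.unique d4
  · have d3 : HasDerivAt (fun t : ℝ => (1 - c) * p j (g ((P, c), t, t • v)))
        ((1 - c) * p j (fderiv ℝ g ((P, c), 0, 0) (0, 1, v))) 0 := d2.const_mul (1 - c)
    have hsh : HasDerivAt (fun t : ℝ => par P + (shift p c (t • v), (0 : Fin m → ℂ)))
        (shift p c v, 0) 0 := by
      have h1 : HasDerivAt (fun t : ℝ => shift p c (t • v)) (shift p c v) 0 := by
        simp only [shift_smul]
        simpa using (hasDerivAt_id (0 : ℝ)).smul_const (shift p c v)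
      exact (h1.prodMk (hasDerivAt_const _ _)).const_add (par P)
    have h00 : par P + (shift p c ((0 : ℝ) • v), (0 : Fin m → ℂ)) = par P := by
      rw [shift_smul]; simp
    have dh : HasDerivAt (fun t : ℝ => h (par P + (shift p c (t • v), 0)))
        (fderiv ℝ h (par P) (shift p c v, 0)) 0 := by
      have h3 : HasFDerivAt h (fderiv ℝ h (par P))
          (par P + (shift p c ((0 : ℝ) • v), (0 : Fin m → ℂ))) := by
        rw [h00]; exact (hh.differentiable (by simp) _).hasFDerivAt
      exact h3.comp_hasDerivAt (0 : ℝ) hsh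
    have dK : HasDerivAt (fun t : ℝ => K (par P + (shift p c (t • v), 0), t * χ c))
        (fderiv ℝ K (par P, 0) ((shift p c v, 0), χ c)) 0 := by
      have h2 : HasDerivAt (fun t : ℝ => (par P + (shift p c (t • v), (0 : Fin m → ℂ)), t * χ c))
          ((shift p c v, 0), χ c) 0 :=
        hsh.prodMk (by simpa using (hasDerivAt_id (0 : ℝ)).mul_const (χ c))
      have h3 : HasFDerivAt K (fderiv ℝ K (par P, 0))
          (par P + (shift p c ((0 : ℝ) • v), (0 : Fin m → ℂ)), (0 : ℝ) * χ c) := by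
        rw [h00, zero_mul]; exact (hK1.differentiable (by simp) _).hasFDerivAt
      exact h3.comp_hasDerivAt (0 : ℝ) h2
    have hK0 : fderiv ℝ K (par P, 0) ((shift p c v, 0), χ c) =
        χ c • fderiv ℝ K (par P, 0) (0, 1) := by
      have h1 : HasFDerivAt (fun x => K (x, (0 : ℝ)))
          ((fderiv ℝ K (par P, 0)).comp (ContinuousLinearMap.inl ℝ _ ℝ)) (par P) :=
        HasFDerivAt.comp (par P) (hK1.differentiable (by simp) (par P, 0)).hasFDerivAt
          (hasFDerivAt_prodMk_left (par P) (0 : ℝ))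
      simp only [hK] at h1
      have h2 := DFunLike.congr_fun (h1.unique (hasFDerivAt_const _ _)) (shift p c v, 0)
      have h3 : (((shift p c v, 0), χ c) : Par d m × ℝ) =
          ((shift p c v, 0), 0) + χ c • (0, 1) := by ext <;> simp
      rw [h3, map_add, map_smul]
      change fderiv ℝ K (par P, 0) ((shift p c v, 0), 0) = 0 at h2
      rw [h2, zero_add]
    rw [hK0] at dK
    have d5 : HasDerivAt (fun t : ℝ => ((h (par P + (shift p c (t • v), 0)) j - h (par P) j +
        K (par P + (shift p c (t • v), 0), t * χ c) j : ℝ) : ℂ))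
        ((fderiv ℝ h (par P) (shift p c v, 0) j + χ c * fderiv ℝ K (par P, 0) (0, 1) j : ℝ) : ℂ)
        0 :=
      ((((hasDerivAt_pi.1 dh j).sub_const _).add (hasDerivAt_pi.1 dK j))).ofReal_comp
    simp only [hg, one_sub_mul_rhs hpb (hh.of_le (by norm_cast)) hK hμ hc] at d3
    exact d3.unique d5

end CoordinateFamily

/-! ### Families of solutions for graphs -/

section CoordinateTheorem

variable {a : ℝ} [ha : HExp a] {d m : ℕ}

/-- The unknown takes values in an inner product space with a dual system `p`, `b`, because the L²
argument needs an inner product while the discs take values in a product with the supremum norm. -/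
theorem eventually_exists_graph_family_of_coord {E : Type} [NormedAddCommGroup E]
    [InnerProductSpace ℂ E] [FiniteDimensional ℂ E] [FiniteDimensional ℝ E] [CompleteSpace E]
    {p : Fin d → E →L[ℂ] ℂ} {b : Fin d → E}
    (hpb : ∀ i j, p i (b j) = if i = j then 1 else 0) (n : ℕ) {h : Par d m → (Fin d → ℝ)}
    (hh : ContDiff ℝ (n + 5 : ℕ) h) (hh0 : fderiv ℝ h 0 = 0) :
    ∀ᶠ u in 𝓝 (0 : FSp a (Cn d m)), ∀ (K : Par d m × ℝ → (Fin d → ℝ)) (μ : ℂ → ℂ) (χ : ℂ → ℝ),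
      ContDiff ℝ (n + 4 : ℕ) K → (∀ a, K (a, 0) = 0) → ContDiff ℝ (n + 4 : ℕ) μ →
      ContDiff ℝ (n + 4 : ℕ) χ → (∀ c, χ c ≠ 0 → (1 - c) * μ c = 1) →
      ∃ (Z : ℝ → ℂ → Fin d → ℂ) (C : ℝ → FSp a (Fin d → ℂ)) (V : ℂ → Fin d → ℂ), C 0 = 0 ∧
        (∀ τ ∈ closedBall (0 : ℂ) 1, Z 0 τ = 0) ∧
        (∀ᶠ η in 𝓝 0, ContDiffAt ℝ (n + 1 : ℕ) C η ∧ (∀ θ, C η θ = Z η (circ θ)) ∧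
          (∀ j, DiffContOnCl ℂ (fun τ => Z η τ j) (ball 0 1)) ∧
          (∀ τ ∈ ball (0 : ℂ) 1,
            ContDiffAt ℝ (n + 4 : ℕ) (fun q : ℝ × ℂ => Z q.1 q.2) (η, τ)) ∧
          ∀ θ j, ((1 - circ θ) * Z η (circ θ) j).im =
            h (par (u θ) + (fun l => ((1 - circ θ) * Z η (circ θ) l).re, 0)) j - h (par (u θ)) j +
            K (par (u θ) + (fun l => ((1 - circ θ) * Z η (circ θ) l).re, 0), η * χ (circ θ)) j) ∧
        (∀ j, DiffContOnCl ℂ (fun τ => V τ j) (ball 0 1)) ∧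
        (∀ θ, HasDerivAt (fun η => C η θ) (V (circ θ)) 0) ∧
        ∀ θ j, ((1 - circ θ) * V (circ θ) j).im =
          fderiv ℝ h (par (u θ)) (fun l => ((1 - circ θ) * V (circ θ) l).re, 0) j +
            χ (circ θ) * fderiv ℝ K (par (u θ), 0) (0, 1) j := by
  -- The coordinate ζ is carried along as a second component of the parameter function, so the base
  -- point is (0, ζ).
  obtain ⟨s, hs⟩ := exists_fSp_of_contDiff (a := a)
    (σ := fun θ => ((0 : Cn d m), circ θ)) (contDiff_const.prodMk contDiff_circ)
    (fun θ => Prod.ext rfl (circ_periodic θ))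
  have hG : ContDiff ℝ (n + 4 : ℕ) (graphRhs (m := m) p b h) :=
    contDiff_graphRhs p b (by exact_mod_cast hh)
  have hh2 : ContDiff ℝ 2 h := hh.of_le (by norm_cast; omega)
  have h1 := eventually_exists_bishop_family (a := a) n hG (graphRhs_zero p b h) s
    (fun θ v => by rw [hs]; exact fderiv_graphRhs_zero p b hh2 hh0 (circ θ) v)
  have hcont : Tendsto (fun u : FSp a (Cn d m) =>
      FSp.map (ContinuousLinearMap.inl ℝ (Cn d m) ℂ) u + s) (𝓝 0) (𝓝 s) := by
    have : Continuous fun u : FSp a (Cn d m) =>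
      FSp.map (ContinuousLinearMap.inl ℝ (Cn d m) ℂ) u + s := by fun_prop
    have h2 := this.tendsto 0
    rwa [map_zero, zero_add] at h2
  filter_upwards [hcont.eventually h1] with u hu K μ χ hK hK0 hμ hχ hμχ
  have hK1 : ContDiff ℝ 1 K := hK.of_le (by norm_cast; omega)
  have hμ1 : ContDiff ℝ 1 μ := hμ.of_le (by norm_cast; omega)
  have hχ1 : ContDiff ℝ 1 χ := hχ.of_le (by norm_cast; omega)
  have hval : ∀ θ, (FSp.map (ContinuousLinearMap.inl ℝ (Cn d m) ℂ) u + s : FSp a (Cn d m × ℂ)) θ =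
      (u θ, circ θ) := fun θ => by
    change (u θ, (0 : ℂ)) + s θ = _
    rw [hs]; simp
  obtain ⟨Z, hZ0, hZ, fV, hfV, hV⟩ := hu (bumpRhs p b K μ χ) (contDiff_bumpRhs p b hK hμ hχ)
    (bumpRhs_zero p b hK0 μ χ)
  let L : E →L[ℝ] (Fin d → ℂ) := ContinuousLinearMap.pi fun j => (p j).restrictScalars ℝ
  have hL : ∀ x j, L x j = p j x := fun x j => rfl
  let H : ℝ → HSp (chordHolder a) E := fun η => FSp.toHSp (Z η)
  have hbd : ∀ f : FSp a E, ∀ θ, cauchyExt (FSp.toHSp (FSp.bishop a E f)) (circ θ) =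
      FSp.bishop a E f θ := fun f θ => by
    rw [FSp.toHSp_bishop, cauchyExt_bishop _ (circ_mem_closedBall θ)]
    exact (HSp.bishop_apply (FSp.toHSp f) θ).symm
  have hhol : ∀ (f : HSp (chordHolder a) E) j,
      DiffContOnCl ℂ (fun τ => p j (cauchyExt f τ)) (ball 0 1) := fun f j => by
    have h2 := diffContOnCl_cauchyExt f
    exact ⟨(p j).differentiable.comp_differentiableOn h2.differentiableOn,
      (p j).continuous.comp_continuousOn h2.continuousOn⟩
  have hshift : ∀ c ζ, shift p c ζ = fun l => ((1 - c) * p l ζ).re := fun c ζ => rfl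
  refine ⟨fun η τ j => p j (cauchyExt (H η) τ), fun η => FSp.map L (Z η),
    fun τ j => p j (cauchyExt (FSp.toHSp (deriv Z 0)) τ), ?_, ?_, ?_, ?_, ?_, ?_⟩
  · simp only [hZ0, map_zero]
  · intro τ hτ
    have h2 : H 0 = 0 := by simp only [H, hZ0, map_zero]
    have h3 := norm_cauchyExt_le (0 : HSp (chordHolder a) E) hτ
    rw [norm_zero, mul_zero, norm_le_zero_iff] at h3
    funext j
    change p j (cauchyExt (H 0) τ) = 0
    rw [h2, h3, map_zero]
  · filter_upwards [hZ] with η hη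
    obtain ⟨hc, ⟨f, hf, hZf⟩, hsq⟩ := hη
    have hb : ∀ θ, cauchyExt (H η) (circ θ) = Z η θ := fun θ => by
      simp only [H]; rw [hZf]; exact hbd f θ
    refine ⟨(FSp.map L).contDiff.contDiffAt.comp η hc, fun θ => ?_, fun j => hhol (H η) j,
      fun τ hτ => ?_, fun θ j => ?_⟩
    · funext j
      simp only [hb, FSp.map_apply, hL]
    · exact L.contDiff.contDiffAt.comp _ (contDiffAt_cauchyExt hsq hτ)
    · have h2 := im_one_sub_mul_bishop (FSp.toHSp f) (p j)
        (R := fun θ => h (par (u θ) + (shift p (circ θ) (Z η θ), 0)) j - h (par (u θ)) j +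
          K (par (u θ) + (shift p (circ θ) (Z η θ), 0), η * χ (circ θ)) j)
        (fun θ => by
          rw [FSp.toHSp_apply, hf, hval]
          exact conj_rhs hpb hK0 hμχ (circ_mul_conj θ) (u θ) η (Z η θ) j)
        (fun θ => by
          rw [FSp.toHSp_apply, hf, hval]
          exact one_sub_mul_rhs hpb (hh2.of_le (by norm_cast)) hK0 hμχ (circ_mul_conj θ) (u θ) η
            (Z η θ) j) θ
      simp only [hb, ← hshift]
      rw [← h2, ← FSp.toHSp_bishop, ← hZf]
      rfl
  · exact fun j => hhol _ j
  · intro θ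
    have h2 : HasDerivAt Z (deriv Z 0) 0 :=
      (hZ.self_of_nhds.1.differentiableAt (by simp)).hasDerivAt
    have h3 : HasDerivAt (fun η => FSp.map L (Z η) θ) (L (deriv Z 0 θ)) 0 :=
      ((FSp.eval θ).comp (FSp.map L)).hasFDerivAt.comp_hasDerivAt (0 : ℝ) h2
    have h4 : L (deriv Z 0 θ) = fun j => p j (cauchyExt (FSp.toHSp (deriv Z 0)) (circ θ)) := by
      funext j
      rw [hV, hbd, hL]
    rw [h4] at h3; exact h3
  · intro θ j
    have hb : ∀ θ, cauchyExt (FSp.toHSp (deriv Z 0)) (circ θ) = deriv Z 0 θ := fun θ => by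
      rw [hV]; exact hbd fV θ
    have h0 : ∀ θ, _ := fun θ => fderiv_rhs hpb hh2 hK1 hK0 hμ1 hχ1 hμχ (circ_mul_conj θ) (u θ)
      (deriv Z 0 θ) j
    have h2 := im_one_sub_mul_bishop (FSp.toHSp fV) (p j)
      (R := fun θ => fderiv ℝ h (par (u θ)) (shift p (circ θ) (deriv Z 0 θ), 0) j +
          χ (circ θ) * fderiv ℝ K (par (u θ), 0) (0, 1) j)
      (fun θ => by
        rw [FSp.toHSp_apply, hfV, hval]
        exact (h0 θ).1)
      (fun θ => by
        rw [FSp.toHSp_apply, hfV, hval]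
        exact (h0 θ).2) θ
    simp only [hb, ← hshift]
    rw [← h2, ← FSp.toHSp_bishop, ← hV]
    rfl

/-- Families of solutions of perturbed Bishop equations for graphs, in coordinates. -/
theorem eventually_exists_graph_family (n : ℕ) {h : Par d m → (Fin d → ℝ)}
    (hh : ContDiff ℝ (n + 5 : ℕ) h) (hh0 : fderiv ℝ h 0 = 0) :
    ∀ᶠ u in 𝓝 (0 : FSp a (Cn d m)), ∀ (K : Par d m × ℝ → (Fin d → ℝ)) (μ : ℂ → ℂ) (χ : ℂ → ℝ),
      ContDiff ℝ (n + 4 : ℕ) K → (∀ a, K (a, 0) = 0) → ContDiff ℝ (n + 4 : ℕ) μ →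
      ContDiff ℝ (n + 4 : ℕ) χ → (∀ c, χ c ≠ 0 → (1 - c) * μ c = 1) →
      ∃ (Z : ℝ → ℂ → Fin d → ℂ) (C : ℝ → FSp a (Fin d → ℂ)) (V : ℂ → Fin d → ℂ), C 0 = 0 ∧
        (∀ τ ∈ closedBall (0 : ℂ) 1, Z 0 τ = 0) ∧
        (∀ᶠ η in 𝓝 0, ContDiffAt ℝ (n + 1 : ℕ) C η ∧ (∀ θ, C η θ = Z η (circ θ)) ∧
          (∀ j, DiffContOnCl ℂ (fun τ => Z η τ j) (ball 0 1)) ∧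
          (∀ τ ∈ ball (0 : ℂ) 1,
            ContDiffAt ℝ (n + 4 : ℕ) (fun q : ℝ × ℂ => Z q.1 q.2) (η, τ)) ∧
          ∀ θ j, ((1 - circ θ) * Z η (circ θ) j).im =
            h (par (u θ) + (fun l => ((1 - circ θ) * Z η (circ θ) l).re, 0)) j - h (par (u θ)) j +
            K (par (u θ) + (fun l => ((1 - circ θ) * Z η (circ θ) l).re, 0), η * χ (circ θ)) j) ∧
        (∀ j, DiffContOnCl ℂ (fun τ => V τ j) (ball 0 1)) ∧
        (∀ θ, HasDerivAt (fun η => C η θ) (V (circ θ)) 0) ∧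
        ∀ θ j, ((1 - circ θ) * V (circ θ) j).im =
          fderiv ℝ h (par (u θ)) (fun l => ((1 - circ θ) * V (circ θ) l).re, 0) j +
            χ (circ θ) * fderiv ℝ K (par (u θ), 0) (0, 1) j := by
  refine eventually_exists_graph_family_of_coord (E := EuclideanSpace ℂ (Fin d))
    (p := fun j => EuclideanSpace.proj j) (b := fun j => EuclideanSpace.single j 1)
    (fun i j => ?_) n hh hh0
  simp

end CoordinateTheorem

/-! ### The normal derivative at 1 through the transport -/

section Geometry

variable {d m : ℕ}

/-- The imaginary part as a linear map. -/
noncomputable def imL (d m : ℕ) : Cn d m →L[ℝ] (Fin d → ℝ) :=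
  ContinuousLinearMap.pi fun j =>
    (Complex.imCLM.comp (ContinuousLinearMap.proj j)).comp
      (ContinuousLinearMap.fst ℝ (Fin d → ℂ) (Fin m → ℂ))

/-- The parameters as a linear map. -/
noncomputable def parL (d m : ℕ) : Cn d m →L[ℝ] Par d m :=
  (ContinuousLinearMap.pi fun j =>
    (Complex.reCLM.comp (ContinuousLinearMap.proj j)).comp
      (ContinuousLinearMap.fst ℝ (Fin d → ℂ) (Fin m → ℂ))).prod
    (ContinuousLinearMap.snd ℝ (Fin d → ℂ) (Fin m → ℂ))

theorem normalPart_eq {h : Par d m → (Fin d → ℝ)} {P : Cn d m} (hd : DifferentiableAt ℝ h (par P))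
    (ξ : Cn d m) : normalPart h P ξ = imPart ξ - fderiv ℝ h (par P) (par ξ) := by
  have h1 : HasFDerivAt (definingFn h) (imL d m - (fderiv ℝ h (par P)).comp (parL d m)) P :=
    (imL d m).hasFDerivAt.sub (HasFDerivAt.comp P hd.hasFDerivAt (parL d m).hasFDerivAt)
  rw [normalPart, h1.fderiv]
  rfl

theorem dzr_eq {h : Par d m → (Fin d → ℝ)} {P : Cn d m} (hd : DifferentiableAt ℝ h (par P)) :
    dzr h P = Matrix.of fun j l => (1 / 2 : ℂ) * (-slopeMatrix h j l P -
      Complex.I * if j = l then 1 else 0) := by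
  have h1 : ∀ ξ, fderiv ℝ (definingFn h) P ξ = imPart ξ - fderiv ℝ h (par P) (par ξ) :=
    normalPart_eq hd
  ext j l
  simp only [dzr, Matrix.of_apply, h1, slopeMatrix]
  have e1 : par ((Pi.single l 1, 0) : Cn d m) = (Pi.single l 1, 0) := by
    refine Prod.ext (funext fun i => ?_) rfl
    by_cases hi : i = l
    · subst hi; simp [par, rePart]
    · simp [par, rePart, hi]
  have e2 : par ((Pi.single l Complex.I, 0) : Cn d m) = 0 := by
    refine Prod.ext (funext fun i => ?_) rfl
    by_cases hi : i = l
    · subst hi; simp [par, rePart]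
    · simp [par, rePart, hi]
  have e3 : imPart ((Pi.single l 1, 0) : Cn d m) j = 0 := by
    by_cases hi : j = l
    · subst hi; simp [imPart]
    · simp [imPart, hi]
  have e4 : imPart ((Pi.single l Complex.I, 0) : Cn d m) j = if j = l then 1 else 0 := by
    by_cases hi : j = l
    · subst hi; simp [imPart]
    · simp [imPart, hi]
  rw [e1, e2, map_zero, sub_zero, e4, Pi.sub_apply, e3]
  split_ifs <;> simp

/-- The inner derivative of an infinitesimal deformation, through the transport. -/
theorem im_eq_avg_transport {V : ℂ → Fin d → ℂ} (hV : ∀ j, DiffContOnCl ℂ (fun τ => V τ j) (ball 0 1))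
    {Φ : ℂ → Matrix (Fin d) (Fin d) ℂ}
    (hΦ : ∀ i j, DiffContOnCl ℂ (fun τ => Φ τ i j) (ball 0 1)) {G : ℂ → Matrix (Fin d) (Fin d) ℝ}
    {h : Par d m → (Fin d → ℝ)} {A : ℂ → Cn d m} {κ : ℝ → Fin d → ℝ} {χ : ℂ → ℝ}
    (hΦG : ∀ θ, Φ (circ θ) = (G (circ θ)).map Complex.ofReal * Matrix.of fun j l =>
      (1 / 2 : ℂ) * (-slopeMatrix h j l (A (circ θ)) - Complex.I * if j = l then 1 else 0))
    (hG1 : G 1 = 1) (hA1 : fderiv ℝ h (par (A 1)) = 0)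
    (hVb : ∀ θ j, ((1 - circ θ) * V (circ θ) j).im =
      fderiv ℝ h (par (A (circ θ))) (fun l => ((1 - circ θ) * V (circ θ) l).re, 0) j +
        χ (circ θ) * κ θ j)
    (hc : ∀ i, Continuous fun θ => χ (circ θ) * (G (circ θ)).mulVec (κ θ) i)
    (h0 : ∀ θ, 0 ≤ (circ θ).re → χ (circ θ) = 0) (i : Fin d) :
    (V 1 i).im = 2 * avg fun θ => (‖circ θ - 1‖ ^ 2)⁻¹ *
      (χ (circ θ) * (G (circ θ)).mulVec (κ θ) i) := by
  have hΨ : DiffContOnCl ℂ (fun τ => ∑ l, Φ τ i l * V τ l) (ball 0 1) := by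
    refine ⟨DifferentiableOn.fun_sum fun l _ => (hΦ i l).differentiableOn.mul (hV l).differentiableOn,
      continuousOn_finsetSum _ fun l _ => (hΦ i l).continuousOn.mul (hV l).continuousOn⟩
  have h1 := re_eq_avg_of_boundary hΨ (hc i) (fun θ => ?_) (fun θ hθ => by simp [h0 θ hθ])
  · rw [← h1]
    have h2 := hΦG 0
    rw [circ_zero, hG1] at h2
    -- Because G(1) = id and Dh vanishes at A(1), the real part of ΦV at 1 is half the imaginary
    -- part of V.
    have h3 : ∀ l, Φ 1 i l = if i = l then -(Complex.I / 2) else 0 := by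
      intro l
      rw [h2]
      simp only [Matrix.map_one Complex.ofReal Complex.ofReal_zero Complex.ofReal_one, one_mul,
        Matrix.of_apply, slopeMatrix, hA1]
      split_ifs <;> (simp; try ring)
    simp only [h3, ite_mul, zero_mul, Finset.sum_ite_eq, Finset.mem_univ, if_true]
    simp only [Complex.mul_re, Complex.neg_re, Complex.neg_im, Complex.div_ofNat_re,
      Complex.div_ofNat_im, Complex.I_re, Complex.I_im]
    ring
  -- With S = ∂h/∂x along the disc, the real part of Φζ is G(Im ζ - S Re ζ)/2, and the linearized
  -- equation says that Im ζ - S Re ζ = χκ.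
  · set ζ : Fin d → ℂ := fun l => (1 - circ θ) * V (circ θ) l with hζ
    have h2 : (1 - circ θ) * ∑ l, Φ (circ θ) i l * V (circ θ) l =
        ∑ j, (G (circ θ) i j : ℂ) * ((1 / 2 : ℂ) *
          (-(∑ l, slopeMatrix h j l (A (circ θ)) * ζ l) - Complex.I * ζ j)) := by
      rw [hΦG θ, Finset.mul_sum]
      simp only [Matrix.mul_apply, Matrix.map_apply, Matrix.of_apply, Finset.sum_mul,
        Finset.mul_sum]
      rw [Finset.sum_comm]
      refine Finset.sum_congr rfl fun j _ => ?_
      have h3 : ∀ l, (1 - circ θ) * ((G (circ θ) i j : ℂ) * (1 / 2 *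
          (-slopeMatrix h j l (A (circ θ)) - Complex.I * if j = l then 1 else 0)) * V (circ θ) l) =
          (G (circ θ) i j : ℂ) * (1 / 2 * (-(slopeMatrix h j l (A (circ θ)) * ζ l) -
            Complex.I * if j = l then ζ l else 0)) := by
        intro l
        simp only [hζ]
        split_ifs <;> ring
      simp only [h3, ← Finset.mul_sum, Finset.sum_sub_distrib, Finset.sum_neg_distrib,
        Finset.sum_ite_eq, Finset.mem_univ, if_true]
    have h4 : ∀ j, (∑ l, slopeMatrix h j l (A (circ θ)) * ζ l).re =
        fderiv ℝ h (par (A (circ θ))) (fun l => (ζ l).re, 0) j := by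
      intro j
      have h5 : ((fun l => (ζ l).re, 0) : Par d m) = ∑ l, (ζ l).re • (Pi.single l 1, 0) := by
        refine Prod.ext ?_ ?_
        · funext i
          simp [Prod.fst_sum, Finset.sum_apply, Pi.single_apply]
        · simp [Prod.snd_sum]
      rw [h5, map_sum, Finset.sum_apply, Complex.re_sum]
      refine Finset.sum_congr rfl fun l _ => ?_
      rw [slopeMatrix, Complex.re_ofReal_mul, map_smul, Pi.smul_apply, smul_eq_mul, mul_comm]
    have h6 : ∀ j, ((G (circ θ) i j : ℂ) * ((1 / 2 : ℂ) *
          (-(∑ l, slopeMatrix h j l (A (circ θ)) * ζ l) - Complex.I * ζ j))).re =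
        1 / 2 * (G (circ θ) i j * (χ (circ θ) * κ θ j)) := by
      intro j
      have h7 := hVb θ j
      rw [Complex.re_ofReal_mul, show (1 / 2 : ℂ) = ((1 / 2 : ℝ) : ℂ) by push_cast; rfl,
        Complex.re_ofReal_mul, Complex.sub_re, Complex.neg_re, h4, Complex.I_mul_re]
      simp only [hζ]
      rw [h7]
      ring
    rw [h2, Complex.re_sum]
    simp only [h6, ← Finset.mul_sum]
    rw [Matrix.mulVec, dotProduct, Finset.mul_sum, Finset.mul_sum, Finset.mul_sum]
    exact Finset.sum_congr rfl fun j _ => by ring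

end Geometry

/-! ### Normalized bumps near -1 -/

section Bumps

theorem exists_inv_one_sub (n : ℕ) : ∃ μ : ℂ → ℂ, ContDiff ℝ n μ ∧
    ∃ r, 0 < r ∧ ∀ c ∈ ball (-1 : ℂ) r, (1 - c) * μ c = 1 := by
  have h1 : ContDiffAt ℝ n (fun c : ℂ => (1 - c)⁻¹) (-1) :=
    (contDiffAt_const.sub contDiffAt_id).inv (by norm_num)
  obtain ⟨μ, hμ, heq, -⟩ := exists_contDiff_eventuallyEq h1 (univ_mem (f := 𝓝 (-1 : ℂ)))
  have h2 : ∀ᶠ c : ℂ in 𝓝 (-1), 1 - c ≠ 0 :=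
    (continuous_const.sub continuous_id).continuousAt.eventually_ne (by norm_num)
  obtain ⟨r, hr, hb⟩ := Metric.eventually_nhds_iff_ball.1 (heq.and h2)
  exact ⟨μ, hμ, r, hr, fun c hc => by rw [(hb c hc).1, mul_inv_cancel₀ (hb c hc).2]⟩

theorem re_neg_of_mem_ball {c : ℂ} (hc : c ∈ ball (-1 : ℂ) 1) : c.re < 0 := by
  have h1 := Complex.abs_re_le_norm (c - (-1))
  rw [mem_ball, dist_eq_norm] at hc
  have h2 := (abs_lt.1 (h1.trans_lt hc)).2
  simp only [Complex.sub_re, Complex.neg_re, Complex.one_re] at h2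
  linarith

/-- The weight `|ζ - 1|⁻²` is continuous on functions supported in the left half circle. -/
theorem continuous_weight_mul {g : ℝ → ℝ} (hg : Continuous g)
    (h0 : ∀ θ, 0 ≤ (circ θ).re → g θ = 0) :
    Continuous fun θ => (‖circ θ - 1‖ ^ 2)⁻¹ * g θ := by
  have h1 : (fun θ => (‖circ θ - 1‖ ^ 2)⁻¹ * g θ) =
      fun θ => (max (‖circ θ - 1‖ ^ 2) 1)⁻¹ * g θ := by
    funext θ
    by_cases hθ : 0 ≤ (circ θ).re
    · simp [h0 θ hθ]
    · rw [max_eq_left]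
      have h2 := Complex.abs_re_le_norm (circ θ - 1)
      rw [Complex.sub_re, Complex.one_re, abs_of_neg (by linarith [not_le.1 hθ])] at h2
      nlinarith [not_le.1 hθ]
  rw [h1]
  exact ((((continuous_circ.sub continuous_const).norm.pow 2).max continuous_const).inv₀
    fun q => (lt_max_of_lt_right one_pos).ne').mul hg

/-- Normalized bump functions near `-1`. -/
theorem exists_bump_near_neg_one (n : ℕ) {r : ℝ} (hr : 0 < r) (hr1 : r ≤ 1) :
    ∃ χ : ℂ → ℝ, ContDiff ℝ n χ ∧ (∀ c, 0 ≤ χ c) ∧ (∀ c, χ c ≠ 0 → c ∈ ball (-1 : ℂ) r) ∧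
      2 * avg (fun θ => (‖circ θ - 1‖ ^ 2)⁻¹ * χ (circ θ)) = 1 := by
  obtain ⟨β, hβ, heq, hs⟩ := exists_contDiff_eventuallyEq (n := n) (f := fun _ : ℂ => (1 : ℝ))
    (x₀ := -1) contDiffAt_const (ball_mem_nhds (-1 : ℂ) hr)
  have hpos : ∀ c, 0 ≤ β c := fun c => by
    obtain ⟨t, ht, h1, -⟩ := hs c
    rw [h1]; simpa using ht
  have hsupp : ∀ c, β c ≠ 0 → c ∈ ball (-1 : ℂ) r := fun c hc => by
    obtain ⟨t, ht, h1, h2⟩ := hs c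
    by_contra hcr
    exact hc (by rw [h1, h2 hcr, zero_smul])
  have h0 : ∀ θ, 0 ≤ (circ θ).re → β (circ θ) = 0 := fun θ hθ => by
    by_contra hne
    exact absurd (re_neg_of_mem_ball (ball_subset_ball hr1 (hsupp _ hne))) (not_lt.2 hθ)
  have hcont := continuous_weight_mul (hβ.continuous.comp continuous_circ) h0
  have hpi : circ Real.pi = -1 := Complex.exp_pi_mul_I
  have hI : 0 < ∫ θ in (0 : ℝ)..2 * Real.pi, (‖circ θ - 1‖ ^ 2)⁻¹ * β (circ θ) := by
    refine intervalIntegral.integral_pos Real.two_pi_pos hcont.continuousOn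
      (fun θ _ => mul_nonneg (by positivity) (hpos _))
      ⟨Real.pi, ⟨Real.pi_pos.le, by linarith [Real.pi_pos]⟩, ?_⟩
    rw [hpi, heq.self_of_nhds]
    norm_num
  have hA : 0 < avg fun θ => (‖circ θ - 1‖ ^ 2)⁻¹ * β (circ θ) := by
    rw [avg, smul_eq_mul]
    positivity
  set I := avg fun θ => (‖circ θ - 1‖ ^ 2)⁻¹ * β (circ θ) with hIdef
  -- The normalization matches the weight 2|ζ - 1|⁻² in the formula for Im V(1).
  refine ⟨fun c => (2 * I)⁻¹ * β c, contDiff_const.mul hβ, fun c => mul_nonneg (by positivity)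
    (hpos c), fun c hc => hsupp c (right_ne_zero_of_mul hc), ?_⟩
  have h1 : (fun θ => (‖circ θ - 1‖ ^ 2)⁻¹ * ((2 * I)⁻¹ * β (circ θ))) =
      fun θ => (2 * I)⁻¹ * ((‖circ θ - 1‖ ^ 2)⁻¹ * β (circ θ)) := by
    funext θ; ring
  rw [h1, avg_const_mul, ← hIdef]
  field_simp

end Bumps

/-! ### Globally defined graphing functions -/

section LocalData

variable {d m : ℕ}

theorem continuous_par : Continuous (par : Cn d m → Par d m) := (contDiff_par (n := 0)).continuous

theorem par_zero : par (0 : Cn d m) = 0 := map_zero (parL d m)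

theorem fderiv_definingFn_congr {h g : Par d m → (Fin d → ℝ)} {P : Cn d m}
    (hg : g =ᶠ[𝓝 (par P)] h) :
    fderiv ℝ (definingFn h) P = fderiv ℝ (definingFn g) P := by
  refine Filter.EventuallyEq.fderiv_eq ?_
  filter_upwards [(continuous_par (d := d) (m := m)).continuousAt.eventually hg] with Q hQ
  change imPart Q - h (par Q) = imPart Q - g (par Q)
  rw [hQ]

/-- The graph may be taken to be globally defined. -/
theorem IsGraphOfOrder.exists_contDiff {k : ℕ} {M : Set (Cn d m)} {h : Par d m → (Fin d → ℝ)}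
    (hM : IsGraphOfOrder k M h) : ∃ g : Par d m → (Fin d → ℝ), ContDiff ℝ (k + 2 : ℕ) g ∧
      fderiv ℝ g 0 = 0 ∧ ∃ ρ > 0, ∀ P ∈ ball (0 : Cn d m) ρ,
        (P ∈ M ↔ imPart P = g (par P)) ∧ g =ᶠ[𝓝 (par P)] h := by
  obtain ⟨g, hg, heq, -⟩ := exists_contDiff_eventuallyEq hM.contDiffAt univ_mem
  refine ⟨g, hg, heq.fderiv_eq.trans hM.fderiv_zero, ?_⟩
  have h1 : ∀ᶠ P in 𝓝 (0 : Cn d m), g =ᶠ[𝓝 (par P)] h := by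
    have h2 : Tendsto par (𝓝 (0 : Cn d m)) (𝓝 (par 0)) := continuous_par.continuousAt
    rw [par_zero] at h2
    exact h2.eventually (p := fun x => g =ᶠ[𝓝 x] h) heq.eventuallyEq_nhds
  obtain ⟨ρ, hρ, hb⟩ := Metric.eventually_nhds_iff_ball.1 (h1.and hM.mem_iff)
  refine ⟨ρ, hρ, fun P hP => ⟨?_, (hb P hP).1⟩⟩
  rw [(hb P hP).1.self_of_nhds]
  exact (hb P hP).2

/-- The extension may be taken to be the graph of a globally defined perturbation. -/
theorem IsExtensionAt.exists_contDiff {k : ℕ} (hk : 1 ≤ k) {h g : Par d m → (Fin d → ℝ)}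
    {M' : Set (Cn d m)} {q v : Cn d m} (hE : IsExtensionAt k h M' q v) (hg : ContDiff ℝ k g)
    (hgh : g =ᶠ[𝓝 (par q)] h) :
    ∃ K : Par d m × ℝ → (Fin d → ℝ), ContDiff ℝ k K ∧ (∀ a, K (a, 0) = 0) ∧
      fderiv ℝ K (par q, 0) (0, 1) = normalPart h q v ∧
      ∃ ρ > 0, ∀ P ∈ ball q ρ, ∀ t, 0 ≤ t → t < ρ → imPart P = g (par P) + K (par P, t) →
        P ∈ M' := by
  obtain ⟨H, W, hW, hqW, hH, hH0, hM', hv, -⟩ := hE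
  have hqW' : W ∈ 𝓝 (par q, (0 : ℝ)) := hW.mem_nhds hqW
  have hfst : Tendsto (Prod.fst : Par d m × ℝ → Par d m) (𝓝 (par q, (0 : ℝ))) (𝓝 (par q)) :=
    continuous_fst.continuousAt
  have hHat : ContDiffAt ℝ k H (par q, 0) := hH.contDiffAt hqW'
  have hf : ContDiffAt ℝ k (fun x => H x - g x.1) (par q, (0 : ℝ)) :=
    hHat.sub (hg.comp contDiff_fst).contDiffAt
  -- The cutoff multiplies H - g by a scalar supported where H is defined and g = h. So K vanishes
  -- at t = 0 everywhere, not only near q.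
  obtain ⟨K, hK, hKf, hKs⟩ := exists_contDiff_eventuallyEq (n := k) hf
    (inter_mem hqW' (hfst.eventually hgh))
  refine ⟨K, hK, fun a => ?_, ?_, ?_⟩
  · obtain ⟨c, -, h1, h2⟩ := hKs (a, 0)
    by_cases ha : (a, (0 : ℝ)) ∈ W ∧ g a = h a
    · rw [h1, hH0 a ha.1, ha.2, sub_self, smul_zero]
    · rw [h1, h2 ha, zero_smul]
  · have hkne : (k : WithTop ℕ∞) ≠ 0 := by norm_cast; omega
    rw [hv, hKf.fderiv_eq]
    have h1 : HasFDerivAt (fun x : Par d m × ℝ => g x.1)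
        ((fderiv ℝ g (par q)).comp (ContinuousLinearMap.fst ℝ (Par d m) ℝ)) (par q, (0 : ℝ)) :=
      HasFDerivAt.comp (par q, (0 : ℝ)) (hg.differentiable hkne (par q)).hasFDerivAt
        hasFDerivAt_fst
    rw [((hHat.differentiableAt hkne).hasFDerivAt.fun_sub h1).fderiv]
    change fderiv ℝ H (par q, 0) (0, 1) - fderiv ℝ g (par q) 0 = fderiv ℝ H (par q, 0) (0, 1)
    rw [map_zero, sub_zero]
  · have h1 : ∀ᶠ x in 𝓝 (q, (0 : ℝ)), (par x.1, x.2) ∈ W ∧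
        K (par x.1, x.2) = H (par x.1, x.2) - g (par x.1) := by
      have h2 : Tendsto (fun x : Cn d m × ℝ => (par x.1, x.2)) (𝓝 (q, (0 : ℝ)))
          (𝓝 (par q, (0 : ℝ))) :=
        ((continuous_par.comp continuous_fst).prodMk continuous_snd).continuousAt
      exact h2.eventually (Filter.inter_mem hqW' hKf)
    obtain ⟨r, hr, hb⟩ := Metric.eventually_nhds_iff_ball.1 h1
    obtain ⟨s, hs, hb'⟩ := Metric.eventually_nhds_iff_ball.1 hM'
    refine ⟨min r s, lt_min hr hs, fun P hP t ht0 ht hPt => ?_⟩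
    have h3 : (P, t) ∈ ball (q, (0 : ℝ)) r := by
      rw [← ball_prod_same]
      refine ⟨ball_subset_ball (min_le_left _ _) hP, ?_⟩
      rw [mem_ball_zero_iff, Real.norm_of_nonneg ht0]
      exact ht.trans_le (min_le_left _ _)
    refine (hb' P (ball_subset_ball (min_le_right _ _) hP)).2 ⟨t, ht0, (hb _ h3).1, ?_⟩
    rw [hPt, (hb _ h3).2, add_sub_cancel]
    rfl

end LocalData

/-! ### Deformed discs -/

section Deformation

variable {d m : ℕ}

/-- The deformation of a disc by `(1 - τ) Z(τ)` in the normal directions. -/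
def deform (A : ℂ → Cn d m) (Z : ℂ → Fin d → ℂ) (τ : ℂ) : Cn d m :=
  ((A τ).1 + (1 - τ) • Z τ, (A τ).2)

theorem deform_one (A : ℂ → Cn d m) (Z : ℂ → Fin d → ℂ) : deform A Z 1 = A 1 := by
  simp [deform]

theorem deform_of_eq_zero {A : ℂ → Cn d m} {Z : ℂ → Fin d → ℂ} {τ : ℂ} (h : Z τ = 0) :
    deform A Z τ = A τ := by
  simp [deform, h]

theorem norm_deform_sub_le (A : ℂ → Cn d m) (Z : ℂ → Fin d → ℂ) {τ : ℂ} (hτ : ‖τ‖ ≤ 1) :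
    ‖deform A Z τ - A τ‖ ≤ 2 * ‖Z τ‖ := by
  have h1 : deform A Z τ - A τ = ((1 - τ) • Z τ, 0) := by
    refine Prod.ext ?_ ?_ <;> simp [deform]
  rw [h1, Prod.norm_mk, norm_zero, max_eq_left (norm_nonneg _), norm_smul]
  gcongr
  calc ‖1 - τ‖ ≤ ‖(1 : ℂ)‖ + ‖τ‖ := norm_sub_le _ _
    _ ≤ 2 := by rw [norm_one]; linarith

theorem par_deform (A : ℂ → Cn d m) (Z : ℂ → Fin d → ℂ) (τ : ℂ) :
    par (deform A Z τ) = par (A τ) + (fun l => ((1 - τ) * Z τ l).re, 0) := by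
  refine Prod.ext (funext fun l => ?_) ?_ <;> simp [par, deform, rePart]

theorem imPart_deform (A : ℂ → Cn d m) (Z : ℂ → Fin d → ℂ) (τ : ℂ) :
    imPart (deform A Z τ) = imPart (A τ) + fun l => ((1 - τ) * Z τ l).im := by
  funext l
  simp [deform, imPart]

theorem diffContOnCl_deform {A : ℂ → Cn d m} (hA : DiffContOnCl ℂ A (ball 0 1))
    {Z : ℂ → Fin d → ℂ} (hZ : ∀ j, DiffContOnCl ℂ (fun τ => Z τ j) (ball 0 1)) :
    DiffContOnCl ℂ (deform A Z) (ball 0 1) := by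
  have hZd : DifferentiableOn ℂ Z (ball 0 1) :=
    differentiableOn_pi.2 fun j => (hZ j).differentiableOn
  have hZc : ContinuousOn Z (closure (ball 0 1)) := continuousOn_pi.2 fun j => (hZ j).continuousOn
  constructor
  · exact (hA.differentiableOn.fst.add
      (((differentiableOn_const 1).sub differentiableOn_id).smul hZd)).prodMk
      hA.differentiableOn.snd
  · exact ((continuous_fst.comp_continuousOn hA.continuousOn).add
      ((continuousOn_const.sub continuousOn_id).smul hZc)).prodMk
      (continuous_snd.comp_continuousOn hA.continuousOn)

/-- At the parameter s on the radius the added normal component is s Im Z(1 - s), so its derivative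
at s = 0 requires only continuity of Z at 1. -/
theorem hasInnerNormalDeriv_deform {h : Par d m → (Fin d → ℝ)} (hh : DifferentiableAt ℝ h 0)
    (hh0 : fderiv ℝ h 0 = 0) {A : ℂ → Cn d m} (hA1 : A 1 = 0) (hA : HasInnerNormalDeriv h A 0)
    {Z : ℂ → Fin d → ℂ} (hZ : ∀ j, DiffContOnCl ℂ (fun τ => Z τ j) (ball 0 1)) :
    HasInnerNormalDeriv h (deform A Z) (fun j => (Z 1 j).im) := by
  have h0 : ∀ ξ, normalPart h 0 ξ = imPart ξ := fun ξ => by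
    rw [normalPart_eq (by rwa [par_zero]), par_zero, hh0]
    simp
  rw [HasInnerNormalDeriv] at hA ⊢
  rw [deform_one]
  rw [hA1] at hA ⊢
  simp only [h0] at hA ⊢
  have h1 : (fun s : ℝ => imPart (deform A Z ((1 - s : ℝ) : ℂ))) =
      fun s : ℝ => imPart (A ((1 - s : ℝ) : ℂ)) + s • fun j => (Z ((1 - s : ℝ) : ℂ) j).im := by
    funext s
    rw [imPart_deform]
    congr 1
    funext l
    rw [show 1 - ((1 - s : ℝ) : ℂ) = (s : ℂ) by push_cast; ring, Complex.im_ofReal_mul]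
    rfl
  rw [h1]
  have h2 : ContinuousWithinAt (fun (s : ℝ) j => (Z ((1 - s : ℝ) : ℂ) j).im) (Ici 0) 0 := by
    refine continuousWithinAt_pi.2 fun j => ?_
    have h3 : ContinuousWithinAt (fun τ => Z τ j) (closedBall 0 1) ((1 - (0 : ℝ) : ℝ) : ℂ) := by
      have := (hZ j).continuousOn
      rw [closure_ball _ one_ne_zero] at this
      exact this _ (by simp)
    have h4 : ContinuousWithinAt (fun s : ℝ => Z ((1 - s : ℝ) : ℂ) j) (Icc 0 2) 0 := by
      refine h3.comp (t := closedBall 0 1) (f := fun s : ℝ => ((1 - s : ℝ) : ℂ))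
        (Complex.continuous_ofReal.comp (continuous_const.sub continuous_id)).continuousWithinAt
        fun s hs => ?_
      rw [mem_closedBall_zero_iff, Complex.norm_real, Real.norm_eq_abs, abs_le]
      constructor <;> linarith [hs.1, hs.2]
    have h5 : ContinuousWithinAt (fun s : ℝ => Z ((1 - s : ℝ) : ℂ) j) (Ici 0) 0 :=
      h4.mono_of_mem_nhdsWithin (Icc_mem_nhdsGE two_pos)
    exact Complex.continuous_im.continuousAt.comp_continuousWithinAt h5
  have h3 := hA.add (hasDerivWithinAt_smul_of_continuousWithinAt h2)
  have e : (0 : Fin d → ℝ) + (fun j => (Z ((1 - (0 : ℝ) : ℝ) : ℂ) j).im) =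
      fun j => (Z 1 j).im := by
    simp
  rw [e] at h3
  exact h3

variable {a : ℝ} [ha : HExp a]

/-- On the boundary the family is a fixed polynomial applied to A, ζ and Z, and a composition
operator on F^{2,a} keeps the class of η ↦ Z. Inside, A is holomorphic, hence smooth, and the joint
class is that of Z. -/
theorem isDiscFamily_deform {n : ℕ} {A : ℂ → Cn d m} (hA : IsFDisc a A) {u : FSp a (Cn d m)}
    (hu : ∀ θ, u θ = bdry A θ) {Z : ℝ → ℂ → Fin d → ℂ} {C : ℝ → FSp a (Fin d → ℂ)} {r η₀ : ℝ}
    (hr : η₀ < r)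
    (hC : ∀ η, |η| < r → ContDiffAt ℝ (n + 1 : ℕ) C η)
    (hCZ : ∀ η, |η| < r → ∀ θ, C η θ = Z η (circ θ))
    (hZ : ∀ η, |η| < r → ∀ j, DiffContOnCl ℂ (fun τ => Z η τ j) (ball 0 1))
    (hZs : ∀ η, |η| < r → ∀ τ ∈ ball (0 : ℂ) 1,
      ContDiffAt ℝ (n + 4 : ℕ) (fun q : ℝ × ℂ => Z q.1 q.2) (η, τ)) :
    IsDiscFamily (n + 4) a η₀ fun η => deform A (Z η) := by
  have hI : ∀ η ∈ Icc 0 η₀, |η| < r := fun η hη => by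
    rw [abs_of_nonneg hη.1]; exact hη.2.trans_lt hr
  set g : (Cn d m × ℂ) × (Fin d → ℂ) → Cn d m :=
    fun x => (x.1.1.1 + (1 - x.1.2) • x.2, x.1.1.2) with hg
  have hgs : ∀ N : ℕ, ContDiff ℝ N g := fun N =>
    ((contDiff_fst.comp (contDiff_fst.comp contDiff_fst)).add
      ((contDiff_const.sub (contDiff_snd.comp contDiff_fst)).smul contDiff_snd)).prodMk
      (contDiff_snd.comp (contDiff_fst.comp contDiff_fst))
  obtain ⟨z, hz⟩ := exists_fSp_of_contDiff (a := a) (σ := circ) contDiff_circ circ_periodic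
  let J1 : Cn d m →L[ℝ] (Cn d m × ℂ) × (Fin d → ℂ) :=
    (ContinuousLinearMap.inl ℝ (Cn d m × ℂ) (Fin d → ℂ)).comp
      (ContinuousLinearMap.inl ℝ (Cn d m) ℂ)
  let J2 : ℂ →L[ℝ] (Cn d m × ℂ) × (Fin d → ℂ) :=
    (ContinuousLinearMap.inl ℝ (Cn d m × ℂ) (Fin d → ℂ)).comp
      (ContinuousLinearMap.inr ℝ (Cn d m) ℂ)
  let J3 : (Fin d → ℂ) →L[ℝ] (Cn d m × ℂ) × (Fin d → ℂ) :=
    ContinuousLinearMap.inr ℝ (Cn d m × ℂ) (Fin d → ℂ)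
  let w : ℝ → FSp a ((Cn d m × ℂ) × (Fin d → ℂ)) := fun η =>
    (FSp.map J1 u + FSp.map J2 z) + FSp.map J3 (C η)
  let c : ℝ → FSp a (Cn d m) := fun η => FSp.nem (hgs 3) (w η)
  have hw : ∀ η θ, w η θ = ((u θ, circ θ), C η θ) := fun η θ => by
    have : w η θ = J1 (u θ) + J2 (z θ) + J3 (C η θ) := rfl
    rw [this, hz]
    simp [J1, J2, J3]
  have hcb : ∀ η, |η| < r → (c η : ℝ → Cn d m) = bdry (deform A (Z η)) := fun η hη => by
    funext θ
    have h1 : c η θ = g (w η θ) := rfl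
    rw [h1, hw, hCZ η hη, hu]
    rfl
  have hcs : ContDiffOn ℝ (n + 1 : ℕ) c (Ioo (-r) r) := fun η hη => by
    have h1 : ContDiffAt ℝ (n + 1 : ℕ) w η :=
      contDiffAt_const.add ((FSp.map J3).contDiff.contDiffAt.comp η (hC η (abs_lt.2 hη)))
    exact ((FSp.contDiff_nem (n + 1) (hgs 3) (hgs (n + 1 + 3))).contDiffAt.comp η
      h1).contDiffWithinAt
  refine ⟨fun η hη => ⟨diffContOnCl_deform hA.1 (hZ η (hI η hη)), ?_⟩, fun x hx => ?_, ?_⟩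
  · rw [← hcb η (hI η hη)]
    obtain ⟨N, -, hN⟩ := exists_fNorm_le (E := Cn d m) ha
    exact (hN (c η)).1
  · refine ContDiffAt.contDiffWithinAt ?_
    have hAs : ContDiffAt ℝ (n + 4 : ℕ) A x.2 :=
      ((hA.1.differentiableOn.contDiffOn isOpen_ball).restrict_scalars ℝ).contDiffAt
        (isOpen_ball.mem_nhds hx.2)
    have h1 : ContDiffAt ℝ (n + 4 : ℕ) (fun p : ℝ × ℂ => ((A p.2, p.2), Z p.1 p.2)) x :=
      ((ContDiffAt.comp x hAs contDiffAt_snd).prodMk contDiffAt_snd).prodMk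
        (hZs x.1 (hI _ hx.1) x.2 hx.2)
    exact (hgs (n + 4)).contDiffAt.comp x h1
  · have h1 := isFCurve_of_contDiffOn (I := Icc 0 η₀) ha isOpen_Ioo
      (fun η hη => abs_lt.1 (hI η hη)) hcs
    obtain ⟨Γ, h2, h3⟩ := h1
    exact ⟨Γ, fun η hη => (h2 η hη).trans (hcb η (hI η hη)), h3⟩

end Deformation

/-! ### Means against concentrated densities -/

section Averages

/-- Averaging against a probability density concentrated where `g` is close to `b`. -/
theorem abs_avg_mul_sub_le {p g : ℝ → ℝ} (hp : Continuous p) (hp0 : ∀ θ, 0 ≤ p θ) (hp1 : avg p = 1)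
    (hg : Continuous fun θ => p θ * g θ) {b δ : ℝ} (hb : ∀ θ, p θ ≠ 0 → |g θ - b| ≤ δ) :
    |avg (fun θ => p θ * g θ) - b| ≤ δ := by
  have hm : ∀ t : ℝ, avg (fun θ => t * p θ) = t := fun t => by rw [avg_const_mul, hp1, mul_one]
  rw [abs_le]
  constructor
  · have h1 := avg_mono (f := fun θ => (b - δ) * p θ) (continuous_const.mul hp) hg fun θ => by
      by_cases h : p θ = 0
      · simp [h]
      · have := (abs_le.1 (hb θ h)).1
        nlinarith [hp0 θ]
    rw [hm] at h1
    linarith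
  · have h1 := avg_mono (g := fun θ => (b + δ) * p θ) hg (continuous_const.mul hp) fun θ => by
      by_cases h : p θ = 0
      · simp [h]
      · have := (abs_le.1 (hb θ h)).2
        nlinarith [hp0 θ]
    rw [hm] at h1
    linarith

end Averages

/-! ### Transports and the first order error -/

section MainArgument

variable {d m : ℕ} {a : ℝ} [ha : HExp a]

theorem IsFDisc.continuousOn {A : ℂ → Cn d m} (hA : IsFDisc a A) :
    ContinuousOn A (closedBall 0 1) := by
  have := hA.1.continuousOn
  rwa [closure_ball _ one_ne_zero] at this

/-- Transports of a disc near the base point, in terms of a global graphing function. -/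
theorem isTransport_iff {g h : Par d m → (Fin d → ℝ)} (hg : Differentiable ℝ g) {A : ℂ → Cn d m}
    (hgh : ∀ θ, g =ᶠ[𝓝 (par (A (circ θ)))] h) {G : ℂ → Matrix (Fin d) (Fin d) ℝ} :
    IsTransport h A G ↔ ContinuousOn G (sphere 0 1) ∧ G 1 = 1 ∧
      ∃ Φ : ℂ → Matrix (Fin d) (Fin d) ℂ,
        (∀ i j, DiffContOnCl ℂ (fun τ => Φ τ i j) (ball 0 1)) ∧
        ∀ θ, Φ (circ θ) = (G (circ θ)).map Complex.ofReal * Matrix.of fun j l =>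
          (1 / 2 : ℂ) * (-slopeMatrix g j l (A (circ θ)) - Complex.I * if j = l then 1 else 0) := by
  have h1 : ∀ θ, dzr h (A (circ θ)) = Matrix.of fun j l =>
      (1 / 2 : ℂ) * (-slopeMatrix g j l (A (circ θ)) - Complex.I * if j = l then 1 else 0) :=
    fun θ => by
      rw [← dzr_eq (hg _), dzr, dzr, fderiv_definingFn_congr (hgh θ)]
  refine and_congr_right fun _ => and_congr_right fun _ => exists_congr fun Φ =>
    and_congr_right fun _ => ⟨fun h2 θ => ?_, fun h2 τ hτ => ?_⟩
  · rw [h2 _ (circ_mem_sphere θ), h1]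
  · obtain ⟨θ, rfl⟩ := exists_circ_eq (mem_sphere_zero_iff_norm.1 hτ)
    rw [h2, h1]

/-- Near `-1` the transported velocity of the bump is close to its value at `-1`. -/
theorem exists_radius {A : ℂ → Cn d m} (hA : ContinuousOn A (closedBall 0 1))
    {G : ℂ → Matrix (Fin d) (Fin d) ℝ} (hG : ContinuousOn G (sphere 0 1))
    {κ : Cn d m → Fin d → ℝ} (hκ : Continuous κ) {ε ρ : ℝ} (hε : 0 < ε) (hρ : 0 < ρ) :
    ∃ r > 0, ∀ c ∈ sphere (0 : ℂ) 1, c ∈ ball (-1 : ℂ) r → A c ∈ ball (A (-1)) ρ ∧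
      ∀ j, |(G c).mulVec (κ (A c)) j - (G (-1)).mulVec (κ (A (-1))) j| ≤ ε := by
  have hm : (-1 : ℂ) ∈ sphere (0 : ℂ) 1 := by simp
  have hAs : ContinuousOn A (sphere 0 1) := hA.mono sphere_subset_closedBall
  have h1 : ContinuousOn (fun c => (G c).mulVec (κ (A c))) (sphere 0 1) := by
    refine continuousOn_pi.2 fun j => ?_
    change ContinuousOn (fun c => ∑ l, G c j l * κ (A c) l) (sphere 0 1)
    refine continuousOn_finsetSum _ fun l _ => ?_
    exact (continuousOn_pi.1 (continuousOn_pi.1 hG j) l).mul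
      (continuousOn_pi.1 (hκ.comp_continuousOn hAs) l)
  have h2 := (hAs _ hm).eventually (ball_mem_nhds _ hρ)
  have h3 := (h1 _ hm).eventually (ball_mem_nhds _ hε)
  obtain ⟨r, hr, hb⟩ := Metric.mem_nhdsWithin_iff.1 (h2.and h3)
  refine ⟨r, hr, fun c hc hcr => ⟨(hb ⟨hcr, hc⟩).1, fun j => ?_⟩⟩
  have h4 : ‖(G c).mulVec (κ (A c)) - (G (-1)).mulVec (κ (A (-1)))‖ < ε := by
    rw [← dist_eq_norm]
    exact (hb ⟨hcr, hc⟩).2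
  exact (norm_le_pi_norm _ j).trans h4.le

/-- The inner derivative of the infinitesimal deformation is close to the transported direction. -/
theorem abs_im_sub_transport_le {V : ℂ → Fin d → ℂ}
    (hV : ∀ j, DiffContOnCl ℂ (fun τ => V τ j) (ball 0 1))
    {g : Par d m → (Fin d → ℝ)} (hg0 : fderiv ℝ g 0 = 0) {A : ℂ → Cn d m}
    (hA : ContinuousOn A (closedBall 0 1)) (hA1 : A 1 = 0) {G : ℂ → Matrix (Fin d) (Fin d) ℝ}
    (hG : ContinuousOn G (sphere 0 1)) (hG1 : G 1 = 1) {Φ : ℂ → Matrix (Fin d) (Fin d) ℂ}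
    (hΦ : ∀ i j, DiffContOnCl ℂ (fun τ => Φ τ i j) (ball 0 1))
    (hΦG : ∀ θ, Φ (circ θ) = (G (circ θ)).map Complex.ofReal * Matrix.of fun j l =>
      (1 / 2 : ℂ) * (-slopeMatrix g j l (A (circ θ)) - Complex.I * if j = l then 1 else 0))
    {κ : Cn d m → Fin d → ℝ} (hκ : Continuous κ) {χ : ℂ → ℝ} (hχ : Continuous χ)
    (hχ0 : ∀ c, 0 ≤ χ c) (hχs : ∀ c, χ c ≠ 0 → c ∈ ball (-1 : ℂ) 1)
    (hχ1 : 2 * avg (fun θ => (‖circ θ - 1‖ ^ 2)⁻¹ * χ (circ θ)) = 1)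
    (hVb : ∀ θ j, ((1 - circ θ) * V (circ θ) j).im =
      fderiv ℝ g (par (A (circ θ))) (fun l => ((1 - circ θ) * V (circ θ) l).re, 0) j +
        χ (circ θ) * κ (A (circ θ)) j) {ε : ℝ} {j : Fin d} {b : ℝ}
    (hb : ∀ c ∈ sphere (0 : ℂ) 1, χ c ≠ 0 → |(G c).mulVec (κ (A c)) j - b| ≤ ε) :
    |(V 1 j).im - b| ≤ ε := by
  have hAc : Continuous fun θ => A (circ θ) :=
    hA.comp_continuous continuous_circ circ_mem_closedBall
  have hGc : Continuous fun θ => G (circ θ) := hG.comp_continuous continuous_circ circ_mem_sphere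
  have hc : ∀ i, Continuous fun θ => χ (circ θ) * (G (circ θ)).mulVec (κ (A (circ θ))) i :=
    fun i => (hχ.comp continuous_circ).mul ((continuous_apply i).comp
      (hGc.matrix_mulVec (hκ.comp hAc)))
  have h0 : ∀ θ, 0 ≤ (circ θ).re → χ (circ θ) = 0 := fun θ hθ => by
    by_contra hne
    exact absurd (re_neg_of_mem_ball (hχs _ hne)) (not_lt.2 hθ)
  have hwc : Continuous fun θ => (‖circ θ - 1‖ ^ 2)⁻¹ * χ (circ θ) :=
    continuous_weight_mul (hχ.comp continuous_circ) h0
  have hwG := continuous_weight_mul (hc j) fun θ hθ => by rw [h0 θ hθ, zero_mul]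
  rw [im_eq_avg_transport hV hΦ hΦG hG1 (by rw [hA1, par_zero, hg0]) hVb hc h0 j, ← avg_const_mul]
  rw [← avg_const_mul] at hχ1
  -- By the normalization of χ the function 2|ζ - 1|⁻²χ is a probability density, so Im V(1) is a
  -- mean of Gκ over its support.
  have e : (fun θ => 2 * ((‖circ θ - 1‖ ^ 2)⁻¹ *
      (χ (circ θ) * (G (circ θ)).mulVec (κ (A (circ θ))) j))) =
      fun θ => 2 * ((‖circ θ - 1‖ ^ 2)⁻¹ * χ (circ θ)) *
        (G (circ θ)).mulVec (κ (A (circ θ))) j := by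
    funext θ; ring
  rw [e]
  refine abs_avg_mul_sub_le (continuous_const.mul hwc)
    (fun θ => mul_nonneg two_pos.le (mul_nonneg (by positivity) (hχ0 _))) hχ1 ?_ fun θ hθ => ?_
  · have h1 := continuous_const (y := (2 : ℝ)).mul hwG
    exact e ▸ h1
  · exact hb _ (circ_mem_sphere θ) (right_ne_zero_of_mul (right_ne_zero_of_mul hθ))

/-- A differentiable curve through the origin, expanded to first order with an error term. -/
theorem isLittleO_sub_smul {F : Type} [NormedAddCommGroup F] [NormedSpace ℝ F] {D : ℝ → F} {D' : F}
    (hD : HasDerivAt D D' 0) (h0 : D 0 = 0) :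
    (fun η : ℝ => D η - η • D') =o[𝓝[>] 0] fun η : ℝ => η := by
  have h1 := hD.isLittleO.mono (nhdsWithin_le_nhds (s := Ioi (0 : ℝ)))
  simpa [h0] using h1

end MainArgument

end CRDisc

/-! ### The proposition -/

open CRDisc

theorem proposition3p3 {d m k : ℕ} (hk : 4 ≤ k) {α : ℝ} (hα : 1 < k * α) (hα1 : α < 1)
    (M : Set (CRDisc.Cn d m)) (h : CRDisc.Par d m → (Fin d → ℝ))
    (hM : CRDisc.IsGraphOfOrder k M h) :
    ∃ δ : ℝ, 0 < δ ∧
      ∀ A : ℂ → CRDisc.Cn d m, CRDisc.IsFDisc α A →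
        CRDisc.fNorm α (CRDisc.bdry A) < ENNReal.ofReal δ →
        CRDisc.IsAttached A M → A 1 = 0 → CRDisc.HasInnerNormalDeriv h A 0 →
        (∃ G, CRDisc.IsTransport h A G) ∧
        ∀ G, CRDisc.IsTransport h A G →
        ∀ (M' : Set (CRDisc.Cn d m)) (v : CRDisc.Cn d m), CRDisc.IsExtensionAt k h M' (A (-1)) v →
        ∀ ε : ℝ, 0 < ε →
        ∃ η₀ : ℝ, 0 < η₀ ∧ ∃ B : ℝ → ℂ → CRDisc.Cn d m,
          CRDisc.IsDiscFamily k α η₀ B ∧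
          EqOn (B 0) A (closedBall 0 1) ∧
          (∀ η ∈ Icc 0 η₀, B η 1 = 0 ∧ CRDisc.IsAttached (B η) (M ∪ M')) ∧
          ∃ (D : ℝ → (Fin d → ℝ)) (e : Fin d → ℝ),
            (∀ η ∈ Icc 0 η₀, CRDisc.HasInnerNormalDeriv h (B η) (D η)) ∧
            ‖e‖ < ε ∧
            (fun η : ℝ =>
                D η - η • ((G (-1)).mulVec (CRDisc.normalPart h (A (-1)) v) + e))
              =o[𝓝[>] 0] (fun η : ℝ => η) := by
  -- With k = n + 4 the class n + 1 obtained in F^{2,α} is k - 3, and the class n + 4 obtained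
  -- inside the disc is k.
  obtain ⟨n, rfl⟩ : ∃ n, k = n + 4 := ⟨k - 4, by omega⟩
  have hα0 : 0 < α := by
    by_contra hneg
    have h1 : ((n + 4 : ℕ) : ℝ) * α ≤ 0 :=
      mul_nonpos_of_nonneg_of_nonpos (by positivity) (not_lt.1 hneg)
    linarith
  have ha : HExp α := ⟨hα0, hα1⟩
  obtain ⟨g, hg, hg0, ρ, hρ, hgM⟩ := hM.exists_contDiff
  have hg5 : ContDiff ℝ (n + 5 : ℕ) g := hg.of_le (by norm_cast; omega)
  have hg4 : ContDiff ℝ (n + 4 : ℕ) g := hg.of_le (by norm_cast; omega)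
  have hgd : Differentiable ℝ g := hg.differentiable (by norm_cast)
  have hgh0 : g =ᶠ[𝓝 0] h := by
    have := (hgM 0 (mem_ball_self hρ)).2
    rwa [par_zero] at this
  have hnormal : ∀ {B : ℂ → Cn d m} {D : Fin d → ℝ}, B 1 = 0 →
      (HasInnerNormalDeriv h B D ↔ HasInnerNormalDeriv g B D) := fun {B D} hB => by
    have h1 : fderiv ℝ (definingFn h) (0 : Cn d m) = fderiv ℝ (definingFn g) 0 :=
      fderiv_definingFn_congr (by rwa [par_zero])
    simp only [HasInnerNormalDeriv, normalPart, hB, h1]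
  have hE1 := eventually_exists_graph_family (a := α) n hg5 hg0
  have hE2 : ∀ᶠ u in 𝓝 (0 : FSp α (Cn d m)), _ :=
    ((FSp.toHSp (E := Cn d m) (a := α)).continuous.tendsto' 0 0 (map_zero _)).eventually
      (eventually_exists_transport (hg.of_le (by norm_cast; omega)) hg0)
  obtain ⟨δ₁, hδ₁, hball⟩ := Metric.eventually_nhds_iff_ball.1 (hE1.and hE2)
  obtain ⟨C₀, hC₀, hC⟩ := exists_mem_fSubmodule_of_memF (E := Cn d m) ha
  have hmin : 0 < min δ₁ ρ := lt_min hδ₁ hρ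
  -- `C₀` compares the two norms of F^{2,α}. The bound by `δ₁` makes the equations solvable, and the
  -- bound by `ρ` keeps the boundary of A where M is the graph of g. The extension and ε play no
  -- part in the choice.
  refine ⟨min δ₁ ρ / (C₀ + 1), by positivity, fun A hA hAδ hAM hA1 hAd => ?_⟩
  obtain ⟨u, hu, huN⟩ := hC (bdry A) hA.2
  have hun : ‖u‖ < min δ₁ ρ := by
    refine (huN _ (by positivity) hAδ.le).trans_lt ?_
    rw [← mul_div_assoc, div_lt_iff₀ (by positivity)]
    nlinarith
  obtain ⟨hfam, G₀, hG₀⟩ := hball u (mem_ball_zero_iff.2 (hun.trans_le (min_le_left _ _)))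
  have huA : ∀ θ, u θ = A (circ θ) := hu
  have hAρ : ∀ θ, A (circ θ) ∈ ball (0 : Cn d m) ρ := fun θ => by
    rw [mem_ball_zero_iff, ← huA]
    exact (u.norm_apply_le θ).trans_lt (hun.trans_le (min_le_right _ _))
  have hT : ∀ {G}, _ := fun {G} => isTransport_iff hgd (A := A) (G := G) fun θ => (hgM _ (hAρ θ)).2
  refine ⟨⟨G₀, hT.2 ⟨hG₀.1, hG₀.2.1, ?_⟩⟩, ?_⟩
  · obtain ⟨Φ, hΦ, hΦG⟩ := hG₀.2.2
    refine ⟨Φ, hΦ, fun θ => ?_⟩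
    rw [hΦG, FSp.toHSp_apply, huA]
  intro G hG M' v hM' ε hε
  obtain ⟨hGc, hG1, Φ, hΦ, hΦG⟩ := hT.1 hG
  have hpi : circ Real.pi = -1 := Complex.exp_pi_mul_I
  obtain ⟨K, hK, hK0, hKv, ρ₁, hρ₁, hKM⟩ := hM'.exists_contDiff (by omega) hg4
    (by rw [← hpi]; exact (hgM _ (hAρ _)).2)
  obtain ⟨μ, hμ, r₀, hr₀, hμr⟩ := exists_inv_one_sub (n + 4)
  set κ : Cn d m → Fin d → ℝ := fun P => fderiv ℝ K (par P, 0) (0, 1) with hκdef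
  have hκ : Continuous κ :=
    ((hK.continuous_fderiv (by norm_cast)).comp
      (continuous_par.prodMk continuous_const)).clm_apply continuous_const
  -- Half of ε makes the final estimate strict; half of `ρ₁` leaves room for the displacement of the
  -- disc.
  obtain ⟨r, hr, hrc⟩ := exists_radius hA.continuousOn hGc hκ (half_pos hε) (half_pos hρ₁)
  -- The three radii keep the support in the left half plane, control the error vector and the
  -- position of A, and guarantee (1 - c)μ = 1.
  obtain ⟨χ, hχ, hχ0, hχs, hχ1⟩ := exists_bump_near_neg_one (n + 4)
    (r := min 1 (min r r₀)) (by positivity) (min_le_left _ _)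
  have hχr : ∀ c, χ c ≠ 0 → c ∈ ball (-1 : ℂ) r := fun c hc =>
    ball_subset_ball ((min_le_right _ _).trans (min_le_left _ _)) (hχs c hc)
  obtain ⟨Z, C, V, hC00, hZ0, hη, hV, hCV, hVb⟩ := hfam K μ χ hK hK0 hμ hχ fun c hc =>
    hμr c (ball_subset_ball ((min_le_right _ _).trans (min_le_right _ _)) (hχs c hc))
  simp only [huA] at hη hVb
  have hCc : ContinuousAt C 0 := hη.self_of_nhds.1.continuousAt
  -- The deformation moves boundary points by less than 2σ, which keeps them within ρ of the origin
  -- and, on the support of χ, within ρ₁/2 + ρ₁/2 of q.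
  set σ : ℝ := min ((ρ - ‖u‖) / 2) (ρ₁ / 4) with hσdef
  have hσ : 0 < σ :=
    lt_min (by linarith [hun.trans_le (min_le_right δ₁ ρ)]) (by positivity)
  have hCs : ∀ᶠ η in 𝓝 (0 : ℝ), ‖C η‖ < σ := by
    have h1 := hCc.norm
    rw [ContinuousAt, hC00, norm_zero] at h1
    exact h1.eventually (gt_mem_nhds hσ)
  obtain ⟨S, hS⟩ := (isCompact_sphere (0 : ℂ) 1).exists_bound_of_continuousOn
    hχ.continuous.continuousOn
  have hχη : ∀ᶠ η in 𝓝 (0 : ℝ), η * S < ρ₁ := by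
    have h1 : ContinuousAt (fun η : ℝ => η * S) 0 := (continuous_id.mul continuous_const).continuousAt
    rw [ContinuousAt, zero_mul] at h1
    exact h1.eventually (gt_mem_nhds hρ₁)
  obtain ⟨R, hR, hRη⟩ := Metric.eventually_nhds_iff_ball.1 (hη.and (hCs.and hχη))
  simp only [mem_ball_zero_iff, Real.norm_eq_abs] at hRη
  have hI : ∀ η ∈ Icc 0 (R / 2), |η| < R := fun η hη => by
    rw [abs_of_nonneg hη.1]; linarith [hη.2]
  refine ⟨R / 2, half_pos hR, fun η => deform A (Z η),
    isDiscFamily_deform hA hu (half_lt_self hR) (fun η hη => (hRη η hη).1.1)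
      (fun η hη => (hRη η hη).1.2.1) (fun η hη => (hRη η hη).1.2.2.1)
      (fun η hη τ hτ => (hRη η hη).1.2.2.2.1 τ (mem_ball_zero_iff.1 hτ)),
    fun τ hτ => deform_of_eq_zero (hZ0 τ hτ), fun η hη => ⟨?_, fun τ hτ => ?_⟩,
    fun η j => (Z η 1 j).im,
    -- The error vector is chosen so that the predicted derivative is exactly Im V(1).
    (fun j => (V 1 j).im) - (G (-1)).mulVec (normalPart h (A (-1)) v), fun η hη => ?_, ?_, ?_⟩
  · exact (deform_one A (Z η)).trans hA1
  · obtain ⟨θ, rfl⟩ := exists_circ_eq (mem_sphere_zero_iff_norm.1 hτ)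
    obtain ⟨⟨-, hCZ, -, -, hb⟩, hCσ, hSη⟩ := hRη η (hI η hη)
    have hd : ‖deform A (Z η) (circ θ) - A (circ θ)‖ < 2 * σ := by
      refine (norm_deform_sub_le A (Z η) (norm_circ θ).le).trans_lt ?_
      rw [← hCZ]
      linarith [(C η).norm_apply_le θ]
    have hBρ : deform A (Z η) (circ θ) ∈ ball (0 : Cn d m) ρ := by
      rw [mem_ball_zero_iff]
      have h1 := norm_le_norm_add_norm_sub' (deform A (Z η) (circ θ)) (A (circ θ))
      have h2 : ‖A (circ θ)‖ ≤ ‖u‖ := by rw [← huA]; exact u.norm_apply_le θ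
      linarith [min_le_left ((ρ - ‖u‖) / 2) (ρ₁ / 4)]
    have hAe : imPart (A (circ θ)) = g (par (A (circ θ))) :=
      (hgM _ (hAρ θ)).1.1 (hAM _ hτ)
    have him : imPart (deform A (Z η) (circ θ)) = g (par (deform A (Z η) (circ θ))) +
        K (par (deform A (Z η) (circ θ)), η * χ (circ θ)) := by
      funext j
      have h1 := congrFun (imPart_deform A (Z η) (circ θ)) j
      rw [Pi.add_apply, hb θ j, hAe, ← par_deform] at h1
      rw [h1, Pi.add_apply]
      ring
    -- Where χ vanishes the point lies on the original graph; elsewhere it lies on M', with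
    -- parameter t = ηχ ≥ 0.
    by_cases hχθ : χ (circ θ) = 0
    · left
      rw [hχθ, mul_zero, hK0, add_zero] at him
      exact (hgM _ hBρ).1.2 him
    · right
      refine hKM _ ?_ _ (mul_nonneg hη.1 (hχ0 _)) ?_ him
      · have h1 := (hrc _ hτ (hχr _ hχθ)).1
        rw [mem_ball] at h1 ⊢
        rw [← dist_eq_norm] at hd
        have h2 := dist_triangle (deform A (Z η) (circ θ)) (A (circ θ)) (A (-1))
        linarith [min_le_right ((ρ - ‖u‖) / 2) (ρ₁ / 4)]
      · refine lt_of_le_of_lt (mul_le_mul_of_nonneg_left ?_ hη.1) hSη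
        exact (le_abs_self _).trans (hS _ hτ)
  · refine (hnormal ((deform_one A (Z η)).trans hA1)).2 ?_
    exact hasInnerNormalDeriv_deform (hgd 0) hg0 hA1 ((hnormal hA1).1 hAd)
      (hRη η (hI η hη)).1.2.2.1
  · refine lt_of_le_of_lt ((pi_norm_le_iff_of_nonneg (half_pos hε).le).2 fun j => ?_)
      (half_lt_self hε)
    rw [Pi.sub_apply, Real.norm_eq_abs, ← hKv]
    exact abs_im_sub_transport_le hV hg0 hA.continuousOn hA1 hGc hG1 hΦ hΦG hκ hχ.continuous hχ0
      (fun c hc => ball_subset_ball (min_le_left _ _) (hχs c hc)) hχ1 hVb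
      fun c hc hcχ => (hrc c hc (hχr c hcχ)).2 j
  -- What remains is that η ↦ Im Z(1) vanishes at 0 and has derivative Im V(1) there.
  · rw [add_sub_cancel]
    refine isLittleO_sub_smul (hasDerivAt_pi.2 fun j => ?_) ?_
    · have h1 := hasDerivAt_pi.1 (hCV 0) j
      rw [circ_zero] at h1
      refine (Complex.imCLM.hasFDerivAt.comp_hasDerivAt (0 : ℝ) h1).congr_of_eventuallyEq ?_
      filter_upwards [hη] with η hη'
      have h2 := hη'.2.1 0
      rw [circ_zero] at h2
      change (Z η 1 j).im = (C η 0 j).im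
      rw [h2]
    · funext j
      simp [hZ0 1 (by simp)]
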